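/- **Setting and definitions.** Fix a universe; "small" means small with respect to it. ${\cal C},{\cal D}$ are small categories. *Simplicial replacement.* $\mathbb C$ is the category of elements of the nerve of ${\cal C}$: its objects are strings $\mathbf c=\mathbf c_{[n]}=(c_0\to\dots\to c_n)$ in ${\cal C}$, and a morphism $\mathbf c_{[n]}\to\mathbf c'_{[m]}$ is a map $\theta:[m]\to[n]$ in $\Delta$ with $\mathbf c'=\mathbf c\circ\theta$. It is an *anchor map* if $\theta(i)=i$ for all $i\in[m]$. There is a functor $t_{\cal C}:\mathbb C\to{\cal C}^{\sf op}$, $\mathbf c_{[n]}\mapsto c_n$. A functor $F:{\cal D}\to{\cal C}$ induces $\mathbb F:\mathbb D\to\mathbb C$. *Resolutions.* $F:{\cal D}\to{\cal C}$ is a *resolution* if it is a Grothendieck opfibration and the nerve of each fibre ${\cal D}(c)$ is contractible. *Transpose.* For a Grothendieck opfibration $p:{\cal E}\to{\cal C}$, the transpose fibration ${\cal E}^\top\to{\cal C}^{\sf op}$ has the objects of ${\cal E}$; a morphism $x\to z$ is an isomorphism class of cospans $x\to y\leftarrow z$ with fibrewise left leg and opCartesian right leg. Thus ${\cal E}^\top(c)\simeq{\cal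 E}(c)$, and pullback in ${\cal E}^\top$ along $f:c\to c'$ (viewed as a morphism $c'\to c$ of ${\cal C}^{\sf op}$) is the transition functor $f_!:{\cal E}(c)\to{\cal E}(c')$. *$\Delta$-structures.* A $\Delta$-structure on a category ${\cal M}$ is a functor $\Delta\times{\cal M}\to{\cal M}$, $([n],x)\mapsto\Delta^n\otimes x$, with a natural coassociative and counital comultiplication $\Delta^n\otimes x\to\Delta^n\otimes(\Delta^n\otimes x)$ and a natural isomorphism $\Delta^0\otimes x\cong x$. For ${\cal M}$ cocomplete put $S\otimes x:=\varinjlim_{\Delta^n\to S}\Delta^n\otimes x$ for a simplicial set $S$, and $|X|:=\int^{[n]}\Delta^n\otimes X_n$ for a simplicial object $X$ of ${\cal M}$. A *homotopical $\Delta$-category* is a category ${\cal M}$ with a $\Delta$-structure and a class ${\cal W}$ of morphisms (*weak equivalences*) which contains all isomorphisms and satisfies two-out-of-three and two-out-of-six, such that: ${\cal M}$ is cocomplete, each $\Delta^n\otimes-$ preserves small colimits, and small coproducts of weak equivalences are weak equivalences; $\otimes:{\bf SSet}\times{\cal M}\to{\cal M}$ preserves weak equivalences in each variable; the action maps $(S\times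 T)\otimes x\to S\otimes(T\otimes x)$ induced by the comultiplication are weak equivalences; $|-|$ sends objectwise weak equivalences to weak equivalences; and for each bisimplicial object $X$ with diagonal $\delta^*X$, the map $|\delta^*X|\to\int^{[n]}\Delta^n\otimes\int^{[m]}\Delta^m\otimes X_{nm}$ induced by the comultiplication is a weak equivalence. *Homotopical $\Delta$-opfibrations.* This is a Grothendieck opfibration $p:{\cal E}\to{\cal C}$ with - a class ${\cal W}$ of fibrewise morphisms of ${\cal E}$ which contains all fibrewise isomorphisms, satisfies two-out-of-three, and is such that for each commutative square $f'\alpha=\alpha' f$ with $\alpha,\alpha'$ opCartesian and $f,f'$ fibrewise, $f\in{\cal W}$ implies $f'\in{\cal W}$; - a $\Delta$-structure on the category ${\cal E}^\top$ for which $\otimes$ is a functor over ${\cal C}^{\sf op}$, and the comultiplication and the unit isomorphism are fibrewise; such that the induced structure on each fibre is that of a homotopical $\Delta$-category. ${\cal W}$ also denotes the corresponding class of fibrewise morphisms of ${\cal E}^\top$. A morphism of ${\cal E}^\top$ is *weakly Cartesian* if it is a morphism of ${\cal W}$ followed by a Cartesian morphism. *Sections.* Let ${\rm PSect}({\cal C},{\cal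 E})$ be the category of functors $A:\mathbb C\to{\cal E}^\top$ over $t_{\cal C}$ and fibrewise natural transformations, and let ${\rm PSect}({\cal D},{\cal E})$ be the category of functors $\mathbb D\to{\cal E}^\top$ over $t_{\cal C}\circ\mathbb F$ and fibrewise natural transformations. Weak equivalences of presections are objectwise. A presection is a *derived section* if it sends anchor maps to weakly Cartesian morphisms. A presection $A$ over ${\cal D}$ is *locally constant* if for each $c\in{\cal C}$ the composite $\mathbb D(c)\to\mathbb D\xrightarrow{A}{\cal E}^\top$ sends all morphisms to ${\cal W}$, where $\mathbb D(c)$ is the simplicial replacement of ${\cal D}(c)$. Let $\mathbb R{\rm Sect}({\cal C},{\cal E})$ and $\mathbb R{\rm Sect}({\cal D},{\cal E})_{lc}$ be the full subcategories of derived sections over ${\cal C}$, and of locally constant derived sections over ${\cal D}$. ${\rm Ho}$ denotes localisation at the weak equivalences. *The functors.* $\mathbb F^*:{\rm PSect}({\cal C},{\cal E})\to{\rm PSect}({\cal D},{\cal E})$ is $A\mapsto A\circ\mathbb F$. The derived pushforward $\mathbb F_!:{\rm PSect}({\cal D},{\cal E})\to{\rm PSect}({\cal C},{\cal E})$ sends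 $S$ to the presection whose value at $\mathbf c=(c_0\xrightarrow{f_1}\dots\xrightarrow{f_m}c_m)$ is the realisation of the simplicial object of the fibre over $c_m$ $$[n]\mapsto\coprod_{\mathbf d_{[n]}\in\mathbb D,\ \alpha:F(d_n)\to c_0}(f_m\cdots f_1\alpha)_!\,S(\mathbf d_{[n]}).$$ *Speciality.* A homotopical $\Delta$-opfibration ${\cal E}\to{\cal C}$ is *$F$-special* if for each $\mathbf d=(d_0\to\dots\to d_n)\in\mathbb D$ and each functor $X:\mathbb D(F(d_0))\to{\cal E}^\top(F(d_n))$ sending all morphisms to weak equivalences, the natural map $X(d_0)\to|X|$ is a weak equivalence. Here $|X|$ is the realisation of $[k]\mapsto\coprod_{\mathbf e_{[k]}\in\mathbb D(F(d_0))}X(\mathbf e_{[k]})$, and the map is induced by the inclusion of the summand of degree $0$ indexed by $d_0$. **Theorem.** Let $F:{\cal D}\to{\cal C}$ be a resolution and let ${\cal E}\to{\cal C}$ be an $F$-special homotopical $\Delta$-opfibration. Then 1. $\mathbb F^*$ and $\mathbb F_!$ preserve weak equivalences of presections; 2. $\mathbb F^*$ sends derived sections over ${\cal C}$ to locally constant derived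 sections over ${\cal D}$; 3. $\mathbb F_!$ sends locally constant derived sections over ${\cal D}$ to derived sections over ${\cal C}$; 4. the induced functor $\mathbb F^*:{\rm Ho}\,\mathbb R{\rm Sect}({\cal C},{\cal E})\to{\rm Ho}\,\mathbb R{\rm Sect}({\cal D},{\cal E})_{lc}$ is an equivalence of categories, and the functor induced by $\mathbb F_!$ is an inverse equivalence. -/

import Mathlib

open CategoryTheory CategoryTheory.Limits Opposite Simplicial

universe w v u v₁ u₁ v₂ u₂ v₃ u₃

namespace DerSect

set_option linter.unusedSectionVars false

section Opfibrations

variable {𝓔 : Type u₁} [Category.{v₁} 𝓔] {C : Type u₂} [Category.{v₂} C]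

/-- Grothendieck opfibrations: opCartesian lifts exist and opCartesian morphisms compose. -/
class IsOpfibration (p : 𝓔 ⥤ C) : Prop where
  exists_isCocartesian {x : 𝓔} {c : C} (f : p.obj x ⟶ c) :
    ∃ (y : 𝓔) (φ : x ⟶ y), p.IsCocartesian f φ
  comp {a b c : C} (f : a ⟶ b) (g : b ⟶ c) {x y z : 𝓔} (φ : x ⟶ y) (ψ : y ⟶ z)
    [p.IsCocartesian f φ] [p.IsCocartesian g ψ] : p.IsCocartesian (f ≫ g) (φ ≫ ψ)

variable (p : 𝓔 ⥤ C) [IsOpfibration p]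

/-- The codomain of a chosen opCartesian lift of `f` starting at `x`, i.e. the value at `x` of the
transition functor along `f`. -/
noncomputable def pushObj {x : 𝓔} {c : C} (f : p.obj x ⟶ c) : 𝓔 :=
  (IsOpfibration.exists_isCocartesian f).choose

/-- The chosen opCartesian lift of `f` starting at `x`. -/
noncomputable def pushMap {x : 𝓔} {c : C} (f : p.obj x ⟶ c) : x ⟶ pushObj p f :=
  (IsOpfibration.exists_isCocartesian f).choose_spec.choose

instance pushMap_isCocartesian {x : 𝓔} {c : C} (f : p.obj x ⟶ c) :
    p.IsCocartesian f (pushMap p f) :=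
  (IsOpfibration.exists_isCocartesian f).choose_spec.choose_spec

theorem isStronglyCocartesian {a b : C} (f : a ⟶ b) {x y : 𝓔} (φ : x ⟶ y)
    [p.IsCocartesian f φ] : p.IsStronglyCocartesian f φ where
  universal_property' {z} g φ' hφ' := by
    obtain rfl := IsHomLift.codomain_eq p f φ
    let ψ := pushMap p g
    have hc : p.IsCocartesian (f ≫ g) (φ ≫ ψ) := IsOpfibration.comp f g φ ψ
    let τ := Functor.IsCocartesian.map p (f ≫ g) (φ ≫ ψ) φ'
    have hτ : φ ≫ ψ ≫ τ = φ' := by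
      rw [← Category.assoc]
      exact Functor.IsCocartesian.fac p (f ≫ g) (φ ≫ ψ) φ'
    refine ⟨ψ ≫ τ, ⟨inferInstance, hτ⟩, ?_⟩
    rintro π ⟨hπ, hπc⟩
    rw [← Functor.IsCocartesian.fac p g ψ π]
    congr 1
    apply Functor.IsCocartesian.map_uniq
    rw [Category.assoc, Functor.IsCocartesian.fac, hπc]

instance pushMap_isStronglyCocartesian {x : 𝓔} {c : C} (f : p.obj x ⟶ c) :
    p.IsStronglyCocartesian f (pushMap p f) :=
  isStronglyCocartesian p f _

section

variable {p}
variable {R S : C} {a b : 𝓔} {f : R ⟶ S} {φ : a ⟶ b}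

/-- The morphism out of the codomain of an opCartesian morphism given by its universal property. -/
noncomputable def coMap (hφ : p.IsCocartesian f φ) {S' : C} {b' : 𝓔} {g : S ⟶ S'} {f' : R ⟶ S'}
    (hf' : f' = f ≫ g) {φ' : a ⟶ b'} (h' : p.IsHomLift f' φ') : b ⟶ b' :=
  haveI := isStronglyCocartesian p f φ
  Functor.IsStronglyCocartesian.map p f φ hf' φ'

theorem coMap_isHomLift (hφ : p.IsCocartesian f φ) {S' : C} {b' : 𝓔} {g : S ⟶ S'} {f' : R ⟶ S'}
    (hf' : f' = f ≫ g) {φ' : a ⟶ b'} (h' : p.IsHomLift f' φ') :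
    p.IsHomLift g (coMap hφ hf' h') :=
  haveI := isStronglyCocartesian p f φ
  Functor.IsStronglyCocartesian.map_isHomLift p f φ hf' φ'

theorem coMap_fac (hφ : p.IsCocartesian f φ) {S' : C} {b' : 𝓔} {g : S ⟶ S'} {f' : R ⟶ S'}
    (hf' : f' = f ≫ g) {φ' : a ⟶ b'} (h' : p.IsHomLift f' φ') :
    φ ≫ coMap hφ hf' h' = φ' :=
  haveI := isStronglyCocartesian p f φ
  Functor.IsStronglyCocartesian.fac p f φ hf' φ'

theorem coMap_uniq (hφ : p.IsCocartesian f φ) {S' : C} {b' : 𝓔} {g : S ⟶ S'} {f' : R ⟶ S'}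
    (hf' : f' = f ≫ g) {φ' : a ⟶ b'} (h' : p.IsHomLift f' φ') (ψ : b ⟶ b')
    (hψ : p.IsHomLift g ψ) (e : φ ≫ ψ = φ') : ψ = coMap hφ hf' h' :=
  haveI := isStronglyCocartesian p f φ
  Functor.IsStronglyCocartesian.map_uniq p f φ hf' φ' ψ e

end

end Opfibrations

section Transpose

variable {𝓔 : Type u₁} [Category.{v₁} 𝓔] {C : Type u₂} [Category.{v₂} C]

/-- The objects of the transpose fibration `𝓔ᵀ` are the objects of `𝓔`. -/
structure Transpose (p : 𝓔 ⥤ C) where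
  of : 𝓔

variable (p : 𝓔 ⥤ C) [IsOpfibration p]

/-- A morphism `x ⟶ z` of the transpose fibration is an isomorphism class of cospans `x ⟶ y ⟵ z`
with fibrewise left leg and opCartesian right leg.  Every such class contains exactly one cospan
whose right leg is the chosen opCartesian lift `pushMap p base` of its image `base` in `C`, and
it is recorded here by that representative. -/
@[ext]
structure TransposeHom (x z : Transpose p) where
  base : p.obj z.of ⟶ p.obj x.of
  leg : x.of ⟶ pushObj p base
  isHomLift : p.IsHomLift (𝟙 (p.obj x.of)) leg

namespace TransposeHom

variable {p} {x z y : Transpose p}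

/-- Given `φ : x ⟶ z` in the transpose fibration and `b : z ⟶ e` in `𝓔` over `base φ ≫ g`, the
composite `x ⟶ (base φ)_! z ⟶ e` over `g`, where the second arrow is induced by `b`. -/
noncomputable def act (φ : TransposeHom p x z) {c : C} (g : p.obj x.of ⟶ c)
    {f : p.obj z.of ⟶ c} (hf : f = φ.base ≫ g) {e : 𝓔} {b : z.of ⟶ e} (hb : p.IsHomLift f b) :
    x.of ⟶ e :=
  φ.leg ≫ coMap (pushMap_isCocartesian p φ.base) hf hb

theorem act_isHomLift (φ : TransposeHom p x z) {c : C} (g : p.obj x.of ⟶ c)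
    {f : p.obj z.of ⟶ c} (hf : f = φ.base ≫ g) {e : 𝓔} {b : z.of ⟶ e} (hb : p.IsHomLift f b) :
    p.IsHomLift g (φ.act g hf hb) := by
  have h1 := φ.isHomLift
  have h2 := coMap_isHomLift (pushMap_isCocartesian p φ.base) hf hb
  unfold act
  infer_instance

theorem leg_eq (φ : TransposeHom p x z) :
    φ.leg = φ.act (𝟙 _) (Category.comp_id _).symm
      (pushMap_isCocartesian p φ.base).toIsHomLift := by
  unfold act
  rw [← coMap_uniq (pushMap_isCocartesian p φ.base) (Category.comp_id _).symm
      (pushMap_isCocartesian p φ.base).toIsHomLift (𝟙 _)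
      (IsHomLift.id (IsHomLift.codomain_eq p φ.base (pushMap p φ.base))) (Category.comp_id _),
    Category.comp_id]

theorem act_comp (φ : TransposeHom p x z) {c : C} (g : p.obj x.of ⟶ c)
    {f : p.obj z.of ⟶ c} (hf : f = φ.base ≫ g) {e : 𝓔} {b : z.of ⟶ e} (hb : p.IsHomLift f b)
    {c' : C} {k : c ⟶ c'} {e' : 𝓔} {κ : e ⟶ e'} (hκ : p.IsHomLift k κ)
    {g' : p.obj x.of ⟶ c'} (hg' : g' = g ≫ k)
    {f' : p.obj z.of ⟶ c'} (hf' : f' = φ.base ≫ g') {b' : z.of ⟶ e'} (hb' : p.IsHomLift f' b')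
    (e : b' = b ≫ κ) :
    φ.act g hf hb ≫ κ = φ.act g' hf' hb' := by
  subst hg'
  unfold act
  rw [Category.assoc]
  congr 1
  apply coMap_uniq
  · have := coMap_isHomLift (pushMap_isCocartesian p φ.base) hf hb
    infer_instance
  · rw [← Category.assoc, coMap_fac, e]

theorem act_congr (φ : TransposeHom p x z) {c : C} {g g' : p.obj x.of ⟶ c} (hg : g = g')
    {f f' : p.obj z.of ⟶ c} (hf : f = φ.base ≫ g) (hf' : f' = φ.base ≫ g') {e : 𝓔}
    {b b' : z.of ⟶ e} (hb : p.IsHomLift f b) (hb' : p.IsHomLift f' b') (e : b = b') :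
    φ.act g hf hb = φ.act g' hf' hb' := by
  subst hg hf hf' e
  rfl

theorem ext_act {φ ψ : TransposeHom p x z} (hb : φ.base = ψ.base)
    (h : ∀ {c : C} (g : p.obj x.of ⟶ c) {f : p.obj z.of ⟶ c} (hf : f = φ.base ≫ g)
      (hf' : f = ψ.base ≫ g) {e : 𝓔} {b : z.of ⟶ e} (hb : p.IsHomLift f b),
      φ.act g hf hb = ψ.act g hf' hb) : φ = ψ := by
  have h1 := φ.leg_eq
  have h2 := ψ.leg_eq
  obtain ⟨f, u, hu⟩ := φ
  obtain ⟨f', u', hu'⟩ := ψ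
  obtain rfl : f = f' := hb
  have := h (𝟙 _) (Category.comp_id _).symm (Category.comp_id _).symm
    (pushMap_isCocartesian p f).toIsHomLift
  obtain rfl : u = u' := h1.trans (this.trans h2.symm)
  rfl

variable (x) in
/-- The identity morphisms of the transpose fibration. -/
noncomputable def id : TransposeHom p x x where
  base := 𝟙 _
  leg := pushMap p (𝟙 _)
  isHomLift := (pushMap_isCocartesian p _).toIsHomLift

theorem id_act {c : C} (g : p.obj x.of ⟶ c) {f : p.obj x.of ⟶ c} (hf : f = (id x).base ≫ g)
    {e : 𝓔} {b : x.of ⟶ e} (hb : p.IsHomLift f b) : (id x).act g hf hb = b :=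
  coMap_fac (pushMap_isCocartesian p (𝟙 _)) hf hb

/-- Composition of cospans: `x ⟶ f_! z ⟶ f_! g_! w ≅ (g ≫ f)_! w`. -/
noncomputable def comp (φ : TransposeHom p x z) (ψ : TransposeHom p z y) : TransposeHom p x y where
  base := ψ.base ≫ φ.base
  leg := φ.act (𝟙 _) (Category.comp_id _).symm
    (ψ.act_isHomLift φ.base rfl (pushMap_isCocartesian p (ψ.base ≫ φ.base)).toIsHomLift)
  isHomLift := φ.act_isHomLift _ _ _

theorem comp_act (φ : TransposeHom p x z) (ψ : TransposeHom p z y) {c : C} (g : p.obj x.of ⟶ c)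
    {f : p.obj y.of ⟶ c} (hf : f = (comp φ ψ).base ≫ g) {e : 𝓔}
    {b : y.of ⟶ e} (hb : p.IsHomLift f b) :
    (comp φ ψ).act g hf hb
      = φ.act g rfl (ψ.act_isHomLift (φ.base ≫ g) (hf.trans (Category.assoc _ _ _)) hb) := by
  refine φ.act_comp (𝟙 _) (Category.comp_id _).symm
    (ψ.act_isHomLift φ.base rfl (pushMap_isCocartesian p (ψ.base ≫ φ.base)).toIsHomLift)
    (coMap_isHomLift (pushMap_isCocartesian p (ψ.base ≫ φ.base)) hf hb)
    (Category.id_comp g).symm rfl _ ?_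
  symm
  exact ψ.act_comp φ.base rfl _ (coMap_isHomLift _ hf hb) rfl (hf.trans (Category.assoc _ _ _))
    hb (coMap_fac _ hf hb).symm

end TransposeHom

noncomputable instance : Category (Transpose p) where
  Hom x z := TransposeHom p x z
  id x := TransposeHom.id x
  comp φ ψ := TransposeHom.comp φ ψ
  id_comp {x z} φ := by
    refine TransposeHom.ext_act (Category.comp_id _) ?_
    intro c g f hf hf' e b hb
    rw [TransposeHom.comp_act, TransposeHom.id_act]
    exact φ.act_congr (Category.id_comp _) _ _ _ _ rfl
  comp_id {x z} φ := by
    refine TransposeHom.ext_act (Category.id_comp _) ?_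
    intro c g f hf hf' e b hb
    rw [TransposeHom.comp_act]
    exact φ.act_congr rfl _ _ _ _ (TransposeHom.id_act _ _ _)
  assoc {x y z w} φ ψ χ := by
    refine TransposeHom.ext_act (Category.assoc _ _ _).symm ?_
    intro c g f hf hf' e b hb
    rw [TransposeHom.comp_act, TransposeHom.comp_act, TransposeHom.comp_act]
    refine φ.act_congr rfl _ _ _ _ ?_
    rw [TransposeHom.comp_act]
    exact ψ.act_congr rfl _ _ _ _ (χ.act_congr (Category.assoc _ _ _) _ _ _ _ rfl)

/-- The transpose fibration `𝓔ᵀ ⥤ Cᵒᵖ`. -/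
def Transpose.proj : Transpose p ⥤ Cᵒᵖ where
  obj x := op (p.obj x.of)
  map φ := φ.base.op
  map_id _ := rfl
  map_comp _ _ := rfl

namespace Transpose

variable {p}

/-- An opCartesian morphism `j : z ⟶ y` of `𝓔`, viewed as the morphism `y ⟶ z` of `𝓔ᵀ` given by
the cospan `y = y ⟵ z`. -/
noncomputable def cart {z y : Transpose p} {j : z.of ⟶ y.of}
    (hj : p.IsCocartesian (p.map j) j) : y ⟶ z where
  base := p.map j
  leg := coMap hj (Category.comp_id _).symm (pushMap_isCocartesian p (p.map j)).toIsHomLift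
  isHomLift := coMap_isHomLift _ _ _

theorem comp_cart_act {z y : Transpose p} {j : z.of ⟶ y.of}
    (hj : p.IsCocartesian (p.map j) j) {c : C} (g : p.obj y.of ⟶ c)
    {f : p.obj z.of ⟶ c} (hf : f = p.map j ≫ g) {e : 𝓔} {b : z.of ⟶ e} (hb : p.IsHomLift f b) :
    j ≫ TransposeHom.act (cart hj) g hf hb = b := by
  have h : j ≫ (cart hj).leg = pushMap p (p.map j) :=
    coMap_fac hj (Category.comp_id _).symm (pushMap_isCocartesian p (p.map j)).toIsHomLift
  unfold TransposeHom.act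
  rw [← Category.assoc, h]
  exact coMap_fac _ hf hb

theorem cart_isStronglyCartesian {z y : Transpose p} {j : z.of ⟶ y.of}
    (hj : p.IsCocartesian (p.map j) j) :
    (Transpose.proj p).IsStronglyCartesian (p.map j).op (cart hj) where
  toIsHomLift := IsHomLift.map (p := Transpose.proj p) (cart hj)
  universal_property' {a} g φ hφ := by
    obtain ⟨g₀, rfl⟩ : ∃ g₀ : p.obj y.of ⟶ p.obj a.of, g = g₀.op := ⟨g.unop, rfl⟩
    have hb : φ.base = p.map j ≫ g₀ :=
      (congrArg Quiver.Hom.unop (@IsHomLift.eq_of_isHomLift _ _ _ _ (Transpose.proj p) a z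
        (g₀.op ≫ (p.map j).op) φ hφ)).symm
    have hl : p.IsHomLift (p.map j ≫ g₀) (j ≫ pushMap p g₀) := inferInstance
    have hb' : p.map j ≫ g₀ = φ.base ≫ 𝟙 _ := by rw [hb, Category.comp_id]
    let χ : a ⟶ y :=
      { base := g₀
        leg := φ.act (𝟙 _) hb' hl
        isHomLift := φ.act_isHomLift _ _ _ }
    refine ⟨χ, ⟨?_, ?_⟩, ?_⟩
    · exact IsHomLift.map (p := Transpose.proj p) χ
    · refine TransposeHom.ext_act hb.symm ?_
      intro c h f hf hf' e b hbl
      have hfj : f = p.map j ≫ g₀ ≫ h := by rw [hf', hb, Category.assoc]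
      refine (TransposeHom.comp_act χ (cart hj) h hf hbl).trans ?_
      refine φ.act_comp (𝟙 _) hb' hl (coMap_isHomLift _ _ _) (Category.id_comp h).symm hf' hbl ?_
      rw [Category.assoc, coMap_fac]
      exact (comp_cart_act hj (g₀ ≫ h) hfj hbl).symm
    · rintro χ' ⟨h1, h2⟩
      have hg : χ'.base = g₀ :=
        (congrArg Quiver.Hom.unop (@IsHomLift.eq_of_isHomLift _ _ _ _ (Transpose.proj p) a y
          g₀.op χ' h1)).symm
      obtain ⟨u, l, hl'⟩ := χ'
      obtain rfl : u = g₀ := hg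
      subst h2
      refine TransposeHom.ext rfl (heq_of_eq ?_)
      refine (TransposeHom.leg_eq _).trans ?_
      symm
      refine (TransposeHom.comp_act _ (cart hj) (𝟙 _) hb' hl).trans ?_
      refine TransposeHom.act_congr _ rfl _ _ _ _ ?_
      refine Eq.trans (coMap_uniq hj (hb'.trans (Category.assoc _ _ _)) hl _
        (TransposeHom.act_isHomLift _ _ _ _) (comp_cart_act hj _ _ hl)) ?_
      symm
      refine coMap_uniq hj _ hl _ ?_ rfl
      rw [Category.comp_id]
      infer_instance

variable (p) in
instance proj_isFibered : (Transpose.proj p).IsFibered :=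
  Functor.IsFibered.of_exists_isStronglyCartesian (by
    rintro z R f
    have key : ∀ {c : C} (f : p.obj z.of ⟶ c) (y : Transpose p) (j : z.of ⟶ y.of)
        (_ : p.IsCocartesian f j),
        ∃ φ : y ⟶ z, (Transpose.proj p).IsStronglyCartesian f.op φ := by
      intro c f y j hj
      obtain rfl := IsHomLift.codomain_eq p f j
      obtain rfl := IsHomLift.eq_of_isHomLift p f j
      exact ⟨_, cart_isStronglyCartesian hj⟩
    obtain ⟨φ, hφ⟩ := key f.unop ⟨pushObj p f.unop⟩ (pushMap p f.unop)
      (pushMap_isCocartesian p _)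
    exact ⟨_, φ, hφ⟩)

end Transpose

end Transpose

section DeltaStructures

theorem hasColimits_simplices {M : Type u} [Category.{v} M] (h : HasColimitsOfSize.{w, w} M) :
    HasColimitsOfSize.{0, w} M :=
  hasColimitsOfSizeShrink.{0, w, w, w} M

theorem hasColimits_zero {M : Type u} [Category.{v} M] (h : HasColimitsOfSize.{w, w} M) :
    HasColimitsOfSize.{0, 0} M :=
  hasColimitsOfSizeShrink.{0, 0, w, w} M

theorem hasCoproducts_small {M : Type u} [Category.{v} M] (h : HasColimitsOfSize.{w, w} M) :
    HasCoproducts.{w} M :=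
  fun _ => h.has_colimits_of_shape _

/-- A `Δ`-structure on a category: a functor `([n], x) ↦ Δⁿ ⊗ x` with a coassociative and counital
comultiplication `Δⁿ ⊗ x ⟶ Δⁿ ⊗ (Δⁿ ⊗ x)` and a natural isomorphism `Δ⁰ ⊗ x ≅ x`. -/
structure DeltaStructure (M : Type u) [Category.{v} M] where
  tensor : SimplexCategory ⥤ M ⥤ M
  diag (n : SimplexCategory) (x : M) :
    (tensor.obj n).obj x ⟶ (tensor.obj n).obj ((tensor.obj n).obj x)
  diag_natural (n : SimplexCategory) {x y : M} (f : x ⟶ y) :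
    (tensor.obj n).map f ≫ diag n y = diag n x ≫ (tensor.obj n).map ((tensor.obj n).map f)
  diag_natural_simplex {m n : SimplexCategory} (θ : m ⟶ n) (x : M) :
    (tensor.map θ).app x ≫ diag n x =
      diag m x ≫ (tensor.obj m).map ((tensor.map θ).app x) ≫ (tensor.map θ).app _
  unit : tensor.obj ⦋0⦌ ≅ 𝟭 M
  coassoc (n : SimplexCategory) (x : M) :
    diag n x ≫ (tensor.obj n).map (diag n x) = diag n x ≫ diag n ((tensor.obj n).obj x)
  counit_left (n : SimplexCategory) (x : M) (σ : n ⟶ ⦋0⦌) :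
    diag n x ≫ (tensor.map σ).app _ ≫ unit.hom.app _ = 𝟙 _
  counit_right (n : SimplexCategory) (x : M) (σ : n ⟶ ⦋0⦌) :
    diag n x ≫ (tensor.obj n).map ((tensor.map σ).app x ≫ unit.hom.app x) = 𝟙 _

namespace DeltaStructure

variable {M : Type u} [Category.{v} M] (S : DeltaStructure M)

section Realization

variable [HasColimitsOfSize.{0, 0} M]

/-- The geometric realization `|Y|`, i.e. the coend of `Δⁿ ⊗ Yₙ`. -/
noncomputable def real : (SimplexCategoryᵒᵖ ⥤ M) ⥤ M where
  obj Y := coend (Y ⋙ S.tensor.flip)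
  map f := coend.map (Functor.whiskerRight f S.tensor.flip)
  map_id Y := by
    refine coend.hom_ext fun n => ?_
    rw [coend.ι_map]
    simp
  map_comp f g := by
    refine coend.hom_ext fun n => ?_
    rw [coend.ι_map, ← Category.assoc, coend.ι_map, Category.assoc, coend.ι_map]
    simp

/-- The canonical morphism `Δⁿ ⊗ Yₙ ⟶ |Y|`. -/
noncomputable def realι (Y : SimplexCategoryᵒᵖ ⥤ M) (n : SimplexCategory) :
    (S.tensor.obj n).obj (Y.obj (op n)) ⟶ S.real.obj Y :=
  coend.ι (Y ⋙ S.tensor.flip) n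

theorem realι_condition (Y : SimplexCategoryᵒᵖ ⥤ M) {m n : SimplexCategory} (θ : m ⟶ n) :
    (S.tensor.obj m).map (Y.map θ.op) ≫ S.realι Y m =
      (S.tensor.map θ).app (Y.obj (op n)) ≫ S.realι Y n :=
  coend.condition (Y ⋙ S.tensor.flip) θ

theorem realι_map {Y Z : SimplexCategoryᵒᵖ ⥤ M} (f : Y ⟶ Z) (n : SimplexCategory) :
    S.realι Y n ≫ S.real.map f = (S.tensor.obj n).map (f.app (op n)) ≫ S.realι Z n :=
  coend.ι_map _ _

/-- Morphisms out of a geometric realization. -/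
noncomputable def realDesc (Y : SimplexCategoryᵒᵖ ⥤ M) {z : M}
    (f : ∀ n : SimplexCategory, (S.tensor.obj n).obj (Y.obj (op n)) ⟶ z)
    (hf : ∀ {m n : SimplexCategory} (θ : m ⟶ n),
      (S.tensor.obj m).map (Y.map θ.op) ≫ f m = (S.tensor.map θ).app (Y.obj (op n)) ≫ f n) :
    S.real.obj Y ⟶ z :=
  coend.desc (F := Y ⋙ S.tensor.flip) f fun _ _ θ => hf θ

theorem realι_desc (Y : SimplexCategoryᵒᵖ ⥤ M) {z : M}
    (f : ∀ n : SimplexCategory, (S.tensor.obj n).obj (Y.obj (op n)) ⟶ z)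
    (hf : ∀ {m n : SimplexCategory} (θ : m ⟶ n),
      (S.tensor.obj m).map (Y.map θ.op) ≫ f m = (S.tensor.map θ).app (Y.obj (op n)) ≫ f n)
    (n : SimplexCategory) : S.realι Y n ≫ S.realDesc Y f hf = f n :=
  coend.ι_desc (F := Y ⋙ S.tensor.flip) f (fun _ _ θ => hf θ) n

theorem real_hom_ext {Y : SimplexCategoryᵒᵖ ⥤ M} {z : M} {f g : S.real.obj Y ⟶ z}
    (h : ∀ n, S.realι Y n ≫ f = S.realι Y n ≫ g) : f = g :=
  coend.hom_ext h

/-- The diagonal of a bisimplicial object. -/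
def diagonal (X : SimplexCategoryᵒᵖ ⥤ SimplexCategoryᵒᵖ ⥤ M) : SimplexCategoryᵒᵖ ⥤ M where
  obj n := (X.obj n).obj n
  map f := (X.map f).app _ ≫ (X.obj _).map f
  map_id n := by simp
  map_comp f g := by simp

theorem diagonalComparison_aux (X : SimplexCategoryᵒᵖ ⥤ SimplexCategoryᵒᵖ ⥤ M) {z : M}
    {m n : SimplexCategory} (θ : m ⟶ n)
    (r : (S.tensor.obj m).obj (S.real.obj (X.obj (op m))) ⟶ z)
    (r' : (S.tensor.obj n).obj (S.real.obj (X.obj (op n))) ⟶ z)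
    (hr : (S.tensor.obj m).map (S.real.map (X.map θ.op)) ≫ r =
      (S.tensor.map θ).app (S.real.obj (X.obj (op n))) ≫ r') :
    (S.tensor.obj m).map ((X.map θ.op).app (op n) ≫ (X.obj (op m)).map θ.op) ≫
        S.diag m ((X.obj (op m)).obj (op m)) ≫
          (S.tensor.obj m).map (S.realι (X.obj (op m)) m) ≫ r =
      (S.tensor.map θ).app ((X.obj (op n)).obj (op n)) ≫
        S.diag n ((X.obj (op n)).obj (op n)) ≫
          (S.tensor.obj n).map (S.realι (X.obj (op n)) n) ≫ r' := by
  have h2 := S.diag_natural_simplex θ ((X.obj (op n)).obj (op n))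
  have h3 := S.realι_condition (X.obj (op m)) θ
  have h5 := S.realι_map (X.map θ.op) n
  have h6 := S.diag_natural m ((X.map θ.op).app (op n) ≫ (X.obj (op m)).map θ.op)
  rw [reassoc_of% h2, reassoc_of% h6]
  congr 1
  rw [← NatTrans.naturality_assoc, ← hr, ← Functor.map_comp_assoc, ← Functor.map_comp_assoc,
    ← Functor.map_comp_assoc]
  congr 2
  rw [Category.assoc, h5, Functor.map_comp, Category.assoc, h3, NatTrans.naturality_assoc]

/-- The natural morphism from the realization of the diagonal of a bisimplicial object to its
iterated realization, given by `Δⁿ ⊗ Xₙₙ ⟶ Δⁿ ⊗ (Δⁿ ⊗ Xₙₙ)`. -/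
noncomputable def diagonalComparison (X : SimplexCategoryᵒᵖ ⥤ SimplexCategoryᵒᵖ ⥤ M) :
    S.real.obj (diagonal X) ⟶ S.real.obj (X ⋙ S.real) :=
  S.realDesc (diagonal X)
    (fun n => S.diag n ((X.obj (op n)).obj (op n)) ≫
      (S.tensor.obj n).map (S.realι (X.obj (op n)) n) ≫ S.realι (X ⋙ S.real) n)
    fun θ => S.diagonalComparison_aux X θ _ _ (S.realι_condition (X ⋙ S.real) θ)

end Realization
section SSetTensor

variable [HasColimitsOfSize.{0, w} M]

/-- The diagram of all `Δⁿ ⊗ x`, indexed by the category of simplices of `T`. -/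
def sDiagram (T : SSet.{w}) (x : M) : T.Elementsᵒᵖ ⥤ M :=
  (CategoryOfElements.π T).leftOp ⋙ S.tensor.flip.obj x

/-- The tensor `T ⊗ x` with a simplicial set: the colimit of `Δⁿ ⊗ x` over the simplices of `T`. -/
noncomputable def sTensor (T : SSet.{w}) (x : M) : M :=
  colimit (S.sDiagram T x)

/-- The morphism `Δⁿ ⊗ x ⟶ T ⊗ x` given by an `n`-simplex of `T`. -/
noncomputable def sι (T : SSet.{w}) (x : M) {n : SimplexCategory} (s : T.obj (op n)) :
    (S.tensor.obj n).obj x ⟶ S.sTensor T x :=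
  colimit.ι (S.sDiagram T x) (op ⟨op n, s⟩)

theorem sι_condition (T : SSet.{w}) (x : M) {m n : SimplexCategory} (θ : m ⟶ n)
    (s : T.obj (op n)) :
    (S.tensor.map θ).app x ≫ S.sι T x s = S.sι T x (T.map θ.op s) :=
  colimit.w (S.sDiagram T x)
    (Quiver.Hom.op (CategoryOfElements.homMk (⟨op n, s⟩ : T.Elements) ⟨op m, T.map θ.op s⟩
      θ.op rfl))

/-- Morphisms out of `T ⊗ x`. -/
noncomputable def sDesc (T : SSet.{w}) (x : M) {z : M}
    (f : ∀ {n : SimplexCategory}, T.obj (op n) → ((S.tensor.obj n).obj x ⟶ z))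
    (hf : ∀ {m n : SimplexCategory} (θ : m ⟶ n) (s : T.obj (op n)),
      (S.tensor.map θ).app x ≫ f s = f (T.map θ.op s)) : S.sTensor T x ⟶ z :=
  colimit.desc (S.sDiagram T x)
    { pt := z
      ι :=
        { app := fun e => f (n := e.unop.1.unop) e.unop.2
          naturality := by
            rintro ⟨⟨⟨n⟩, s⟩⟩ ⟨⟨⟨m⟩, t⟩⟩ ⟨θ, hθ⟩
            refine Eq.trans ?_ (Category.comp_id _).symm
            have h2 : T.map θ t = s := hθ
            exact (hf θ.unop t).trans (congrArg f h2) } }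

theorem sι_desc (T : SSet.{w}) (x : M) {z : M}
    (f : ∀ {n : SimplexCategory}, T.obj (op n) → ((S.tensor.obj n).obj x ⟶ z))
    (hf : ∀ {m n : SimplexCategory} (θ : m ⟶ n) (s : T.obj (op n)),
      (S.tensor.map θ).app x ≫ f s = f (T.map θ.op s)) {n : SimplexCategory} (s : T.obj (op n)) :
    S.sι T x s ≫ S.sDesc T x f hf = f s :=
  colimit.ι_desc _ _

/-- The morphism `T ⊗ f : T ⊗ x ⟶ T ⊗ y`. -/
noncomputable def sMapRight (T : SSet.{w}) {x y : M} (f : x ⟶ y) :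
    S.sTensor T x ⟶ S.sTensor T y :=
  S.sDesc T x (fun {n} s => (S.tensor.obj n).map f ≫ S.sι T y s) fun θ s => by
    rw [← NatTrans.naturality_assoc, sι_condition]

theorem sι_mapRight (T : SSet.{w}) {x y : M} (f : x ⟶ y) {n : SimplexCategory}
    (s : T.obj (op n)) :
    S.sι T x s ≫ S.sMapRight T f = (S.tensor.obj n).map f ≫ S.sι T y s :=
  S.sι_desc T x (fun {n} s => (S.tensor.obj n).map f ≫ S.sι T y s) (fun θ s => by
    rw [← NatTrans.naturality_assoc, sι_condition]) s

/-- The morphism `g ⊗ x : T ⊗ x ⟶ T' ⊗ x`. -/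
noncomputable def sMapLeft {T T' : SSet.{w}} (g : T ⟶ T') (x : M) :
    S.sTensor T x ⟶ S.sTensor T' x :=
  S.sDesc T x (fun {n} s => S.sι T' x (g.app (op n) s)) fun {m n} θ s => by
    rw [sι_condition]
    congr 1
    exact (NatTrans.naturality_apply g θ.op s).symm

/-- The action map `(T × T') ⊗ x ⟶ T ⊗ (T' ⊗ x)`, which on the `n`-simplex `(s, s')` is
`Δⁿ ⊗ x ⟶ Δⁿ ⊗ (Δⁿ ⊗ x)` followed by the inclusions given by `s'` and `s`. -/
noncomputable def actionMap (T T' : SSet.{w}) (x : M) :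
    S.sTensor (MonoidalCategory.tensorObj T T') x ⟶ S.sTensor T (S.sTensor T' x) :=
  S.sDesc (MonoidalCategory.tensorObj T T') x
    (fun {n} s => S.diag n x ≫ (S.tensor.obj n).map
        (S.sι T' x ((CartesianMonoidalCategory.snd T T').app (op n) s)) ≫
      S.sι T (S.sTensor T' x) ((CartesianMonoidalCategory.fst T T').app (op n) s))
    fun {m n} θ s => by
      have h1 := S.diag_natural_simplex θ x
      have h2 : (CartesianMonoidalCategory.snd T T').app (op m)
          ((MonoidalCategory.tensorObj T T').map θ.op s) =
          T'.map θ.op ((CartesianMonoidalCategory.snd T T').app (op n) s) :=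
        NatTrans.naturality_apply (CartesianMonoidalCategory.snd T T') θ.op s
      have h3 : (CartesianMonoidalCategory.fst T T').app (op m)
          ((MonoidalCategory.tensorObj T T').map θ.op s) =
          T.map θ.op ((CartesianMonoidalCategory.fst T T').app (op n) s) :=
        NatTrans.naturality_apply (CartesianMonoidalCategory.fst T T') θ.op s
      rw [h2, h3, reassoc_of% h1, ← NatTrans.naturality_assoc, ← Functor.map_comp_assoc,
        sι_condition, sι_condition]

end SSetTensor

/-- Weak homotopy equivalences of simplicial sets: morphisms whose geometric realization is a
homotopy equivalence. -/
def SSetWeakEquiv {T T' : SSet.{w}} (g : T ⟶ T') : Prop :=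
  ∃ e : ContinuousMap.HomotopyEquiv (SSet.toTop.obj T) (SSet.toTop.obj T'),
    e.toFun = (SSet.toTop.map g).hom

/-- A `Δ`-structure `S` on `M` and a class `W` of morphisms make `M` into a homotopical
`Δ`-category. -/
structure IsHomotopical (W : MorphismProperty M) : Prop where
  isos : MorphismProperty.isomorphisms M ≤ W
  two_out_of_three : W.HasTwoOutOfThreeProperty
  two_out_of_six {a b c d : M} (f : a ⟶ b) (g : b ⟶ c) (h : c ⟶ d) (hfg : W (f ≫ g))
    (hgh : W (g ≫ h)) : W f ∧ W g ∧ W h ∧ W (f ≫ g ≫ h)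
  cocomplete : HasColimitsOfSize.{w, w} M
  preserves (n : SimplexCategory) : PreservesColimitsOfSize.{w, w} (S.tensor.obj n)
  coproducts {ι : Type w} (x y : ι → M) (f : ∀ i, x i ⟶ y i) (hf : ∀ i, W (f i)) :
    W (Limits.Sigma.map f)
  tensor_left {T T' : SSet.{w}} (g : T ⟶ T') (hg : SSetWeakEquiv g) (x : M) :
    haveI := hasColimits_simplices cocomplete
    W (S.sMapLeft g x)
  tensor_right (T : SSet.{w}) {x y : M} (f : x ⟶ y) (hf : W f) :
    haveI := hasColimits_simplices cocomplete
    W (S.sMapRight T f)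
  action (T T' : SSet.{w}) (x : M) :
    haveI := hasColimits_simplices cocomplete
    W (S.actionMap T T' x)
  realization {Y Z : SimplexCategoryᵒᵖ ⥤ M} (f : Y ⟶ Z) (hf : ∀ n, W (f.app n)) :
    haveI := hasColimits_zero.{w} cocomplete
    W (S.real.map f)
  diagonal (X : SimplexCategoryᵒᵖ ⥤ SimplexCategoryᵒᵖ ⥤ M) :
    haveI := hasColimits_zero.{w} cocomplete
    W (S.diagonalComparison X)

end DeltaStructure
end DeltaStructures

section Fibrations

variable {𝓕 : Type u₁} [Category.{v₁} 𝓕] {B : Type u₂} [Category.{v₂} B] {q : 𝓕 ⥤ B}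

theorem isHomLift_comp {a b c : B} {f : a ⟶ b} {g : b ⟶ c} {x y z : 𝓕} {φ : x ⟶ y} {ψ : y ⟶ z}
    (hφ : q.IsHomLift f φ) (hψ : q.IsHomLift g ψ) : q.IsHomLift (f ≫ g) (φ ≫ ψ) :=
  inferInstance

theorem isHomLift_id_comp {a b : B} {f : a ⟶ b} {x y z : 𝓕} {φ : x ⟶ y} {ψ : y ⟶ z}
    (hφ : q.IsHomLift (𝟙 a) φ) (hψ : q.IsHomLift f ψ) : q.IsHomLift f (φ ≫ ψ) :=
  inferInstance

theorem isHomLift_comp_id {a b : B} {f : a ⟶ b} {x y z : 𝓕} {φ : x ⟶ y} {ψ : y ⟶ z}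
    (hφ : q.IsHomLift f φ) (hψ : q.IsHomLift (𝟙 b) ψ) : q.IsHomLift f (φ ≫ ψ) :=
  inferInstance

theorem isHomLift_of_eq {b b' : B} {x y : 𝓕} (h : b = b') {f : x ⟶ y}
    (hf : q.IsHomLift (𝟙 b) f) : q.IsHomLift (𝟙 b') f := by
  subst h
  exact hf

/-- The object of the total category underlying an object of a fibre. -/
def fobj {b : B} (x : q.Fiber b) : 𝓕 := x.1

theorem fobj_over {b : B} (x : q.Fiber b) : q.obj (fobj x) = b := x.2

/-- The morphism of the total category underlying a morphism of a fibre. -/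
def fval {b : B} {x y : q.Fiber b} (f : x ⟶ y) : fobj x ⟶ fobj y := f.1

/-- Constructor for morphisms of a fibre. -/
def fmk {b : B} {x y : q.Fiber b} (f : fobj x ⟶ fobj y) (hf : q.IsHomLift (𝟙 b) f) : x ⟶ y := ⟨f, hf⟩

theorem fval_over {b : B} {x y : q.Fiber b} (f : x ⟶ y) : q.IsHomLift (𝟙 b) (fval f) := f.2

theorem fval_fmk {b : B} {x y : q.Fiber b} (f : fobj x ⟶ fobj y) (hf : q.IsHomLift (𝟙 b) f) :
    fval (fmk f hf) = f := rfl

theorem fval_comp {b : B} {x y z : q.Fiber b} (f : x ⟶ y) (g : y ⟶ z) :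
    fval (f ≫ g) = fval f ≫ fval g := rfl

theorem fval_id {b : B} (x : q.Fiber b) : fval (𝟙 x) = 𝟙 (fobj x) := rfl

theorem fval_ext {b : B} {x y : q.Fiber b} {f g : x ⟶ y} (h : fval f = fval g) : f = g :=
  Subtype.ext h

variable (q) in
/-- A `Δ`-structure on a fibration: a `Δ`-structure on the total category whose tensor product is
a functor over the base and whose comultiplication and unit isomorphism are fibrewise.  That the
pullback functors `f^*` are `Δ`-functors for the induced comparison
`Δⁿ ⊗ f^* x ⟶ f^* (Δⁿ ⊗ x)` is then automatic: the comparison is defined by the universal property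
of Cartesian morphisms, and its compatibility with comultiplication and unit is the naturality of
these with respect to the Cartesian morphisms `f^* x ⟶ x`. -/
structure DeltaFibStructure extends DeltaStructure 𝓕 where
  tensor_over (n : SimplexCategory) {x y : 𝓕} (f : x ⟶ y) :
    q.IsHomLift (q.map f) ((tensor.obj n).map f)
  tensor_simplex_over {m n : SimplexCategory} (θ : m ⟶ n) (x : 𝓕) :
    q.IsHomLift (𝟙 (q.obj x)) ((tensor.map θ).app x)
  diag_over (n : SimplexCategory) (x : 𝓕) : q.IsHomLift (𝟙 (q.obj x)) (diag n x)
  unit_over (x : 𝓕) : q.IsHomLift (𝟙 (q.obj x)) (unit.hom.app x)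

namespace DeltaFibStructure

variable (S : DeltaFibStructure q)

theorem tensor_isHomLift (n : SimplexCategory) {b b' : B} {g : b ⟶ b'} {x y : 𝓕} {f : x ⟶ y}
    (hf : q.IsHomLift g f) : q.IsHomLift g ((S.tensor.obj n).map f) := by
  obtain rfl := IsHomLift.domain_eq q g f
  obtain rfl := IsHomLift.codomain_eq q g f
  obtain rfl := IsHomLift.eq_of_isHomLift q g f
  exact S.tensor_over n f

theorem tensor_obj (n : SimplexCategory) (x : 𝓕) : q.obj ((S.tensor.obj n).obj x) = q.obj x :=
  haveI := S.tensor_over n (𝟙 x)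
  IsHomLift.domain_eq q (q.map (𝟙 x)) ((S.tensor.obj n).map (𝟙 x))

/-- The tensor product `Δⁿ ⊗ x` in a fibre. -/
def fiberTensor (b : B) : SimplexCategory ⥤ q.Fiber b ⥤ q.Fiber b where
  obj n :=
    { obj := fun x => ⟨(S.tensor.obj n).obj (fobj x), (S.tensor_obj n (fobj x)).trans (fobj_over x)⟩
      map := fun f => fmk ((S.tensor.obj n).map (fval f)) (S.tensor_isHomLift n (fval_over f))
      map_id := fun x => fval_ext ((S.tensor.obj n).map_id (fobj x))
      map_comp := fun f g => fval_ext ((S.tensor.obj n).map_comp (fval f) (fval g)) }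
  map θ :=
    { app := fun x => fmk ((S.tensor.map θ).app (fobj x))
        (isHomLift_of_eq (fobj_over x) (S.tensor_simplex_over θ (fobj x)))
      naturality := fun _ _ f => fval_ext ((S.tensor.map θ).naturality (fval f)) }
  map_id n := NatTrans.ext (funext fun x =>
    fval_ext (congrArg (fun t => NatTrans.app t (fobj x)) (S.tensor.map_id n)))
  map_comp θ θ' := NatTrans.ext (funext fun x =>
    fval_ext (congrArg (fun t => NatTrans.app t (fobj x)) (S.tensor.map_comp θ θ')))

/-- The `Δ`-structure on a fibre. -/
def fiber (b : B) : DeltaStructure (q.Fiber b) where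
  tensor := S.fiberTensor b
  diag n x := fmk (S.diag n (fobj x)) (isHomLift_of_eq (fobj_over x) (S.diag_over n (fobj x)))
  diag_natural n x y f := fval_ext (S.diag_natural n (fval f))
  diag_natural_simplex θ x := fval_ext (S.diag_natural_simplex θ (fobj x))
  unit := NatIso.ofComponents
    (fun x =>
      { hom := fmk (S.unit.hom.app (fobj x)) (isHomLift_of_eq (fobj_over x) (S.unit_over (fobj x)))
        inv := fmk (S.unit.inv.app (fobj x)) (by
          have h := isHomLift_of_eq (fobj_over x) (S.unit_over (fobj x))
          exact @IsHomLift.lift_id_inv _ _ _ _ q b _ _ (S.unit.app (fobj x)) h)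
        hom_inv_id := fval_ext (S.unit.hom_inv_id_app (fobj x))
        inv_hom_id := fval_ext (S.unit.inv_hom_id_app (fobj x)) })
    (fun f => fval_ext (S.unit.hom.naturality (fval f)))
  coassoc n x := fval_ext (S.coassoc n (fobj x))
  counit_left n x σ := fval_ext (S.counit_left n (fobj x) σ)
  counit_right n x σ := fval_ext (S.counit_right n (fobj x) σ)

end DeltaFibStructure

variable [q.IsFibered]

/-- A chosen pullback `g^* y` of an object of a fibre. -/
noncomputable def pull {b b' : B} (g : b ⟶ b') (y : q.Fiber b') : q.Fiber b :=
  ⟨Functor.IsPreFibered.pullbackObj (fobj_over y) g, Functor.IsPreFibered.pullbackObj_proj (fobj_over y) g⟩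

/-- The Cartesian morphism `g^* y ⟶ y`. -/
noncomputable def pullπ {b b' : B} (g : b ⟶ b') (y : q.Fiber b') : fobj (pull g y) ⟶ fobj y :=
  Functor.IsPreFibered.pullbackMap (fobj_over y) g

theorem pullπ_isCartesian {b b' : B} (g : b ⟶ b') (y : q.Fiber b') :
    q.IsCartesian g (pullπ g y) :=
  Functor.IsPreFibered.pullbackMap.IsCartesian (fobj_over y) g

theorem pullπ_isStronglyCartesian {b b' : B} (g : b ⟶ b') (y : q.Fiber b') :
    q.IsStronglyCartesian g (pullπ g y) :=
  haveI := pullπ_isCartesian g y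
  inferInstance

theorem pullπ_over {b b' : B} (g : b ⟶ b') (y : q.Fiber b') : q.IsHomLift g (pullπ g y) :=
  (pullπ_isCartesian g y).toIsHomLift

/-- The morphism to `g^* y` over `k` induced by a morphism to `y` over `k ≫ g`. -/
noncomputable def toPull {a b b' : B} (k : a ⟶ b) (g : b ⟶ b') {l : a ⟶ b'} (e : l = k ≫ g)
    {x : 𝓕} {y : q.Fiber b'} {f : x ⟶ fobj y} (hf : q.IsHomLift l f) : x ⟶ fobj (pull g y) :=
  haveI := pullπ_isStronglyCartesian g y
  Functor.IsStronglyCartesian.map q g (pullπ g y) e f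

section

variable {a b b' : B} {k : a ⟶ b} {g : b ⟶ b'} {l : a ⟶ b'} (e : l = k ≫ g)
    {x : 𝓕} {y : q.Fiber b'}

theorem toPull_over {f : x ⟶ fobj y} (hf : q.IsHomLift l f) : q.IsHomLift k (toPull k g e hf) :=
  haveI := pullπ_isStronglyCartesian g y
  Functor.IsStronglyCartesian.map_isHomLift q g (pullπ g y) e f

theorem toPull_fac {f : x ⟶ fobj y} (hf : q.IsHomLift l f) : toPull k g e hf ≫ pullπ g y = f :=
  haveI := pullπ_isStronglyCartesian g y
  Functor.IsStronglyCartesian.fac q g (pullπ g y) e f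

theorem pull_hom_ext {f f' : x ⟶ fobj (pull g y)} (hf : q.IsHomLift k f) (hf' : q.IsHomLift k f')
    (h : f ≫ pullπ g y = f' ≫ pullπ g y) : f = f' :=
  haveI := pullπ_isStronglyCartesian g y
  Functor.IsStronglyCartesian.ext q g (pullπ g y) k h

end

section Coproducts

variable [∀ b : B, HasCoproducts.{w} (q.Fiber b)] {ι : Type w} {b b' : B}

/-- Morphisms over `g` out of a coproduct taken in a fibre. -/
noncomputable def sigmaDescOver (x : ι → q.Fiber b) {z : q.Fiber b'} (g : b ⟶ b')
    {f : ∀ i, fobj (x i) ⟶ fobj z} (hf : ∀ i, q.IsHomLift g (f i)) : fobj (∐ x) ⟶ fobj z :=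
  fval (Sigma.desc (f := x) (P := pull g z) fun i =>
    fmk (toPull (𝟙 b) g (Category.id_comp g).symm (hf i)) (toPull_over _ (hf i))) ≫ pullπ g z

theorem sigmaDescOver_over (x : ι → q.Fiber b) {z : q.Fiber b'} (g : b ⟶ b')
    {f : ∀ i, fobj (x i) ⟶ fobj z} (hf : ∀ i, q.IsHomLift g (f i)) :
    q.IsHomLift g (sigmaDescOver x g hf) :=
  isHomLift_id_comp (fval_over _) (pullπ_over g z)

theorem ι_sigmaDescOver (x : ι → q.Fiber b) {z : q.Fiber b'} (g : b ⟶ b')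
    {f : ∀ i, fobj (x i) ⟶ fobj z} (hf : ∀ i, q.IsHomLift g (f i)) (i : ι) :
    fval (Sigma.ι x i) ≫ sigmaDescOver x g hf = f i := by
  unfold sigmaDescOver
  rw [← Category.assoc, ← fval_comp, Sigma.ι_desc, fval_fmk, toPull_fac]

theorem sigma_hom_ext_over {x : ι → q.Fiber b} {z : q.Fiber b'} {g : b ⟶ b'}
    {f f' : fobj (∐ x) ⟶ fobj z} (hf : q.IsHomLift g f) (hf' : q.IsHomLift g f')
    (h : ∀ i, fval (Sigma.ι x i) ≫ f = fval (Sigma.ι x i) ≫ f') : f = f' := by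
  rw [← toPull_fac (Category.id_comp g).symm hf, ← toPull_fac (Category.id_comp g).symm hf']
  congr 1
  have : (fmk (toPull (𝟙 b) g (Category.id_comp g).symm hf) (toPull_over _ hf) : ∐ x ⟶ pull g z) =
      fmk (toPull (𝟙 b) g (Category.id_comp g).symm hf') (toPull_over _ hf') := by
    refine Sigma.hom_ext _ _ fun i => fval_ext ?_
    refine pull_hom_ext (k := 𝟙 b) (fval_over _) (fval_over _) ?_
    rw [fval_comp, fval_comp, fval_fmk, fval_fmk, Category.assoc, Category.assoc, toPull_fac,
      toPull_fac, h i]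
  exact congrArg fval this

end Coproducts

section Realization

variable (S : DeltaFibStructure q) [∀ b : B, HasColimitsOfSize.{0, 0} (q.Fiber b)] {b b' b'' : B}

/-- Families `Yₙ ⟶ Y'ₙ` of morphisms over `g`, natural in `n`. -/
structure SimplicialOver (g : b ⟶ b') (Y : SimplexCategoryᵒᵖ ⥤ q.Fiber b)
    (Y' : SimplexCategoryᵒᵖ ⥤ q.Fiber b') where
  app (n : SimplexCategoryᵒᵖ) : fobj (Y.obj n) ⟶ fobj (Y'.obj n)
  isHomLift (n : SimplexCategoryᵒᵖ) : q.IsHomLift g (app n)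
  naturality {m n : SimplexCategoryᵒᵖ} (θ : m ⟶ n) :
    fval (Y.map θ) ≫ app n = app m ≫ fval (Y'.map θ)

variable {g : b ⟶ b'} {Y : SimplexCategoryᵒᵖ ⥤ q.Fiber b} {Y' : SimplexCategoryᵒᵖ ⥤ q.Fiber b'}

namespace DeltaFibStructure

/-- The canonical morphism `Δⁿ ⊗ Yₙ ⟶ |Y|` in the total category. -/
noncomputable def ιOver (Y : SimplexCategoryᵒᵖ ⥤ q.Fiber b) (n : SimplexCategory) :
    (S.tensor.obj n).obj (fobj (Y.obj (op n))) ⟶ fobj ((S.fiber b).real.obj Y) :=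
  fval ((S.fiber b).realι Y n)

theorem real_ext_over {z : q.Fiber b'} 
    {f f' : fobj ((S.fiber b).real.obj Y) ⟶ fobj z} (hf : q.IsHomLift g f) (hf' : q.IsHomLift g f')
    (h : ∀ n, S.ιOver Y n ≫ f = S.ιOver Y n ≫ f') : f = f' := by
  rw [← toPull_fac (Category.id_comp g).symm hf, ← toPull_fac (Category.id_comp g).symm hf']
  congr 1
  have : (fmk (toPull (𝟙 b) g (Category.id_comp g).symm hf) (toPull_over _ hf) :
        (S.fiber b).real.obj Y ⟶ pull g z) =
      fmk (toPull (𝟙 b) g (Category.id_comp g).symm hf') (toPull_over _ hf') := by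
    refine (S.fiber b).real_hom_ext fun i => fval_ext ?_
    refine pull_hom_ext (k := 𝟙 b) (fval_over _) (fval_over _) ?_
    rw [fval_comp, fval_comp, fval_fmk, fval_fmk, Category.assoc, Category.assoc, toPull_fac,
      toPull_fac]
    exact h i
  exact congrArg fval this

theorem ιOver_over (Y : SimplexCategoryᵒᵖ ⥤ q.Fiber b) (n : SimplexCategory) :
    q.IsHomLift (𝟙 b) (S.ιOver Y n) :=
  fval_over ((S.fiber b).realι Y n)

theorem ιOver_condition (Y : SimplexCategoryᵒᵖ ⥤ q.Fiber b) {m n : SimplexCategory} (θ : m ⟶ n) :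
    (S.tensor.obj m).map (fval (Y.map θ.op)) ≫ S.ιOver Y m =
      (S.tensor.map θ).app (fobj (Y.obj (op n))) ≫ S.ιOver Y n :=
  congrArg fval ((S.fiber b).realι_condition Y θ)

theorem realOver_aux (φ : SimplicialOver g Y Y') {m n : SimplexCategory} (θ : m ⟶ n) :
    (S.tensor.obj m).map (fval (Y.map θ.op)) ≫ (S.tensor.obj m).map (φ.app (op m)) ≫
        S.ιOver Y' m =
      (S.tensor.map θ).app (fobj (Y.obj (op n))) ≫ (S.tensor.obj n).map (φ.app (op n)) ≫
        S.ιOver Y' n := by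
  rw [← Functor.map_comp_assoc, φ.naturality, Functor.map_comp_assoc, ιOver_condition,
    NatTrans.naturality_assoc]

theorem realOver_aux' (φ : SimplicialOver g Y Y') {m n : SimplexCategory} (θ : m ⟶ n) :
    ((S.fiber b).tensor.obj m).map (Y.map θ.op) ≫
      (fmk (toPull (𝟙 b) g (Category.id_comp g).symm
        (f := (S.tensor.obj m).map (φ.app (op m)) ≫ S.ιOver Y' m)
        (isHomLift_comp_id (S.tensor_isHomLift m (φ.isHomLift _)) (S.ιOver_over _ _)))
          (toPull_over _ _) : ((S.fiber b).tensor.obj m).obj (Y.obj (op m)) ⟶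
            pull g ((S.fiber b').real.obj Y')) =
    ((S.fiber b).tensor.map θ).app (Y.obj (op n)) ≫
      fmk (toPull (𝟙 b) g (Category.id_comp g).symm
        (f := (S.tensor.obj n).map (φ.app (op n)) ≫ S.ιOver Y' n)
        (isHomLift_comp_id (S.tensor_isHomLift n (φ.isHomLift _)) (S.ιOver_over _ _)))
          (toPull_over _ _) := by
  refine fval_ext ?_
  refine pull_hom_ext (k := 𝟙 b) (fval_over _) (fval_over _) ?_
  rw [fval_comp, fval_comp, fval_fmk, fval_fmk, Category.assoc, Category.assoc, toPull_fac,
    toPull_fac]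
  exact S.realOver_aux φ θ

/-- The functoriality of geometric realizations with respect to morphisms of simplicial objects
over a morphism `g` of the base. -/
noncomputable def realOver (φ : SimplicialOver g Y Y') :
    fobj ((S.fiber b).real.obj Y) ⟶ fobj ((S.fiber b').real.obj Y') :=
  fval ((S.fiber b).realDesc Y (z := pull g ((S.fiber b').real.obj Y'))
    (fun n => fmk (toPull (𝟙 b) g (Category.id_comp g).symm
      (f := (S.tensor.obj n).map (φ.app (op n)) ≫ S.ιOver Y' n)
      (isHomLift_comp_id (S.tensor_isHomLift n (φ.isHomLift _)) (S.ιOver_over _ _)))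
        (toPull_over _ _))
    (S.realOver_aux' φ)) ≫ pullπ g _

theorem realOver_over (φ : SimplicialOver g Y Y') : q.IsHomLift g (S.realOver φ) :=
  isHomLift_id_comp (fval_over _) (pullπ_over g _)

theorem ι_realOver (φ : SimplicialOver g Y Y') (n : SimplexCategory) :
    S.ιOver Y n ≫ S.realOver φ = (S.tensor.obj n).map (φ.app (op n)) ≫ S.ιOver Y' n := by
  have h := congrArg fval ((S.fiber b).realι_desc Y (z := pull g ((S.fiber b').real.obj Y'))
    (fun n => fmk (toPull (𝟙 b) g (Category.id_comp g).symm
      (f := (S.tensor.obj n).map (φ.app (op n)) ≫ S.ιOver Y' n)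
      (isHomLift_comp_id (S.tensor_isHomLift n (φ.isHomLift _)) (S.ιOver_over _ _)))
        (toPull_over _ _)) (S.realOver_aux' φ) n)
  refine (Category.assoc _ _ _).symm.trans ?_
  refine (congrArg (· ≫ pullπ g _) h).trans ?_
  exact toPull_fac (Category.id_comp g).symm
    (isHomLift_comp_id (S.tensor_isHomLift n (φ.isHomLift _)) (S.ιOver_over _ _))

theorem realOver_id {g : b ⟶ b} (hg : g = 𝟙 b) (Y : SimplexCategoryᵒᵖ ⥤ q.Fiber b)
    (φ : SimplicialOver g Y Y) (h : ∀ n, φ.app n = 𝟙 _) : S.realOver φ = 𝟙 _ := by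
  subst hg
  refine S.real_ext_over (S.realOver_over φ) (IsHomLift.id (fobj_over _)) fun n => ?_
  refine (S.ι_realOver φ n).trans ?_
  rw [h, CategoryTheory.Functor.map_id, Category.id_comp]
  exact (Category.comp_id _).symm

theorem realOver_comp {g' : b' ⟶ b''} {g'' : b ⟶ b''} (hg : g ≫ g' = g'')
    {Y'' : SimplexCategoryᵒᵖ ⥤ q.Fiber b''} (φ : SimplicialOver g Y Y')
    (φ' : SimplicialOver g' Y' Y'') (φ'' : SimplicialOver g'' Y Y'')
    (h : ∀ n, φ''.app n = φ.app n ≫ φ'.app n) :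
    S.realOver φ'' = S.realOver φ ≫ S.realOver φ' := by
  subst hg
  refine S.real_ext_over (S.realOver_over φ'')
    (isHomLift_comp (S.realOver_over φ) (S.realOver_over φ')) fun n => ?_
  refine (S.ι_realOver φ'' n).trans ?_
  refine Eq.trans ?_ (Category.assoc _ _ _)
  refine Eq.trans ?_ (congrArg (· ≫ S.realOver φ') (S.ι_realOver φ n)).symm
  rw [h, Functor.map_comp, Category.assoc, Category.assoc, ι_realOver]

end DeltaFibStructure

end Realization

end Fibrations

section SimplicialReplacement

variable {C : Type w} [Category.{w} C]

/-- The simplicial replacement of a small category: the category of elements of its nerve.  Objects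
are composable strings `c₀ ⟶ ⋯ ⟶ cₙ`, and a morphism to `c'₀ ⟶ ⋯ ⟶ c'ₘ` is a map `[m] ⟶ [n]` which
carries the first string to the second one. -/
abbrev Simp (C : Type w) [Category.{w} C] : Type w := (nerve C).Elements

/-- The length `n` of a string `c₀ ⟶ ⋯ ⟶ cₙ`. -/
def deg (x : Simp C) : ℕ := x.1.unop.len

/-- The string of composable morphisms underlying an object of the simplicial replacement. -/
def arrows (x : Simp C) : ComposableArrows C (deg x) := x.2

/-- The object `c₀` of `c₀ ⟶ ⋯ ⟶ cₙ`. -/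
abbrev headObj (x : Simp C) : C := (arrows x).obj 0

/-- The object `cₙ` of `c₀ ⟶ ⋯ ⟶ cₙ`. -/
abbrev lastObj (x : Simp C) : C := (arrows x).obj (Fin.last _)

/-- The composite of the string `c₀ ⟶ ⋯ ⟶ cₙ`. -/
def total (x : Simp C) : headObj x ⟶ lastObj x := (arrows x).map (homOfLE (Fin.zero_le _))

/-- The map `[m] ⟶ [n]` underlying a morphism of the simplicial replacement. -/
def ordMap {x y : Simp C} (f : x ⟶ y) : Fin (deg y + 1) →o Fin (deg x + 1) :=
  f.1.unop.toOrderHom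

theorem arrows_obj {x y : Simp C} (f : x ⟶ y) (i : Fin (deg y + 1)) :
    (arrows y).obj i = (arrows x).obj (ordMap f i) := by
  have h : (nerve C).map f.1 x.2 = y.2 := f.2
  have h2 : arrows y = (arrows x).whiskerLeft (SimplexCategory.toCat.map f.1.unop).toFunctor :=
    h.symm
  exact CategoryTheory.Functor.congr_obj h2 i

theorem arrows_map {x y : Simp C} (f : x ⟶ y) {i j : Fin (deg y + 1)} (h : i ≤ j) :
    (arrows y).map (homOfLE h) = eqToHom (arrows_obj f i) ≫
      (arrows x).map (homOfLE ((ordMap f).monotone h)) ≫ eqToHom (arrows_obj f j).symm := by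
  have h0 : (nerve C).map f.1 x.2 = y.2 := f.2
  have h2 : arrows y = (arrows x).whiskerLeft (SimplexCategory.toCat.map f.1.unop).toFunctor :=
    h0.symm
  exact CategoryTheory.Functor.congr_hom h2 (homOfLE h)

/-- The morphism `c'ₘ ⟶ cₙ` induced by a morphism of the simplicial replacement. -/
def lastMap {x y : Simp C} (f : x ⟶ y) : lastObj y ⟶ lastObj x :=
  eqToHom (arrows_obj f (Fin.last _)) ≫ (arrows x).map (homOfLE (Fin.le_last _))

/-- The morphism `c₀ ⟶ c'₀` induced by a morphism of the simplicial replacement. -/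
def headMap {x y : Simp C} (f : x ⟶ y) : headObj x ⟶ headObj y :=
  (arrows x).map (homOfLE (Fin.zero_le _)) ≫ eqToHom (arrows_obj f 0).symm

theorem lastMap_id (x : Simp C) : lastMap (𝟙 x) = 𝟙 _ := by
  have : (arrows x).map (homOfLE (Fin.le_last (Fin.last (deg x)))) = 𝟙 _ :=
    (arrows x).map_id _
  exact (Category.id_comp _).trans this

theorem headMap_id (x : Simp C) : headMap (𝟙 x) = 𝟙 _ := by
  have : (arrows x).map (homOfLE (Fin.zero_le (0 : Fin (deg x + 1)))) = 𝟙 _ :=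
    (arrows x).map_id _
  exact (Category.comp_id _).trans this

theorem ordMap_comp {x y z : Simp C} (f : x ⟶ y) (g : y ⟶ z) (i : Fin (deg z + 1)) :
    ordMap (f ≫ g) i = ordMap f (ordMap g i) := rfl

theorem arrows_comp (x : Simp C) {i j k : Fin (deg x + 1)} (h : i ≤ j) (h' : j ≤ k) :
    (arrows x).map (homOfLE h) ≫ (arrows x).map (homOfLE h') =
      (arrows x).map (homOfLE (h.trans h')) :=
  ((arrows x).map_comp _ _).symm

theorem lastMap_comp {x y z : Simp C} (f : x ⟶ y) (g : y ⟶ z) :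
    lastMap (f ≫ g) = lastMap g ≫ lastMap f := by
  unfold lastMap
  rw [arrows_map f]
  simp only [Category.assoc, eqToHom_trans_assoc, eqToHom_refl, Category.id_comp]
  rw [arrows_comp]
  rfl

theorem headMap_comp {x y z : Simp C} (f : x ⟶ y) (g : y ⟶ z) :
    headMap (f ≫ g) = headMap f ≫ headMap g := by
  unfold headMap
  rw [arrows_map f]
  simp only [Category.assoc, eqToHom_trans, eqToHom_trans_assoc, eqToHom_refl, Category.id_comp]
  rw [← Category.assoc, arrows_comp]
  rfl

theorem head_total_last {x y : Simp C} (f : x ⟶ y) :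
    headMap f ≫ total y ≫ lastMap f = total x := by
  unfold headMap lastMap total
  rw [arrows_map f]
  simp only [Category.assoc, eqToHom_trans_assoc, eqToHom_refl, Category.id_comp]
  rw [arrows_comp, arrows_comp]

variable (C) in
/-- The functor sending `c₀ ⟶ ⋯ ⟶ cₙ` to `cₙ`. -/
def tail : Simp C ⥤ Cᵒᵖ where
  obj x := op (lastObj x)
  map f := (lastMap f).op
  map_id x := congrArg Quiver.Hom.op (lastMap_id x)
  map_comp f g := congrArg Quiver.Hom.op (lastMap_comp f g)

/-- Anchor maps: `[m]` is included into `[n]` as its first `m + 1` elements. -/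
def IsAnchor {x y : Simp C} (f : x ⟶ y) : Prop :=
  ∀ i, (ordMap f i : ℕ) = i

/-- The functor between simplicial replacements induced by a functor. -/
abbrev simpMap {D : Type w} [Category.{w} D] (F : D ⥤ C) : Simp D ⥤ Simp C :=
  NatTrans.mapElements (nerveMap F)

end SimplicialReplacement

section Sections

variable {𝓕 : Type u₁} [Category.{v₁} 𝓕] {B : Type u₂} [Category.{v₂} B]
  {K : Type u₃} [Category.{v₃} K]

/-- Sections over `K` of the pullback of `q` along `k`, i.e. lifts of `k` along `q`. -/
structure Sect (k : K ⥤ B) (q : 𝓕 ⥤ B) where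
  toFunctor : K ⥤ 𝓕
  isHomLift {x y : K} (f : x ⟶ y) : q.IsHomLift (k.map f) (toFunctor.map f)

variable {k : K ⥤ B} {q : 𝓕 ⥤ B}

/-- Morphisms of sections: fibrewise natural transformations. -/
@[ext]
structure SectHom (A A' : Sect k q) where
  toNatTrans : A.toFunctor ⟶ A'.toFunctor
  isHomLift (x : K) : q.IsHomLift (𝟙 (k.obj x)) (toNatTrans.app x)

namespace Sect

theorem proj_obj (A : Sect k q) (x : K) : q.obj (A.toFunctor.obj x) = k.obj x :=
  haveI := A.isHomLift (𝟙 x)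
  IsHomLift.domain_eq q (k.map (𝟙 x)) (A.toFunctor.map (𝟙 x))

/-- The value of a section, as an object of a fibre. -/
def val (A : Sect k q) (x : K) : q.Fiber (k.obj x) := ⟨A.toFunctor.obj x, A.proj_obj x⟩

/-- The action of a section on morphisms. -/
def mor (A : Sect k q) {x y : K} (f : x ⟶ y) : fobj (A.val x) ⟶ fobj (A.val y) :=
  A.toFunctor.map f

theorem mor_over (A : Sect k q) {x y : K} (f : x ⟶ y) : q.IsHomLift (k.map f) (A.mor f) :=
  A.isHomLift f

theorem mor_id (A : Sect k q) (x : K) : A.mor (𝟙 x) = 𝟙 _ := A.toFunctor.map_id x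

theorem mor_comp (A : Sect k q) {x y z : K} (f : x ⟶ y) (g : y ⟶ z) :
    A.mor (f ≫ g) = A.mor f ≫ A.mor g := A.toFunctor.map_comp f g

instance : Category (Sect k q) where
  Hom A A' := SectHom A A'
  id A := ⟨𝟙 _, fun x => IsHomLift.id (A.proj_obj x)⟩
  comp η η' := ⟨η.toNatTrans ≫ η'.toNatTrans, fun x =>
    isHomLift_comp_id (η.isHomLift x) (η'.isHomLift x)⟩
  id_comp _ := SectHom.ext (Category.id_comp _)
  comp_id _ := SectHom.ext (Category.comp_id _)
  assoc _ _ _ := SectHom.ext (Category.assoc _ _ _)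

/-- The components of a morphism of sections. -/
def app {A A' : Sect k q} (η : A ⟶ A') (x : K) : fobj (A.val x) ⟶ fobj (A'.val x) :=
  η.toNatTrans.app x

theorem app_over {A A' : Sect k q} (η : A ⟶ A') (x : K) :
    q.IsHomLift (𝟙 (k.obj x)) (app η x) := η.isHomLift x

theorem app_id (A : Sect k q) (x : K) : app (𝟙 A) x = 𝟙 _ := rfl

theorem app_comp {A A' A'' : Sect k q} (η : A ⟶ A') (η' : A' ⟶ A'') (x : K) :
    app (η ≫ η') x = app η x ≫ app η' x := rfl

theorem app_naturality {A A' : Sect k q} (η : A ⟶ A') {x y : K} (f : x ⟶ y) :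
    A.mor f ≫ app η y = app η x ≫ A'.mor f := η.toNatTrans.naturality f

/-- Pullback of sections along a functor. -/
def pullback {K' : Type*} [Category* K'] (G : K' ⥤ K) : Sect k q ⥤ Sect (G ⋙ k) q where
  obj A := ⟨G ⋙ A.toFunctor, fun f => A.isHomLift (G.map f)⟩
  map η := ⟨Functor.whiskerLeft G η.toNatTrans, fun x => η.isHomLift (G.obj x)⟩
  map_id _ := rfl
  map_comp _ _ := rfl

end Sect
end Sections

section Pi

variable {M : Type u} [Category.{v} M] [HasCoproducts.{w} M] {T : SSet.{w}} (X : T.Elements ⥤ M)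

/-- An `n`-simplex, as an object of the category of elements. -/
def elt (T : SSet.{w}) (n : SimplexCategoryᵒᵖ) (s : T.obj n) : T.Elements := ⟨n, s⟩

/-- The morphism of `T.Elements` from a simplex `s` to its image under a simplicial operator. -/
def simplexMap {m n : SimplexCategoryᵒᵖ} (θ : m ⟶ n) (s : T.obj m) :
    elt T m s ⟶ elt T n (T.map θ s) :=
  CategoryOfElements.homMk (elt T m s) (elt T n (T.map θ s)) θ rfl

/-- The inclusions of the summands of `(ΠX)ₙ`. -/
noncomputable def piι (n : SimplexCategoryᵒᵖ) (s : T.obj n) :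
    X.obj (elt T n s) ⟶ ∐ fun s : T.obj n => X.obj (elt T n s) :=
  Sigma.ι (fun s : T.obj n => X.obj (elt T n s)) s

theorem map_piι {m n : SimplexCategoryᵒᵖ} {s : T.obj m} {t : T.obj n}
    (f : elt T m s ⟶ elt T n t) (θ : m ⟶ n) (hf : f.1 = θ) :
    X.map f ≫ piι X n t = X.map (simplexMap θ s) ≫ piι X n (T.map θ s) := by
  have h : T.map θ s = t := hf ▸ f.2
  subst h
  have h : f = simplexMap θ s := Subtype.ext hf
  rw [h]

/-- The left Kan extension `ΠX` of `X : T.Elements ⥤ M` along the projection to `Δᵒᵖ`, a discrete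
opfibration: `(ΠX)ₙ` is the coproduct of `X(s)` over the `n`-simplices `s` of `T`. -/
noncomputable def piObj : SimplexCategoryᵒᵖ ⥤ M where
  obj n := ∐ fun s : T.obj n => X.obj (elt T n s)
  map {_ n} θ := Sigma.desc fun s => X.map (simplexMap θ s) ≫ piι X n (T.map θ s)
  map_id n := by
    refine Sigma.hom_ext _ _ fun s => ?_
    rw [Sigma.ι_desc, Category.comp_id]
    refine (map_piι X (𝟙 (elt T n s)) (𝟙 n) rfl).symm.trans ?_
    rw [CategoryTheory.Functor.map_id, Category.id_comp]
    rfl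
  map_comp {m n l} θ θ' := by
    refine Sigma.hom_ext _ _ fun s => ?_
    rw [Sigma.ι_desc, ← Category.assoc, Sigma.ι_desc, Category.assoc]
    have h : piι X n (T.map θ s) ≫ Limits.Sigma.desc (fun s : T.obj n =>
        X.map (simplexMap θ' s) ≫ piι X l (T.map θ' s)) =
        X.map (simplexMap θ' (T.map θ s)) ≫ piι X l (T.map θ' (T.map θ s)) :=
      Sigma.ι_desc (f := fun s : T.obj n => X.obj (elt T n s)) _ _
    rw [h, ← CategoryTheory.Functor.map_comp_assoc]
    exact (map_piι X (simplexMap θ s ≫ simplexMap θ' (T.map θ s)) (θ ≫ θ') rfl).symm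

theorem piι_map {m n : SimplexCategoryᵒᵖ} (θ : m ⟶ n) (s : T.obj m) :
    piι X m s ≫ (piObj X).map θ = X.map (simplexMap θ s) ≫ piι X n (T.map θ s) :=
  Sigma.ι_desc _ _

end Pi

section PullMap

variable {𝓕 : Type u₁} [Category.{v₁} 𝓕] {B : Type u₂} [Category.{v₂} B] {q : 𝓕 ⥤ B}
  [q.IsFibered]

/-- The morphism of pullbacks `g^* y ⟶ g'^* y'` over `u` induced by a morphism `y ⟶ y'`. -/
noncomputable def pullMap {b b' a a' : B} {g : b ⟶ a} {g' : b' ⟶ a'} {u : b ⟶ b'} {k : a ⟶ a'}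
    (e : g ≫ k = u ≫ g') {y : q.Fiber a} {y' : q.Fiber a'} {s : fobj y ⟶ fobj y'}
    (hs : q.IsHomLift k s) : fobj (pull g y) ⟶ fobj (pull g' y') :=
  toPull u g' e (isHomLift_comp (pullπ_over g y) hs)

variable {b b' b'' a a' a'' : B} {g : b ⟶ a} {g' : b' ⟶ a'} {g'' : b'' ⟶ a''}
  {u : b ⟶ b'} {k : a ⟶ a'} {u' : b' ⟶ b''} {k' : a' ⟶ a''}

theorem pullMap_over (e : g ≫ k = u ≫ g') {y : q.Fiber a} {y' : q.Fiber a'} {s : fobj y ⟶ fobj y'}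
    (hs : q.IsHomLift k s) : q.IsHomLift u (pullMap e hs) :=
  toPull_over e _

theorem pullMap_fac (e : g ≫ k = u ≫ g') {y : q.Fiber a} {y' : q.Fiber a'} {s : fobj y ⟶ fobj y'}
    (hs : q.IsHomLift k s) : pullMap e hs ≫ pullπ g' y' = pullπ g y ≫ s :=
  toPull_fac e _

theorem pullMap_eq_id {u : b ⟶ b} (hu : u = 𝟙 b) {k : a ⟶ a} (e : g ≫ k = u ≫ g) {y : q.Fiber a}
    {s : fobj y ⟶ fobj y} (hs : q.IsHomLift k s) (h : s = 𝟙 _) :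
    pullMap e hs = 𝟙 (fobj (pull g y)) := by
  subst hu
  refine pull_hom_ext (pullMap_over e hs) (IsHomLift.id (fobj_over _)) ?_
  rw [pullMap_fac, h, Category.comp_id, Category.id_comp]

theorem pullMap_comp {v : b ⟶ b''} (hv : u ≫ u' = v) {l : a ⟶ a''} (e : g ≫ k = u ≫ g')
    (e' : g' ≫ k' = u' ≫ g'') (e'' : g ≫ l = v ≫ g'')
    {y : q.Fiber a} {y' : q.Fiber a'} {y'' : q.Fiber a''} {s : fobj y ⟶ fobj y'}
    {s' : fobj y' ⟶ fobj y''} {s'' : fobj y ⟶ fobj y''} (hs : q.IsHomLift k s)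
    (hs' : q.IsHomLift k' s') (hs'' : q.IsHomLift l s'') (h : s'' = s ≫ s') :
    pullMap e'' hs'' = pullMap e hs ≫ pullMap e' hs' := by
  subst hv
  refine pull_hom_ext (pullMap_over _ _) (isHomLift_comp (pullMap_over e hs)
    (pullMap_over e' hs')) ?_
  rw [Category.assoc, pullMap_fac, pullMap_fac, ← Category.assoc, pullMap_fac, h, Category.assoc]

end PullMap

section Pushforward

variable {C D : Type w} [Category.{w} C] [Category.{w} D] (k : Simp D ⥤ Cᵒᵖ)

theorem idx_ext {c : C} {m n : SimplexCategoryᵒᵖ} (x : (nerve D).obj m)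
    (α : op c ⟶ k.obj (elt (nerve D) m x)) (θ : m ⟶ n) (y : (nerve D).obj n)
    (f : elt (nerve D) m x ⟶ elt (nerve D) n y) (hf : f.1 = θ) :
    (⟨y, α ≫ k.map f⟩ : Σ y : (nerve D).obj n, (op c ⟶ k.obj (elt (nerve D) n y))) =
      ⟨(nerve D).map θ x, α ≫ k.map (simplexMap θ x)⟩ := by
  have h : (nerve D).map θ x = y := hf ▸ f.2
  subst h
  have h : f = simplexMap θ x := Subtype.ext hf
  rw [h]

/-- For `k : Simp D ⥤ Cᵒᵖ` sending `𝐝 = (d₀ ⟶ ⋯ ⟶ dₙ)` to `F dₙ`, the simplicial set of pairs of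
such a string `𝐝` and a morphism `F dₙ ⟶ c` of `C`. -/
def idx (c : C) : SSet.{w} where
  obj n := Σ x : (nerve D).obj n, (op c ⟶ k.obj (elt (nerve D) n x))
  map θ := ↾fun s => ⟨(nerve D).map θ s.1, s.2 ≫ k.map (simplexMap θ s.1)⟩
  map_id n := by
    refine ConcreteCategory.hom_ext _ _ ?_
    rintro ⟨x, α⟩
    refine (idx_ext k x α (𝟙 n) x (𝟙 _) rfl).symm.trans ?_
    rw [CategoryTheory.Functor.map_id, Category.comp_id]
    rfl
  map_comp {_ n _} θ θ' := by
    refine ConcreteCategory.hom_ext _ _ ?_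
    rintro ⟨x, α⟩
    refine (idx_ext k x α (θ ≫ θ') _ (simplexMap θ x ≫ simplexMap θ' _) rfl).symm.trans ?_
    rw [CategoryTheory.Functor.map_comp, ← Category.assoc]
    rfl

section

variable {k} {c : C}

/-- The string `𝐝` of a simplex of `idx k c`. -/
def idxPt (e : (idx k c).Elements) : Simp D := elt (nerve D) e.1 e.2.1

/-- The morphism `F dₙ ⟶ c` of a simplex of `idx k c`, in the opposite category. -/
def idxArr (e : (idx k c).Elements) : op c ⟶ k.obj (idxPt e) := e.2.2

/-- The morphism of strings underlying a morphism of simplices of `idx k c`. -/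
def idxPtMap {e e' : (idx k c).Elements} (f : e ⟶ e') : idxPt e ⟶ idxPt e' :=
  CategoryOfElements.homMk (idxPt e) (idxPt e') f.1 (congrArg Sigma.fst f.2)

theorem idxArr_aux (e : (idx k c).Elements) {n : SimplexCategoryᵒᵖ} (θ : e.1 ⟶ n)
    (s : (idx k c).obj n) (h : (idx k c).map θ e.2 = s) (f : idxPt e ⟶ elt (nerve D) n s.1)
    (hf : f.1 = θ) : idxArr e ≫ k.map f = s.2 := by
  subst h
  have h : f = simplexMap θ e.2.1 := Subtype.ext hf
  rw [h]
  rfl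

theorem idxArr_map {e e' : (idx k c).Elements} (f : e ⟶ e') :
    idxArr e ≫ k.map (idxPtMap f) = idxArr e' :=
  idxArr_aux e f.1 e'.2 f.2 (idxPtMap f) rfl

end

/-- The composite `c₀ ⟶ cₙ` of a string, in the opposite category. -/
def totalOp (x : Simp C) : (tail C).obj x ⟶ op (headObj x) := (total x).op

/-- The map `headMap`, in the opposite category. -/
def headOp {x y : Simp C} (f : x ⟶ y) : op (headObj y) ⟶ op (headObj x) := (headMap f).op

theorem totalOp_eq {x y : Simp C} (f : x ⟶ y) :
    totalOp x = (tail C).map f ≫ totalOp y ≫ headOp f :=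
  (congrArg Quiver.Hom.op (head_total_last f)).symm.trans
    (Category.assoc ((tail C).map f) (totalOp y) (headOp f))

theorem headOp_id (x : Simp C) : headOp (𝟙 x) = 𝟙 _ := congrArg Quiver.Hom.op (headMap_id x)

theorem headOp_comp {x y z : Simp C} (f : x ⟶ y) (g : y ⟶ z) :
    headOp (f ≫ g) = headOp g ≫ headOp f :=
  congrArg Quiver.Hom.op (headMap_comp f g)

variable {k} {𝓕 : Type u₁} [Category.{v₁} 𝓕] {q : 𝓕 ⥤ Cᵒᵖ} [q.IsFibered]

theorem barDiagram_aux (x : Simp C) {e e' : (idx k (headObj x)).Elements} (f : e ⟶ e') :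
    (totalOp x ≫ idxArr e) ≫ k.map (idxPtMap f) = 𝟙 _ ≫ totalOp x ≫ idxArr e' := by
  rw [Category.assoc, idxArr_map, Category.id_comp]

/-- The functor on the simplices of `idx k c₀` which sends `(𝐝, α : F dₙ ⟶ c₀)` to
`(fₘ ⋯ f₁ α)_! S(𝐝)`, for a string `𝐜 = (c₀ ⟶ ⋯ ⟶ cₘ)` with morphisms `fᵢ`. -/
noncomputable def barDiagram (S : Sect k q) (x : Simp C) :
    (idx k (headObj x)).Elements ⥤ q.Fiber ((tail C).obj x) where
  obj e := pull (totalOp x ≫ idxArr e) (S.val (idxPt e))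
  map f := fmk (pullMap (barDiagram_aux x f) (S.mor_over (idxPtMap f))) (pullMap_over _ _)
  map_id e := fval_ext (pullMap_eq_id rfl (barDiagram_aux x (𝟙 e)) (S.mor_over (idxPtMap (𝟙 e)))
    (S.mor_id _))
  map_comp f g := fval_ext (pullMap_comp (Category.id_comp _) (barDiagram_aux x f)
    (barDiagram_aux x g) (barDiagram_aux x (f ≫ g)) (S.mor_over (idxPtMap f))
    (S.mor_over (idxPtMap g)) (S.mor_over (idxPtMap (f ≫ g)))
    (S.mor_comp (idxPtMap f) (idxPtMap g)))

variable [∀ b : Cᵒᵖ, HasCoproducts.{w} (q.Fiber b)]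

/-- The simplicial object `Bₙ(S)(𝐜) = ∐ (fₘ ⋯ f₁ α)_! S(𝐝)` of the fibre over `𝐜`, the coproduct
being over all strings `𝐝` of length `n` and `α : F dₙ ⟶ c₀`. -/
noncomputable def bar (S : Sect k q) (x : Simp C) :
    SimplexCategoryᵒᵖ ⥤ q.Fiber ((tail C).obj x) :=
  piObj (barDiagram S x)

/-- The summand of `Bₙ(S)(𝐜)` given by `𝐝` and `α`. -/
noncomputable def barTerm (S : Sect k q) (x : Simp C) {n : SimplexCategoryᵒᵖ} (d : (nerve D).obj n)
    (α : op (headObj x) ⟶ k.obj (elt (nerve D) n d)) : q.Fiber ((tail C).obj x) :=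
  pull (totalOp x ≫ α) (S.val (elt (nerve D) n d))

/-- The inclusion of the summand of `Bₙ(S)(𝐜)` given by `𝐝` and `α`. -/
noncomputable def barι (S : Sect k q) (x : Simp C) {n : SimplexCategoryᵒᵖ} (d : (nerve D).obj n)
    (α : op (headObj x) ⟶ k.obj (elt (nerve D) n d)) :
    fobj (barTerm S x d α) ⟶ fobj ((bar S x).obj n) :=
  fval (piι (barDiagram S x) n ⟨d, α⟩)

theorem bar_hom_ext {S : Sect k q} {x : Simp C} {n : SimplexCategoryᵒᵖ} {b : Cᵒᵖ} {z : q.Fiber b}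
    {g : (tail C).obj x ⟶ b} {f f' : fobj ((bar S x).obj n) ⟶ fobj z} (hf : q.IsHomLift g f)
    (hf' : q.IsHomLift g f') (h : ∀ d α, barι S x d α ≫ f = barι S x d α ≫ f') : f = f' :=
  sigma_hom_ext_over hf hf' fun s => h s.1 s.2

section

variable {S S' S'' : Sect k q} {x y z : Simp C} {n m l : SimplexCategoryᵒᵖ}
  {d : (nerve D).obj n} {d' : (nerve D).obj m} {d'' : (nerve D).obj l}
  {α : op (headObj x) ⟶ k.obj (elt (nerve D) n d)}
  {β β' : op (headObj y) ⟶ k.obj (elt (nerve D) m d')}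
  {γ : op (headObj z) ⟶ k.obj (elt (nerve D) l d'')}
  {u u₁ : (tail C).obj x ⟶ (tail C).obj y} {u' : (tail C).obj y ⟶ (tail C).obj z}
  {κ κ₁ : k.obj (elt (nerve D) n d) ⟶ k.obj (elt (nerve D) m d')}
  {κ' : k.obj (elt (nerve D) m d') ⟶ k.obj (elt (nerve D) l d'')}
  {s s₁ : fobj (S.val (elt (nerve D) n d)) ⟶ fobj (S'.val (elt (nerve D) m d'))}
  {s' : fobj (S'.val (elt (nerve D) m d')) ⟶ fobj (S''.val (elt (nerve D) l d''))}

/-- The morphism between summands of the bar construction induced by a morphism between values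
of sections. -/
noncomputable def barTermMap (e : (totalOp x ≫ α) ≫ κ = u ≫ totalOp y ≫ β)
    (hs : q.IsHomLift κ s) : fobj (barTerm S x d α) ⟶ fobj (barTerm S' y d' β) :=
  pullMap e hs

theorem barTermMap_over (e : (totalOp x ≫ α) ≫ κ = u ≫ totalOp y ≫ β) (hs : q.IsHomLift κ s) :
    q.IsHomLift u (barTermMap e hs) :=
  pullMap_over e hs

theorem barTermMap_aux (e : (totalOp x ≫ α) ≫ κ = u ≫ totalOp y ≫ β)
    (e' : (totalOp y ≫ β) ≫ κ' = u' ≫ totalOp z ≫ γ) :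
    (totalOp x ≫ α) ≫ κ ≫ κ' = (u ≫ u') ≫ totalOp z ≫ γ := by
  rw [← Category.assoc, e, Category.assoc, e', Category.assoc]

theorem barTermMap_comp (e : (totalOp x ≫ α) ≫ κ = u ≫ totalOp y ≫ β)
    (e' : (totalOp y ≫ β) ≫ κ' = u' ≫ totalOp z ≫ γ) (hs : q.IsHomLift κ s)
    (hs' : q.IsHomLift κ' s') :
    barTermMap e hs ≫ barTermMap e' hs' =
      barTermMap (barTermMap_aux e e') (isHomLift_comp hs hs') :=
  (pullMap_comp rfl e e' (barTermMap_aux e e') hs hs' (isHomLift_comp hs hs') rfl).symm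

theorem barTermMap_barι_congr (e : (totalOp x ≫ α) ≫ κ = u ≫ totalOp y ≫ β)
    (hs : q.IsHomLift κ s) (e' : (totalOp x ≫ α) ≫ κ₁ = u₁ ≫ totalOp y ≫ β')
    (hs' : q.IsHomLift κ₁ s₁) (hβ : β = β') (hu : u = u₁) (hκ : κ = κ₁) (h : s = s₁) :
    barTermMap e hs ≫ barι S' y d' β = barTermMap e' hs' ≫ barι S' y d' β' := by
  subst hβ hu hκ h
  rfl

end

theorem barι_map_aux (x : Simp C) {n m : SimplexCategoryᵒᵖ} (θ : n ⟶ m)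
    (d : (nerve D).obj n) (α : op (headObj x) ⟶ k.obj (elt (nerve D) n d)) :
    (totalOp x ≫ α) ≫ k.map (simplexMap θ d) =
      𝟙 _ ≫ totalOp x ≫ (α ≫ k.map (simplexMap θ d)) := by
  rw [Category.assoc, Category.id_comp]

theorem barι_map (S : Sect k q) (x : Simp C) {n m : SimplexCategoryᵒᵖ} (θ : n ⟶ m)
    (d : (nerve D).obj n) (α : op (headObj x) ⟶ k.obj (elt (nerve D) n d)) :
    barι S x d α ≫ fval ((bar S x).map θ) =
      barTermMap (barι_map_aux x θ d α) (S.mor_over (simplexMap θ d)) ≫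
        barι S x ((nerve D).map θ d) (α ≫ k.map (simplexMap θ d)) :=
  congrArg fval (piι_map (barDiagram S x) θ ⟨d, α⟩)

theorem barApp_aux {x y : Simp C} (ζ : x ⟶ y) {n : SimplexCategoryᵒᵖ}
    (d : (nerve D).obj n) (α : op (headObj x) ⟶ k.obj (elt (nerve D) n d)) :
    (totalOp x ≫ α) ≫ 𝟙 _ = (tail C).map ζ ≫ totalOp y ≫ (headOp ζ ≫ α) := by
  rw [totalOp_eq ζ]
  simp only [Category.assoc, Category.comp_id]

/-- The functoriality of `Bₙ(S)(𝐜)` in `S` and `𝐜`. -/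
noncomputable def barApp {S S' : Sect k q} {x y : Simp C} (ζ : x ⟶ y) (η : S ⟶ S')
    (n : SimplexCategoryᵒᵖ) : fobj ((bar S x).obj n) ⟶ fobj ((bar S' y).obj n) :=
  sigmaDescOver (fun s => (barDiagram S x).obj (elt _ n s)) (z := (bar S' y).obj n)
    ((tail C).map ζ)
    (f := fun s => barTermMap (barApp_aux ζ s.1 s.2) (Sect.app_over η _) ≫
      barι S' y s.1 (headOp ζ ≫ s.2))
    (fun _ => isHomLift_comp_id (barTermMap_over _ _) (fval_over _))

theorem barApp_over {S S' : Sect k q} {x y : Simp C} (ζ : x ⟶ y) (η : S ⟶ S')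
    (n : SimplexCategoryᵒᵖ) : q.IsHomLift ((tail C).map ζ) (barApp ζ η n) :=
  sigmaDescOver_over _ _ _

theorem barι_barApp {S S' : Sect k q} {x y : Simp C} (ζ : x ⟶ y) (η : S ⟶ S')
    {n : SimplexCategoryᵒᵖ} (d : (nerve D).obj n)
    (α : op (headObj x) ⟶ k.obj (elt (nerve D) n d)) :
    barι S x d α ≫ barApp ζ η n =
      barTermMap (barApp_aux ζ d α) (Sect.app_over η _) ≫ barι S' y d (headOp ζ ≫ α) :=
  ι_sigmaDescOver (fun s => (barDiagram S x).obj (elt _ n s)) (z := (bar S' y).obj n)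
    ((tail C).map ζ)
    (f := fun s => barTermMap (barApp_aux ζ s.1 s.2) (Sect.app_over η _) ≫
      barι S' y s.1 (headOp ζ ≫ s.2))
    (fun _ => isHomLift_comp_id (barTermMap_over _ _) (fval_over _)) ⟨d, α⟩

theorem barApp_naturality {S S' : Sect k q} {x y : Simp C} (ζ : x ⟶ y) (η : S ⟶ S')
    {n m : SimplexCategoryᵒᵖ} (θ : n ⟶ m) :
    fval ((bar S x).map θ) ≫ barApp ζ η m = barApp ζ η n ≫ fval ((bar S' y).map θ) := by
  refine bar_hom_ext (isHomLift_id_comp (fval_over _) (barApp_over ζ η m))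
    (isHomLift_comp_id (barApp_over ζ η n) (fval_over _)) fun d α => ?_
  have h1 : barι S x d α ≫ fval ((bar S x).map θ) ≫ barApp ζ η m =
      barTermMap (barTermMap_aux (barι_map_aux x θ d α) (barApp_aux ζ _ _))
        (isHomLift_comp (S.mor_over (simplexMap θ d)) (Sect.app_over η _)) ≫
        barι S' y ((nerve D).map θ d) (headOp ζ ≫ α ≫ k.map (simplexMap θ d)) := by
    rw [← Category.assoc, barι_map, Category.assoc, barι_barApp, ← Category.assoc, barTermMap_comp]
  have h2 : barι S x d α ≫ barApp ζ η n ≫ fval ((bar S' y).map θ) =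
      barTermMap (barTermMap_aux (barApp_aux ζ d α) (barι_map_aux y θ d (headOp ζ ≫ α)))
        (isHomLift_comp (Sect.app_over η _) (S'.mor_over (simplexMap θ d))) ≫
        barι S' y ((nerve D).map θ d) ((headOp ζ ≫ α) ≫ k.map (simplexMap θ d)) := by
    rw [← Category.assoc, barι_barApp, Category.assoc, barι_map, ← Category.assoc, barTermMap_comp]
  refine h1.trans (Eq.trans ?_ h2.symm)
  refine barTermMap_barι_congr _ _ _ _ (Category.assoc _ _ _).symm ?_ ?_ ?_
  · rw [Category.id_comp, Category.comp_id]
  · rw [Category.id_comp, Category.comp_id]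
  · exact Sect.app_naturality η _

theorem barApp_id (S : Sect k q) (x : Simp C) (n : SimplexCategoryᵒᵖ) :
    barApp (𝟙 x) (𝟙 S) n = 𝟙 _ := by
  refine bar_hom_ext (barApp_over (𝟙 x) (𝟙 S) n) ?_ fun d α => ?_
  · rw [(tail C).map_id]
    exact IsHomLift.id (fobj_over _)
  · rw [barι_barApp, Category.comp_id]
    have e : (totalOp x ≫ α) ≫ 𝟙 (k.obj (elt (nerve D) n d)) = 𝟙 _ ≫ totalOp x ≫ α := by
      rw [Category.comp_id, Category.id_comp]
    have hs : q.IsHomLift (𝟙 (k.obj (elt (nerve D) n d))) (𝟙 (fobj (S.val (elt (nerve D) n d)))) :=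
      IsHomLift.id (fobj_over _)
    have h : barTermMap (S := S) (S' := S) e hs = 𝟙 _ := pullMap_eq_id rfl e hs rfl
    refine (barTermMap_barι_congr _ _ e hs ?_ ((tail C).map_id x) rfl rfl).trans ?_
    · rw [headOp_id, Category.id_comp]
    · rw [h, Category.id_comp]

theorem barApp_comp {S S' S'' : Sect k q} {x y z : Simp C} (ζ : x ⟶ y) (ζ' : y ⟶ z) (η : S ⟶ S')
    (η' : S' ⟶ S'') (n : SimplexCategoryᵒᵖ) :
    barApp (ζ ≫ ζ') (η ≫ η') n = barApp ζ η n ≫ barApp ζ' η' n := by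
  refine bar_hom_ext (barApp_over _ _ n) ?_ fun d α => ?_
  · rw [(tail C).map_comp]
    exact isHomLift_comp (barApp_over ζ η n) (barApp_over ζ' η' n)
  · rw [barι_barApp, ← Category.assoc, barι_barApp, Category.assoc, barι_barApp, ← Category.assoc,
      barTermMap_comp]
    refine barTermMap_barι_congr _ _ _ _ ?_ ((tail C).map_comp ζ ζ') (Category.comp_id _).symm rfl
    rw [headOp_comp, Category.assoc]

/-- The functoriality of `B_•(S)(𝐜)` in `S` and `𝐜`, as a morphism of simplicial objects. -/
noncomputable def barOver {S S' : Sect k q} {x y : Simp C} (ζ : x ⟶ y) (η : S ⟶ S') :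
    SimplicialOver ((tail C).map ζ) (bar S x) (bar S' y) where
  app n := barApp ζ η n
  isHomLift n := barApp_over ζ η n
  naturality θ := barApp_naturality ζ η θ

variable (Δ : DeltaFibStructure q) [∀ b : Cᵒᵖ, HasColimitsOfSize.{0, 0} (q.Fiber b)]

/-- The functoriality of `|B_•(S)(𝐜)|` in `S` and `𝐜`. -/
noncomputable def pushMor {S S' : Sect k q} {x y : Simp C} (ζ : x ⟶ y) (η : S ⟶ S') :
    fobj ((Δ.fiber _).real.obj (bar S x)) ⟶ fobj ((Δ.fiber _).real.obj (bar S' y)) :=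
  Δ.realOver (barOver ζ η)

theorem pushMor_over {S S' : Sect k q} {x y : Simp C} (ζ : x ⟶ y) (η : S ⟶ S') :
    q.IsHomLift ((tail C).map ζ) (pushMor Δ ζ η) :=
  Δ.realOver_over _

theorem pushMor_id (S : Sect k q) (x : Simp C) : pushMor Δ (𝟙 x) (𝟙 S) = 𝟙 _ :=
  Δ.realOver_id ((tail C).map_id x) _ _ fun n => barApp_id S x n

theorem pushMor_comp {S S' S'' : Sect k q} {x y z : Simp C} (ζ : x ⟶ y) (ζ' : y ⟶ z) (η : S ⟶ S')
    (η' : S' ⟶ S'') :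
    pushMor Δ (ζ ≫ ζ') (η ≫ η') = pushMor Δ ζ η ≫ pushMor Δ ζ' η' :=
  Δ.realOver_comp ((tail C).map_comp ζ ζ').symm _ _ _ fun n => barApp_comp ζ ζ' η η' n

/-- The derived pushforward: `S` is sent to the section `𝐜 ↦ |B_•(S)(𝐜)|`. -/
noncomputable def pushforward : Sect k q ⥤ Sect (tail C) q where
  obj S :=
    { toFunctor :=
        { obj := fun x => fobj ((Δ.fiber _).real.obj (bar S x))
          map := fun ζ => pushMor Δ ζ (𝟙 S)
          map_id := fun x => pushMor_id Δ S x
          map_comp := fun ζ ζ' => by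
            rw [← pushMor_comp, Category.comp_id] }
      isHomLift := fun ζ => pushMor_over Δ ζ (𝟙 S) }
  map {S S'} η :=
    { toNatTrans :=
        { app := fun x => pushMor Δ (𝟙 x) η
          naturality := fun x y ζ => by
            refine (pushMor_comp Δ ζ (𝟙 y) (𝟙 S) η).symm.trans ?_
            refine Eq.trans ?_ (pushMor_comp Δ (𝟙 x) ζ η (𝟙 S'))
            rw [Category.comp_id, Category.id_comp, Category.comp_id, Category.id_comp] }
      isHomLift := fun x => (tail C).map_id x ▸ pushMor_over Δ (𝟙 x) η }
  map_id S := SectHom.ext (NatTrans.ext (funext fun x => pushMor_id Δ S x))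
  map_comp {S S' S''} η η' := SectHom.ext (NatTrans.ext (funext fun x => by
    exact (congrArg (fun t => pushMor Δ t (η ≫ η')) (Category.comp_id (𝟙 x)).symm).trans
      (pushMor_comp Δ (𝟙 x) (𝟙 x) η η')))

end Pushforward

section HomotopicalOpfibrations

variable {C : Type w} [Category.{w} C] {𝓔 : Type u} [Category.{v} 𝓔] (p : 𝓔 ⥤ C) [IsOpfibration p]

/-- The class of morphisms of the transpose fibration induced by a class of fibrewise morphisms:
the morphisms over identities of the base whose left leg belongs to the given class. -/
def transposeW (W : MorphismProperty 𝓔) : MorphismProperty (Transpose p) := fun x z φ =>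
  ∃ h : p.obj z.of = p.obj x.of, TransposeHom.base φ = eqToHom h ∧ W (TransposeHom.leg φ)

/-- The class of morphisms of the fibre `𝓔ᵀ(b)` induced by a class of fibrewise morphisms. -/
def fiberW (W : MorphismProperty 𝓔) (b : Cᵒᵖ) : MorphismProperty ((Transpose.proj p).Fiber b) :=
  fun _ _ f => transposeW p W (fval f)

/-- Homotopical `Δ`-opfibrations: an opfibration with a homotopical structure (a class `W` of
fibrewise weak equivalences preserved by the transition functors) and a `Δ`-structure (on the
transpose fibration), such that all fibres are homotopical `Δ`-categories. -/
structure HomotopicalDeltaOpfibration where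
  W : MorphismProperty 𝓔
  vertical {x y : 𝓔} (f : x ⟶ y) (hf : W f) : p.IsHomLift (𝟙 (p.obj x)) f
  isos {x y : 𝓔} (f : x ⟶ y) (hf : IsIso f) (h : p.IsHomLift (𝟙 (p.obj x)) f) : W f
  two_out_of_three : W.HasTwoOutOfThreeProperty
  push {c c' : C} {g : c ⟶ c'} {x y x' y' : 𝓔} {α : x ⟶ x'} {α' : y ⟶ y'}
    (hα : p.IsCocartesian g α) (hα' : p.IsCocartesian g α') {f : x ⟶ y} {f' : x' ⟶ y'}
    (hf' : p.IsHomLift (𝟙 c') f') (e : f ≫ α' = α ≫ f') (hf : W f) : W f'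
  delta : DeltaFibStructure (Transpose.proj p)
  homotopical (b : Cᵒᵖ) : DeltaStructure.IsHomotopical.{w} (delta.fiber b) (fiberW p W b)

end HomotopicalOpfibrations

section DerivedSections

variable {C D : Type w} [Category.{w} C] [Category.{w} D] {𝓔 : Type u} [Category.{v} 𝓔]

/-- Resolutions: opfibrations whose fibres have contractible nerves. -/
structure IsResolution (F : D ⥤ C) : Prop where
  isOpfibration : IsOpfibration F
  contractible (c : C) : ContractibleSpace (SSet.toTop.obj (nerve (F.Fiber c)))

/-- The category of presections of `p` over `C`: sections over the simplicial replacement of `C` of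
the pullback of the transpose fibration of `p` along the last object functor. -/
abbrev PSect (p : 𝓔 ⥤ C) [IsOpfibration p] := Sect (tail C) (Transpose.proj p)

/-- The category of presections over `D` of the pullback of `p` along `F : D ⥤ C`: sections over the
simplicial replacement of `D` of the pullback of the transpose fibration of `p` along the functor
sending `d₀ ⟶ ⋯ ⟶ dₙ` to `F dₙ`. -/
abbrev PSectOver (F : D ⥤ C) (p : 𝓔 ⥤ C) [IsOpfibration p] :=
  Sect (simpMap F ⋙ tail C) (Transpose.proj p)

/-- The pullback functor `𝔽^*` on presections. -/
noncomputable abbrev pullbackFunctor (F : D ⥤ C) (p : 𝓔 ⥤ C) [IsOpfibration p] : PSect p ⥤ PSectOver F p :=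
  Sect.pullback (simpMap F)

variable {p : 𝓔 ⥤ C} [IsOpfibration p]

namespace HomotopicalDeltaOpfibration

variable (H : HomotopicalDeltaOpfibration p)

/-- Weakly Cartesian morphisms of the transpose fibration: a weak equivalence followed by a
Cartesian morphism. -/
def IsWeaklyCartesian {x z : Transpose p} (f : x ⟶ z) : Prop :=
  ∃ (y : Transpose p) (j : x ⟶ y) (κ : y ⟶ z), transposeW p H.W j ∧
    (Transpose.proj p).IsCartesian ((Transpose.proj p).map κ) κ ∧ j ≫ κ = f

/-- The weak equivalences of (pre)sections, defined objectwise. -/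
def weakEquivalences (k : Simp D ⥤ Cᵒᵖ) : MorphismProperty (Sect k (Transpose.proj p)) :=
  fun _ _ η => ∀ x, transposeW p H.W (Sect.app η x)

/-- Derived sections: presections sending anchor maps to weakly Cartesian morphisms. -/
def IsDerived (k : Simp D ⥤ Cᵒᵖ) : ObjectProperty (Sect k (Transpose.proj p)) :=
  fun A => ∀ ⦃x y : Simp D⦄ (f : x ⟶ y), IsAnchor f → H.IsWeaklyCartesian (A.mor f)

/-- Locally constant presections over `D`: for each fibre `D(c)` of `F`, all morphisms of the
simplicial replacement of `D(c)` are sent to weak equivalences. -/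
def IsLocallyConstant (F : D ⥤ C) : ObjectProperty (PSectOver F p) :=
  fun A => ∀ (c : C) ⦃x y : Simp (F.Fiber c)⦄ (f : x ⟶ y),
    transposeW p H.W (A.mor ((simpMap (Functor.Fiber.fiberInclusion (p := F) (S := c))).map f))

/-- The presections over `D` which are locally constant derived sections. -/
def IsDerivedLocallyConstant (F : D ⥤ C) : ObjectProperty (PSectOver F p) :=
  fun A => H.IsDerived _ A ∧ H.IsLocallyConstant F A

theorem hasCoproducts (H : HomotopicalDeltaOpfibration p) (b : Cᵒᵖ) : HasCoproducts.{w} ((Transpose.proj p).Fiber b) :=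
  hasCoproducts_small (H.homotopical b).cocomplete

theorem hasColimits (H : HomotopicalDeltaOpfibration p) (b : Cᵒᵖ) : HasColimitsOfSize.{0, 0} ((Transpose.proj p).Fiber b) :=
  hasColimits_zero.{w} (H.homotopical b).cocomplete

/-- The derived pushforward `𝔽_!`. -/
noncomputable def pushforwardFunctor (F : D ⥤ C) : PSectOver F p ⥤ PSect p :=
  haveI := H.hasCoproducts
  haveI := H.hasColimits
  pushforward (k := simpMap F ⋙ tail C) H.delta

/-- The object `d₀` of a string `𝐝 = (d₀ ⟶ ⋯ ⟶ dₙ)`, as an object (a string of length `0`) of the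
simplicial replacement of the fibre `D(F d₀)`. -/
def headPoint (F : D ⥤ C) (x : Simp D) : Simp (F.Fiber (F.obj (headObj x))) :=
  elt (nerve (F.Fiber (F.obj (headObj x)))) (op ⦋0⦌)
    (ComposableArrows.mk₀ (Functor.Fiber.mk (p := F) (a := headObj x) rfl))

/-- For a functor `X` from the simplicial replacement of a category to a fibre of the transpose
fibration, the simplicial object `ΠX` and its realization `|X| = |ΠX|`. -/
noncomputable def realizationOf {B : Type w} [Category.{w} B] {b : Cᵒᵖ}
    (X : Simp B ⥤ (Transpose.proj p).Fiber b) : (Transpose.proj p).Fiber b :=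
  haveI := H.hasCoproducts
  haveI := H.hasColimits
  (H.delta.fiber b).real.obj (piObj X)

/-- The morphism `X(a) ⟶ |X|` given by the inclusion of the summand `X(a)` of `(ΠX)₀`, for an object
`a` viewed as a string of length `0`. -/
noncomputable def toRealizationOf {B : Type w} [Category.{w} B] {b : Cᵒᵖ}
    (X : Simp B ⥤ (Transpose.proj p).Fiber b) (a : (nerve B).obj (op ⦋0⦌)) :
    X.obj (elt (nerve B) (op ⦋0⦌) a) ⟶ H.realizationOf X :=
  haveI := H.hasCoproducts
  haveI := H.hasColimits
  piι X (op ⦋0⦌) a ≫ (H.delta.fiber b).unit.inv.app _ ≫ (H.delta.fiber b).realι (piObj X) ⦋0⦌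

/-- `F`-special homotopical `Δ`-opfibrations: for each string `𝐝 = (d₀ ⟶ ⋯ ⟶ dₙ)` in `D` and each
functor `X` from the simplicial replacement of the fibre `D(F d₀)` to the fibre over `F dₙ` which
sends all morphisms to weak equivalences, `X(d₀) ⟶ |X|` is a weak equivalence. -/
def IsSpecial (F : D ⥤ C) : Prop :=
  ∀ (x : Simp D)
    (X : Simp (F.Fiber (F.obj (headObj x))) ⥤
      (Transpose.proj p).Fiber ((simpMap F ⋙ tail C).obj x)),
    (∀ ⦃y z⦄ (f : y ⟶ z), fiberW p H.W _ (X.map f)) →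
      fiberW p H.W _ (H.toRealizationOf X (headPoint F x).2)

end HomotopicalDeltaOpfibration

end DerivedSections

section HomotopyCategories

variable {𝓐 : Type u₁} [Category.{v₁} 𝓐] {𝓑 : Type u₂} [Category.{v₂} 𝓑]

/-- The homotopy category of the full subcategory of `𝓐` on the objects satisfying `P`: its
localization at the weak equivalences of `𝓐` between its objects. -/
abbrev Ho (W : MorphismProperty 𝓐) (P : ObjectProperty 𝓐) :=
  (W.inverseImage P.ι).Localization

/-- The functor between homotopy categories of full subcategories induced by a functor which
preserves weak equivalences between their objects, and maps one subcategory to the other one. -/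
noncomputable def hoMap {W : MorphismProperty 𝓐} {P : ObjectProperty 𝓐} {W' : MorphismProperty 𝓑}
    {P' : ObjectProperty 𝓑} (G : 𝓐 ⥤ 𝓑) (hP : ∀ A, P A → P' (G.obj A))
    (hW : ∀ ⦃A A' : 𝓐⦄ (f : A ⟶ A'), P A → P A' → W f → W' (G.map f)) : Ho W P ⥤ Ho W' P' :=
  Localization.Construction.lift
    (P'.lift (P.ι ⋙ G) (fun A => hP A.obj A.property) ⋙ (W'.inverseImage P'.ι).Q)
    fun A A' f hf => (W'.inverseImage P'.ι).Q_inverts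
      ((P'.lift (P.ι ⋙ G) (fun A => hP A.obj A.property)).map f)
      (hW f.hom A.property A'.property hf)

end HomotopyCategories

end DerSect

/-!
Write `T_𝐜 = |B_•(S)(𝐜)|` for the value of the derived pushforward `𝔽_! S` at a string
`𝐜 = (c₀ ⟶ ⋯ ⟶ cₘ)`, where `B_n(S)(𝐜)` is the coproduct of the values of `S` (transported to the
fibre over `cₘ`) over the pairs of a string `d₀ ⟶ ⋯ ⟶ dₙ` of `D` and a morphism `F dₙ ⟶ c₀`.

*The values of the pushforward.*  The key point is `bar_point_W`: if `S` is a locally constant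
derived section, then for every object `d` of the fibre `D(c₀)` the summand of `B_0(S)(𝐜)` given by
`d` and `F d = c₀` includes into `T_𝐜` by a weak equivalence.  Indeed `B_•(S)(𝐜)` is the
simplicial object `ΠX` of a functor `X` on the category of elements of the simplicial set
`K = {(d₀ ⟶ ⋯ ⟶ dₙ, F dₙ ⟶ c₀)}`, and the nerve `K'` of `D(c₀)` maps to `K`.  The bisimplicial
object `relBi`, which in bidegree `(n, m)` is the coproduct of the `X(s)` over the simplices `s` of
`K` of dimension `[n] ⋆ [m]` of which the restriction to `[m]` comes from `K'`, has augmentations to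
`ΠX` and to the restriction of `ΠX` to `K'`.  In the `n`-direction it is contractible because
`[n] ⋆ [m]` contracts to `[m]` (`relBiSnd_W`); in the `m`-direction it is so because the opCartesian
morphism `dₙ ⟶ α_! dₙ` can be inserted into a string between `[n]` and `[m]` in a unique way
(`fibreInsertion`, `relBiFst_W`).  As realizations of diagonals can be computed by iterated
realizations, `|ΠX|` is compared with the realization of the restriction to `D(c₀)` (`real_point`),
for which the statement is the `F`-speciality of the opfibration.  It follows that `𝔽_! S` is a
derived section (`isDerived_pushforward`).

*The equivalence.*  There is no direct natural transformation between `A` and `𝔽_! 𝔽^* A`, or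
between `S` and `𝔽^* 𝔽_! S`, but there are zigzags `A ⟵ joinSect F A ⟶ 𝔽_! 𝔽^* A` and
`S ⟵ joinSect (𝟭 D) S ⟶ 𝔽^* 𝔽_! S`.  Here the value of `joinSect` at a string `x` is the realization
of the coproducts of the values of the section over the strings of dimension `[n] ⋆ [m]` with end
`x` and with a first part which comes from `D`; the two morphisms are the restriction of such
strings to `x` and to their first part.  In the first zigzag the second morphism is a weak
equivalence (`joinBar_W`), as restrictions to first parts are anchor maps; in the second zigzag the
first morphism is one (`joinAug_W`), as `[n] ⋆ [m]` contracts to `[m]`.  In both cases the other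
morphism is a weak equivalence by two-out-of-three (`joinAug_W_iff`): both are so after composition
with the inclusion of the summand given by a degenerate string, by the computation of the values of
the pushforward above.  The zigzags become isomorphisms of functors between the homotopy categories
(`hoMapCompIso`).
-/

namespace DerSect

set_option linter.unusedSectionVars false

/-! ### Coproducts over the elements of a presheaf -/

section ElementSums

variable {M : Type u} [Category.{v} M] [HasCoproducts.{w} M] {P : Type u₁} [Category.{v₁} P]

/-- An element of a presheaf, as an object of the category of elements. -/
abbrev el (T : P ⥤ Type w) (n : P) (s : T.obj n) : T.Elements := ⟨n, s⟩

/-- The morphism of the category of elements from an element to its image. -/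
def eltMap {T : P ⥤ Type w} {m n : P} (θ : m ⟶ n) (s : T.obj m) :
    el T m s ⟶ el T n (T.map θ s) :=
  CategoryOfElements.homMk (el T m s) (el T n (T.map θ s)) θ rfl

variable {T : P ⥤ Type w} (X : T.Elements ⥤ M)

theorem map_sigma_congr {a : T.Elements} {n : P} {s t : T.obj n} (f : a ⟶ el T n s)
    (g : a ⟶ el T n t) (h : f.1 = g.1) :
    X.map f ≫ Sigma.ι (fun s : T.obj n => X.obj (el T n s)) s =
      X.map g ≫ Sigma.ι (fun s : T.obj n => X.obj (el T n s)) t := by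
  obtain rfl : s = t := by
    refine (f.2 : T.map f.1 a.2 = s).symm.trans ?_
    rw [h]
    exact g.2
  rw [show f = g from Subtype.ext h]

/-- The left Kan extension of `X` along the projection from the category of elements: its value
at `n` is the coproduct of `X(s)` over the elements `s` of `T` at `n`. -/
noncomputable def elSum : P ⥤ M where
  obj n := ∐ fun s : T.obj n => X.obj (el T n s)
  map {_ n} θ := Sigma.desc fun s => X.map (eltMap θ s) ≫
    Sigma.ι (fun s : T.obj n => X.obj (el T n s)) (T.map θ s)
  map_id n := by
    refine Sigma.hom_ext _ _ fun s => ?_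
    rw [Sigma.ι_desc, Category.comp_id]
    refine (map_sigma_congr X (eltMap (𝟙 n) s) (𝟙 (el T n s)) rfl).trans ?_
    rw [CategoryTheory.Functor.map_id, Category.id_comp]
  map_comp {m n l} θ θ' := by
    refine Sigma.hom_ext _ _ fun s => ?_
    rw [Sigma.ι_desc, ← Category.assoc, Sigma.ι_desc, Category.assoc, Sigma.ι_desc,
      ← CategoryTheory.Functor.map_comp_assoc]
    exact map_sigma_congr X _ (eltMap θ s ≫ eltMap θ' (T.map θ s)) rfl

/-- The inclusion of a summand of `∐ₛ X(s)`. -/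
noncomputable def elι (n : P) (s : T.obj n) : X.obj (el T n s) ⟶ (elSum X).obj n :=
  Sigma.ι (fun s : T.obj n => X.obj (el T n s)) s

theorem map_elι_congr {a : T.Elements} {n : P} {s t : T.obj n} (f : a ⟶ el T n s)
    (g : a ⟶ el T n t) (h : f.1 = g.1) : X.map f ≫ elι X n s = X.map g ≫ elι X n t :=
  map_sigma_congr X f g h

theorem elι_map {m n : P} (θ : m ⟶ n) (s : T.obj m) :
    elι X m s ≫ (elSum X).map θ = X.map (eltMap θ s) ≫ elι X n (T.map θ s) :=
  Sigma.ι_desc _ _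

variable {X} in
theorem elSum_hom_ext {n : P} {z : M} {f g : (elSum X).obj n ⟶ z}
    (h : ∀ s, elι X n s ≫ f = elι X n s ≫ g) : f = g :=
  Sigma.hom_ext _ _ h

/-- Morphisms out of `∐ₛ X(s)`. -/
noncomputable def elDesc {n : P} {z : M} (f : ∀ s : T.obj n, X.obj (el T n s) ⟶ z) :
    (elSum X).obj n ⟶ z := Sigma.desc f

theorem elι_desc {n : P} {z : M} (f : ∀ s : T.obj n, X.obj (el T n s) ⟶ z) (s : T.obj n) :
    elι X n s ≫ elDesc X f = f s := Sigma.ι_desc _ _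

theorem elι_desc_assoc {n : P} {z z' : M} (f : ∀ s : T.obj n, X.obj (el T n s) ⟶ z) (s : T.obj n)
    (h : z ⟶ z') : elι X n s ≫ elDesc X f ≫ h = f s ≫ h := by
  rw [← Category.assoc, elι_desc]

/-- Natural transformations out of `∐ₛ X(s)`. -/
noncomputable def elSumDesc {Y : P ⥤ M} (f : ∀ (n : P) (s : T.obj n), X.obj (el T n s) ⟶ Y.obj n)
    (hf : ∀ {m n : P} (θ : m ⟶ n) (s : T.obj m),
      X.map (eltMap θ s) ≫ f n (T.map θ s) = f m s ≫ Y.map θ) : elSum X ⟶ Y where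
  app n := elDesc X (f n)
  naturality {m n} θ := elSum_hom_ext fun s => by
    rw [← Category.assoc, elι_map, Category.assoc, elι_desc, hf, elι_desc_assoc]

theorem elι_elSumDesc {Y : P ⥤ M} (f : ∀ (n : P) (s : T.obj n), X.obj (el T n s) ⟶ Y.obj n)
    (hf : ∀ {m n : P} (θ : m ⟶ n) (s : T.obj m),
      X.map (eltMap θ s) ≫ f n (T.map θ s) = f m s ≫ Y.map θ) (n : P) (s : T.obj n) :
    elι X n s ≫ (elSumDesc X f hf).app n = f n s := elι_desc _ _ _

/-- The functor `X` with constant value `x` on the elements of `T`. -/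
noncomputable abbrev constEl (T : P ⥤ Type w) (x : M) : T.Elements ⥤ M :=
  (Functor.const T.Elements).obj x

/-- The coproduct of copies of `x` indexed by the elements of `T`. -/
noncomputable abbrev copower (T : P ⥤ Type w) (x : M) : P ⥤ M := elSum (constEl T x)

/-- The inclusion of a copy of `x` in a copower. -/
noncomputable def copι (T : P ⥤ Type w) (x : M) (n : P) (s : T.obj n) :
    x ⟶ (copower T x).obj n := elι (constEl T x) n s

theorem copι_map (T : P ⥤ Type w) (x : M) {m n : P} (θ : m ⟶ n) (s : T.obj m) :
    copι T x m s ≫ (copower T x).map θ = copι T x n (T.map θ s) :=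
  (elι_map (constEl T x) θ s).trans (Category.id_comp _)

theorem copι_map_assoc (T : P ⥤ Type w) (x : M) {m n : P} (θ : m ⟶ n) (s : T.obj m) {z : M}
    (h : (copower T x).obj n ⟶ z) :
    copι T x m s ≫ (copower T x).map θ ≫ h = copι T x n (T.map θ s) ≫ h := by
  rw [← Category.assoc, copι_map]

theorem copower_hom_ext {T : P ⥤ Type w} {x : M} {n : P} {z : M} {f g : (copower T x).obj n ⟶ z}
    (h : ∀ s, copι T x n s ≫ f = copι T x n s ≫ g) : f = g := elSum_hom_ext h

/-- Morphisms out of a copower. -/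
noncomputable def copDesc {T : P ⥤ Type w} {x : M} {n : P} {z : M} (f : T.obj n → (x ⟶ z)) :
    (copower T x).obj n ⟶ z := elDesc (constEl T x) f

theorem copι_desc {T : P ⥤ Type w} {x : M} {n : P} {z : M} (f : T.obj n → (x ⟶ z)) (s : T.obj n) :
    copι T x n s ≫ copDesc f = f s := elι_desc _ _ _

theorem copι_desc_assoc {T : P ⥤ Type w} {x : M} {n : P} {z z' : M} (f : T.obj n → (x ⟶ z))
    (s : T.obj n) (h : z ⟶ z') : copι T x n s ≫ copDesc f ≫ h = f s ≫ h := by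
  rw [← Category.assoc, copι_desc]

/-- The functoriality of copowers. -/
noncomputable def copMap {T T' : P ⥤ Type w} (g : T ⟶ T') {x y : M} (f : x ⟶ y) :
    copower T x ⟶ copower T' y where
  app n := copDesc fun s => f ≫ copι T' y n (g.app n s)
  naturality {m n} θ := copower_hom_ext fun s => by
    rw [copι_map_assoc, copι_desc, copι_desc_assoc, Category.assoc, copι_map,
      NatTrans.naturality_apply]

theorem copι_copMap {T T' : P ⥤ Type w} (g : T ⟶ T') {x y : M} (f : x ⟶ y) (n : P)
    (s : T.obj n) : copι T x n s ≫ (copMap g f).app n = f ≫ copι T' y n (g.app n s) :=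
  copι_desc _ _

theorem copι_copMap_assoc {T T' : P ⥤ Type w} (g : T ⟶ T') {x y : M} (f : x ⟶ y) (n : P)
    (s : T.obj n) {z : M} (h : (copower T' y).obj n ⟶ z) :
    copι T x n s ≫ (copMap g f).app n ≫ h = f ≫ copι T' y n (g.app n s) ≫ h := by
  rw [← Category.assoc, copι_copMap, Category.assoc]

end ElementSums

/-! ### Homotopical `Δ`-categories -/

section Homotopical

variable {M : Type u} [Category.{v} M] {S : DeltaStructure M} {W : MorphismProperty M}

namespace DeltaStructure

section

variable [HasColimitsOfSize.{0, 0} M]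

/-- The morphism between diagonals induced by a morphism of bisimplicial objects. -/
def diagonalMap {X Y : SimplexCategoryᵒᵖ ⥤ SimplexCategoryᵒᵖ ⥤ M} (f : X ⟶ Y) :
    diagonal X ⟶ diagonal Y where
  app n := (f.app n).app n
  naturality m n θ := by
    have h1 := (f.app n).naturality θ
    have h2 := congrArg (fun t => NatTrans.app t m) (f.naturality θ)
    simp only [NatTrans.comp_app] at h2
    change ((X.map θ).app m ≫ (X.obj n).map θ) ≫ (f.app n).app n =
      (f.app m).app m ≫ (Y.map θ).app m ≫ (Y.obj n).map θ
    rw [Category.assoc, h1, reassoc_of% h2]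

theorem ι_diagonalComparison (X : SimplexCategoryᵒᵖ ⥤ SimplexCategoryᵒᵖ ⥤ M)
    (n : SimplexCategory) :
    S.realι (diagonal X) n ≫ S.diagonalComparison X =
      S.diag n ((X.obj (op n)).obj (op n)) ≫ (S.tensor.obj n).map (S.realι (X.obj (op n)) n) ≫
        S.realι (X ⋙ S.real) n :=
  S.realι_desc (diagonal X) _
    (fun θ => S.diagonalComparison_aux X θ _ _ (S.realι_condition (X ⋙ S.real) θ)) n

theorem diagonalMap_comparison_aux {X Y : SimplexCategoryᵒᵖ ⥤ SimplexCategoryᵒᵖ ⥤ M} (f : X ⟶ Y)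
    (n : SimplexCategory) :
    (S.tensor.obj n).map ((f.app (op n)).app (op n)) ≫ S.diag n ((Y.obj (op n)).obj (op n)) ≫
        (S.tensor.obj n).map (S.realι (Y.obj (op n)) n) ≫ S.realι (Y ⋙ S.real) n =
      S.diag n ((X.obj (op n)).obj (op n)) ≫ (S.tensor.obj n).map (S.realι (X.obj (op n)) n) ≫
        (S.tensor.obj n).map (S.real.map (f.app (op n))) ≫ S.realι (Y ⋙ S.real) n := by
  have h1 := S.diag_natural n ((f.app (op n)).app (op n))
  rw [reassoc_of% h1, ← Functor.map_comp_assoc, ← S.realι_map, Functor.map_comp_assoc]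

theorem diagonalMap_comparison {X Y : SimplexCategoryᵒᵖ ⥤ SimplexCategoryᵒᵖ ⥤ M} (f : X ⟶ Y) :
    S.real.map (diagonalMap f) ≫ S.diagonalComparison Y =
      S.diagonalComparison X ≫ S.real.map (Functor.whiskerRight f S.real) := by
  refine S.real_hom_ext fun n => ?_
  refine (Category.assoc _ _ _).symm.trans ?_
  refine (congrArg (· ≫ S.diagonalComparison Y) (S.realι_map (diagonalMap f) n)).trans ?_
  refine (Category.assoc _ _ _).trans ?_
  refine (congrArg (_ ≫ ·) (S.ι_diagonalComparison Y n)).trans ?_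
  refine (S.diagonalMap_comparison_aux f n).trans ?_
  refine Eq.trans ?_ (Category.assoc _ _ _)
  refine Eq.trans ?_ (congrArg (· ≫ _) (S.ι_diagonalComparison X n).symm)
  rw [Category.assoc, Category.assoc, S.realι_map]
  rfl

/-- The canonical morphism from `x` to the realization of the constant simplicial object. -/
noncomputable def toRealConst (x : M) :
    x ⟶ S.real.obj ((Functor.const SimplexCategoryᵒᵖ).obj x) :=
  S.unit.inv.app x ≫ S.realι ((Functor.const SimplexCategoryᵒᵖ).obj x) ⦋0⦌

theorem realAug_aux {X : SimplexCategoryᵒᵖ ⥤ M} {x : M}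
    (ε : X ⟶ (Functor.const SimplexCategoryᵒᵖ).obj x) {m n : SimplexCategory} (θ : m ⟶ n) :
    (S.tensor.obj m).map (X.map θ.op) ≫ (S.tensor.obj m).map (ε.app (op m)) ≫
      (S.tensor.map (SimplexCategory.const m ⦋0⦌ 0)).app x ≫ S.unit.hom.app x =
    (S.tensor.map θ).app (X.obj (op n)) ≫ (S.tensor.obj n).map (ε.app (op n)) ≫
      (S.tensor.map (SimplexCategory.const n ⦋0⦌ 0)).app x ≫ S.unit.hom.app x := by
  have h : (S.tensor.map θ).app x ≫ (S.tensor.map (SimplexCategory.const n ⦋0⦌ 0)).app x =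
      (S.tensor.map (SimplexCategory.const m ⦋0⦌ 0)).app x := by
    rw [← NatTrans.comp_app, ← Functor.map_comp]
    congr 2
  have h' : X.map θ.op ≫ ε.app (op m) = ε.app (op n) :=
    (ε.naturality θ.op).trans (Category.comp_id _)
  rw [← Functor.map_comp_assoc, h', ← NatTrans.naturality_assoc]
  exact congrArg (_ ≫ ·) ((reassoc_of% h) _).symm

/-- The morphism from a geometric realization given by an augmentation. -/
noncomputable def realAug {X : SimplexCategoryᵒᵖ ⥤ M} {x : M}
    (ε : X ⟶ (Functor.const SimplexCategoryᵒᵖ).obj x) : S.real.obj X ⟶ x :=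
  S.realDesc X (fun n => (S.tensor.obj n).map (ε.app (op n)) ≫
      (S.tensor.map (SimplexCategory.const n ⦋0⦌ 0)).app x ≫ S.unit.hom.app x)
    (S.realAug_aux ε)

theorem ι_realAug {X : SimplexCategoryᵒᵖ ⥤ M} {x : M}
    (ε : X ⟶ (Functor.const SimplexCategoryᵒᵖ).obj x) (n : SimplexCategory) :
    S.realι X n ≫ S.realAug ε = (S.tensor.obj n).map (ε.app (op n)) ≫
      (S.tensor.map (SimplexCategory.const n ⦋0⦌ 0)).app x ≫ S.unit.hom.app x :=
  S.realι_desc X _ (S.realAug_aux ε) n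

theorem ι_realAug_assoc {X : SimplexCategoryᵒᵖ ⥤ M} {x y : M}
    (ε : X ⟶ (Functor.const SimplexCategoryᵒᵖ).obj x) (n : SimplexCategory) (h : x ⟶ y) :
    S.realι X n ≫ S.realAug ε ≫ h = (S.tensor.obj n).map (ε.app (op n)) ≫
      (S.tensor.map (SimplexCategory.const n ⦋0⦌ 0)).app x ≫ S.unit.hom.app x ≫ h := by
  rw [← Category.assoc, ι_realAug, Category.assoc, Category.assoc]

theorem toRealConst_realAug (x : M) : S.toRealConst x ≫ S.realAug (𝟙 _) = 𝟙 x := by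
  unfold toRealConst
  rw [Category.assoc, ι_realAug]
  have : SimplexCategory.const ⦋0⦌ ⦋0⦌ 0 = 𝟙 _ := by
    apply Subsingleton.elim
  rw [this, CategoryTheory.Functor.map_id]
  simp

theorem realAug_toRealConst (x : M) :
    S.realAug (𝟙 ((Functor.const SimplexCategoryᵒᵖ).obj x)) ≫ S.toRealConst x = 𝟙 _ := by
  refine S.real_hom_ext fun n => ?_
  rw [ι_realAug_assoc]
  unfold toRealConst
  have h := S.realι_condition ((Functor.const SimplexCategoryᵒᵖ).obj x)
    (SimplexCategory.const n ⦋0⦌ 0)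
  simp only [NatTrans.id_app, CategoryTheory.Functor.map_id, Category.id_comp,
    Iso.hom_inv_id_app_assoc, Category.comp_id]
  refine h.symm.trans ?_
  simp

theorem realAug_eq {X : SimplexCategoryᵒᵖ ⥤ M} {x : M}
    (ε : X ⟶ (Functor.const SimplexCategoryᵒᵖ).obj x) :
    S.realAug ε = S.real.map ε ≫ S.realAug (𝟙 _) := by
  refine S.real_hom_ext fun n => ?_
  rw [ι_realAug, ← Category.assoc (S.realι X n), S.realι_map, Category.assoc, ι_realAug]
  simp

theorem isIso_realAug_id (x : M) :
    IsIso (S.realAug (𝟙 ((Functor.const SimplexCategoryᵒᵖ).obj x))) :=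
  ⟨S.toRealConst x, S.realAug_toRealConst x, S.toRealConst_realAug x⟩

end

end DeltaStructure

end Homotopical

section Homotopical

variable {M : Type u} [Category.{v} M] {S : DeltaStructure M} {W : MorphismProperty M}

section CopowerTensor

variable [HasCoproducts.{w} M] {P : Type u₁} [Category.{v₁} P] (G : M ⥤ M)
  [PreservesColimitsOfSize.{w, w} G]

instance isIso_sigmaComparison {ι : Type w} (x : ι → M) : IsIso (sigmaComparison G x) := by
  have : PreservesColimit (Discrete.functor x) G :=
    (PreservesColimitsOfSize.preservesColimitsOfShape (F := G)).preservesColimit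
  infer_instance

/-- Morphisms out of the image of a copower under a functor preserving coproducts. -/
noncomputable def mapCopDesc {T : P ⥤ Type w} {x z : M} {n : P} (f : T.obj n → (G.obj x ⟶ z)) :
    G.obj ((copower T x).obj n) ⟶ z :=
  (@asIso _ _ _ _ (sigmaComparison G fun _ : T.obj n => x) (isIso_sigmaComparison G _)).inv ≫
    Sigma.desc f

theorem map_copι_desc {T : P ⥤ Type w} {x z : M} {n : P} (f : T.obj n → (G.obj x ⟶ z))
    (s : T.obj n) : G.map (copι T x n s) ≫ mapCopDesc G f = f s := by
  have h : G.map (copι T x n s) =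
      Sigma.ι (fun _ : T.obj n => G.obj x) s ≫ sigmaComparison G fun _ : T.obj n => x :=
    (ι_comp_sigmaComparison G (fun _ : T.obj n => x) s).symm
  refine (congrArg (· ≫ mapCopDesc G f) h).trans ((Category.assoc _ _ _).trans ?_)
  exact (congrArg (_ ≫ ·) (Iso.hom_inv_id_assoc (@asIso _ _ _ _
    (sigmaComparison G fun _ : T.obj n => x) (isIso_sigmaComparison G _)) (Sigma.desc f))).trans
      (Sigma.ι_desc f s)

theorem map_copι_desc_assoc {T : P ⥤ Type w} {x z z' : M} {n : P} (f : T.obj n → (G.obj x ⟶ z))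
    (s : T.obj n) (h : z ⟶ z') : G.map (copι T x n s) ≫ mapCopDesc G f ≫ h = f s ≫ h := by
  rw [← Category.assoc, map_copι_desc]

theorem map_copower_hom_ext {T : P ⥤ Type w} {x z : M} {n : P}
    {f g : G.obj ((copower T x).obj n) ⟶ z}
    (h : ∀ s, G.map (copι T x n s) ≫ f = G.map (copι T x n s) ≫ g) : f = g := by
  refine (cancel_epi (sigmaComparison G fun _ : T.obj n => x)).mp ?_
  refine Sigma.hom_ext _ _ fun s => ?_
  have h' : Sigma.ι (fun _ : T.obj n => G.obj x) s ≫ (sigmaComparison G fun _ : T.obj n => x) =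
      G.map (copι T x n s) := ι_comp_sigmaComparison G (fun _ : T.obj n => x) s
  refine (Category.assoc _ _ _).symm.trans (Eq.trans ?_ (Category.assoc _ _ _))
  refine (congrArg (· ≫ f) h').trans ((h s).trans ?_)
  exact (congrArg (· ≫ g) h').symm

end CopowerTensor

namespace DeltaStructure

section

variable [HasCoproducts.{w} M] [HasColimitsOfSize.{0, 0} M] [HasColimitsOfSize.{0, w} M]

theorem sTensorToReal_aux (T : SSet.{w}) (x : M) {m n : SimplexCategory} (θ : m ⟶ n)
    (s : T.obj (op n)) :
    (S.tensor.map θ).app x ≫ (S.tensor.obj n).map (copι T x (op n) s) ≫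
      S.realι (copower T x) n =
    (S.tensor.obj m).map (copι T x (op m) (T.map θ.op s)) ≫ S.realι (copower T x) m := by
  rw [← copι_map, Functor.map_comp_assoc, S.realι_condition, NatTrans.naturality_assoc]

/-- The comparison of the tensor product with a simplicial set with the realization of a
copower. -/
noncomputable def sTensorToReal (T : SSet.{w}) (x : M) :
    S.sTensor T x ⟶ S.real.obj (copower T x) :=
  S.sDesc T x (fun {n} s => (S.tensor.obj n).map (copι T x (op n) s) ≫ S.realι (copower T x) n)
    (S.sTensorToReal_aux T x)

theorem ι_sTensorToReal (T : SSet.{w}) (x : M) {n : SimplexCategory} (s : T.obj (op n)) :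
    S.sι T x s ≫ S.sTensorToReal T x =
      (S.tensor.obj n).map (copι T x (op n) s) ≫ S.realι (copower T x) n :=
  S.sι_desc T x (fun {n} s => (S.tensor.obj n).map (copι T x (op n) s) ≫ S.realι (copower T x) n)
    (S.sTensorToReal_aux T x) s

theorem ι_sTensorToReal_assoc (T : SSet.{w}) (x : M) {n : SimplexCategory} (s : T.obj (op n))
    {y : M} (h : S.real.obj (copower T x) ⟶ y) : S.sι T x s ≫ S.sTensorToReal T x ≫ h =
      (S.tensor.obj n).map (copι T x (op n) s) ≫ S.realι (copower T x) n ≫ h := by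
  rw [← Category.assoc, ι_sTensorToReal, Category.assoc]

theorem sTensor_hom_ext {T : SSet.{w}} {x z : M} {f g : S.sTensor T x ⟶ z}
    (h : ∀ (n : SimplexCategory) (s : T.obj (op n)), S.sι T x s ≫ f = S.sι T x s ≫ g) :
    f = g :=
  colimit.hom_ext fun e => h e.unop.1.unop e.unop.2

theorem realToSTensor_aux [∀ n, PreservesColimitsOfSize.{w, w} (S.tensor.obj n)] (T : SSet.{w})
    (x : M) {m n : SimplexCategory} (θ : m ⟶ n) :
    (S.tensor.obj m).map ((copower T x).map θ.op) ≫
      mapCopDesc (S.tensor.obj m) (fun s : T.obj (op m) => S.sι T x s) =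
    (S.tensor.map θ).app ((copower T x).obj (op n)) ≫
      mapCopDesc (S.tensor.obj n) (fun s : T.obj (op n) => S.sι T x s) := by
  refine map_copower_hom_ext _ fun s => ?_
  rw [← Functor.map_comp_assoc, copι_map, map_copι_desc, NatTrans.naturality_assoc,
    map_copι_desc, S.sι_condition]

/-- The tensor product with a simplicial set is the realization of a copower, as the functors
`Δⁿ ⊗ -` preserve coproducts. -/
theorem isIso_sTensorToReal [∀ n, PreservesColimitsOfSize.{w, w} (S.tensor.obj n)] (T : SSet.{w})
    (x : M) : IsIso (S.sTensorToReal T x) := by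
  have h n : S.realι (copower T x) n ≫ S.realDesc (copower T x) _ (S.realToSTensor_aux T x) =
      mapCopDesc (S.tensor.obj n) (fun s : T.obj (op n) => S.sι T x s) :=
    S.realι_desc (copower T x) _ (S.realToSTensor_aux T x) n
  refine ⟨S.realDesc (copower T x) _ (S.realToSTensor_aux T x), ?_, ?_⟩
  · refine sTensor_hom_ext fun n s => ?_
    rw [ι_sTensorToReal_assoc, h, map_copι_desc, Category.comp_id]
  · refine S.real_hom_ext fun n => ?_
    rw [reassoc_of% h, Category.comp_id]
    refine map_copower_hom_ext _ fun s => ?_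
    rw [map_copι_desc_assoc, ι_sTensorToReal]

theorem ι_sMapLeft {T T' : SSet.{w}} (g : T ⟶ T') (x : M) {n : SimplexCategory}
    (s : T.obj (op n)) : S.sι T x s ≫ S.sMapLeft g x = S.sι T' x (g.app (op n) s) :=
  S.sι_desc T x (fun {n} s => S.sι T' x (g.app (op n) s)) (fun {m n} θ s => by
    rw [sι_condition]
    congr 1
    exact (NatTrans.naturality_apply g θ.op s).symm) s

theorem ι_sMapLeft_assoc {T T' : SSet.{w}} (g : T ⟶ T') (x : M) {n : SimplexCategory}
    (s : T.obj (op n)) {y : M} (h : S.sTensor T' x ⟶ y) :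
    S.sι T x s ≫ S.sMapLeft g x ≫ h = S.sι T' x (g.app (op n) s) ≫ h := by
  rw [← Category.assoc, ι_sMapLeft]

theorem sMapLeft_toReal {T T' : SSet.{w}} (g : T ⟶ T') (x : M) :
    S.sMapLeft g x ≫ S.sTensorToReal T' x = S.sTensorToReal T x ≫ S.real.map (copMap g (𝟙 x)) := by
  refine sTensor_hom_ext fun n s => ?_
  rw [ι_sMapLeft_assoc, ι_sTensorToReal, ι_sTensorToReal_assoc, S.realι_map, ← Functor.map_comp_assoc,
    copι_copMap, Category.id_comp]

end

end DeltaStructure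

/-! ### Weak equivalences between realizations -/

namespace DeltaStructure

/-- The swap of the two simplicial directions does not change the diagonal. -/
def diagonalFlip (X : SimplexCategoryᵒᵖ ⥤ SimplexCategoryᵒᵖ ⥤ M) :
    diagonal X ≅ diagonal X.flip :=
  NatIso.ofComponents (fun _ => Iso.refl _) fun {m n} θ => by
    refine (Category.comp_id _).trans (Eq.trans ?_ (Category.id_comp _).symm)
    exact ((X.map θ).naturality θ).symm

namespace IsHomotopical

theorem of_isIso (h : IsHomotopical.{w} S W) {x y : M} (f : x ⟶ y) [IsIso f] : W f :=
  h.isos f (MorphismProperty.isomorphisms.infer_property f)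

theorem comp (h : IsHomotopical.{w} S W) {x y z : M} {f : x ⟶ y} {g : y ⟶ z} (hf : W f)
    (hg : W g) : W (f ≫ g) :=
  have := h.two_out_of_three
  W.comp_mem f g hf hg

theorem of_comp_right (h : IsHomotopical.{w} S W) {x y z : M} {f : x ⟶ y} {g : y ⟶ z} (hg : W g)
    (hfg : W (f ≫ g)) : W f :=
  have := h.two_out_of_three
  W.of_postcomp f g hg hfg

theorem of_comp_left (h : IsHomotopical.{w} S W) {x y z : M} {f : x ⟶ y} {g : y ⟶ z} (hf : W f)
    (hfg : W (f ≫ g)) : W g :=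
  have := h.two_out_of_three
  W.of_precomp f g hf hfg

variable [HasCoproducts.{w} M] [HasColimitsOfSize.{0, 0} M]

/-- A weak equivalence of simplicial sets induces a weak equivalence between the realizations of
copowers. -/
theorem real_copMap (h : IsHomotopical.{w} S W) {T T' : SSet.{w}} (g : T ⟶ T')
    (hg : SSetWeakEquiv g) (x : M) : W (S.real.map (copMap g (𝟙 x))) := by
  have := hasColimits_simplices h.cocomplete
  have := h.preserves
  have := isIso_sTensorToReal (S := S) T x
  have := isIso_sTensorToReal (S := S) T' x
  refine h.of_comp_left (h.of_isIso (S.sTensorToReal T x)) ?_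
  rw [← sMapLeft_toReal]
  exact h.comp (h.tensor_left g hg x) (h.of_isIso _)

/-- A morphism of bisimplicial objects whose realizations in one direction are weak equivalences
induces a weak equivalence between the realizations of the diagonals. -/
theorem real_diagonalMap (h : IsHomotopical.{w} S W)
    {X Y : SimplexCategoryᵒᵖ ⥤ SimplexCategoryᵒᵖ ⥤ M} (f : X ⟶ Y)
    (hf : ∀ n, W (S.real.map (f.app n))) : W (S.real.map (diagonalMap f)) := by
  refine h.of_comp_right (h.diagonal Y) ?_
  rw [diagonalMap_comparison]
  exact h.comp (h.diagonal X) (h.realization _ hf)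

/-- The variant of `real_diagonalMap` for the realizations in the other direction. -/
theorem real_diagonalMap_flip (h : IsHomotopical.{w} S W)
    {X Y : SimplexCategoryᵒᵖ ⥤ SimplexCategoryᵒᵖ ⥤ M} (f : X ⟶ Y)
    (hf : ∀ n, W (S.real.map (((flipFunctor _ _ _).map f).app n))) :
    W (S.real.map (diagonalMap f)) := by
  have e : diagonalMap f ≫ (diagonalFlip Y).hom =
      (diagonalFlip X).hom ≫ diagonalMap ((flipFunctor _ _ _).map f) := by
    refine NatTrans.ext (funext fun n => ?_)
    exact (Category.comp_id _).trans (Category.id_comp _).symm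
  refine h.of_comp_right (h.of_isIso (S.real.map (diagonalFlip Y).hom)) ?_
  rw [← Functor.map_comp, e, Functor.map_comp]
  exact h.comp (h.of_isIso _) (h.real_diagonalMap _ hf)

end IsHomotopical

end DeltaStructure

end Homotopical

/-! ### Topological realizations of simplices -/

section Topology

/-- Any morphism between simplicial sets with contractible realizations is a weak equivalence. -/
theorem sSetWeakEquiv_of_contractible {T T' : SSet.{w}} (g : T ⟶ T')
    [ContractibleSpace (SSet.toTop.obj T)] [ContractibleSpace (SSet.toTop.obj T')] :
    DeltaStructure.SSetWeakEquiv g := by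
  obtain ⟨x, hx⟩ := id_nullhomotopic (SSet.toTop.obj T)
  obtain ⟨y, hy⟩ := id_nullhomotopic (SSet.toTop.obj T')
  have h1 : (ContinuousMap.const (SSet.toTop.obj T') x).comp (SSet.toTop.map g).hom =
    ContinuousMap.const _ x := rfl
  have h2 : (SSet.toTop.map g).hom.comp (ContinuousMap.const (SSet.toTop.obj T') x) =
    ContinuousMap.const _ ((SSet.toTop.map g).hom x) := rfl
  have h3 : (ContinuousMap.const (SSet.toTop.obj T') y).Homotopic
      (ContinuousMap.const _ ((SSet.toTop.map g).hom x)) :=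
    ContinuousMap.homotopic_const_iff.mpr (PathConnectedSpace.joined _ _)
  exact ⟨⟨(SSet.toTop.map g).hom, ContinuousMap.const _ x, by rw [h1]; exact hx.symm,
    by rw [h2]; exact (hy.trans h3).symm⟩, rfl⟩

instance contractibleSpace_stdSimplex (n : SimplexCategory) :
    ContractibleSpace (SSet.toTop.obj (SSet.stdSimplex.{w}.obj n)) := by
  have h1 : ContractibleSpace (stdSimplex ℝ (Fin (n.len + 1))) :=
    (convex_stdSimplex ℝ (Fin (n.len + 1))).contractibleSpace
      ⟨_, (inferInstance : Nonempty (stdSimplex ℝ (Fin (n.len + 1)))).some.2⟩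
  have e : SSet.toTop.obj (SSet.stdSimplex.{w}.obj n) ≃ₜ stdSimplex ℝ (Fin (n.len + 1)) :=
    (TopCat.homeoOfIso (SSet.toTopSimplex.{w}.app n)).trans Homeomorph.ulift
  exact e.contractibleSpace

theorem nonempty_of_toTop {T : SSet.{w}} (h : Nonempty (SSet.toTop.obj T)) :
    Nonempty (T.obj (op ⦋0⦌)) := by
  by_contra h0
  have h1 (n : SimplexCategoryᵒᵖ) (s : T.obj n) : False :=
    h0 ⟨T.map (SimplexCategory.const ⦋0⦌ n.unop 0).op s⟩
  let f : T ⟶ TopCat.toSSet.obj (TopCat.of PEmpty.{w + 1}) :=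
    { app := fun n => ↾fun s => (h1 n s).elim
      naturality := fun m n θ => by
        ext s
        exact (h1 m s).elim }
  exact (((sSetTopAdj.homEquiv T (TopCat.of PEmpty.{w + 1})).symm f).hom h.some).elim

end Topology

/-! ### Simplicial homotopies -/

section Homotopies

variable {M : Type u} [Category.{v} M]

/-- A homotopy `X × Δ¹ ⟶ Y` of simplicial objects, given by its restrictions to the copies of
`Xₙ` indexed by the `n`-simplices of `Δ¹`. -/
structure SHomotopy (X Y : SimplexCategoryᵒᵖ ⥤ M) where
  h (n : SimplexCategory) (τ : n ⟶ ⦋1⦌) : X.obj (op n) ⟶ Y.obj (op n)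
  naturality {m n : SimplexCategory} (θ : m ⟶ n) (τ : n ⟶ ⦋1⦌) :
    X.map θ.op ≫ h m (θ ≫ τ) = h n τ ≫ Y.map θ.op

namespace SHomotopy

variable {X Y : SimplexCategoryᵒᵖ ⥤ M} (H : SHomotopy X Y)

/-- The two ends of a homotopy. -/
def side (i : Fin 2) : X ⟶ Y where
  app n := H.h n.unop (SimplexCategory.const n.unop ⦋1⦌ i)
  naturality _ _ θ := H.naturality θ.unop (SimplexCategory.const _ ⦋1⦌ i)

variable [HasCoproducts.{w} M]

/-- The functor `x ↦ T · x` given by copowers. -/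
noncomputable def copowerFunctor (T : SSet.{w}) : M ⥤ SimplexCategoryᵒᵖ ⥤ M where
  obj x := copower T x
  map f := copMap (𝟙 T) f
  map_id x := by
    refine NatTrans.ext (funext fun n => copower_hom_ext fun s => ?_)
    rw [copι_copMap, Category.id_comp]
    exact (Category.comp_id _).symm
  map_comp f g := by
    refine NatTrans.ext (funext fun n => copower_hom_ext fun s => ?_)
    rw [copι_copMap, NatTrans.comp_app, copι_copMap_assoc, copι_copMap, Category.assoc]
    rfl

/-- The functoriality of copowers in the simplicial set. -/
noncomputable def copowerFunctorMap {T T' : SSet.{w}} (g : T ⟶ T') :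
    copowerFunctor (M := M) T ⟶ copowerFunctor T' where
  app x := copMap g (𝟙 x)
  naturality x y f := by
    refine NatTrans.ext (funext fun n => copower_hom_ext fun s => ?_)
    refine (copι_copMap_assoc (𝟙 T) f n s _).trans ?_
    refine Eq.trans ?_ (copι_copMap_assoc g (𝟙 x) n s _).symm
    rw [Category.id_comp]
    refine (congrArg (f ≫ ·) (copι_copMap g (𝟙 y) n _)).trans ?_
    refine Eq.trans ?_ (copι_copMap (𝟙 T') f n _).symm
    rw [Category.id_comp]
    rfl

/-- The simplicial object `X × T`, as the diagonal of a bisimplicial object. -/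
noncomputable abbrev cyl (X : SimplexCategoryᵒᵖ ⥤ M) (T : SSet.{w}) : SimplexCategoryᵒᵖ ⥤ M :=
  DeltaStructure.diagonal (X ⋙ copowerFunctor T)

/-- The isomorphism `X ⟶ X × Δ⁰`. -/
noncomputable def toCyl (X : SimplexCategoryᵒᵖ ⥤ M) : X ⟶ cyl X (SSet.stdSimplex.{w}.obj ⦋0⦌) where
  app n := copι _ (X.obj n) n (SSet.stdSimplex.objEquiv.symm (SimplexCategory.const n.unop ⦋0⦌ 0))
  naturality m n θ := by
    refine Eq.trans ?_ (Category.assoc _ _ _)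
    refine Eq.trans ?_ (congrArg (· ≫ _) (copι_copMap (𝟙 _) (X.map θ) m _).symm)
    refine Eq.trans ?_ (Category.assoc _ _ _).symm
    exact congrArg (X.map θ ≫ ·) (copι_map (SSet.stdSimplex.{w}.obj ⦋0⦌) (X.obj n) θ
      (SSet.stdSimplex.objEquiv.symm (SimplexCategory.const m.unop ⦋0⦌ 0))).symm

theorem isIso_toCyl (X : SimplexCategoryᵒᵖ ⥤ M) : IsIso (toCyl.{w} X) := by
  have h n : IsIso ((toCyl.{w} X).app n) := by
    refine ⟨copDesc fun _ => 𝟙 _, copι_desc _ _, ?_⟩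
    refine copower_hom_ext fun s => ?_
    refine (copι_desc_assoc _ s _).trans ?_
    refine (Category.id_comp _).trans (Eq.trans ?_ (Category.comp_id _).symm)
    refine congrArg (copι _ (X.obj n) n) (SSet.stdSimplex.objEquiv.injective ?_)
    exact Subsingleton.elim (α := (n.unop ⟶ ⦋0⦌)) _ _
  exact NatIso.isIso_of_isIso_app _

/-- The morphism `X × Δ¹ ⟶ Y` given by a homotopy. -/
noncomputable def ofCyl : cyl X (SSet.stdSimplex.{w}.obj ⦋1⦌) ⟶ Y where
  app n := copDesc fun s => H.h n.unop (SSet.stdSimplex.objEquiv s)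
  naturality m n θ := by
    refine copower_hom_ext fun s => ?_
    refine (congrArg (copι (SSet.stdSimplex.{w}.obj ⦋1⦌) (X.obj m) m s ≫ ·)
      (Category.assoc ((copMap (𝟙 (SSet.stdSimplex.{w}.obj ⦋1⦌)) (X.map θ)).app m)
        ((copower (SSet.stdSimplex.{w}.obj ⦋1⦌) (X.obj n)).map θ) _)).trans ?_
    refine (copι_copMap_assoc (𝟙 (SSet.stdSimplex.{w}.obj ⦋1⦌)) (X.map θ) m s _).trans ?_
    refine (congrArg (X.map θ ≫ ·) (copι_map_assoc (SSet.stdSimplex.{w}.obj ⦋1⦌) (X.obj n) θ s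
      _)).trans ?_
    refine (congrArg (X.map θ ≫ ·) (copι_desc _ ((SSet.stdSimplex.{w}.obj ⦋1⦌).map θ s))).trans ?_
    refine Eq.trans ?_ (copι_desc_assoc _ s _).symm
    exact H.naturality θ.unop (SSet.stdSimplex.objEquiv s)

/-- The two ends of a homotopy factor through `X × Δ¹ ⟶ Y`. -/
theorem side_eq (i : Fin 2) :
    toCyl.{w} X ≫ DeltaStructure.diagonalMap (Functor.whiskerLeft X
      (copowerFunctorMap (SSet.stdSimplex.{w}.map (SimplexCategory.const ⦋0⦌ ⦋1⦌ i)))) ≫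
        H.ofCyl = H.side i := by
  refine NatTrans.ext (funext fun n => ?_)
  refine (copι_copMap_assoc _ (𝟙 (X.obj n)) n _ _).trans ?_
  refine (Category.id_comp (X := X.obj n) (Y := Y.obj n) _).trans ?_
  refine (copι_desc _ _).trans ?_
  change H.h n.unop _ = H.h n.unop _
  congr 1

variable {S : DeltaStructure M} {W : MorphismProperty M} [HasColimitsOfSize.{0, 0} M]

/-- The realizations of homotopic morphisms are simultaneously weak equivalences: both ends are
obtained from `X × Δ¹ ⟶ Y` by composition with weak equivalences `|X| ⟶ |X × Δ¹|`. -/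
theorem real_side (h : DeltaStructure.IsHomotopical.{w} S W) {i : Fin 2}
    (hi : W (S.real.map (H.side i))) (j : Fin 2) : W (S.real.map (H.side j)) := by
  have key (l : Fin 2) : W (S.real.map (toCyl.{w} X ≫ DeltaStructure.diagonalMap
      (Functor.whiskerLeft X (copowerFunctorMap
        (SSet.stdSimplex.{w}.map (SimplexCategory.const ⦋0⦌ ⦋1⦌ l)))))) := by
    have := isIso_toCyl.{w} X
    rw [Functor.map_comp]
    exact h.comp (h.of_isIso _) (h.real_diagonalMap _ fun n =>
      h.real_copMap _ (sSetWeakEquiv_of_contractible _) _)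
  have e (l : Fin 2) := congrArg S.real.map (H.side_eq.{w} l)
  simp only [← Category.assoc] at e
  simp only [S.real.map_comp (toCyl.{w} X ≫ _)] at e
  rw [← e] at hi ⊢
  exact h.comp (key j) (h.of_comp_left (key i) hi)

end SHomotopy

variable {S : DeltaStructure M} {W : MorphismProperty M} [HasColimitsOfSize.{0, 0} M]
  [HasCoproducts.{w} M]

/-- A deformation retraction of a simplicial object to a constant one is a weak equivalence on
realizations. -/
theorem DeltaStructure.IsHomotopical.real_of_retract (h : DeltaStructure.IsHomotopical.{w} S W)
    {X Y : SimplexCategoryᵒᵖ ⥤ M} (ε : X ⟶ Y) (ρ : Y ⟶ X) (e : ρ ≫ ε = 𝟙 Y)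
    (H : SHomotopy X X) {i j : Fin 2}
    (h0 : H.side i = ε ≫ ρ) (h1 : H.side j = 𝟙 X) : W (S.real.map ε) := by
  have h2 : W (S.real.map ε ≫ S.real.map ρ) := by
    rw [← Functor.map_comp, ← h0]
    refine H.real_side h (i := j) ?_ i
    rw [h1]
    exact h.of_isIso _
  have h3 : W (S.real.map ρ ≫ S.real.map ε) := by
    rw [← Functor.map_comp, e]
    exact h.of_isIso _
  -- Both composites are weak equivalences, so two-out-of-six for `ε`, `ρ`, `ε` applies.
  exact (h.two_out_of_six _ _ _ h2 h3).1

/-- Data on an augmented cosimplicial object `J` with augmentation `o ⟶ J` which turn the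
simplicial object `G ∘ J`, for any presheaf `G`, into a deformation retract of the constant
simplicial object with value `G(o)`: a retraction `p` of the augmentation `r`, and a homotopy `u`
indexed by the simplices of `Δ¹`, with `p ≫ r` at the end `i` and the identity at the end `j`. -/
structure ContractionData {P : Type u₁} [Category.{v₁} P] (J : SimplexCategory ⥤ P) (o : P) where
  r (n : SimplexCategory) : o ⟶ J.obj n
  r_naturality {m n : SimplexCategory} (θ : m ⟶ n) : r m ≫ J.map θ = r n
  p (n : SimplexCategory) : J.obj n ⟶ o
  p_naturality {m n : SimplexCategory} (θ : m ⟶ n) : J.map θ ≫ p n = p m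
  r_p (n : SimplexCategory) : r n ≫ p n = 𝟙 o
  u (n : SimplexCategory) (τ : n ⟶ ⦋1⦌) : J.obj n ⟶ J.obj n
  u_naturality {m n : SimplexCategory} (θ : m ⟶ n) (τ : n ⟶ ⦋1⦌) :
    u m (θ ≫ τ) ≫ J.map θ = J.map θ ≫ u n τ
  i : Fin 2
  j : Fin 2
  u_retract (n : SimplexCategory) : u n (SimplexCategory.const n ⦋1⦌ i) = p n ≫ r n
  u_id (n : SimplexCategory) : u n (SimplexCategory.const n ⦋1⦌ j) = 𝟙 _

namespace ContractionData

variable {P : Type u₁} [Category.{v₁} P] {J : SimplexCategory ⥤ P} {o : P}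

/-- The image of contraction data under a functor. -/
def map (c : ContractionData J o) {Q : Type u₂} [Category.{v₂} Q] (L : P ⥤ Q) :
    ContractionData (J ⋙ L) (L.obj o) where
  r n := L.map (c.r n)
  r_naturality θ := by rw [Functor.comp_map, ← L.map_comp, c.r_naturality]
  p n := L.map (c.p n)
  p_naturality θ := by rw [Functor.comp_map, ← L.map_comp, c.p_naturality]
  r_p n := by rw [← L.map_comp, c.r_p, L.map_id]
  u n τ := L.map (c.u n τ)
  u_naturality θ τ := by
    rw [Functor.comp_map, ← L.map_comp, c.u_naturality, L.map_comp]
  i := c.i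
  j := c.j
  u_retract n := by rw [c.u_retract n, L.map_comp]
  u_id n := (congrArg L.map (c.u_id n)).trans (L.map_id _)

/-- The augmentation of the simplicial object `G ∘ J`. -/
def aug (c : ContractionData J o) (G : Pᵒᵖ ⥤ M) :
    J.op ⋙ G ⟶ (Functor.const SimplexCategoryᵒᵖ).obj (G.obj (op o)) where
  app n := G.map (c.r n.unop).op
  naturality m n θ := by
    refine Eq.trans ?_ (Category.comp_id _).symm
    refine (G.map_comp _ _).symm.trans (congrArg G.map ?_)
    exact congrArg Quiver.Hom.op (c.r_naturality θ.unop)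

/-- The augmentation of `G ∘ J` induces a weak equivalence between realizations. -/
theorem real_aug (c : ContractionData J o) (h : DeltaStructure.IsHomotopical.{w} S W)
    (G : Pᵒᵖ ⥤ M) : W (S.real.map (c.aug G)) := by
  let ρ : (Functor.const SimplexCategoryᵒᵖ).obj (G.obj (op o)) ⟶ J.op ⋙ G :=
    { app := fun n => G.map (c.p n.unop).op
      naturality := fun m n θ => by
        refine (Category.id_comp _).trans (Eq.trans ?_ (G.map_comp _ _))
        exact congrArg G.map (congrArg Quiver.Hom.op (c.p_naturality θ.unop).symm) }
  let H : SHomotopy (J.op ⋙ G) (J.op ⋙ G) :=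
    { h := fun n τ => G.map (c.u n τ).op
      naturality := fun θ τ => by
        refine (G.map_comp _ _).symm.trans (Eq.trans ?_ (G.map_comp _ _))
        exact congrArg G.map (congrArg Quiver.Hom.op (c.u_naturality θ τ)) }
  refine h.real_of_retract (c.aug G) ρ ?_ H (i := c.i) (j := c.j) ?_ ?_
  · refine NatTrans.ext (funext fun n => (G.map_comp _ _).symm.trans ?_)
    exact (congrArg G.map (congrArg Quiver.Hom.op (c.r_p n.unop))).trans (G.map_id _)
  · refine NatTrans.ext (funext fun n => Eq.trans ?_ (G.map_comp _ _))
    exact congrArg G.map (congrArg Quiver.Hom.op (c.u_retract n.unop))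
  · refine NatTrans.ext (funext fun n => ?_)
    exact (congrArg G.map (congrArg Quiver.Hom.op (c.u_id n.unop))).trans (G.map_id _)

end ContractionData

end Homotopies

/-! ### Joins of finite ordinals -/

section Joins

theorem simplex_hom_ext {m n : SimplexCategory} {f g : m ⟶ n}
    (h : ∀ i, f.toOrderHom i = g.toOrderHom i) : f = g :=
  SimplexCategory.Hom.ext _ _ (OrderHom.ext _ _ (funext h))

/-- The join `[n] ⋆ [m] = [n + m + 1]`. -/
abbrev jn (n m : SimplexCategory) : SimplexCategory := ⦋n.len + m.len + 1⦌

/-- The inclusion of `[n]` into `[n] ⋆ [m]`, as the first elements. -/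
def jl (n m : SimplexCategory) : n ⟶ jn n m :=
  SimplexCategory.mkHom ⟨fun i => ⟨i.val, by simp; omega⟩, fun i j h => h⟩

/-- The inclusion of `[m]` into `[n] ⋆ [m]`, as the last elements. -/
def jr (n m : SimplexCategory) : m ⟶ jn n m :=
  SimplexCategory.mkHom ⟨fun i => ⟨n.len + 1 + i.val, by simp; omega⟩, fun i j h => by
    simpa using h⟩

theorem jl_val (n m : SimplexCategory) (i : Fin (n.len + 1)) :
    ((jl n m).toOrderHom i : ℕ) = i := rfl

theorem jr_val (n m : SimplexCategory) (i : Fin (m.len + 1)) :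
    ((jr n m).toOrderHom i : ℕ) = n.len + 1 + i := rfl

theorem jn_cases {n m : SimplexCategory} (i : Fin ((jn n m).len + 1)) :
    (∃ a, (jl n m).toOrderHom a = i) ∨ ∃ b, (jr n m).toOrderHom b = i := by
  have hi := i.2
  simp only [SimplexCategory.len_mk] at hi
  by_cases h : i.val ≤ n.len
  · exact Or.inl ⟨⟨i.val, by omega⟩, Fin.ext rfl⟩
  · exact Or.inr ⟨⟨i.val - (n.len + 1), by omega⟩, Fin.ext (by rw [jr_val]; dsimp only; omega)⟩

variable {n m k : SimplexCategory}

theorem jn_hom_ext {f g : jn n m ⟶ k} (hl : jl n m ≫ f = jl n m ≫ g)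
    (hr : jr n m ≫ f = jr n m ≫ g) : f = g := by
  refine simplex_hom_ext fun i => ?_
  obtain ⟨a, rfl⟩ | ⟨b, rfl⟩ := jn_cases i
  · exact congrArg (fun t => t.toOrderHom a) hl
  · exact congrArg (fun t => t.toOrderHom b) hr

/-- The monotone map out of a join given by its restrictions. -/
def jdesc (f : n ⟶ k) (g : m ⟶ k)
    (h : f.toOrderHom (Fin.last _) ≤ g.toOrderHom 0) : jn n m ⟶ k :=
  SimplexCategory.mkHom
    { toFun := fun i => if hi : i.val ≤ n.len then f.toOrderHom ⟨i.val, by omega⟩ else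
        g.toOrderHom ⟨i.val - (n.len + 1), by have := i.2; simp at this; omega⟩
      monotone' := fun i j hij => by
        have hij' : i.val ≤ j.val := hij
        by_cases hj : j.val ≤ n.len
        · simp only [hj, hij'.trans hj, dif_pos]
          exact f.toOrderHom.monotone hij'
        · by_cases hi : i.val ≤ n.len
          · simp only [hj, hi, dif_pos, dif_neg, not_false_eq_true]
            exact (f.toOrderHom.monotone (Fin.le_last _)).trans
              (h.trans (g.toOrderHom.monotone (Fin.zero_le _)))
          · simp only [hj, hi, dif_neg, not_false_eq_true]
            refine g.toOrderHom.monotone ?_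
            change i.val - (n.len + 1) ≤ j.val - (n.len + 1)
            omega }

theorem jl_desc (f : n ⟶ k) (g : m ⟶ k)
    (h : f.toOrderHom (Fin.last _) ≤ g.toOrderHom 0) : jl n m ≫ jdesc f g h = f := by
  refine simplex_hom_ext fun i => ?_
  exact dif_pos (Nat.lt_succ_iff.mp i.2)

theorem jr_desc (f : n ⟶ k) (g : m ⟶ k)
    (h : f.toOrderHom (Fin.last _) ≤ g.toOrderHom 0) : jr n m ≫ jdesc f g h = g := by
  refine simplex_hom_ext fun i => ?_
  refine (dif_neg ?_).trans ?_
  · change ¬ (n.len + 1 + i.val ≤ n.len)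
    omega
  · exact congrArg g.toOrderHom (Fin.ext (Nat.add_sub_cancel_left _ _))

-- Only the two restrictions of `jdesc` matter below; unfolding it slows down unification.
attribute [irreducible] jdesc

theorem jl_le_jr (a : Fin (n.len + 1)) (b : Fin (m.len + 1)) :
    (jl n m).toOrderHom a ≤ (jr n m).toOrderHom b := by
  change a.val ≤ n.len + 1 + b.val
  have := a.2
  omega

/-- The functoriality of joins. -/
def jmap {n n' m m' : SimplexCategory} (θ : n ⟶ n') (θ' : m ⟶ m') : jn n m ⟶ jn n' m' :=
  jdesc (θ ≫ jl n' m') (θ' ≫ jr n' m') (jl_le_jr _ _)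

theorem jl_map {n n' m m' : SimplexCategory} (θ : n ⟶ n') (θ' : m ⟶ m') :
    jl n m ≫ jmap θ θ' = θ ≫ jl n' m' := jl_desc _ _ _

theorem jl_map_assoc {n n' m m' k : SimplexCategory} (θ : n ⟶ n') (θ' : m ⟶ m')
    (f : jn n' m' ⟶ k) : jl n m ≫ jmap θ θ' ≫ f = θ ≫ jl n' m' ≫ f := by
  rw [← Category.assoc, jl_map, Category.assoc]

theorem jr_map {n n' m m' : SimplexCategory} (θ : n ⟶ n') (θ' : m ⟶ m') :
    jr n m ≫ jmap θ θ' = θ' ≫ jr n' m' := jr_desc _ _ _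

theorem jr_map_assoc {n n' m m' k : SimplexCategory} (θ : n ⟶ n') (θ' : m ⟶ m')
    (f : jn n' m' ⟶ k) : jr n m ≫ jmap θ θ' ≫ f = θ' ≫ jr n' m' ≫ f := by
  rw [← Category.assoc, jr_map, Category.assoc]

theorem jmap_id (n m : SimplexCategory) : jmap (𝟙 n) (𝟙 m) = 𝟙 _ := by
  refine jn_hom_ext ?_ ?_
  · rw [jl_map, Category.id_comp, Category.comp_id]
  · rw [jr_map, Category.id_comp, Category.comp_id]

theorem jmap_comp {n n' n'' m m' m'' : SimplexCategory} (θ : n ⟶ n') (θ' : m ⟶ m')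
    (η : n' ⟶ n'') (η' : m' ⟶ m'') :
    jmap (θ ≫ η) (θ' ≫ η') = jmap θ θ' ≫ jmap η η' := by
  refine jn_hom_ext ?_ ?_
  · rw [jl_map, jl_map_assoc, jl_map, Category.assoc]
  · rw [jr_map, jr_map_assoc, jr_map, Category.assoc]

theorem jr_last (n m : SimplexCategory) :
    (jr n m).toOrderHom (Fin.last _) = Fin.last _ :=
  Fin.ext (by rw [jr_val]; simp; omega)

/-! ### Contractions of joins -/

/-- The retraction of `[n] ⋆ [m]` onto `[m]` which sends `[n]` to the first element of `[m]`. -/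
def jp (n m : SimplexCategory) : jn n m ⟶ m :=
  jdesc (SimplexCategory.const n m 0) (𝟙 m) le_rfl

theorem jr_jp (n m : SimplexCategory) : jr n m ≫ jp n m = 𝟙 m := jr_desc _ _ _

theorem jr_jp_assoc (n m : SimplexCategory) {k : SimplexCategory} (f : m ⟶ k) :
    jr n m ≫ jp n m ≫ f = f := by
  rw [← Category.assoc, jr_jp, Category.id_comp]

theorem jl_jp (n m : SimplexCategory) : jl n m ≫ jp n m = SimplexCategory.const n m 0 :=
  jl_desc _ _ _

theorem jmap_jp {n n' : SimplexCategory} (θ : n ⟶ n') (m : SimplexCategory) :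
    jmap θ (𝟙 m) ≫ jp n' m = jp n m := by
  refine jn_hom_ext ?_ ?_
  · rw [jl_map_assoc, jl_jp, jl_jp]
    rfl
  · rw [jr_map_assoc, jr_jp, jr_jp, Category.id_comp]

/-- The homotopy from the identity of `[n] ⋆ [m]` to the retraction onto `[m]`. -/
def jhL (n m : SimplexCategory) (τ : n ⟶ ⦋1⦌) : jn n m ⟶ jn n m :=
  jdesc (SimplexCategory.mkHom
    { toFun := fun i => if τ.toOrderHom i = 0 then (jl n m).toOrderHom i else
        (jr n m).toOrderHom 0
      monotone' := fun i j hij => by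
        have h := τ.toOrderHom.monotone hij
        by_cases hj : τ.toOrderHom j = 0
        · have hi : τ.toOrderHom i = 0 := Fin.le_zero_iff.mp (hj ▸ h)
          simp only [hi, hj, if_true]
          exact (jl n m).toOrderHom.monotone hij
        · by_cases hi : τ.toOrderHom i = 0
          · simp only [hi, hj, if_true, if_false]
            exact jl_le_jr _ _
          · simp only [hi, hj, if_false]
            exact le_rfl }) (jr n m) (by
    change (if _ then _ else _) ≤ _
    split_ifs
    · exact jl_le_jr _ _
    · exact le_rfl)

theorem jr_jhL (n m : SimplexCategory) (τ : n ⟶ ⦋1⦌) : jr n m ≫ jhL n m τ = jr n m :=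
  jr_desc _ _ _

theorem jr_jhL_assoc (n m : SimplexCategory) (τ : n ⟶ ⦋1⦌) {k : SimplexCategory}
    (f : jn n m ⟶ k) : jr n m ≫ jhL n m τ ≫ f = jr n m ≫ f := by
  rw [← Category.assoc, jr_jhL]

theorem jhL_l (n m : SimplexCategory) (τ : n ⟶ ⦋1⦌) (i : Fin (n.len + 1)) :
    (jl n m ≫ jhL n m τ).toOrderHom i = if τ.toOrderHom i = 0 then (jl n m).toOrderHom i else
        (jr n m).toOrderHom 0 := by
  unfold jhL
  rw [jl_desc]
  rfl

theorem jhL_naturality {n n' : SimplexCategory} (θ : n ⟶ n') (m : SimplexCategory)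
    (τ : n' ⟶ ⦋1⦌) : jhL n m (θ ≫ τ) ≫ jmap θ (𝟙 m) = jmap θ (𝟙 m) ≫ jhL n' m τ := by
  refine jn_hom_ext ?_ ?_
  · refine simplex_hom_ext fun i => ?_
    have h1 := jhL_l n m (θ ≫ τ) i
    have h2 := jhL_l n' m τ (θ.toOrderHom i)
    have h3 := congrArg (fun t => t.toOrderHom i) (jl_map θ (𝟙 m))
    have h4 := congrArg (fun t => t.toOrderHom 0) (jr_map θ (𝟙 m))
    have e1 : (jl n m ≫ jmap θ (𝟙 m) ≫ jhL n' m τ).toOrderHom i =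
        (jl n' m ≫ jhL n' m τ).toOrderHom (θ.toOrderHom i) :=
      congrArg (fun t => t.toOrderHom i) (jl_map_assoc θ (𝟙 m) (jhL n' m τ))
    rw [e1, h2]
    refine (congrArg (jmap θ (𝟙 m)).toOrderHom h1).trans ?_
    change (jmap θ (𝟙 m)).toOrderHom (if τ.toOrderHom (θ.toOrderHom i) = 0 then _ else _) = _
    split_ifs
    · exact h3
    · exact h4
  · rw [jr_jhL_assoc, jr_map, jr_map_assoc, jr_jhL]

theorem jhL_zero (n m : SimplexCategory) : jhL n m (SimplexCategory.const n ⦋1⦌ 0) = 𝟙 _ := by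
  refine jn_hom_ext (simplex_hom_ext fun i => ?_) ?_
  · exact (jhL_l n m _ i).trans (if_pos rfl)
  · rw [jr_jhL, Category.comp_id]

theorem jhL_one (n m : SimplexCategory) :
    jhL n m (SimplexCategory.const n ⦋1⦌ 1) = jp n m ≫ jr n m := by
  refine jn_hom_ext (simplex_hom_ext fun i => ?_) ?_
  · refine (jhL_l n m _ i).trans ((if_neg (by change ¬ ((1 : Fin 2) = 0); decide)).trans ?_)
    exact (congrArg (fun t => (t ≫ jr n m).toOrderHom i) (jl_jp n m)).symm
  · rw [jr_jhL, jr_jp_assoc]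

/-- The retraction of `[0] ⋆ [m]` onto `[0]`. -/
def jq (m : SimplexCategory) : jn ⦋0⦌ m ⟶ ⦋0⦌ := SimplexCategory.const _ _ 0

/-- The homotopy from the retraction of `[0] ⋆ [m]` onto `[0]` to the identity. -/
def jhR (m : SimplexCategory) (τ : m ⟶ ⦋1⦌) : jn ⦋0⦌ m ⟶ jn ⦋0⦌ m :=
  jdesc (jl ⦋0⦌ m) (SimplexCategory.mkHom
    { toFun := fun i => if τ.toOrderHom i = 0 then (jl ⦋0⦌ m).toOrderHom 0 else
        (jr ⦋0⦌ m).toOrderHom i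
      monotone' := fun i j hij => by
        have h := τ.toOrderHom.monotone hij
        by_cases hi : τ.toOrderHom i = 0
        · by_cases hj : τ.toOrderHom j = 0
          · simp only [hi, hj, if_true]
            exact le_rfl
          · simp only [hi, hj, if_true, if_false]
            exact jl_le_jr _ _
        · have hj : τ.toOrderHom j ≠ 0 := fun hj => hi (Fin.le_zero_iff.mp (hj ▸ h))
          simp only [hi, hj, if_false]
          exact (jr ⦋0⦌ m).toOrderHom.monotone hij }) (by
    change _ ≤ (if _ then _ else _)
    split_ifs
    · exact le_rfl
    · exact jl_le_jr _ _)

theorem jl_jhR (m : SimplexCategory) (τ : m ⟶ ⦋1⦌) : jl ⦋0⦌ m ≫ jhR m τ = jl ⦋0⦌ m :=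
  jl_desc _ _ _

theorem jl_jhR_assoc (m : SimplexCategory) (τ : m ⟶ ⦋1⦌) {k : SimplexCategory}
    (f : jn ⦋0⦌ m ⟶ k) : jl ⦋0⦌ m ≫ jhR m τ ≫ f = jl ⦋0⦌ m ≫ f := by
  rw [← Category.assoc, jl_jhR]

theorem jhR_r (m : SimplexCategory) (τ : m ⟶ ⦋1⦌) (i : Fin (m.len + 1)) :
    (jr ⦋0⦌ m ≫ jhR m τ).toOrderHom i = if τ.toOrderHom i = 0 then
      (jl ⦋0⦌ m).toOrderHom 0 else (jr ⦋0⦌ m).toOrderHom i := by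
  unfold jhR
  rw [jr_desc]
  rfl

theorem jhR_naturality {m m' : SimplexCategory} (θ : m ⟶ m') (τ : m' ⟶ ⦋1⦌) :
    jhR m (θ ≫ τ) ≫ jmap (𝟙 ⦋0⦌) θ = jmap (𝟙 ⦋0⦌) θ ≫ jhR m' τ := by
  refine jn_hom_ext ?_ ?_
  · rw [jl_jhR_assoc, jl_map, jl_map_assoc, jl_jhR]
  · refine simplex_hom_ext fun i => ?_
    have h1 := jhR_r m (θ ≫ τ) i
    have h2 := jhR_r m' τ (θ.toOrderHom i)
    have h3 := congrArg (fun t => t.toOrderHom i) (jr_map (𝟙 ⦋0⦌) θ)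
    have h4 := congrArg (fun t => t.toOrderHom 0) (jl_map (𝟙 ⦋0⦌) θ)
    have e1 : (jr ⦋0⦌ m ≫ jmap (𝟙 ⦋0⦌) θ ≫ jhR m' τ).toOrderHom i =
        (jr ⦋0⦌ m' ≫ jhR m' τ).toOrderHom (θ.toOrderHom i) :=
      congrArg (fun t => t.toOrderHom i) (jr_map_assoc (𝟙 ⦋0⦌) θ (jhR m' τ))
    rw [e1, h2]
    refine (congrArg (jmap (𝟙 ⦋0⦌) θ).toOrderHom h1).trans ?_
    change (jmap (𝟙 ⦋0⦌) θ).toOrderHom (if τ.toOrderHom (θ.toOrderHom i) = 0 then _ else _) = _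
    split_ifs
    · exact h4
    · exact h3

theorem jhR_one (m : SimplexCategory) : jhR m (SimplexCategory.const m ⦋1⦌ 1) = 𝟙 _ := by
  refine jn_hom_ext ?_ (simplex_hom_ext fun i => ?_)
  · rw [jl_jhR, Category.comp_id]
  · exact (jhR_r m _ i).trans (if_neg (by change ¬ ((1 : Fin 2) = 0); decide))

theorem jhR_zero (m : SimplexCategory) :
    jhR m (SimplexCategory.const m ⦋1⦌ 0) = jq m ≫ jl ⦋0⦌ m := by
  refine jn_hom_ext ?_ (simplex_hom_ext fun i => ?_)
  · rw [jl_jhR]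
    exact simplex_hom_ext fun i => congrArg _ (Subsingleton.elim (α := Fin 1) _ _)
  · exact (jhR_r m _ i).trans (if_pos rfl)

/-- Ordinals under `[m]` with structure map preserving the last element. -/
structure LastUnder (m : SimplexCategory) where
  obj : SimplexCategory
  r : m ⟶ obj
  last : r.toOrderHom (Fin.last _) = Fin.last _

instance (m : SimplexCategory) : Category (LastUnder m) where
  Hom a b := { θ : a.obj ⟶ b.obj // a.r ≫ θ = b.r }
  id a := ⟨𝟙 _, Category.comp_id _⟩
  comp f g := ⟨f.1 ≫ g.1, by rw [← Category.assoc, f.2, g.2]⟩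

/-- The ordinals `[n] ⋆ [m]` under `[m]`. -/
def joinUnder (m : SimplexCategory) : SimplexCategory ⥤ LastUnder m where
  obj n := ⟨jn n m, jr n m, jr_last n m⟩
  map θ := ⟨jmap θ (𝟙 m), by rw [jr_map, Category.id_comp]⟩
  map_id n := Subtype.ext (jmap_id n m)
  map_comp θ θ' := Subtype.ext ((congrArg (jmap (θ ≫ θ')) (Category.id_comp (𝟙 m)).symm).trans
    (jmap_comp θ (𝟙 m) θ' (𝟙 m)))

/-- The contraction of `n ↦ [n] ⋆ [m]` to `[m]`. -/
def joinUnderContraction (m : SimplexCategory) :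
    ContractionData (joinUnder m) ⟨m, 𝟙 m, rfl⟩ where
  r n := ⟨jr n m, Category.id_comp _⟩
  r_naturality θ := Subtype.ext ((jr_map θ (𝟙 m)).trans (Category.id_comp _))
  p n := ⟨jp n m, jr_jp n m⟩
  p_naturality θ := Subtype.ext (jmap_jp θ m)
  r_p n := Subtype.ext (jr_jp n m)
  u n τ := ⟨jhL n m τ, jr_jhL n m τ⟩
  u_naturality θ τ := Subtype.ext (jhL_naturality θ m τ)
  i := 1
  j := 0
  u_retract n := Subtype.ext (jhL_one n m)
  u_id n := Subtype.ext (jhL_zero n m)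

/-- Ordinals under `[m]`, as arrows. -/
def LastUnder.toArrow (m : SimplexCategory) : LastUnder m ⥤ Arrow SimplexCategory where
  obj a := Arrow.mk a.r
  map f := Arrow.homMk (𝟙 m) f.1 ((Category.id_comp _).trans f.2.symm)

/-- Pointed ordinals. -/
structure Pointed where
  obj : SimplexCategory
  pt : ⦋0⦌ ⟶ obj

instance : Category Pointed where
  Hom a b := { θ : a.obj ⟶ b.obj // a.pt ≫ θ = b.pt }
  id a := ⟨𝟙 _, Category.comp_id _⟩
  comp f g := ⟨f.1 ≫ g.1, by rw [← Category.assoc, f.2, g.2]⟩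

/-- The ordinals `[0] ⋆ [m]` with base point `0`. -/
def joinPointed : SimplexCategory ⥤ Pointed where
  obj m := ⟨jn ⦋0⦌ m, jl ⦋0⦌ m⟩
  map θ := ⟨jmap (𝟙 _) θ, by rw [jl_map, Category.id_comp]⟩
  map_id n := Subtype.ext (jmap_id _ n)
  map_comp θ θ' := Subtype.ext ((congrArg (fun t => jmap t (θ ≫ θ'))
    (Category.id_comp (𝟙 (⦋0⦌ : SimplexCategory))).symm).trans (jmap_comp (𝟙 _) θ (𝟙 _) θ'))

/-- The contraction of `m ↦ [0] ⋆ [m]` to `[0]`. -/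
def joinPointedContraction : ContractionData joinPointed ⟨⦋0⦌, 𝟙 _⟩ where
  r m := ⟨jl ⦋0⦌ m, Category.id_comp _⟩
  r_naturality θ := Subtype.ext ((jl_map (𝟙 _) θ).trans (Category.id_comp _))
  p m := ⟨jq m, Subsingleton.elim _ _⟩
  p_naturality _ := Subtype.ext (Subsingleton.elim _ _)
  r_p _ := Subtype.ext (Subsingleton.elim _ _)
  u m τ := ⟨jhR m τ, jl_jhR m τ⟩
  u_naturality θ τ := Subtype.ext (jhR_naturality θ τ)
  i := 0
  j := 1
  u_retract m := Subtype.ext (jhR_zero m)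
  u_id m := Subtype.ext (jhR_one m)

end Joins

/-! ### Comparison of the realizations of `ΠX` and of its restriction to a subcomplex -/

section Comparison

variable {M : Type u} [Category.{v} M] {S : DeltaStructure M} {W : MorphismProperty M}

theorem DeltaStructure.IsHomotopical.of_iso (h : DeltaStructure.IsHomotopical.{w} S W) {x y : M}
    (e : x ≅ y) : W e.hom :=
  h.of_isIso e.hom

theorem DeltaStructure.IsHomotopical.real_comp [HasColimitsOfSize.{0, 0} M]
    (h : DeltaStructure.IsHomotopical.{w} S W) {X Y Z : SimplexCategoryᵒᵖ ⥤ M} {f : X ⟶ Y}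
    {g : Y ⟶ Z} {k : X ⟶ Z} (hf : W (S.real.map f)) (hg : W (S.real.map g)) (e : k = f ≫ g) :
    W (S.real.map k) := by
  rw [e, Functor.map_comp]
  exact h.comp hf hg

theorem DeltaStructure.IsHomotopical.real_of_comp_left [HasColimitsOfSize.{0, 0} M]
    (h : DeltaStructure.IsHomotopical.{w} S W) {X Y Z : SimplexCategoryᵒᵖ ⥤ M} {f : X ⟶ Y}
    {g : Y ⟶ Z} {k : X ⟶ Z} (hf : W (S.real.map f)) (hk : W (S.real.map k)) (e : f ≫ g = k) :
    W (S.real.map g) := by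
  rw [← e, Functor.map_comp] at hk
  exact h.of_comp_left hf hk

theorem DeltaStructure.IsHomotopical.sigma (h : DeltaStructure.IsHomotopical.{w} S W)
    [HasCoproducts.{w} M] {ι ι' : Type w} (x : ι → M) (y : ι' → M) (φ : ι → ι')
    (hφ : Function.Bijective φ) (g : ∀ i, x i ⟶ y (φ i)) (hg : ∀ i, W (g i)) {f : ∐ x ⟶ ∐ y}
    (e : ∀ i, Sigma.ι x i ≫ f = g i ≫ Sigma.ι y (φ i)) : W f := by
  have e : f = Limits.Sigma.map g ≫ (Sigma.reindex (Equiv.ofBijective φ hφ) y).hom := by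
    refine Sigma.hom_ext _ _ fun i => (e i).trans ?_
    refine Eq.trans ?_ (Category.assoc _ _ _)
    refine Eq.trans ?_ (congrArg (· ≫ _) (Sigma.ι_map g i).symm)
    refine Eq.trans ?_ (Category.assoc _ _ _).symm
    exact congrArg (g i ≫ ·) (Sigma.ι_reindex_hom (Equiv.ofBijective φ hφ) y i).symm
  rw [e]
  exact h.comp (h.coproducts _ _ g hg) (h.of_iso _)

variable [HasCoproducts.{w} M] {P : Type u₁} [Category.{v₁} P] {P' : Type u₂} [Category.{v₂} P']

/-- A morphism between coproducts over elements is a weak equivalence if it is given by a bijection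
of the indices and weak equivalences of the summands. -/
theorem DeltaStructure.IsHomotopical.elSum (h : DeltaStructure.IsHomotopical.{w} S W)
    {T : P ⥤ Type w} {T' : P' ⥤ Type w} {X : T.Elements ⥤ M} {X' : T'.Elements ⥤ M} {n : P}
    {n' : P'} {f : (elSum X).obj n ⟶ (DerSect.elSum X').obj n'} (φ : T.obj n → T'.obj n')
    (hφ : Function.Bijective φ) (g : ∀ s, X.obj (el T n s) ⟶ X'.obj (el T' n' (φ s)))
    (hg : ∀ s, W (g s)) (e : ∀ s, elι X n s ≫ f = g s ≫ elι X' n' (φ s)) : W f :=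
  h.sigma (fun s : T.obj n => X.obj (el T n s)) (fun s : T'.obj n' => X'.obj (el T' n' s)) φ hφ
    g hg e

section

variable [HasColimitsOfSize.{0, 0} M]

/-- The morphism from the object of degree `0` to the realization. -/
noncomputable def DeltaStructure.to0 (S : DeltaStructure M) (Y : SimplexCategoryᵒᵖ ⥤ M) :
    Y.obj (op ⦋0⦌) ⟶ S.real.obj Y :=
  S.unit.inv.app _ ≫ S.realι Y ⦋0⦌

theorem DeltaStructure.to0_map (S : DeltaStructure M) {Y Y' : SimplexCategoryᵒᵖ ⥤ M} (f : Y ⟶ Y') :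
    S.to0 Y ≫ S.real.map f = f.app (op ⦋0⦌) ≫ S.to0 Y' := by
  unfold DeltaStructure.to0
  rw [Category.assoc, S.realι_map, ← Category.assoc, ← Category.assoc]
  exact congrArg (· ≫ _) (S.unit.inv.naturality (f.app (op ⦋0⦌))).symm

end

variable {K K' : SSet.{w}} (ι : K' ⟶ K)

/-- For a morphism `ι : K' ⟶ K` of simplicial sets, the presheaf of pairs of simplices of `K` and
`K'` with a compatibility on the domains of maps `[m] ⟶ [k]`. -/
def relIdx : (Arrow SimplexCategory)ᵒᵖ ⥤ Type w where
  obj a := { x : K.obj (op a.unop.right) × K'.obj (op a.unop.left) //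
    K.map a.unop.hom.op x.1 = ι.app _ x.2 }
  map {a b} f := ↾fun x => ⟨(K.map f.unop.right.op x.1.1, K'.map f.unop.left.op x.1.2), by
    have h1 : K.map b.unop.hom.op (K.map f.unop.right.op x.1.1) =
        K.map (b.unop.hom ≫ f.unop.right).op x.1.1 := by
      rw [op_comp, Functor.map_comp]
      rfl
    have h2 : K.map (f.unop.left ≫ a.unop.hom).op x.1.1 =
        K.map f.unop.left.op (K.map a.unop.hom.op x.1.1) := by
      rw [op_comp, Functor.map_comp]
      rfl
    refine h1.trans ((congrArg (fun t => K.map (Quiver.Hom.op t) x.1.1)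
      (Arrow.w f.unop).symm).trans (h2.trans ?_))
    rw [x.2]
    exact (NatTrans.naturality_apply ι f.unop.left.op x.1.2).symm⟩
  map_id a := by
    refine ConcreteCategory.hom_ext _ _ fun x => Subtype.ext (Prod.ext ?_ ?_)
    · exact congrArg (fun t => t x.1.1) (K.map_id (op a.unop.right))
    · exact congrArg (fun t => t x.1.2) (K'.map_id (op a.unop.left))
  map_comp f g := by
    refine ConcreteCategory.hom_ext _ _ fun x => Subtype.ext (Prod.ext ?_ ?_)
    · exact congrArg (fun t => t x.1.1) (K.map_comp f.unop.right.op g.unop.right.op)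
    · exact congrArg (fun t => t x.1.2) (K'.map_comp f.unop.left.op g.unop.left.op)

/-- The simplex of `K` of an element of `relIdx`. -/
def relFst : (relIdx ι).Elements ⥤ K.Elements where
  obj e := el K (op e.1.unop.right) e.2.1.1
  map {e e'} f := CategoryOfElements.homMk (el K _ e.2.1.1) (el K _ e'.2.1.1) f.1.unop.right.op
    (congrArg (fun t => t.1.1) f.2)
  map_id _ := rfl
  map_comp _ _ := rfl

variable (X : K.Elements ⥤ M)

/-- The presheaf which sends `[m] ⟶ [k]` to the coproduct of `X(s)` over all pairs of a simplex
`s` of `K` of dimension `k` and a simplex of `K'` of dimension `m` over the restriction of `s`. -/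
noncomputable abbrev relSum : (Arrow SimplexCategory)ᵒᵖ ⥤ M := elSum (relFst ι ⋙ X)

/-- The functor `([n], [m]) ↦ ([m] ⟶ [n] ⋆ [m])`. -/
def joinArrow : SimplexCategory ⥤ SimplexCategory ⥤ Arrow SimplexCategory where
  obj n :=
    { obj := fun m => Arrow.mk (jr n m)
      map := fun θ => Arrow.homMk θ (jmap (𝟙 n) θ) (jr_map _ _).symm
      map_id := fun m => Arrow.hom_ext _ _ rfl (jmap_id n m)
      map_comp := fun θ θ' => Arrow.hom_ext _ _ rfl ((congrArg (fun t => jmap t (θ ≫ θ'))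
        (Category.id_comp (𝟙 n)).symm).trans (jmap_comp (𝟙 n) θ (𝟙 n) θ')) }
  map {n n'} θ :=
    { app := fun m => Arrow.homMk (𝟙 m) (jmap θ (𝟙 m)) (jr_map _ _).symm
      naturality := fun m m' θ' => by
        refine Arrow.hom_ext _ _ ((Category.comp_id θ').trans (Category.id_comp θ').symm) ?_
        refine (jmap_comp (𝟙 n) θ' θ (𝟙 m')).symm.trans (Eq.trans ?_ (jmap_comp θ (𝟙 m) (𝟙 n') θ'))
        rw [Category.id_comp, Category.id_comp, Category.comp_id, Category.comp_id] }
  map_id n := NatTrans.ext (funext fun m => Arrow.hom_ext _ _ rfl (jmap_id n m))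
  map_comp θ θ' := NatTrans.ext (funext fun m => Arrow.hom_ext _ _ (Category.comp_id _).symm
    ((congrArg (jmap (θ ≫ θ')) (Category.id_comp (𝟙 m)).symm).trans (jmap_comp θ (𝟙 m) θ' (𝟙 m))))

/-- The composite of a functor of two variables with a contravariant functor. -/
def biComp {A : Type*} [Category* A] {B : Type*} [Category* B] {Q : Type*} [Category* Q]
    (J : A ⥤ B ⥤ Q) (G : Qᵒᵖ ⥤ M) : Aᵒᵖ ⥤ Bᵒᵖ ⥤ M where
  obj n := (J.obj n.unop).op ⋙ G
  map θ :=
    { app := fun m => G.map ((J.map θ.unop).app m.unop).op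
      naturality := fun m m' θ' => by
        refine (G.map_comp _ _).symm.trans (Eq.trans ?_ (G.map_comp _ _))
        exact congrArg (fun t => G.map (Quiver.Hom.op t))
          ((J.map θ.unop).naturality θ'.unop).symm }
  map_id n := NatTrans.ext (funext fun m => by
    refine Eq.trans ?_ (G.map_id _)
    exact congrArg (fun t => G.map (Quiver.Hom.op (NatTrans.app t m.unop))) (J.map_id n.unop))
  map_comp θ θ' := NatTrans.ext (funext fun m => by
    refine Eq.trans ?_ (G.map_comp _ _)
    exact congrArg (fun t => G.map (Quiver.Hom.op (NatTrans.app t m.unop)))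
      (J.map_comp θ'.unop θ.unop))

/-- The bisimplicial object `(n, m) ↦ ∐ X(s)`, over the pairs of a simplex `s` of `K` of dimension
`[n] ⋆ [m]` and a simplex of `K'` over the restriction of `s` to `[m]`. -/
noncomputable abbrev relBi : SimplexCategoryᵒᵖ ⥤ SimplexCategoryᵒᵖ ⥤ M :=
  biComp joinArrow (relSum ι X)

/-- The restriction `X ∘ ι`. -/
abbrev resEl : K'.Elements ⥤ M := NatTrans.mapElements ι ⋙ X

/-- The morphism of `K.Elements` from a simplex `s` to `t = θ^* s`. -/
def elHom {T : P ⥤ Type w} {m n : P} (θ : m ⟶ n) {s : T.obj m} {t : T.obj n} (h : T.map θ s = t) :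
    el T m s ⟶ el T n t :=
  CategoryOfElements.homMk (el T m s) (el T n t) θ h

theorem relSnd_aux {a b : (Arrow SimplexCategory)ᵒᵖ} (f : a ⟶ b) (x : (relIdx ι).obj a) :
    (relFst ι ⋙ X).map (eltMap f x) ≫ X.map (elHom (T := K) b.unop.hom.op
        ((relIdx ι).map f x).2) ≫ elι (resEl ι X) (op b.unop.left) ((relIdx ι).map f x).1.2 =
      (X.map (elHom (T := K) a.unop.hom.op x.2) ≫ elι (resEl ι X) (op a.unop.left) x.1.2) ≫
        (Arrow.leftFunc.op ⋙ elSum (resEl ι X)).map f := by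
  refine (Category.assoc _ _ _).symm.trans ?_
  refine Eq.trans ?_ (Category.assoc _ _ _).symm
  refine Eq.trans ?_ (congrArg (X.map (elHom (T := K) a.unop.hom.op x.2) ≫ ·)
    (elι_map (resEl ι X) f.unop.left.op x.1.2).symm)
  refine Eq.trans ?_ (Category.assoc _ _ _)
  refine congrArg (· ≫ elι (resEl ι X) (op b.unop.left) ((relIdx ι).map f x).1.2) ?_
  refine (X.map_comp _ _).symm.trans (Eq.trans ?_ (X.map_comp _ _))
  refine congrArg X.map (Subtype.ext ?_)
  exact congrArg Quiver.Hom.op (Arrow.w f.unop).symm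

/-- Equal simplices are isomorphic, by the isomorphism over an identity map. -/
def elIso {T : P ⥤ Type w} {m : P} {s s' t : T.obj m} (h : s' = s) (h' : s' = t) :
    el T m s ≅ el T m t where
  hom := elHom (𝟙 m) (by rw [T.map_id, ← h', h]; rfl)
  inv := elHom (𝟙 m) (by rw [T.map_id, ← h', h]; rfl)
  hom_inv_id := Subtype.ext (Category.id_comp _)
  inv_hom_id := Subtype.ext (Category.id_comp _)

/-- Restriction of simplices of dimension `[n] ⋆ [m]` to `[m]`. -/
noncomputable def relSnd : relSum ι X ⟶ Arrow.leftFunc.op ⋙ elSum (resEl ι X) :=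
  elSumDesc (relFst ι ⋙ X) (Y := Arrow.leftFunc.op ⋙ elSum (resEl ι X))
    (fun a x => X.map (elHom (T := K) a.unop.hom.op x.2) ≫
      elι (resEl ι X) (op a.unop.left) x.1.2) (relSnd_aux ι X)

theorem ι_relSnd (a : (Arrow SimplexCategory)ᵒᵖ) (x : (relIdx ι).obj a) :
    elι (relFst ι ⋙ X) a x ≫ (relSnd ι X).app a = X.map (elHom (T := K) a.unop.hom.op x.2) ≫
      elι (resEl ι X) (op a.unop.left) x.1.2 :=
  elι_elSumDesc (relFst ι ⋙ X) (Y := Arrow.leftFunc.op ⋙ elSum (resEl ι X)) _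
    (relSnd_aux ι X) a x

/-- The augmentation of `relBi` in the first direction. -/
noncomputable def relBiSnd : relBi ι X ⟶ (Functor.const _).obj (elSum (resEl ι X)) where
  app n := Functor.whiskerLeft (joinArrow.obj n.unop).op (relSnd ι X)
  naturality n n' θ := NatTrans.ext (funext fun m => by
    refine ((relSnd ι X).naturality ((joinArrow.map θ.unop).app m.unop).op).trans ?_
    refine congrArg (_ ≫ ·) ?_
    exact (elSum (resEl ι X)).map_id m)

/-- For fixed `m`, the augmentation of `relBi` in the first direction is a weak equivalence, by the
contraction of `n ↦ [n] ⋆ [m]` to `[m]`. -/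
theorem relBiSnd_W [HasColimitsOfSize.{0, 0} M] (h : DeltaStructure.IsHomotopical.{w} S W)
    (m : SimplexCategoryᵒᵖ) :
    W (S.real.map (((flipFunctor _ _ _).map (relBiSnd ι X)).app m)) := by
  let c := (joinUnderContraction m.unop).map (LastUnder.toArrow m.unop)
  let a : (Arrow SimplexCategory)ᵒᵖ := op (Arrow.mk (𝟙 m.unop))
  -- Over `[m] = [m]` the simplex of `K` is determined by the one of `K'`.
  let v : (relSum ι X).obj a ⟶ (elSum (resEl ι X)).obj m := (relSnd ι X).app a
  have hv : W v := by
    refine h.elSum (fun x => x.1.2) ⟨?_, ?_⟩ (fun x => X.map (elHom (T := K) (𝟙 m) x.2)) ?_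
      (fun x => ι_relSnd ι X a x)
    · intro x y hxy
      refine Subtype.ext (Prod.ext ?_ hxy)
      have hx : x.1.1 = ι.app m x.1.2 := (congrArg (fun t => t x.1.1) (K.map_id m)).symm.trans x.2
      have hy : y.1.1 = ι.app m y.1.2 := (congrArg (fun t => t y.1.1) (K.map_id m)).symm.trans y.2
      exact hx.trans ((congrArg (ι.app m) hxy).trans hy.symm)
    · intro b
      exact ⟨⟨(ι.app m b, b), congrArg (fun t => t (ι.app m b)) (K.map_id m)⟩, rfl⟩
    · intro x
      exact h.of_iso (X.mapIso (elIso (congrArg (fun t => t x.1.1) (K.map_id m)) x.2))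
  have e : ((flipFunctor _ _ _).map (relBiSnd ι X)).app m =
      c.aug (relSum ι X) ≫ (Functor.const SimplexCategoryᵒᵖ).map v := by
    refine NatTrans.ext (funext fun n => ?_)
    refine Eq.trans ?_ ((relSnd ι X).naturality (c.r n.unop).op).symm
    refine Eq.trans ?_ (congrArg (_ ≫ ·) ((elSum (resEl ι X)).map_id m).symm)
    exact (Category.comp_id _).symm
  exact h.real_comp (c.real_aug h _) (h.realization _ fun _ => hv) e

/-- Restriction of simplices of dimension `[n] ⋆ [m]` to `[n]`. -/
noncomputable def relFstApp (n m : SimplexCategory) :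
    (relSum ι X).obj (op ((joinArrow.obj n).obj m)) ⟶ (elSum X).obj (op n) :=
  elDesc _ fun x => X.map (eltMap (jl n m).op x.1.1) ≫ elι X (op n) (K.map (jl n m).op x.1.1)

theorem ι_relFstApp (n m : SimplexCategory) (x) :
    elι (relFst ι ⋙ X) (op ((joinArrow.obj n).obj m)) x ≫ relFstApp ι X n m =
      X.map (eltMap (jl n m).op x.1.1) ≫ elι X (op n) (K.map (jl n m).op x.1.1) :=
  elι_desc _ _ _

theorem ι_relFstApp_assoc (n m : SimplexCategory) (x) {z : M} (h : (elSum X).obj (op n) ⟶ z) :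
    elι (relFst ι ⋙ X) (op ((joinArrow.obj n).obj m)) x ≫ relFstApp ι X n m ≫ h =
      (X.map (eltMap (jl n m).op x.1.1) ≫ elι X (op n) (K.map (jl n m).op x.1.1)) ≫ h :=
  (Category.assoc _ _ _).symm.trans (congrArg (· ≫ h) (ι_relFstApp ι X n m x))

theorem relFstApp_naturality {n m n' m' : SimplexCategory} (θ : n ⟶ n')
    (f : (joinArrow.obj n).obj m ⟶ (joinArrow.obj n').obj m')
    (hf : jl n m ≫ f.right = θ ≫ jl n' m') :
    (relSum ι X).map f.op ≫ relFstApp ι X n m =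
      relFstApp ι X n' m' ≫ (elSum X).map θ.op := by
  refine elSum_hom_ext fun x => ?_
  refine (Category.assoc _ _ _).symm.trans ?_
  refine (congrArg (· ≫ _) (elι_map (relFst ι ⋙ X) f.op x)).trans ?_
  refine (Category.assoc _ _ _).trans ?_
  refine (congrArg (_ ≫ ·) (ι_relFstApp ι X n m ((relIdx ι).map f.op x))).trans ?_
  refine Eq.trans ?_ (ι_relFstApp_assoc ι X n' m' x _).symm
  refine Eq.trans ?_ (Category.assoc _ _ _).symm
  refine Eq.trans ?_ (congrArg (X.map (eltMap (jl n' m').op x.1.1) ≫ ·) (elι_map X θ.op _).symm)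
  refine (Category.assoc _ _ _).symm.trans (Eq.trans ?_ (Category.assoc _ _ _))
  refine (congrArg (· ≫ _) (X.map_comp ((relFst ι).map (eltMap f.op x)) _).symm).trans ?_
  refine Eq.trans ?_ (congrArg (· ≫ _) (X.map_comp _ _))
  exact map_elι_congr X _ _ (congrArg Quiver.Hom.op hf)

/-- The augmentation of `relBi` in the second direction. -/
noncomputable def relBiFst : relBi ι X ⟶ elSum X ⋙ Functor.const _ where
  app n :=
    { app := fun m => relFstApp ι X n.unop m.unop
      naturality := fun m m' θ => by
        refine (relFstApp_naturality ι X (𝟙 n.unop) ((joinArrow.obj n.unop).map θ.unop)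
          (jl_map (𝟙 _) _)).trans ?_
        exact congrArg (_ ≫ ·) ((elSum X).map_id n) }
  naturality n n' θ := NatTrans.ext (funext fun m =>
    relFstApp_naturality ι X θ.unop ((joinArrow.map θ.unop).app m.unop) (jl_map θ.unop _))

/-- The functor `[m] ↦ ([m] ⟶ [n] ⋆ [m])` on pointed ordinals. -/
abbrev pointedArrow (n : SimplexCategory) : Pointed ⥤ Arrow SimplexCategory where
  obj a := (joinArrow.obj n).obj a.obj
  map f := (joinArrow.obj n).map f.1
  map_id a := (joinArrow.obj n).map_id a.obj
  map_comp f g := (joinArrow.obj n).map_comp f.1 g.1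

/-- A way to insert a vertex of `K'` into simplices of dimension `[n] ⋆ [m]`, of which the
restriction to `[m]` belongs to `K'`, between `[n]` and `[m]`: an extension `e` of `n`-simplices to
`[n] ⋆ [0]`, such that a simplex of dimension `[n] ⋆ [m]` and the extension of its restriction to
`[n]` are the restrictions of a unique simplex of dimension `[n] ⋆ ([0] ⋆ [m])`. -/
structure Insertion (n : SimplexCategory) where
  e : K.obj (op n) → (relIdx ι).obj (op ((joinArrow.obj n).obj ⦋0⦌))
  l_e (s : K.obj (op n)) : K.map (jl n ⦋0⦌).op (e s).1.1 = s
  insert (m : SimplexCategory) (x : (relIdx ι).obj (op ((joinArrow.obj n).obj m))) :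
    ∃! y : (relIdx ι).obj (op ((joinArrow.obj n).obj (jn ⦋0⦌ m))),
      (relIdx ι).map ((joinArrow.obj n).map (jl ⦋0⦌ m)).op y = e (K.map (jl n m).op x.1.1) ∧
      (relIdx ι).map ((joinArrow.obj n).map (jr ⦋0⦌ m)).op y = x

namespace Insertion

variable {ι} {n : SimplexCategory} (i : Insertion ι n)

theorem map_l {m m' : SimplexCategory} (θ : m ⟶ m')
    (y : (relIdx ι).obj (op ((joinArrow.obj n).obj m'))) :
    K.map (jl n m).op ((relIdx ι).map ((joinArrow.obj n).map θ).op y).1.1 =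
      K.map (jl n m').op y.1.1 := by
  change K.map (jl n m).op (K.map (jmap (𝟙 n) θ).op y.1.1) = _
  have h : K.map (jl n m ≫ jmap (𝟙 n) θ).op y.1.1 = K.map (jl n m).op
      (K.map (jmap (𝟙 n) θ).op y.1.1) := by
    rw [op_comp, Functor.map_comp]
    rfl
  rw [← h, jl_map, Category.id_comp]

/-- The presheaf of simplices with inserted vertices. -/
def idx : Pointedᵒᵖ ⥤ Type w where
  obj a := { y : (relIdx ι).obj (op ((joinArrow.obj n).obj a.unop.obj)) //
    (relIdx ι).map ((joinArrow.obj n).map a.unop.pt).op y =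
      i.e (K.map (jl n a.unop.obj).op y.1.1) }
  map {a b} f := ↾fun y => ⟨(relIdx ι).map ((joinArrow.obj n).map f.unop.1).op y.1, by
    have h1 : (relIdx ι).map ((joinArrow.obj n).map b.unop.pt).op
        ((relIdx ι).map ((joinArrow.obj n).map f.unop.1).op y.1) =
        (relIdx ι).map ((joinArrow.obj n).map (b.unop.pt ≫ f.unop.1)).op y.1 := by
      rw [Functor.map_comp, op_comp, Functor.map_comp]
      rfl
    rw [h1, f.unop.2, y.2]
    exact congrArg i.e (map_l f.unop.1 y.1).symm⟩
  map_id a := by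
    refine ConcreteCategory.hom_ext _ _ fun y => Subtype.ext ?_
    exact congrArg (fun t => t y.1) (((pointedArrow n).op ⋙ relIdx ι).map_id a)
  map_comp f g := by
    refine ConcreteCategory.hom_ext _ _ fun y => Subtype.ext ?_
    exact congrArg (fun t => t y.1) (((pointedArrow n).op ⋙ relIdx ι).map_comp f g)

/-- The functor from simplices with inserted vertices to `relIdx`. -/
def toRel : i.idx.Elements ⥤ (relIdx ι).Elements where
  obj y := el (relIdx ι) (op ((joinArrow.obj n).obj y.1.unop.obj)) y.2.1
  map {y y'} f := CategoryOfElements.homMk (el (relIdx ι) _ y.2.1) (el (relIdx ι) _ y'.2.1)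
    ((pointedArrow n).map f.1.unop).op (congrArg Subtype.val f.2)
  map_id y := Subtype.ext ((pointedArrow n).op.map_id y.1)
  map_comp f g := Subtype.ext ((pointedArrow n).op.map_comp f.1 g.1)

/-- The coproducts of the values of `X` over simplices with inserted vertices. -/
noncomputable abbrev sum : Pointedᵒᵖ ⥤ M := elSum (i.toRel ⋙ relFst ι ⋙ X)

theorem incl_aux {a b : Pointedᵒᵖ} (f : a ⟶ b) (y : i.idx.obj a) :
    (i.toRel ⋙ relFst ι ⋙ X).map (eltMap f y) ≫
        elι (relFst ι ⋙ X) (op ((joinArrow.obj n).obj b.unop.obj)) (i.idx.map f y).1 =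
      elι (relFst ι ⋙ X) (op ((joinArrow.obj n).obj a.unop.obj)) y.1 ≫
        ((pointedArrow n).op ⋙ relSum ι X).map f :=
  (elι_map (relFst ι ⋙ X) ((pointedArrow n).map f.unop).op y.1).symm

/-- The natural transformation which forgets the condition on the inserted vertices. -/
noncomputable def incl : i.sum X ⟶ (pointedArrow n).op ⋙ relSum ι X :=
  elSumDesc (i.toRel ⋙ relFst ι ⋙ X) (Y := (pointedArrow n).op ⋙ relSum ι X)
    (fun _ y => elι (relFst ι ⋙ X) _ y.1) (i.incl_aux X)

theorem ι_incl (a : Pointedᵒᵖ) (y : i.idx.obj a) :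
    elι (i.toRel ⋙ relFst ι ⋙ X) a y ≫ (i.incl X).app a = elι (relFst ι ⋙ X) _ y.1 :=
  elι_elSumDesc (i.toRel ⋙ relFst ι ⋙ X) (Y := (pointedArrow n).op ⋙ relSum ι X) _
    (i.incl_aux X) a y

theorem ι_incl_assoc (a : Pointedᵒᵖ) (y : i.idx.obj a) {z : M}
    (h : ((pointedArrow n).op ⋙ relSum ι X).obj a ⟶ z) :
    elι (i.toRel ⋙ relFst ι ⋙ X) a y ≫ (i.incl X).app a ≫ h = elι (relFst ι ⋙ X) _ y.1 ≫ h :=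
  (Category.assoc _ _ _).symm.trans (congrArg (· ≫ h) (i.ι_incl X a y))

/-- The natural transformation which forgets inserted vertices. -/
noncomputable def forget : joinPointed.op ⋙ i.sum X ⟶ (relBi ι X).obj (op n) where
  app m := (i.incl X).app (op (joinPointed.obj m.unop)) ≫
    (relSum ι X).map ((joinArrow.obj n).map (jr ⦋0⦌ m.unop)).op
  naturality m m' θ := by
    refine ((i.incl X).naturality_assoc (joinPointed.map θ.unop).op _).trans ?_
    refine Eq.trans (congrArg (_ ≫ ·) ?_) (Category.assoc _ _ _).symm
    refine ((relSum ι X).map_comp _ _).symm.trans (Eq.trans ?_ ((relSum ι X).map_comp _ _))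
    refine congrArg (fun t => (relSum ι X).map (Quiver.Hom.op t)) ?_
    refine ((joinArrow.obj n).map_comp _ _).symm.trans
      (Eq.trans ?_ ((joinArrow.obj n).map_comp _ _))
    exact congrArg (joinArrow.obj n).map (jr_map _ _)

theorem ι_forget (m : SimplexCategoryᵒᵖ) (y : i.idx.obj (op (joinPointed.obj m.unop))) :
    elι (i.toRel ⋙ relFst ι ⋙ X) _ y ≫ (i.forget X).app m =
      X.map ((relFst ι).map (eltMap ((joinArrow.obj n).map (jr ⦋0⦌ m.unop)).op y.1)) ≫
        elι (relFst ι ⋙ X) _ ((relIdx ι).map ((joinArrow.obj n).map (jr ⦋0⦌ m.unop)).op y.1) :=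
  (i.ι_incl_assoc X _ y _).trans (elι_map (relFst ι ⋙ X) _ y.1)

variable [HasColimitsOfSize.{0, 0} M]

/-- For fixed `n`, the augmentation of `relBi` in the second direction is a weak equivalence.
Insertion of a vertex identifies `relBi` with a presheaf evaluated at `[0] ⋆ [m]`, and
`m ↦ [0] ⋆ [m]` contracts to `[0]`. -/
theorem relBiFst_W (i : Insertion ι n) (h : DeltaStructure.IsHomotopical.{w} S W)
    (hX : ∀ (m : SimplexCategory) (s : K.obj (op (jn n m))), W (X.map (eltMap (jl n m).op s))) :
    W (S.real.map ((relBiFst ι X).app (op n))) := by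
  let c := joinPointedContraction
  let o : Pointedᵒᵖ := op ⟨⦋0⦌, 𝟙 _⟩
  -- Over `[0]` only the `n`-simplex matters, as its extension by a vertex is fixed.
  let v : (i.sum X).obj o ⟶ (elSum X).obj (op n) := (i.incl X).app o ≫ relFstApp ι X n ⦋0⦌
  have hv : W v := by
    refine h.elSum (fun y => K.map (jl n ⦋0⦌).op y.1.1.1) ⟨?_, ?_⟩
      (fun y => X.map (eltMap (jl n ⦋0⦌).op y.1.1.1)) (fun y => hX ⦋0⦌ _) (fun y => ?_)
    · intro y y' hy
      have key (z : i.idx.obj o) : z.1 = i.e (K.map (jl n ⦋0⦌).op z.1.1.1) := by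
        refine Eq.trans ?_ z.2
        refine (congrArg (fun t => t z.1) ((relIdx ι).map_id _)).symm.trans ?_
        exact congrArg (fun t => (relIdx ι).map (Quiver.Hom.op t) z.1)
          ((joinArrow.obj n).map_id ⦋0⦌).symm
      exact Subtype.ext ((key y).trans ((congrArg i.e hy).trans (key y').symm))
    · intro s
      refine ⟨⟨i.e s, ?_⟩, i.l_e s⟩
      refine Eq.trans ?_ (congrArg i.e (i.l_e s)).symm
      refine Eq.trans ?_ (congrArg (fun t => t (i.e s)) ((relIdx ι).map_id _))
      exact congrArg (fun t => (relIdx ι).map (Quiver.Hom.op t) (i.e s))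
          ((joinArrow.obj n).map_id ⦋0⦌)
    · exact (i.ι_incl_assoc X o y _).trans (ι_relFstApp ι X n ⦋0⦌ y.1)
  -- A vertex can be inserted in a unique way, and `X` inverts the restrictions to `[n]`.
  have hf (m : SimplexCategoryᵒᵖ) : W ((i.forget X).app m) := by
    refine h.elSum (fun y => (relIdx ι).map ((joinArrow.obj n).map (jr ⦋0⦌ m.unop)).op y.1)
      ⟨?_, ?_⟩ _ (fun y => ?_) (i.ι_forget X m)
    · intro y y' hy
      have key (z : i.idx.obj (op (joinPointed.obj m.unop))) :
          (relIdx ι).map ((joinArrow.obj n).map (jl ⦋0⦌ m.unop)).op z.1 =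
            i.e (K.map (jl n m.unop).op
              ((relIdx ι).map ((joinArrow.obj n).map (jr ⦋0⦌ m.unop)).op z.1).1.1) :=
        z.2.trans (congrArg i.e (map_l _ z.1).symm)
      refine Subtype.ext ((i.insert m.unop _).unique ⟨key y, rfl⟩ ⟨?_, hy.symm⟩)
      exact (key y').trans (congrArg (fun t => i.e (K.map (jl n m.unop).op t.1.1)) hy.symm)
    · intro x
      obtain ⟨y, ⟨hy, hy'⟩, -⟩ := i.insert m.unop x
      refine ⟨⟨y, hy.trans (congrArg i.e ?_)⟩, hy'⟩
      rw [← hy']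
      exact map_l _ _
    · let κ := elIso (T := K) rfl (map_l (ι := ι) (jr ⦋0⦌ m.unop) y.1)
      have e : X.map ((relFst ι).map (eltMap ((joinArrow.obj n).map (jr ⦋0⦌ m.unop)).op y.1)) ≫
          X.map (eltMap (jl n m.unop).op _) ≫ X.map κ.hom =
          X.map (eltMap (jl n (jn ⦋0⦌ m.unop)).op y.1.1.1) := by
        refine (congrArg (_ ≫ ·) (X.map_comp _ _).symm).trans ((X.map_comp _ _).symm.trans ?_)
        refine congrArg X.map (Subtype.ext ?_)
        refine (congrArg (_ ≫ ·) (Category.comp_id _)).trans ?_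
        exact congrArg Quiver.Hom.op ((jl_map (𝟙 n) (jr ⦋0⦌ m.unop)).trans (Category.id_comp _))
      exact h.of_comp_right (h.comp (hX m.unop _) (h.of_iso (X.mapIso κ))) (e ▸ hX _ _)
  have e : i.forget X ≫ (relBiFst ι X).app (op n) =
      c.aug (i.sum X) ≫ (Functor.const SimplexCategoryᵒᵖ).map v := by
    refine NatTrans.ext (funext fun m => ?_)
    refine (Category.assoc _ _ _).trans ?_
    refine (congrArg (_ ≫ ·) (relFstApp_naturality ι X (𝟙 n)
      ((joinArrow.obj n).map (jr ⦋0⦌ m.unop)) (jl_map (𝟙 n) _))).trans ?_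
    refine Eq.trans ?_ ((i.incl X).naturality_assoc (c.r m.unop).op _).symm
    exact congrArg (_ ≫ ·) (relFstApp_naturality ι X (𝟙 n)
      ((joinArrow.obj n).map (jl ⦋0⦌ m.unop)) (jl_map (𝟙 n) _)).symm
  exact h.real_of_comp_left (h.realization _ hf)
    (h.real_comp (c.real_aug h _) (h.realization _ fun _ => hv) rfl) e

end Insertion

end Comparison

section PointComparison

variable {M : Type u} [Category.{v} M] {S : DeltaStructure M} {W : MorphismProperty M}

/-- The diagonal of a bisimplicial object which is constant in the first direction. -/
def diagonalConstFst (Y : SimplexCategoryᵒᵖ ⥤ M) :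
    DeltaStructure.diagonal ((Functor.const SimplexCategoryᵒᵖ).obj Y) ≅ Y :=
  NatIso.ofComponents (fun _ => Iso.refl _) fun θ =>
    (Category.comp_id _).trans ((Category.id_comp (Y.map θ)).trans (Category.id_comp _).symm)

/-- The diagonal of a bisimplicial object which is constant in the second direction. -/
def diagonalConstSnd (Y : SimplexCategoryᵒᵖ ⥤ M) :
    DeltaStructure.diagonal (Y ⋙ Functor.const SimplexCategoryᵒᵖ) ≅ Y :=
  NatIso.ofComponents (fun _ => Iso.refl _) fun θ =>
    (Category.comp_id _).trans ((Category.comp_id (Y.map θ)).trans (Category.id_comp _).symm)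

variable [HasCoproducts.{w} M] [HasColimitsOfSize.{0, 0} M] {K K' : SSet.{w}} {ι : K' ⟶ K}
  {X : K.Elements ⥤ M}

/-- The simplex of dimension `[0] ⋆ [0]` given by a vertex of `K'`, as an element of `relIdx`. -/
def relPt (ι : K' ⟶ K) (d : K'.obj (op ⦋0⦌)) :
    (relIdx ι).obj (op ((joinArrow.obj ⦋0⦌).obj ⦋0⦌)) :=
  ⟨(K.map (jp ⦋0⦌ ⦋0⦌).op (ι.app _ d), d), by
    have h : K.map (jr ⦋0⦌ ⦋0⦌ ≫ jp ⦋0⦌ ⦋0⦌).op (ι.app _ d) = ι.app _ d := by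
      rw [jr_jp, op_id, K.map_id]
      rfl
    rw [op_comp, K.map_comp] at h
    exact h⟩

/-- The comparison of `|ΠX|` with the realization of the restriction of `X` along `ι`, at a vertex
of `K'`: both are weakly equivalent to the realization of the diagonal of `relBi ι X`. -/
theorem DeltaStructure.IsHomotopical.real_point (h : DeltaStructure.IsHomotopical.{w} S W)
    (hX : ∀ (n m : SimplexCategory) (s : K.obj (op (jn n m))), W (X.map (eltMap (jl n m).op s)))
    (i : ∀ n, Nonempty (Insertion ι n)) (d : K'.obj (op ⦋0⦌))
    (hd : W (elι (resEl ι X) (op ⦋0⦌) d ≫ S.to0 (DerSect.elSum (resEl ι X)))) :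
    W (elι X (op ⦋0⦌) (ι.app _ d) ≫ S.to0 (DerSect.elSum X)) := by
  let A : DeltaStructure.diagonal (relBi ι X) ⟶ DerSect.elSum (resEl ι X) :=
    diagonalMap (relBiSnd ι X) ≫ (diagonalConstFst _).hom
  let B : DeltaStructure.diagonal (relBi ι X) ⟶ DerSect.elSum X :=
    diagonalMap (relBiFst ι X) ≫ (diagonalConstSnd _).hom
  have hA : W (S.real.map A) := h.real_comp (h.real_diagonalMap_flip _ (relBiSnd_W ι X h))
    (h.of_iso (S.real.mapIso (diagonalConstFst _))) rfl
  have hB : W (S.real.map B) := h.real_comp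
    (h.real_diagonalMap _ fun n => (i n.unop).some.relBiFst_W X h (hX n.unop))
    (h.of_iso (S.real.mapIso (diagonalConstSnd _))) rfl
  -- The summand of the diagonal given by the degenerate simplex on `d` is sent to the two summands.
  let f : X.obj (el K (op ⦋0⦌) (ι.app _ d)) ⟶ (DeltaStructure.diagonal (relBi ι X)).obj (op ⦋0⦌) :=
    X.map (eltMap (jp ⦋0⦌ ⦋0⦌).op (ι.app _ d)) ≫ elι (relFst ι ⋙ X) _ (relPt ι d)
  have fA : f ≫ A.app (op ⦋0⦌) = elι (resEl ι X) (op ⦋0⦌) d := by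
    refine (congrArg (f ≫ ·) (Category.comp_id _)).trans ((Category.assoc _ _ _).trans ?_)
    refine (congrArg (_ ≫ ·) (ι_relSnd ι X _ (relPt ι d))).trans ?_
    refine (Category.assoc _ _ _).symm.trans ?_
    refine (congrArg (· ≫ _) (X.map_comp _ _).symm).trans ?_
    have e : eltMap (jp ⦋0⦌ ⦋0⦌).op (ι.app _ d) ≫ elHom (T := K) (jr ⦋0⦌ ⦋0⦌).op
        (relPt ι d).2 = 𝟙 _ :=
      Subtype.ext (congrArg Quiver.Hom.op (jr_jp ⦋0⦌ ⦋0⦌))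
    exact (congrArg (· ≫ _) ((congrArg X.map e).trans (X.map_id _))).trans (Category.id_comp _)
  have fB : f ≫ B.app (op ⦋0⦌) = elι X (op ⦋0⦌) (ι.app _ d) := by
    refine (congrArg (f ≫ ·) (Category.comp_id _)).trans ((Category.assoc _ _ _).trans ?_)
    refine (congrArg (_ ≫ ·) (ι_relFstApp ι X ⦋0⦌ ⦋0⦌ (relPt ι d))).trans ?_
    refine (Category.assoc _ _ _).symm.trans ?_
    refine (congrArg (· ≫ _) (X.map_comp _ _).symm).trans ?_
    refine (map_elι_congr X _ (𝟙 _) ?_).trans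
      ((congrArg (· ≫ _) (X.map_id _)).trans (Category.id_comp _))
    exact congrArg Quiver.Hom.op (Subsingleton.elim (α := (⦋0⦌ : SimplexCategory) ⟶ ⦋0⦌) _ _)
  have eA : (f ≫ S.to0 _) ≫ S.real.map A = elι (resEl ι X) (op ⦋0⦌) d ≫ S.to0 _ := by
    rw [Category.assoc, S.to0_map, ← Category.assoc, fA]
    rfl
  have eB : (f ≫ S.to0 _) ≫ S.real.map B = elι X (op ⦋0⦌) (ι.app _ d) ≫ S.to0 _ := by
    rw [Category.assoc, S.to0_map, ← Category.assoc, fB]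
  rw [← eB]
  exact h.comp (h.of_comp_right hA (eA ▸ hd)) hB

end PointComparison

/-! ### Gluing of strings -/

section Glue

variable {D : Type w} [Category.{w} D]

/-- The order on the ordinal sum of two linear orders. -/
def sumLE {A B : Type*} [LE A] [LE B] : A ⊕ B → A ⊕ B → Prop :=
  Sum.elim (fun a => Sum.elim (fun a' => a ≤ a') fun _ => True)
    (fun b => Sum.elim (fun _ => False) fun b' => b ≤ b')

variable {n m : ℕ} (τ : ComposableArrows D n) (e : ComposableArrows D m)
  (g : τ.obj (Fin.last n) ⟶ e.obj 0)

/-- The objects of a concatenation of strings. -/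
def glueObj : Fin (n + 1) ⊕ Fin (m + 1) → D := Sum.elim τ.obj e.obj

/-- The morphisms of a concatenation of strings. -/
def glueMap : ∀ (x y : Fin (n + 1) ⊕ Fin (m + 1)), sumLE x y → (glueObj τ e x ⟶ glueObj τ e y) :=
  Sum.rec (fun a => Sum.rec (fun _ h => τ.map (homOfLE h))
      fun b _ => τ.map (homOfLE (Fin.le_last a)) ≫ g ≫ e.map (homOfLE (Fin.zero_le b)))
    fun _ => Sum.rec (fun _ h => False.elim h) fun _ h => e.map (homOfLE h)

theorem glueMap_id (x : Fin (n + 1) ⊕ Fin (m + 1)) (h : sumLE x x) :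
    glueMap τ e g x x h = 𝟙 _ := by
  cases x
  · exact τ.map_id _
  · exact e.map_id _

theorem glueMap_comp (x y z : Fin (n + 1) ⊕ Fin (m + 1)) (h : sumLE x y) (h' : sumLE y z)
    (h'' : sumLE x z) :
    glueMap τ e g x z h'' = glueMap τ e g x y h ≫ glueMap τ e g y z h' := by
  rcases x with a | a <;> rcases y with b | b <;> rcases z with c | c
  · exact τ.map_comp (homOfLE h) (homOfLE h')
  · refine Eq.trans ?_ (Category.assoc _ _ _)
    exact congrArg (· ≫ _) (τ.map_comp (homOfLE h) (homOfLE (Fin.le_last _)))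
  · exact False.elim h'
  · refine Eq.trans ?_ (Category.assoc _ _ _).symm
    refine congrArg (_ ≫ ·) (Eq.trans ?_ (Category.assoc _ _ _).symm)
    exact congrArg (_ ≫ ·) (e.map_comp (homOfLE (Fin.zero_le _)) (homOfLE h'))
  · exact False.elim h
  · exact False.elim h
  · exact False.elim h'
  · exact e.map_comp (homOfLE h) (homOfLE h')

end Glue

section GlueNerve

variable {D : Type w} [Category.{w} D] {n m : SimplexCategory}

/-- An element of `[n] ⋆ [m]` belongs to `[n]` or to `[m]`. -/
def joinSplit (n m : SimplexCategory) (i : Fin ((jn n m).len + 1)) :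
    Fin (n.len + 1) ⊕ Fin (m.len + 1) :=
  if h : i.val ≤ n.len then Sum.inl ⟨i.val, by omega⟩ else
    Sum.inr ⟨i.val - (n.len + 1), by have := i.2; simp at this; omega⟩

theorem joinSplit_l (a : Fin (n.len + 1)) :
    joinSplit n m ((jl n m).toOrderHom a) = Sum.inl a :=
  dif_pos (Nat.lt_succ_iff.mp a.2)

theorem joinSplit_r (b : Fin (m.len + 1)) :
    joinSplit n m ((jr n m).toOrderHom b) = Sum.inr b := by
  refine (dif_neg ?_).trans (congrArg Sum.inr (Fin.ext ?_))
  · rw [jr_val]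
    omega
  · exact Nat.add_sub_cancel_left _ _

theorem joinSplit_mono {i j : Fin ((jn n m).len + 1)} (h : i ≤ j) :
    sumLE (joinSplit n m i) (joinSplit n m j) := by
  have h' : i.val ≤ j.val := h
  obtain ⟨a, rfl⟩ | ⟨b, rfl⟩ := jn_cases i
  · obtain ⟨a', rfl⟩ | ⟨b', rfl⟩ := jn_cases j
    · rw [joinSplit_l, joinSplit_l]
      exact h
    · rw [joinSplit_l, joinSplit_r]
      trivial
  · obtain ⟨a', rfl⟩ | ⟨b', rfl⟩ := jn_cases j
    · rw [jl_val, jr_val] at h'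
      have := a'.2
      omega
    · rw [joinSplit_r, joinSplit_r]
      rw [jr_val, jr_val] at h'
      exact Nat.le_of_add_le_add_left h'

/-- The concatenation of two strings by a morphism from the end of the first one to the beginning
of the second one. -/
def glue (τ : (nerve D).obj (op n)) (e : (nerve D).obj (op m))
    (g : τ.obj (Fin.last _) ⟶ e.obj 0) : (nerve D).obj (op (jn n m)) where
  obj i := glueObj τ e (joinSplit n m i)
  map f := glueMap τ e g _ _ (joinSplit_mono (leOfHom f))
  map_id _ := glueMap_id _ _ _ _ _
  map_comp _ _ := glueMap_comp _ _ _ _ _ _ _ _ _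

/-- The morphism of a string of length `[n] ⋆ [m]` between its two parts. -/
def conn (σ : (nerve D).obj (op (jn n m))) :
    ((nerve D).map (jl n m).op σ).obj (Fin.last _) ⟶ ((nerve D).map (jr n m).op σ).obj 0 :=
  σ.map (homOfLE (jl_le_jr _ _))

theorem glueMap_heq {n m : ℕ} (τ : ComposableArrows D n) (e : ComposableArrows D m)
    (g : τ.obj (Fin.last n) ⟶ e.obj 0) {x x' y y' : Fin (n + 1) ⊕ Fin (m + 1)} (hx : x = x')
    (hy : y = y') (h : sumLE x y) (h' : sumLE x' y') :
    glueMap τ e g x y h ≍ glueMap τ e g x' y' h' := by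
  subst hx hy
  rfl

theorem arrows_map_heq {n : ℕ} (σ : ComposableArrows D n) {i i' j j' : Fin (n + 1)} (hi : i = i')
    (hj : j = j') (h : i ≤ j) (h' : i' ≤ j') :
    σ.map (homOfLE h) ≍ σ.map (homOfLE h') := by
  subst hi hj
  rfl

theorem glue_l (τ : (nerve D).obj (op n)) (e : (nerve D).obj (op m))
    (g : τ.obj (Fin.last _) ⟶ e.obj 0) : (nerve D).map (jl n m).op (glue τ e g) = τ :=
  CategoryTheory.Functor.hext (fun a => congrArg (glueObj τ e) (joinSplit_l a)) fun a a' f =>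
    glueMap_heq τ e g (joinSplit_l a) (joinSplit_l a') _ (leOfHom f)

theorem glue_r (τ : (nerve D).obj (op n)) (e : (nerve D).obj (op m))
    (g : τ.obj (Fin.last _) ⟶ e.obj 0) : (nerve D).map (jr n m).op (glue τ e g) = e :=
  CategoryTheory.Functor.hext (fun a => congrArg (glueObj τ e) (joinSplit_r a)) fun a a' f =>
    glueMap_heq τ e g (joinSplit_r a) (joinSplit_r a') _ (leOfHom f)

theorem conn_glue (τ : (nerve D).obj (op n)) (e : (nerve D).obj (op m))
    (g : τ.obj (Fin.last _) ⟶ e.obj 0) : conn (glue τ e g) ≍ g := by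
  refine (glueMap_heq τ e g (joinSplit_l _) (joinSplit_r _) _ trivial).trans (heq_of_eq ?_)
  refine (congrArg (· ≫ _) (τ.map_id _)).trans ((Category.id_comp _).trans ?_)
  exact (congrArg (g ≫ ·) (e.map_id _)).trans (Category.comp_id _)

theorem glue_conn (σ : (nerve D).obj (op (jn n m))) :
    glue ((nerve D).map (jl n m).op σ) ((nerve D).map (jr n m).op σ) (conn σ) = σ := by
  have ho i : glueObj ((nerve D).map (jl n m).op σ) ((nerve D).map (jr n m).op σ)
      (joinSplit n m i) = σ.obj i := by
    obtain ⟨a, rfl⟩ | ⟨b, rfl⟩ := jn_cases i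
    · rw [joinSplit_l]
      rfl
    · rw [joinSplit_r]
      rfl
  refine CategoryTheory.Functor.hext ho fun i j f => ?_
  have h : i ≤ j := leOfHom f
  obtain ⟨a, rfl⟩ | ⟨b, rfl⟩ := jn_cases i
  · obtain ⟨a', rfl⟩ | ⟨b', rfl⟩ := jn_cases j
    · exact glueMap_heq _ _ _ (joinSplit_l a) (joinSplit_l a') _ h
    · refine (glueMap_heq _ _ _ (joinSplit_l a) (joinSplit_r b') _ trivial).trans (heq_of_eq ?_)
      refine (congrArg (_ ≫ ·) (σ.map_comp (homOfLE (jl_le_jr _ _)) (homOfLE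
        ((jr n m).toOrderHom.monotone (Fin.zero_le b')))).symm).trans ?_
      exact (σ.map_comp (homOfLE ((jl n m).toOrderHom.monotone (Fin.le_last a))) _).symm
  · obtain ⟨a', rfl⟩ | ⟨b', rfl⟩ := jn_cases j
    · have h' : n.len + 1 + b.val ≤ a'.val := h
      have := a'.2
      omega
    · refine glueMap_heq _ _ _ (joinSplit_r b) (joinSplit_r b') _ ?_
      exact Nat.le_of_add_le_add_left (show n.len + 1 + b.val ≤ n.len + 1 + b'.val from h)

theorem glue_congr {τ τ' : (nerve D).obj (op n)} {e e' : (nerve D).obj (op m)}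
    {g : τ.obj (Fin.last _) ⟶ e.obj 0} {g' : τ'.obj (Fin.last _) ⟶ e'.obj 0} (hτ : τ = τ')
    (he : e = e') (hg : g ≍ g') : glue τ e g = glue τ' e' g' := by
  subst hτ he
  rw [eq_of_heq hg]

theorem join_string_ext {σ σ' : (nerve D).obj (op (jn n m))}
    (hl : (nerve D).map (jl n m).op σ = (nerve D).map (jl n m).op σ')
    (hr : (nerve D).map (jr n m).op σ = (nerve D).map (jr n m).op σ') (hc : conn σ ≍ conn σ') :
    σ = σ' := by
  rw [← glue_conn σ, ← glue_conn σ']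
  exact glue_congr hl hr hc

end GlueNerve

/-! ### Insertion of vertices of a fibre into strings -/

section HEq

variable {D : Type u₁} [Category.{v₁} D]

theorem comp_heq {a a' b b' c c' : D} (ha : a = a') (hb : b = b') (hc : c = c') {f : a ⟶ b}
    {f' : a' ⟶ b'} {g : b ⟶ c} {g' : b' ⟶ c'} (hf : f ≍ f') (hg : g ≍ g') :
    f ≫ g ≍ f' ≫ g' := by
  subst ha hb hc
  rw [eq_of_heq hf, eq_of_heq hg]

theorem comp_eqToHom_heq' {a b b' : D} (f : a ⟶ b) (h : b = b') : f ≫ eqToHom h ≍ f := by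
  subst h
  rw [eqToHom_refl, Category.comp_id]

theorem arrows_map_heq' {n : ℕ} {σ σ' : ComposableArrows D n} (h : σ = σ') {i j : Fin (n + 1)}
    (f : i ⟶ j) : σ.map f ≍ σ'.map f := by
  subst h
  rfl

theorem map_comp_eqToHom_heq {C : Type u₂} [Category.{v₂} C] (F : D ⥤ C) {a a' b b' : D} {c : C}
    (ha : a = a') (hb : b = b') {f : a ⟶ b} {f' : a' ⟶ b'} (hf : f ≍ f') (h : F.obj b = c)
    (h' : F.obj b' = c) : F.map f ≫ eqToHom h ≍ F.map f' ≫ eqToHom h' := by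
  subst ha hb
  rw [eq_of_heq hf]

end HEq

section

variable {C D : Type w} [Category.{w} C] [Category.{w} D] (F : D ⥤ C) (c : C)

/-- The functor `(d₀ ⟶ ⋯ ⟶ dₙ) ↦ F dₙ`. -/
abbrev tailOver : Simp D ⥤ Cᵒᵖ := simpMap F ⋙ tail C

variable {F c}

theorem fiber_map {b b' : F.Fiber c} (f : b ⟶ b') (h : F.obj b.1 = F.obj b'.1) :
    F.map f.1 = eqToHom h := by
  have := f.2
  rw [IsHomLift.fac' F (𝟙 c) f.1]
  simp

theorem isHomLift_map_eqToHom {a b : D} (f : a ⟶ b) (h : F.obj b = c) :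
    F.IsHomLift (F.map f ≫ eqToHom h) f := by
  subst h
  rw [eqToHom_refl, Category.comp_id]
  exact IsHomLift.map (p := F) f

/-- The morphism `F dₙ ⟶ c` of a simplex of `idx (tailOver F) c`. -/
def idxHom {n : SimplexCategoryᵒᵖ} (z : (idx (tailOver F) c).obj n) :
    F.obj (z.1.obj (Fin.last _)) ⟶ c := z.2.unop

theorem idx_hext {n : SimplexCategoryᵒᵖ} {z z' : (idx (tailOver F) c).obj n} (h : z.1 = z'.1)
    (h' : idxHom z ≍ idxHom z') : z = z' := by
  obtain ⟨σ, α⟩ := z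
  obtain ⟨σ', α'⟩ := z'
  obtain rfl : σ = σ' := h
  have : α.unop = α'.unop := eq_of_heq h'
  rw [Quiver.Hom.unop_inj this]

theorem idxHom_map {n m : SimplexCategoryᵒᵖ} (θ : n ⟶ m) (z : (idx (tailOver F) c).obj n) :
    idxHom ((idx (tailOver F) c).map θ z) =
      F.map (z.1.map (homOfLE (Fin.le_last (θ.unop.toOrderHom (Fin.last _))))) ≫ idxHom z :=
  congrArg (· ≫ idxHom z) (Category.id_comp _)

variable (F c) in
/-- The inclusion of the nerve of the fibre `D(c)`. -/
def fibreIncl : nerve (F.Fiber c) ⟶ idx (tailOver F) c where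
  app n := ↾fun b => ⟨(nerveMap Functor.Fiber.fiberInclusion).app n b,
    (eqToHom (b.obj (Fin.last _)).2).op⟩
  naturality n m θ := by
    refine ConcreteCategory.hom_ext _ _ fun b => ?_
    let z : (idx (tailOver F) c).obj n := ⟨(nerveMap Functor.Fiber.fiberInclusion).app n b,
      (eqToHom (b.obj (Fin.last _)).2).op⟩
    have e : F.map (b.map (homOfLE (Fin.le_last (θ.unop.toOrderHom (Fin.last _))))).1 =
        eqToHom ((b.obj _).2.trans (b.obj _).2.symm) := fiber_map _ _
    have h : idxHom ((idx (tailOver F) c).map θ z) = eqToHom (b.obj _).2 :=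
      (idxHom_map θ z).trans ((congrArg (· ≫ idxHom z) e).trans
        (eqToHom_trans _ (b.obj (Fin.last _)).2))
    exact idx_hext rfl (heq_of_eq h.symm)

/-- The simplices which come from the fibre are given by identities, up to equalities of objects. -/
theorem idxHom_of_eq {n : SimplexCategoryᵒᵖ} {z : (idx (tailOver F) c).obj n}
    {b : (nerve (F.Fiber c)).obj n} (h : z = (fibreIncl F c).app n b)
    (j : Fin (n.unop.len + 1)) (hj : F.obj (z.1.obj j) = c) :
    F.map (z.1.map (homOfLE (Fin.le_last j))) ≫ idxHom z = eqToHom hj := by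
  subst h
  have e : F.map (b.map (homOfLE (Fin.le_last j))).1 =
      eqToHom ((b.obj j).2.trans (b.obj (Fin.last _)).2.symm) := fiber_map _ _
  exact (congrArg (· ≫ idxHom ((fibreIncl F c).app n b)) e).trans
    (eqToHom_trans ((b.obj j).2.trans (b.obj (Fin.last _)).2.symm) (b.obj (Fin.last _)).2)

theorem eq_eqToHom_of_last {n : ℕ} {σ : ComposableArrows D n} {i : Fin (n + 1)}
    (hi : i = Fin.last n) {α : F.obj (σ.obj (Fin.last n)) ⟶ c} {h : F.obj (σ.obj i) = c}
    (h' : F.obj (σ.obj (Fin.last n)) = c)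
    (e : F.map (σ.map (homOfLE (Fin.le_last i))) ≫ α = eqToHom h) : α = eqToHom h' := by
  subst hi
  refine Eq.trans ?_ e
  have : homOfLE (Fin.le_last (Fin.last n)) = 𝟙 _ := rfl
  rw [this, σ.map_id, F.map_id, Category.id_comp]

theorem map_eqToHom_of_last {n : ℕ} {σ : ComposableArrows D n} {i : Fin (n + 1)}
    (hi : i = Fin.last n) (h : F.obj (σ.obj i) = c) (h' : F.obj (σ.obj (Fin.last n)) = c) :
    F.map (σ.map (homOfLE (Fin.le_last i))) ≫ eqToHom h' = eqToHom h := by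
  subst hi
  have : homOfLE (Fin.le_last (Fin.last n)) = 𝟙 _ := rfl
  rw [this, σ.map_id, F.map_id, Category.id_comp]

section

variable {n m : SimplexCategory} (x : (relIdx (fibreIncl F c)).obj (op ((joinArrow.obj n).obj m)))

/-- The part of length `[n]` of an element of `relIdx (fibreIncl F c)`. -/
def relL : (nerve D).obj (op n) := (nerve D).map (jl n m).op x.1.1.1

/-- The part in the fibre `D(c)` of an element of `relIdx (fibreIncl F c)`. -/
def relB : (nerve (F.Fiber c)).obj (op m) := x.1.2

theorem rel_r : (nerve D).map (jr n m).op x.1.1.1 =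
    (nerveMap Functor.Fiber.fiberInclusion).app _ (relB x) :=
  congrArg Sigma.fst x.2

theorem rel_obj (j : Fin (m.len + 1)) :
    x.1.1.1.obj ((jr n m).toOrderHom j) = ((relB x).obj j).1 :=
  CategoryTheory.Functor.congr_obj (rel_r x) j

theorem rel_over (j : Fin (m.len + 1)) : F.obj (x.1.1.1.obj ((jr n m).toOrderHom j)) = c :=
  (congrArg F.obj (rel_obj x j)).trans ((relB x).obj j).2

/-- The morphism between the two parts of an element of `relIdx (fibreIncl F c)`. -/
def relConn : (relL x).obj (Fin.last _) ⟶ ((relB x).obj 0).1 :=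
  conn x.1.1.1 ≫ eqToHom (rel_obj x 0)

theorem relConn_heq : relConn x ≍ conn x.1.1.1 := comp_eqToHom_heq' _ _

theorem rel_hom (j : Fin (m.len + 1)) :
    F.map (x.1.1.1.map (homOfLE (Fin.le_last ((jr n m).toOrderHom j)))) ≫ idxHom x.1.1 =
      eqToHom (rel_over x j) := by
  have h := idxHom_of_eq (z := (idx (tailOver F) c).map (jr n m).op x.1.1) x.2 j (rel_over x j)
  refine Eq.trans ?_ h
  refine Eq.trans ?_ (congrArg (_ ≫ ·) (idxHom_map (jr n m).op x.1.1).symm)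
  refine Eq.trans ?_ (Category.assoc _ _ _)
  refine congrArg (· ≫ _) (Eq.trans ?_ (F.map_comp _ _))
  exact congrArg F.map (x.1.1.1.map_comp
    (homOfLE ((jr n m).toOrderHom.monotone (Fin.le_last j))) _)

theorem rel_idxHom (h : F.obj (x.1.1.1.obj (Fin.last _)) = c) : idxHom x.1.1 = eqToHom h :=
  eq_eqToHom_of_last (jr_last n m) h (rel_hom x (Fin.last _))

theorem rel_over_last : F.obj (x.1.1.1.obj (Fin.last _)) = c :=
  (congrArg (fun i => F.obj (x.1.1.1.obj i)) (jr_last n m)).symm.trans (rel_over x (Fin.last _))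

theorem idxHom_relL : idxHom ((idx (tailOver F) c).map (jl n m).op x.1.1) =
    F.map (relConn x) ≫ eqToHom ((relB x).obj 0).2 := by
  refine (idxHom_map (jl n m).op x.1.1).trans ?_
  have h : x.1.1.1.map (homOfLE (Fin.le_last ((jl n m).toOrderHom (Fin.last _)))) =
      conn x.1.1.1 ≫ x.1.1.1.map (homOfLE (Fin.le_last ((jr n m).toOrderHom 0))) :=
    x.1.1.1.map_comp (homOfLE (jl_le_jr _ _)) (homOfLE (Fin.le_last ((jr n m).toOrderHom 0)))
  refine (congrArg (fun t => F.map t ≫ _) h).trans ?_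
  refine (congrArg (· ≫ _) (F.map_comp _ _)).trans ((Category.assoc _ _ _).trans ?_)
  refine (congrArg (_ ≫ ·) (rel_hom x 0)).trans ?_
  have e : F.map (relConn x) = F.map (conn x.1.1.1) ≫ eqToHom (congrArg F.obj (rel_obj x 0)) :=
    (F.map_comp _ _).trans (congrArg (_ ≫ ·) (eqToHom_map F _))
  refine Eq.trans ?_ (congrArg (· ≫ _) e).symm
  refine Eq.trans ?_ (Category.assoc _ _ _).symm
  exact (congrArg (F.map (conn x.1.1.1) ≫ ·)
    (eqToHom_trans (congrArg F.obj (rel_obj x 0)) ((relB x).obj 0).2)).symm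

theorem relConn_isHomLift :
    F.IsHomLift (idxHom ((idx (tailOver F) c).map (jl n m).op x.1.1)) (relConn x) := by
  rw [idxHom_relL]
  exact isHomLift_map_eqToHom (relConn x) ((relB x).obj 0).2

variable {x} in
theorem rel_ext {x' : (relIdx (fibreIncl F c)).obj (op ((joinArrow.obj n).obj m))}
    (hl : relL x = relL x') (hb : relB x = relB x') (hc : relConn x ≍ relConn x') : x = x' := by
  have h : x.1.1 = x'.1.1 := by
    have h1 : x.1.1.1 = x'.1.1.1 := by
      refine join_string_ext hl ?_ ((relConn_heq x).symm.trans (hc.trans (relConn_heq x')))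
      exact (rel_r x).trans ((congrArg _ hb).trans (rel_r x').symm)
    refine idx_hext h1 ?_
    rw [rel_idxHom x (rel_over_last x), rel_idxHom x' (rel_over_last x')]
    have key {a a' : D} (e : a = a') (h : F.obj a = c) (h' : F.obj a' = c) :
        eqToHom h ≍ eqToHom h' := by
      subst e
      rfl
    exact key (congrArg (fun s => s.obj (Fin.last _)) h1) _ _
  exact Subtype.ext (Prod.ext h hb)

theorem relL_map {m' : SimplexCategory} (θ : m' ⟶ m) :
    relL ((relIdx (fibreIncl F c)).map ((joinArrow.obj n).map θ).op x) = relL x :=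
  congrArg Sigma.fst (Insertion.map_l θ x)

theorem conn_map {n m m' : SimplexCategory} (θ : m' ⟶ m) (σ : (nerve D).obj (op (jn n m))) :
    conn ((nerve D).map (jmap (𝟙 n) θ).op σ) ≍
      conn σ ≫ ((nerve D).map (jr n m).op σ).map (homOfLE (Fin.zero_le (θ.toOrderHom 0))) := by
  have h : conn σ ≫ ((nerve D).map (jr n m).op σ).map (homOfLE (Fin.zero_le (θ.toOrderHom 0))) =
      σ.map (homOfLE (jl_le_jr (Fin.last _) (θ.toOrderHom 0))) :=
    (σ.map_comp (homOfLE (jl_le_jr _ _)) (homOfLE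
      ((jr n m).toOrderHom.monotone (Fin.zero_le (θ.toOrderHom 0))))).symm
  rw [h]
  refine arrows_map_heq σ ?_ ?_ _ _
  · exact congrArg (fun t => t.toOrderHom (Fin.last _)) (jl_map (𝟙 n) θ)
  · exact congrArg (fun t => t.toOrderHom 0) (jr_map (𝟙 n) θ)

theorem relConn_map {m' : SimplexCategory} (θ : m' ⟶ m) :
    relConn ((relIdx (fibreIncl F c)).map ((joinArrow.obj n).map θ).op x) ≍
      relConn x ≫ ((relB x).map (homOfLE (Fin.zero_le (θ.toOrderHom 0)))).1 := by
  refine (relConn_heq _).trans ((conn_map θ x.1.1.1).trans ?_)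
  exact comp_heq rfl (rel_obj x 0) (rel_obj x (θ.toOrderHom 0)) (relConn_heq x).symm
    (arrows_map_heq' (rel_r x) _)

end

section

variable {n m : SimplexCategory} (τ : (nerve D).obj (op n)) (b : (nerve (F.Fiber c)).obj (op m))
  (g : τ.obj (Fin.last _) ⟶ (b.obj 0).1)

theorem relMk_aux : F.obj ((glue τ ((nerveMap Functor.Fiber.fiberInclusion).app _ b) g).obj
    (Fin.last _)) = c := by
  rw [← jr_last n m]
  refine Eq.trans (congrArg F.obj ?_) (b.obj (Fin.last _)).2
  exact congrArg (glueObj τ _) (joinSplit_r _)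

/-- The element of `relIdx (fibreIncl F c)` with given parts. -/
def relMk : (relIdx (fibreIncl F c)).obj (op ((joinArrow.obj n).obj m)) :=
  ⟨(⟨glue τ ((nerveMap Functor.Fiber.fiberInclusion).app _ b) g,
    (eqToHom (relMk_aux τ b g)).op⟩, b), by
    have h : (nerve D).map (jr n m).op (glue τ ((nerveMap
      Functor.Fiber.fiberInclusion).app _ b) g) = (nerveMap
        Functor.Fiber.fiberInclusion).app _ b := glue_r _ _ _
    refine idx_hext h ?_
    refine (heq_of_eq ((idxHom_map (jr n m).op _).trans (map_eqToHom_of_last (jr_last n m) ?_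
      (relMk_aux τ b g)))).trans ?_
    · exact (congrArg (fun s => F.obj (s.obj (Fin.last _))) h).trans (b.obj (Fin.last _)).2
    · have key {a a' : D} (e : a = a') (h : F.obj a = c) (h' : F.obj a' = c) :
          eqToHom h ≍ eqToHom h' := by
        subst e
        rfl
      exact key (congrArg (fun s => s.obj (Fin.last _)) h) _ (b.obj (Fin.last _)).2⟩

theorem relL_mk : relL (relMk τ b g) = τ :=
  glue_l τ ((nerveMap Functor.Fiber.fiberInclusion).app _ b) g

theorem relConn_mk : relConn (relMk τ b g) ≍ g :=
  (relConn_heq _).trans (conn_glue τ ((nerveMap Functor.Fiber.fiberInclusion).app _ b) g)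

end

/-- The uniqueness part of the universal property of opCartesian morphisms, for morphisms which
agree up to equalities of their ends. -/
theorem cocartesian_heq {x x' : D} {α : F.obj x ⟶ c} {b b' d d' : F.Fiber c} (hx : x = x')
    (hb : b = b') (hd : d = d') {f : x ⟶ b.1} {f' : x' ⟶ b'.1} (hf : F.IsCocartesian α f)
    (hff : f ≍ f') {γ : b ⟶ d} {γ' : b' ⟶ d'} (h : f ≫ γ.1 ≍ f' ≫ γ'.1) : γ ≍ γ' := by
  subst hx hb hd
  obtain rfl := eq_of_heq hff
  have h1 := γ.2
  have h2 := γ'.2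
  exact heq_of_eq (Subtype.ext (Functor.IsCocartesian.ext F α f γ.1 γ'.1 (eq_of_heq h)))

variable [IsOpfibration F]

/-- The value `α_! dₙ` of the transition functor for a simplex `(d₀ ⟶ ⋯ ⟶ dₙ, α : F dₙ ⟶ c)`. -/
noncomputable def idxPush {n : SimplexCategoryᵒᵖ} (z : (idx (tailOver F) c).obj n) : F.Fiber c :=
  ⟨pushObj F (idxHom z), IsHomLift.codomain_eq F (idxHom z) (pushMap F (idxHom z))⟩

/-- The opCartesian morphism `dₙ ⟶ α_! dₙ`. -/
noncomputable def idxPushMap {n : SimplexCategoryᵒᵖ} (z : (idx (tailOver F) c).obj n) :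
    z.1.obj (Fin.last _) ⟶ (idxPush z).1 := pushMap F (idxHom z)

theorem idxPushMap_cocartesian {n : SimplexCategoryᵒᵖ} (z : (idx (tailOver F) c).obj n) :
    F.IsCocartesian (idxHom z) (idxPushMap z) := pushMap_isCocartesian F (idxHom z)

variable (F c) in
/-- Insertion of the vertex `α_! dₙ` into strings of which the end belongs to the fibre `D(c)`. -/
noncomputable def fibreInsertion (n : SimplexCategory) : Insertion (fibreIncl F c) n where
  e z := relMk z.1 (ComposableArrows.mk₀ (idxPush z)) (idxPushMap z)
  l_e z := by
    refine idx_hext (relL_mk _ _ _) ?_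
    rw [idxHom_relL]
    have h := idxPushMap_cocartesian z
    have e : F.map (idxPushMap z) ≫ eqToHom (idxPush z).2 = idxHom z := by
      rw [IsHomLift.fac' F (idxHom z) (idxPushMap z)]
      simp
    refine HEq.trans ?_ (heq_of_eq e)
    exact map_comp_eqToHom_heq F (congrArg (fun s => s.obj (Fin.last _))
      (relL_mk z.1 (ComposableArrows.mk₀ (idxPush z)) (idxPushMap z))) rfl
      (relConn_mk z.1 (ComposableArrows.mk₀ (idxPush z)) (idxPushMap z)) _ (idxPush z).2
  insert m x := by
    refine existsUnique_of_exists_of_unique ?_ ?_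
    -- Existence: the morphism to the part in the fibre factors through the opCartesian one.
    · let z := (idx (tailOver F) c).map (jl n m).op x.1.1
      have hz := idxPushMap_cocartesian z
      let γ : (idxPush z) ⟶ (relB x).obj 0 := ⟨coMap hz (Category.comp_id _).symm
        (relConn_isHomLift x), coMap_isHomLift _ _ _⟩
      have hγ : idxPushMap z ≫ γ.1 = relConn x :=
        coMap_fac hz (Category.comp_id _).symm (relConn_isHomLift x)
      let b := glue (ComposableArrows.mk₀ (idxPush z)) (relB x) γ
      have hb0 : (b.obj 0) = idxPush z :=
        congrArg (fun s => s.obj 0) (glue_l (ComposableArrows.mk₀ (idxPush z)) (relB x) γ)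
      have hb1 : b.obj ((jr ⦋0⦌ m).toOrderHom 0) = (relB x).obj 0 :=
        congrArg (fun s => s.obj 0) (glue_r (ComposableArrows.mk₀ (idxPush z)) (relB x) γ)
      have hbγ : b.map (homOfLE (Fin.zero_le ((jr ⦋0⦌ m).toOrderHom 0))) ≍ γ :=
        conn_glue (ComposableArrows.mk₀ (idxPush z)) (relB x) γ
      let y := relMk z.1 b (idxPushMap z ≫ eqToHom (congrArg Subtype.val hb0.symm))
      have hy : relConn y ≍ idxPushMap z := (relConn_mk _ _ _).trans (comp_eqToHom_heq' _ _)
      refine ⟨y, rel_ext ?_ ?_ ?_, rel_ext ?_ ?_ ?_⟩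
      · exact (relL_map _ _).trans ((relL_mk _ _ _).trans (relL_mk _ _ _).symm)
      · exact glue_l _ _ _
      · refine (relConn_map _ _).trans (HEq.trans ?_ (hy.trans
          (relConn_mk z.1 (ComposableArrows.mk₀ (idxPush z)) (idxPushMap z)).symm))
        refine heq_of_eq (Eq.trans ?_ (Category.comp_id _))
        exact congrArg (fun t => relConn y ≫ Subtype.val t) (b.map_id 0)
      · exact (relL_map _ _).trans (relL_mk _ _ _)
      · exact glue_r _ _ _
      · refine (relConn_map _ _).trans (HEq.trans ?_ (heq_of_eq hγ))
        refine comp_heq (congrArg (fun s => s.obj (Fin.last _)) (relL_mk z.1 b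
          (idxPushMap z ≫ eqToHom (congrArg Subtype.val hb0.symm))))
          (congrArg Subtype.val hb0) (congrArg Subtype.val hb1) hy ?_
        have key {p p' q q' : F.Fiber c} (hp : p = p') (hq : q = q') {f : p ⟶ q} {f' : p' ⟶ q'}
            (hf : f ≍ f') : f.1 ≍ f'.1 := by
          subst hp hq
          rw [eq_of_heq hf]
        exact key hb0 hb1 hbγ
    -- Uniqueness: such a factorization is unique.
    · rintro y y' ⟨h1, h2⟩ ⟨h1', h2'⟩
      let z := (idx (tailOver F) c).map (jl n m).op x.1.1
      have hL {y} (h2 : (relIdx (fibreIncl F c)).map ((joinArrow.obj n).map (jr ⦋0⦌ m)).op y = x) :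
          relL y = relL x := (relL_map y _).symm.trans (congrArg relL h2)
      have hconn {y} (h1 : (relIdx (fibreIncl F c)).map ((joinArrow.obj n).map (jl ⦋0⦌ m)).op y =
          relMk z.1 (ComposableArrows.mk₀ (idxPush z)) (idxPushMap z)) :
          relConn y ≍ idxPushMap z := by
        refine HEq.trans ?_ (relConn_mk z.1 (ComposableArrows.mk₀ (idxPush z)) (idxPushMap z))
        rw [← h1]
        refine HEq.trans ?_ (relConn_map y (jl ⦋0⦌ m)).symm
        refine heq_of_eq ((Category.comp_id _).symm.trans ?_)
        exact congrArg (fun t => relConn y ≫ Subtype.val t) ((relB y).map_id 0).symm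
      have hB {y} (h1 : (relIdx (fibreIncl F c)).map ((joinArrow.obj n).map (jl ⦋0⦌ m)).op y =
          relMk z.1 (ComposableArrows.mk₀ (idxPush z)) (idxPushMap z)) :
          (nerve (F.Fiber c)).map (jl ⦋0⦌ m).op (relB y) = ComposableArrows.mk₀ (idxPush z) :=
        congrArg relB h1
      have hB' {y} (h2 : (relIdx (fibreIncl F c)).map ((joinArrow.obj n).map (jr ⦋0⦌ m)).op y = x) :
          (nerve (F.Fiber c)).map (jr ⦋0⦌ m).op (relB y) = relB x :=
        congrArg relB h2
      have hc {y} (h2 : (relIdx (fibreIncl F c)).map ((joinArrow.obj n).map (jr ⦋0⦌ m)).op y = x) :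
          relConn y ≫ (conn (relB y)).1 ≍ relConn x := by
        refine (relConn_map y (jr ⦋0⦌ m)).symm.trans ?_
        rw [h2]
      refine rel_ext ((hL h2).trans (hL h2').symm) (join_string_ext ((hB h1).trans (hB h1').symm)
        ((hB' h2).trans (hB' h2').symm) ?_) ((hconn h1).trans (hconn h1').symm)
      have key {y} (h1 : (relIdx (fibreIncl F c)).map ((joinArrow.obj n).map (jl ⦋0⦌ m)).op y =
          relMk z.1 (ComposableArrows.mk₀ (idxPush z)) (idxPushMap z))
          (h2 : (relIdx (fibreIncl F c)).map ((joinArrow.obj n).map (jr ⦋0⦌ m)).op y = x) :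
          (⟨coMap (idxPushMap_cocartesian z) (Category.comp_id _).symm
        (relConn_isHomLift x), coMap_isHomLift _ _ _⟩ : (idxPush z) ⟶ (relB x).obj 0) ≍
          conn (relB y) := by
        refine cocartesian_heq (f := idxPushMap z) (f' := relConn y)
          (congrArg (fun s => s.obj (Fin.last _)) (hL h2).symm)
          (congrArg (fun s => s.obj 0) (hB h1).symm) (congrArg (fun s => s.obj 0) (hB' h2).symm)
          (idxPushMap_cocartesian z) (hconn h1).symm ?_
        exact (heq_of_eq (coMap_fac (idxPushMap_cocartesian z) (Category.comp_id _).symm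
          (relConn_isHomLift x))).trans (hc h2).symm
      exact (key h1 h2).symm.trans (key h1' h2')

end

/-! ### Weakly Cartesian morphisms of the transpose fibration -/

section Vertical

variable {𝓔 : Type u₁} [Category.{v₁} 𝓔] {C : Type u₂} [Category.{v₂} C] {p : 𝓔 ⥤ C}

theorem isHomLift_of_id_comp {a c R : C} {z e : 𝓔} {k : a ⟶ R} (hk : p.IsHomLift k (𝟙 z))
    {g : R ⟶ c} {b : z ⟶ e} (hb : p.IsHomLift (k ≫ g) b) : p.IsHomLift g b := by
  obtain rfl := IsHomLift.domain_eq p k (𝟙 z)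
  obtain rfl := IsHomLift.codomain_eq p k (𝟙 z)
  obtain rfl := IsHomLift.eq_of_isHomLift p k (𝟙 z)
  rwa [p.map_id, Category.id_comp] at hb

theorem isHomLift_codomain {a b : C} {g : a ⟶ b} {x y : 𝓔} {φ : x ⟶ y} (h : p.IsHomLift g φ) :
    p.obj y = b :=
  IsHomLift.codomain_eq p g φ

theorem isHomLift_id_of_map_eq {x y : 𝓔} {φ : x ⟶ y} {c : C} (hx : p.obj x = c)
    (h : p.obj x = p.obj y) (e : p.map φ = eqToHom h) : p.IsHomLift (𝟙 c) φ := by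
  subst hx
  refine IsHomLift.of_fac' p _ _ rfl h.symm ?_
  rw [e, eqToHom_refl, Category.id_comp, Category.id_comp]

theorem isHomLift_of_comp {a b : C} {g : a ⟶ b} {x y z : 𝓔} {φ : x ⟶ y} {ψ : y ⟶ z}
    (h : p.IsHomLift (𝟙 a) φ) (h' : p.IsHomLift g (φ ≫ ψ)) : p.IsHomLift g ψ := by
  obtain rfl := IsHomLift.codomain_eq p (𝟙 a) φ
  obtain rfl := IsHomLift.codomain_eq p g (φ ≫ ψ)
  have e := IsHomLift.fac' p (𝟙 (p.obj y)) φ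
  have e' := IsHomLift.fac p g (φ ≫ ψ)
  rw [p.map_comp, e] at e'
  refine IsHomLift.of_fac p _ _ rfl rfl (e'.trans ?_)
  simp

theorem isCartesian_map {a b : C} {g : a ⟶ b} {x y : 𝓔} {φ : x ⟶ y} (h : p.IsCartesian g φ) :
    p.IsCartesian (p.map φ) φ := by
  obtain rfl := IsHomLift.domain_eq p g φ
  obtain rfl := IsHomLift.codomain_eq p g φ
  obtain rfl := IsHomLift.eq_of_isHomLift p g φ
  exact h

theorem isCocartesian_map {a b : C} {g : a ⟶ b} {x y : 𝓔} {φ : x ⟶ y} (h : p.IsCocartesian g φ) :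
    p.IsCocartesian (p.map φ) φ := by
  obtain rfl := IsHomLift.domain_eq p g φ
  obtain rfl := IsHomLift.codomain_eq p g φ
  obtain rfl := IsHomLift.eq_of_isHomLift p g φ
  exact h

theorem isCartesian_of_map {a b : C} {g : a ⟶ b} {x y : 𝓔} {φ : x ⟶ y}
    (h : p.IsCartesian (p.map φ) φ) (h' : p.IsHomLift g φ) : p.IsCartesian g φ := by
  obtain rfl := IsHomLift.domain_eq p g φ
  obtain rfl := IsHomLift.codomain_eq p g φ
  obtain rfl := IsHomLift.eq_of_isHomLift p g φ
  exact h

variable [IsOpfibration p] {x z : Transpose p}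

/-- A morphism `x ⟶ z` of the transpose fibration over an identity, viewed as a morphism of `𝓔`. -/
noncomputable def TransposeHom.vert (φ : TransposeHom p x z) (h : p.IsHomLift φ.base (𝟙 z.of)) :
    x.of ⟶ z.of :=
  φ.act (𝟙 _) (Category.comp_id _).symm h

theorem TransposeHom.vert_over (φ : TransposeHom p x z) (h : p.IsHomLift φ.base (𝟙 z.of)) :
    p.IsHomLift (𝟙 (p.obj x.of)) (φ.vert h) :=
  φ.act_isHomLift _ _ _

theorem TransposeHom.act_eq_vert_comp (φ : TransposeHom p x z) (h : p.IsHomLift φ.base (𝟙 z.of))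
    {c : C} (g : p.obj x.of ⟶ c) {f : p.obj z.of ⟶ c} (hf : f = φ.base ≫ g) {e : 𝓔} {b : z.of ⟶ e}
    (hb : p.IsHomLift f b) : φ.act g hf hb = φ.vert h ≫ b :=
  (φ.act_comp (𝟙 _) (Category.comp_id _).symm h
    (isHomLift_of_id_comp h (hf ▸ hb)) (Category.id_comp g).symm hf hb
    (Category.id_comp b).symm).symm

theorem TransposeHom.exists_vert (φ : TransposeHom p x z) (h : p.IsHomLift φ.base (𝟙 z.of)) :
    ∃ k : pushObj p φ.base ⟶ z.of, IsIso k ∧ p.IsHomLift (𝟙 (p.obj x.of)) k ∧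
      φ.vert h = φ.leg ≫ k := by
  have hc := pushMap_isCocartesian p φ.base
  have h1 := coMap_fac hc (Category.comp_id _).symm h
  have h2 := coMap_isHomLift hc (Category.comp_id _).symm h
  have h3 : p.IsHomLift (𝟙 (p.obj x.of)) (pushMap p φ.base) :=
    isHomLift_of_id_comp h ((Category.comp_id φ.base).symm ▸ hc.toIsHomLift)
  refine ⟨_, ⟨pushMap p φ.base, ?_, h1⟩, h2, rfl⟩
  have h4 : p.IsHomLift (𝟙 (p.obj x.of)) (coMap hc (Category.comp_id _).symm h ≫
    pushMap p φ.base) := isHomLift_comp_id h2 h3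
  have h5 : p.IsHomLift (𝟙 (p.obj x.of)) (𝟙 (pushObj p φ.base)) :=
    IsHomLift.id (IsHomLift.codomain_eq p φ.base (pushMap p φ.base))
  refine Functor.IsCocartesian.ext p φ.base (pushMap p φ.base) _ _ ?_
  rw [← Category.assoc, h1, Category.id_comp, Category.comp_id]

theorem base_lift_id {b : Cᵒᵖ} {φ : x ⟶ z} (h : (Transpose.proj p).IsHomLift (𝟙 b) φ) :
    p.IsHomLift (TransposeHom.base φ) (𝟙 z.of) := by
  have h1 := IsHomLift.domain_eq (Transpose.proj p) (𝟙 b) φ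
  have h2 := IsHomLift.codomain_eq (Transpose.proj p) (𝟙 b) φ
  have h3 : (TransposeHom.base φ).op = _ := IsHomLift.fac' (Transpose.proj p) (𝟙 b) φ
  have h4 : p.obj z.of = p.obj x.of := congrArg unop (h2.trans h1.symm)
  have h5 : TransposeHom.base φ = eqToHom h4 := by
    refine Quiver.Hom.op_inj (h3.trans ?_)
    rw [Category.id_comp, eqToHom_trans, eqToHom_op]
    rfl
  rw [h5]
  have key {c c' : C} (e : c' = c) {y : 𝓔} (hy : p.obj y = c') : p.IsHomLift (eqToHom e) (𝟙 y) := by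
    subst e
    exact IsHomLift.id hy
  exact key h4 rfl

theorem Transpose.cart_act_self {z y : Transpose p} {j : z.of ⟶ y.of}
    (hj : p.IsCocartesian (p.map j) j) {c : C} {g : p.obj y.of ⟶ c} {f : p.obj z.of ⟶ c}
    (hf : f = p.map j ≫ g) (hg : p.IsHomLift g (𝟙 y.of)) (hb : p.IsHomLift f j) :
    TransposeHom.act (Transpose.cart hj) g hf hb = 𝟙 _ :=
  (coMap_uniq hj hf hb _ (TransposeHom.act_isHomLift _ _ _ _)
    (Transpose.comp_cart_act hj _ _ _)).trans
  (coMap_uniq hj hf hb (𝟙 _) hg (Category.comp_id _)).symm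

/-- A commutative square in the transpose fibration with Cartesian and vertical sides is a
commutative square in `𝓔` with opCartesian and fibrewise sides. -/
theorem Transpose.cart_square {y y' v v' : Transpose p} {j : y.of ⟶ v.of} {j' : y'.of ⟶ v'.of}
    (hj : p.IsCocartesian (p.map j) j) (hj' : p.IsCocartesian (p.map j') j') {s : y ⟶ y'}
    {s' : v ⟶ v'} (e : s' ≫ Transpose.cart hj' = Transpose.cart hj ≫ s)
    (hs : p.IsHomLift (TransposeHom.base s) (𝟙 y'.of))
    (hs' : p.IsHomLift (TransposeHom.base s') (𝟙 v'.of)) :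
    TransposeHom.vert s hs ≫ j' = j ≫ TransposeHom.vert s' hs' := by
  have hb' : p.IsHomLift (p.map j' ≫ TransposeHom.base s') j' := by
    have h := isHomLift_comp (IsHomLift.map (p := p) j') hs'
    rwa [Category.comp_id] at h
  have hb : p.IsHomLift (TransposeHom.base (s' ≫ Transpose.cart hj') ≫ 𝟙 (p.obj v.of)) j' :=
    (Category.comp_id (p.map j' ≫ TransposeHom.base s')).symm ▸ hb'
  have hg : p.IsHomLift (TransposeHom.base s' ≫ 𝟙 (p.obj v.of)) (𝟙 v'.of) :=
    (Category.comp_id (TransposeHom.base s')).symm ▸ hs'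
  have hc : TransposeHom.base (Transpose.cart hj ≫ s) =
      TransposeHom.base (s' ≫ Transpose.cart hj') := congrArg TransposeHom.base e.symm
  have h1 : TransposeHom.act (s' ≫ Transpose.cart hj') (𝟙 _) rfl hb =
      TransposeHom.vert s' hs' := by
    refine (TransposeHom.comp_act s' (Transpose.cart hj') (𝟙 _) rfl hb).trans ?_
    exact s'.act_congr rfl _ _ _ _ (Transpose.cart_act_self hj' _ hg _)
  have h2 : TransposeHom.act (Transpose.cart hj ≫ s) (𝟙 _) (congrArg (· ≫ _) hc.symm) hb =
      TransposeHom.vert s' hs' := by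
    have key {a c : Transpose p} {φ ψ : a ⟶ c} (e : φ = ψ) {f : p.obj c.of ⟶ p.obj a.of} {d : 𝓔}
        {b : c.of ⟶ d} (hb : p.IsHomLift f b) (h : f = TransposeHom.base φ ≫ 𝟙 _)
        (h' : f = TransposeHom.base ψ ≫ 𝟙 _) :
        TransposeHom.act φ (𝟙 _) h hb = TransposeHom.act ψ (𝟙 _) h' hb := by
      subst e
      rfl
    exact (key e.symm hb _ _).trans h1
  refine Eq.trans ?_ (congrArg (j ≫ ·) h2)
  refine Eq.trans ?_ (congrArg (j ≫ ·)
    (TransposeHom.comp_act (Transpose.cart hj) s (𝟙 _) (congrArg (· ≫ _) hc.symm) hb)).symm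
  have hf : TransposeHom.base (s' ≫ Transpose.cart hj') ≫ 𝟙 (p.obj v.of) =
      TransposeHom.base s ≫ p.map j ≫ 𝟙 _ :=
    (congrArg (· ≫ _) hc.symm).trans (Category.assoc _ _ _)
  exact (TransposeHom.act_eq_vert_comp s hs (p.map j ≫ 𝟙 _) hf hb).symm.trans
    (Transpose.comp_cart_act hj (𝟙 _) rfl (TransposeHom.act_isHomLift s _ hf hb)).symm

end Vertical

section WeaklyCartesian

variable {C : Type w} [Category.{w} C] {𝓔 : Type u} [Category.{v} 𝓔] {p : 𝓔 ⥤ C} [IsOpfibration p]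

namespace HomotopicalDeltaOpfibration

variable (H : HomotopicalDeltaOpfibration p)

/-- For morphisms over an identity, the class `transposeW` is the class of weak equivalences
of `𝓔`. -/
theorem transposeW_iff {x z : Transpose p} (φ : x ⟶ z)
    (h : p.IsHomLift (TransposeHom.base φ) (𝟙 z.of)) :
    transposeW p H.W φ ↔ H.W (TransposeHom.vert φ h) := by
  obtain ⟨k, hk, hk', e⟩ := TransposeHom.exists_vert φ h
  have := H.two_out_of_three
  have hkW : H.W k :=
    H.isos k hk (isHomLift_of_eq (IsHomLift.domain_eq p (𝟙 (p.obj x.of)) k).symm hk')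
  constructor
  · rintro ⟨-, -, hW⟩
    rw [e]
    exact H.W.comp_mem _ _ hW hkW
  · intro hW
    refine ⟨IsHomLift.codomain_eq p (TransposeHom.base φ) (𝟙 z.of), ?_,
      H.W.of_postcomp _ _ hkW (e ▸ hW)⟩
    refine (IsHomLift.fac p (TransposeHom.base φ) (𝟙 z.of)).trans ?_
    rw [p.map_id, Category.id_comp, eqToHom_trans]

variable {b b' b'' : Cᵒᵖ}

theorem fiberW_iff {x y : (Transpose.proj p).Fiber b} (f : x ⟶ y) :
    fiberW p H.W b f ↔ H.W (TransposeHom.vert (fval f) (base_lift_id (fval_over f))) :=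
  H.transposeW_iff _ _

end HomotopicalDeltaOpfibration

theorem Transpose.cart_over {c c' : C} {g : c ⟶ c'} {z y : Transpose p} {j : z.of ⟶ y.of}
    (hj : p.IsCocartesian g j) :
    (Transpose.proj p).IsHomLift g.op (Transpose.cart (isCocartesian_map hj)) := by
  obtain rfl := IsHomLift.domain_eq p g j
  obtain rfl := IsHomLift.codomain_eq p g j
  obtain rfl := IsHomLift.eq_of_isHomLift p g j
  exact IsHomLift.map (p := Transpose.proj p) (Transpose.cart (isCocartesian_map hj))

variable {b b' b'' : Cᵒᵖ}

theorem Transpose.exists_cart (g : b ⟶ b') (y : (Transpose.proj p).Fiber b') :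
    ∃ (u : (Transpose.proj p).Fiber b) (j : (fobj y).of ⟶ (fobj u).of)
      (hj : p.IsCocartesian g.unop j),
      (Transpose.proj p).IsCartesian g (Transpose.cart (isCocartesian_map hj)) := by
  obtain ⟨y, rfl⟩ := y
  have hj := pushMap_isCocartesian p (x := y.of) g.unop
  refine ⟨⟨⟨pushObj p g.unop⟩, congrArg op (isHomLift_codomain hj.toIsHomLift)⟩,
    pushMap p g.unop, hj, ?_⟩
  have h := Transpose.cart_isStronglyCartesian
    (z := y) (y := ⟨pushObj p g.unop⟩) (isCocartesian_map hj)
  exact isCartesian_of_map (p := Transpose.proj p)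
    (isCartesian_map (@Functor.IsStronglyCartesian.isCartesian_of_isStronglyCartesian _ _ _ _
      (Transpose.proj p) _ _ _ _ _ _ h)) (Transpose.cart_over hj)

section

variable {𝓕 : Type u₁} [Category.{v₁} 𝓕] {B : Type u₂} [Category.{v₂} B] {q : 𝓕 ⥤ B} {a a' : B}
  {g : a ⟶ a'}

/-- Cartesian morphisms with the same codomain and the same image differ by an isomorphism of the
fibre. -/
theorem exists_cartesian_iso {u u' : q.Fiber a} {y : 𝓕} {κ : fobj u ⟶ y} {κ' : fobj u' ⟶ y}
    (h : q.IsCartesian g κ) (h' : q.IsCartesian g κ') :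
    ∃ i : u ≅ u', fval i.hom ≫ κ' = κ := by
  let i : u ⟶ u' := fmk (Functor.IsCartesian.map q g κ' κ) inferInstance
  let j : u' ⟶ u := fmk (Functor.IsCartesian.map q g κ κ') inferInstance
  have hi : fval i ≫ κ' = κ := Functor.IsCartesian.fac q g κ' κ
  have hj : fval j ≫ κ = κ' := Functor.IsCartesian.fac q g κ κ'
  refine ⟨⟨i, j, fval_ext ?_, fval_ext ?_⟩, hi⟩
  · have h1 := fval_over (i ≫ j)
    have h2 := fval_over (𝟙 u)
    refine Functor.IsCartesian.ext q g κ _ _ ?_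
    rw [fval_comp, Category.assoc, hj, hi]
    exact (Category.id_comp κ).symm
  · have h1 := fval_over (j ≫ i)
    have h2 := fval_over (𝟙 u')
    refine Functor.IsCartesian.ext q g κ' _ _ ?_
    rw [fval_comp, Category.assoc, hi, hj]
    exact (Category.id_comp κ').symm

variable [q.IsFibered]

/-- The morphism to the pullback of its codomain induced by a morphism of a fibration. -/
noncomputable def toPullFib {x : q.Fiber a} {y : q.Fiber a'} {f : fobj x ⟶ fobj y}
    (hf : q.IsHomLift g f) : x ⟶ pull g y :=
  fmk (toPull (𝟙 a) g (Category.id_comp g).symm hf) (toPull_over _ hf)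

theorem toPullFib_fac {x : q.Fiber a} {y : q.Fiber a'} {f : fobj x ⟶ fobj y}
    (hf : q.IsHomLift g f) : fval (toPullFib hf) ≫ pullπ g y = f :=
  toPull_fac (Category.id_comp g).symm hf

/-- The functoriality of pullbacks. -/
noncomputable def pullFib (g : a ⟶ a') {y y' : q.Fiber a'} (s : y ⟶ y') : pull g y ⟶ pull g y' :=
  toPullFib (isHomLift_comp_id (pullπ_over g y) (fval_over s))

theorem pullFib_fac (g : a ⟶ a') {y y' : q.Fiber a'} (s : y ⟶ y') :
    fval (pullFib g s) ≫ pullπ g y' = pullπ g y ≫ fval s :=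
  toPullFib_fac _

end

namespace HomotopicalDeltaOpfibration

variable (H : HomotopicalDeltaOpfibration p)

/-- The class of weak equivalences is stable under pullbacks, as it is stable under the transition
functors. -/
theorem fiberW_of_cartesian {g : b ⟶ b'} {u u' : (Transpose.proj p).Fiber b}
    {y y' : (Transpose.proj p).Fiber b'} {κ : fobj u ⟶ fobj y} {κ' : fobj u' ⟶ fobj y'}
    (hκ : (Transpose.proj p).IsCartesian g κ) (hκ' : (Transpose.proj p).IsCartesian g κ')
    {s : y ⟶ y'} {s' : u ⟶ u'} (e : fval s' ≫ κ' = κ ≫ fval s) (hs : fiberW p H.W b' s) :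
    fiberW p H.W b s' := by
  obtain ⟨v, j, hj, hc⟩ := Transpose.exists_cart g y
  obtain ⟨v', j', hj', hc'⟩ := Transpose.exists_cart g y'
  obtain ⟨i, hi⟩ := exists_cartesian_iso hc hκ
  obtain ⟨i', hi'⟩ := exists_cartesian_iso hκ' hc'
  have hs' : fiberW p H.W b (i.hom ≫ s' ≫ i'.hom) := by
    rw [fiberW_iff] at hs ⊢
    refine H.push hj hj' ?_ (Transpose.cart_square (isCocartesian_map hj) (isCocartesian_map hj')
      ?_ _ _) hs
    · have h := TransposeHom.vert_over (fval (i.hom ≫ s' ≫ i'.hom))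
        (base_lift_id (fval_over (i.hom ≫ s' ≫ i'.hom)))
      exact isHomLift_of_eq (congrArg unop (fobj_over v)) h
    · refine (congrArg (· ≫ _) ((fval_comp _ _).trans (congrArg (_ ≫ ·) (fval_comp _ _)))).trans ?_
      refine (Category.assoc _ _ _).trans ?_
      refine (congrArg (_ ≫ ·) ((Category.assoc _ _ _).trans (congrArg (_ ≫ ·) hi'))).trans ?_
      refine (congrArg (_ ≫ ·) e).trans ?_
      refine (Category.assoc _ _ _).symm.trans ?_
      exact congrArg (· ≫ _) hi
  have h := H.homotopical b
  exact h.of_comp_right (h.of_iso i') (h.of_comp_left (h.of_iso i) hs')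

/-- Whether a morphism is weakly Cartesian can be tested on its factorization through any Cartesian
morphism. -/
theorem isWeaklyCartesian_iff {g : b ⟶ b'} {x u : (Transpose.proj p).Fiber b}
    {y : (Transpose.proj p).Fiber b'} {κ : fobj u ⟶ fobj y} {f : fobj x ⟶ fobj y}
    (hκ : (Transpose.proj p).IsCartesian g κ) (j : x ⟶ u) (e : fval j ≫ κ = f) :
    H.IsWeaklyCartesian f ↔ fiberW p H.W b j := by
  constructor
  · rintro ⟨y₁, j₁, κ₁, hj₁, hκ₁, e₁⟩
    have hf : (Transpose.proj p).IsHomLift g f := by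
      rw [← e]
      exact isHomLift_id_comp (fval_over j) hκ.toIsHomLift
    obtain ⟨h, hb, -⟩ := id hj₁
    have h1 : (Transpose.proj p).IsHomLift (𝟙 b) j₁ :=
      isHomLift_id_of_map_eq (fobj_over x) (congrArg op h.symm)
        ((congrArg Quiver.Hom.op hb).trans (eqToHom_op _))
    have h2 : (Transpose.proj p).IsHomLift g κ₁ := isHomLift_of_comp h1 (e₁.symm ▸ hf)
    let u₁ : (Transpose.proj p).Fiber b := ⟨y₁, isHomLift_codomain h1⟩
    have hκ' : (Transpose.proj p).IsCartesian g κ₁ := isCartesian_of_map hκ₁ h2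
    obtain ⟨i, hi⟩ := exists_cartesian_iso (u := u₁) (u' := u) hκ' hκ
    have hj : j = (fmk j₁ h1 : x ⟶ u₁) ≫ i.hom := by
      have h3 := fval_over j
      have h4 := fval_over ((fmk j₁ h1 : x ⟶ u₁) ≫ i.hom)
      refine fval_ext (Functor.IsCartesian.ext (Transpose.proj p) g κ _ _ ?_)
      refine e.trans (e₁.symm.trans ?_)
      exact Eq.symm ((Category.assoc _ _ _).trans (congrArg (j₁ ≫ ·) hi))
    have hm := H.homotopical b
    rw [hj]
    exact hm.comp hj₁ (hm.of_iso i)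
  · intro hj
    exact ⟨_, _, _, hj, isCartesian_map hκ, e⟩

theorem isWeaklyCartesian_iff_toPullFib {g : b ⟶ b'} {x : (Transpose.proj p).Fiber b}
    {y : (Transpose.proj p).Fiber b'} {f : fobj x ⟶ fobj y}
    (hf : (Transpose.proj p).IsHomLift g f) :
    H.IsWeaklyCartesian f ↔ fiberW p H.W b (toPullFib hf) :=
  H.isWeaklyCartesian_iff (pullπ_isCartesian g y) _ (toPullFib_fac hf)

theorem isWeaklyCartesian_fval_iff {x y : (Transpose.proj p).Fiber b} (f : x ⟶ y) :
    H.IsWeaklyCartesian (fval f) ↔ fiberW p H.W b f := by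
  have h : (Transpose.proj p).IsHomLift (𝟙 b) (𝟙 (fobj y)) := IsHomLift.id (fobj_over y)
  exact H.isWeaklyCartesian_iff (u := y) (κ := 𝟙 (fobj y)) (g := 𝟙 b) inferInstance f
    (Category.comp_id _)

theorem isWeaklyCartesian_of_isCartesian {g : b ⟶ b'} {x : (Transpose.proj p).Fiber b}
    {y : (Transpose.proj p).Fiber b'} {f : fobj x ⟶ fobj y}
    (hf : (Transpose.proj p).IsCartesian g f) : H.IsWeaklyCartesian f :=
  (H.isWeaklyCartesian_iff hf (𝟙 x) (Category.id_comp f)).mpr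
    ((H.homotopical b).of_iso (Iso.refl x))

/-- For composable morphisms of which the second one is weakly Cartesian, the first one is weakly
Cartesian if and only if the composite is. -/
theorem isWeaklyCartesian_comp_iff {g : b ⟶ b'} {g' : b' ⟶ b''} {x : (Transpose.proj p).Fiber b}
    {y : (Transpose.proj p).Fiber b'} {z : (Transpose.proj p).Fiber b''} {f : fobj x ⟶ fobj y}
    {f' : fobj y ⟶ fobj z} (hf : (Transpose.proj p).IsHomLift g f)
    (hf' : (Transpose.proj p).IsHomLift g' f') (hW : H.IsWeaklyCartesian f') :
    H.IsWeaklyCartesian (f ≫ f') ↔ H.IsWeaklyCartesian f := by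
  rw [H.isWeaklyCartesian_iff_toPullFib hf'] at hW
  have hW' : fiberW p H.W b (pullFib g (toPullFib hf')) :=
    H.fiberW_of_cartesian (pullπ_isCartesian g y) (pullπ_isCartesian g (pull g' z))
      (pullFib_fac g _) hW
  have h1 := pullπ_isStronglyCartesian g (pull g' z)
  have h2 := pullπ_isStronglyCartesian g' z
  have h : (Transpose.proj p).IsCartesian (g ≫ g') (pullπ g (pull g' z) ≫ pullπ g' z) :=
    inferInstance
  rw [H.isWeaklyCartesian_iff h (toPullFib hf ≫ pullFib g (toPullFib hf')) ?_,
    H.isWeaklyCartesian_iff_toPullFib hf]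
  · exact ⟨fun h => (H.homotopical b).of_comp_right hW' h, fun h => (H.homotopical b).comp h hW'⟩
  · refine (Category.assoc (fval (toPullFib hf)) _ _).trans ?_
    refine (congrArg (_ ≫ ·) ((Category.assoc _ _ _).symm.trans
      (congrArg (· ≫ _) (pullFib_fac g (toPullFib hf'))))).trans ?_
    refine (congrArg (_ ≫ ·) ((Category.assoc _ _ _).trans
      (congrArg (_ ≫ ·) (toPullFib_fac hf')))).trans ?_
    refine (Category.assoc _ _ _).symm.trans ?_
    exact congrArg (· ≫ f') (toPullFib_fac hf)

theorem isWeaklyCartesian_fval_comp_iff {g : b ⟶ b'} {x y : (Transpose.proj p).Fiber b}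
    {z : (Transpose.proj p).Fiber b'} {f : x ⟶ y} {f' : fobj y ⟶ fobj z}
    (hf' : (Transpose.proj p).IsHomLift g f') (hW : fiberW p H.W b f) :
    H.IsWeaklyCartesian (fval f ≫ f') ↔ H.IsWeaklyCartesian f' := by
  rw [H.isWeaklyCartesian_iff (pullπ_isCartesian g z) (f ≫ toPullFib hf') ?_,
    H.isWeaklyCartesian_iff_toPullFib hf']
  · exact ⟨fun h => (H.homotopical b).of_comp_left hW h, fun h => (H.homotopical b).comp hW h⟩
  · exact (Category.assoc (fval f) _ _).trans (congrArg (_ ≫ ·) (toPullFib_fac hf'))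

theorem isWeaklyCartesian_pullMap {a a' : Cᵒᵖ} {g : b ⟶ a} {g' : b' ⟶ a'} {u : b ⟶ b'} {k : a ⟶ a'}
    (e : g ≫ k = u ≫ g') {y : (Transpose.proj p).Fiber a} {y' : (Transpose.proj p).Fiber a'}
    {s : fobj y ⟶ fobj y'} (hs : (Transpose.proj p).IsHomLift k s) (hW : H.IsWeaklyCartesian s) :
    H.IsWeaklyCartesian (pullMap e hs) := by
  rw [← H.isWeaklyCartesian_comp_iff (pullMap_over e hs) (pullπ_over g' y')
    (H.isWeaklyCartesian_of_isCartesian (pullπ_isCartesian g' y')), pullMap_fac,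
    H.isWeaklyCartesian_comp_iff (pullπ_over g y) hs hW]
  exact H.isWeaklyCartesian_of_isCartesian (pullπ_isCartesian g y)

end HomotopicalDeltaOpfibration

end WeaklyCartesian

/-! ### The fibres of the derived pushforward -/

section BarPoint

variable {C D : Type w} [Category.{w} C] [Category.{w} D] {𝓔 : Type u} [Category.{v} 𝓔]
  {p : 𝓔 ⥤ C} [IsOpfibration p] (H : HomotopicalDeltaOpfibration p) {F : D ⥤ C}

namespace HomotopicalDeltaOpfibration

theorem isWeaklyCartesian_of_transposeW {x z : Transpose p} {φ : x ⟶ z}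
    (h : transposeW p H.W φ) : H.IsWeaklyCartesian φ := by
  have h' : (Transpose.proj p).IsHomLift (𝟙 ((Transpose.proj p).obj z)) (𝟙 z) := IsHomLift.id rfl
  exact ⟨z, φ, 𝟙 z, h, isCartesian_map (g := 𝟙 ((Transpose.proj p).obj z)) inferInstance,
    Category.comp_id φ⟩

variable [IsOpfibration F]

/-- Speciality, with the string in `D` replaced by an object of a fibre `D(c)` and a morphism
`c ⟶ c'`: an opCartesian lift of the latter is a string of length one. -/
theorem toRealizationOf_W (hs : H.IsSpecial F) {c c' : C} (f : c ⟶ c') (d : F.Fiber c)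
    (X : Simp (F.Fiber c) ⥤ (Transpose.proj p).Fiber (op c'))
    (hX : ∀ ⦃y z⦄ (f : y ⟶ z), fiberW p H.W _ (X.map f)) :
    fiberW p H.W _ (H.toRealizationOf X (ComposableArrows.mk₀ d)) := by
  obtain ⟨d, rfl⟩ := d
  obtain ⟨d', φ, hφ⟩ := IsOpfibration.exists_isCocartesian (p := F) f
  obtain rfl := IsHomLift.codomain_eq F f φ
  exact hs (elt (nerve D) (op ⦋1⦌) (ComposableArrows.mk₁ φ)) X hX

variable [∀ b, HasCoproducts.{w} ((Transpose.proj p).Fiber b)]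
  [∀ b, HasColimitsOfSize.{0, 0} ((Transpose.proj p).Fiber b)]

/-- The diagram of the bar construction sends a morphism to a weak equivalence if the section sends
it to a weakly Cartesian morphism. -/
theorem fiberW_barDiagram_map {S : PSectOver F p} {x : Simp C}
    {e e' : (idx (tailOver F) (headObj x)).Elements} (f : e ⟶ e')
    (h : H.IsWeaklyCartesian (S.mor (idxPtMap f))) :
    fiberW p H.W _ ((barDiagram S x).map f) :=
  (H.isWeaklyCartesian_fval_iff _).mp
    (H.isWeaklyCartesian_pullMap (barDiagram_aux x f) (S.mor_over (idxPtMap f)) h)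

/-- For a locally constant derived section `S`, the value of the derived pushforward of `S` is
computed by the value of `S` at any object of the fibre. -/
theorem bar_point_W (hs : H.IsSpecial F) {S : PSectOver F p} (hS : H.IsDerivedLocallyConstant F S)
    (x : Simp C) (d : F.Fiber (headObj x)) :
    fiberW p H.W _ (elι (barDiagram S x) (op ⦋0⦌)
      ((fibreIncl F (headObj x)).app _ (ComposableArrows.mk₀ d)) ≫
        (H.delta.fiber _).to0 (elSum (barDiagram S x))) := by
  refine (H.homotopical _).real_point (ι := fibreIncl F (headObj x)) (fun n m s => ?_)
    (fun n => ⟨fibreInsertion F _ n⟩) (ComposableArrows.mk₀ d) ?_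
  -- Restrictions of strings to their first parts are anchor maps.
  · exact H.fiberW_barDiagram_map _ (hS.1 _ fun i => rfl)
  · refine H.toRealizationOf_W hs (total x) d (resEl (fibreIncl F (headObj x)) (barDiagram S x))
      fun y z f => ?_
    exact H.fiberW_barDiagram_map _ (H.isWeaklyCartesian_of_transposeW (hS.2 (headObj x) f))

end HomotopicalDeltaOpfibration

end BarPoint

/-! ### Spans of strings -/

section Spans

variable {C : Type w} [Category.{w} C]

theorem lastMap_of_last {x y : Simp C} (f : x ⟶ y) (h : ordMap f (Fin.last _) = Fin.last _)
    (e : lastObj y = lastObj x) : lastMap f = eqToHom e := by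
  have key {n : ℕ} (σ : ComposableArrows C n) {c : C} {i : Fin (n + 1)} (hi : i = Fin.last n)
      (e : c = σ.obj i) (e' : c = σ.obj (Fin.last n)) :
      eqToHom e ≫ σ.map (homOfLE (Fin.le_last i)) = eqToHom e' := by
    subst hi e
    exact (Category.id_comp _).trans (σ.map_id _)
  exact key _ h _ _

theorem lastObj_of_last {x y : Simp C} (f : x ⟶ y) (h : ordMap f (Fin.last _) = Fin.last _) :
    lastObj y = lastObj x :=
  (arrows_obj f (Fin.last _)).trans (congrArg (arrows x).obj h)

variable {s a x s' a' x' : Simp C}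

/-- For a string `s` and two substrings `a` and `x`, the second one to the right of the first one,
the morphism of `s` from the end of `a` to the beginning of `x`. -/
def connMap (l : s ⟶ a) (r : s ⟶ x) (h : ordMap l (Fin.last _) ≤ ordMap r 0) :
    lastObj a ⟶ headObj x :=
  eqToHom (arrows_obj l (Fin.last _)) ≫ (arrows s).map (homOfLE h) ≫
    eqToHom (arrows_obj r 0).symm

theorem lastMap_eq_connMap (l : s ⟶ a) (r : s ⟶ x) (h : ordMap l (Fin.last _) ≤ ordMap r 0) :
    lastMap l = connMap l r h ≫ total x ≫ lastMap r := by
  unfold connMap lastMap total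
  rw [arrows_map r]
  simp only [Category.assoc, eqToHom_trans_assoc, eqToHom_refl, Category.id_comp]
  rw [arrows_comp, arrows_comp]

theorem connMap_naturality {l : s ⟶ a} {r : s ⟶ x} {l' : s' ⟶ a'} {r' : s' ⟶ x'} (f : s ⟶ s')
    {u : a ⟶ a'} {ζ : x ⟶ x'} (hl : f ≫ l' = l ≫ u) (hr : f ≫ r' = r ≫ ζ)
    (h : ordMap l (Fin.last _) ≤ ordMap r 0) (h' : ordMap l' (Fin.last _) ≤ ordMap r' 0) :
    connMap l' r' h' = lastMap u ≫ connMap l r h ≫ headMap ζ := by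
  have key {n : ℕ} (σ : ComposableArrows C n) {i i' j j' : Fin (n + 1)} (hi : i = i') (hj : j = j')
      (hij : i ≤ j) (hij' : i' ≤ j') {c d : C} (e : c = σ.obj i) (e' : c = σ.obj i')
      (e₁ : σ.obj j = d) (e₁' : σ.obj j' = d) :
      eqToHom e ≫ σ.map (homOfLE hij) ≫ eqToHom e₁ =
        eqToHom e' ≫ σ.map (homOfLE hij') ≫ eqToHom e₁' := by
    subst hi hj
    rfl
  unfold connMap lastMap headMap
  rw [arrows_map f, arrows_map l, arrows_map r]
  simp only [Category.assoc, eqToHom_trans_assoc, eqToHom_trans, eqToHom_refl, Category.id_comp]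
  refine Eq.trans ?_ (congrArg (eqToHom _ ≫ ·) (Category.assoc _ _ _))
  rw [arrows_comp, ← Category.assoc ((arrows s).map _), arrows_comp]
  refine key _ ?_ ?_ _ _ _ _ _ _
  · exact congrArg (fun t => ordMap t (Fin.last _)) hl
  · exact congrArg (fun t => ordMap t 0) hr

end Spans

/-! ### Sections given by joins of strings -/

section JoinIdx

variable {C D : Type w} [Category.{w} C] [Category.{w} D] (G : D ⥤ C)

/-- The set of strings of dimension `[n] ⋆ [m]` which consist of the image of a string
`d₀ ⟶ ⋯ ⟶ dₙ` of `D` and the given string `x` of length `m`. -/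
def JoinIdx (x : Simp C) (n : SimplexCategoryᵒᵖ) : Type w :=
  { s : (nerve D).obj n × (nerve C).obj (op (jn n.unop x.1.unop)) //
    (nerve C).map (jl n.unop x.1.unop).op s.2 = (nerveMap G).app n s.1 ∧
      (nerve C).map (jr n.unop x.1.unop).op s.2 = x.2 }

variable {G} {x y z : Simp C} {n m k : SimplexCategoryᵒᵖ}

/-- The functoriality of `JoinIdx`. -/
def joinIdxMap (θ : n ⟶ m) (ζ : x ⟶ y) (s : JoinIdx G x n) : JoinIdx G y m :=
  ⟨((nerve D).map θ s.1.1, (nerve C).map (jmap θ.unop ζ.1.unop).op s.1.2), by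
    have h1 (f : m.unop ⟶ jn n.unop x.1.unop) (hf : jl _ _ ≫ jmap θ.unop ζ.1.unop = f) :
        (nerve C).map (jl m.unop y.1.unop).op ((nerve C).map (jmap θ.unop ζ.1.unop).op s.1.2) =
          (nerve C).map f.op s.1.2 := by
      rw [← hf, op_comp, Functor.map_comp]
      rfl
    refine (h1 _ (jl_map _ _)).trans ?_
    rw [op_comp, Functor.map_comp]
    refine (congrArg ((nerve C).map θ) s.2.1).trans ?_
    exact (NatTrans.naturality_apply (nerveMap G) θ s.1.1).symm, by
    have h1 (f : y.1.unop ⟶ jn n.unop x.1.unop) (hf : jr _ _ ≫ jmap θ.unop ζ.1.unop = f) :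
        (nerve C).map (jr m.unop y.1.unop).op ((nerve C).map (jmap θ.unop ζ.1.unop).op s.1.2) =
          (nerve C).map f.op s.1.2 := by
      rw [← hf, op_comp, Functor.map_comp]
      rfl
    refine (h1 _ (jr_map _ _)).trans ?_
    rw [op_comp, Functor.map_comp]
    exact (congrArg ((nerve C).map ζ.1) s.2.2).trans ζ.2⟩

theorem joinIdx_ext {s t : JoinIdx G x n} (h : s.1.1 = t.1.1) (h' : s.1.2 = t.1.2) : s = t :=
  Subtype.ext (Prod.ext h h')

theorem joinIdxMap_id (s : JoinIdx G x n) : joinIdxMap (𝟙 n) (𝟙 x) s = s := by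
  refine joinIdx_ext ?_ ?_
  · exact congrArg (fun t => t s.1.1) ((nerve D).map_id n)
  · refine (congrArg (fun t => (nerve C).map (Quiver.Hom.op t) s.1.2) (jmap_id _ _)).trans ?_
    exact congrArg (fun t => t s.1.2) ((nerve C).map_id _)

theorem joinIdxMap_comp (θ : n ⟶ m) (θ' : m ⟶ k) (ζ : x ⟶ y) (ζ' : y ⟶ z) (s : JoinIdx G x n) :
    joinIdxMap (θ ≫ θ') (ζ ≫ ζ') s = joinIdxMap θ' ζ' (joinIdxMap θ ζ s) := by
  refine joinIdx_ext ?_ ?_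
  · exact congrArg (fun t => t s.1.1) ((nerve D).map_comp θ θ')
  · refine (congrArg (fun t => (nerve C).map (Quiver.Hom.op t) s.1.2)
      (jmap_comp θ'.unop ζ'.1.unop θ.unop ζ.1.unop)).trans ?_
    exact congrArg (fun t => t s.1.2)
      ((nerve C).map_comp (jmap θ.unop ζ.1.unop).op (jmap θ'.unop ζ'.1.unop).op)

variable (G x) in
/-- The simplicial set of the strings in `JoinIdx G x`. -/
def joinIdx : SSet.{w} where
  obj n := JoinIdx G x n
  map θ := ↾fun s => joinIdxMap θ (𝟙 x) s
  map_id n := ConcreteCategory.hom_ext _ _ fun s => joinIdxMap_id s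
  map_comp θ θ' := ConcreteCategory.hom_ext _ _ fun s =>
    (congrArg (fun t => joinIdxMap (θ ≫ θ') t s) (Category.comp_id (𝟙 x)).symm).trans
      (joinIdxMap_comp θ θ' (𝟙 x) (𝟙 x) s)

/-- The string of an element of `JoinIdx`. -/
def joinStr (s : JoinIdx G x n) : Simp C := elt (nerve C) (op (jn n.unop x.1.unop)) s.1.2

/-- The restriction of a string of dimension `[n] ⋆ [m]` to `[m]`. -/
def joinR (s : JoinIdx G x n) : joinStr s ⟶ x :=
  CategoryOfElements.homMk (joinStr s) x (jr n.unop x.1.unop).op s.2.2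

/-- The restriction of a string of dimension `[n] ⋆ [m]` to `[n]`. -/
def joinL (s : JoinIdx G x n) : joinStr s ⟶ (simpMap G).obj (elt (nerve D) n s.1.1) :=
  CategoryOfElements.homMk (joinStr s) ((simpMap G).obj (elt (nerve D) n s.1.1))
    (jl n.unop x.1.unop).op s.2.1

theorem joinR_last (s : JoinIdx G x n) : ordMap (joinR s) (Fin.last _) = Fin.last _ :=
  jr_last _ _

theorem joinL_le_joinR (s : JoinIdx G x n) :
    ordMap (joinL s) (Fin.last _) ≤ ordMap (joinR s) 0 :=
  jl_le_jr _ _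

/-- The morphism of strings underlying the functoriality of `JoinIdx`. -/
def joinHom (θ : n ⟶ m) (ζ : x ⟶ y) {s : JoinIdx G x n} {t : JoinIdx G y m}
    (h : joinIdxMap θ ζ s = t) : joinStr s ⟶ joinStr t :=
  CategoryOfElements.homMk (joinStr s) (joinStr t) (jmap θ.unop ζ.1.unop).op
    (congrArg (fun r => r.1.2) h)

section

variable {θ : n ⟶ m} {ζ : x ⟶ y} {s : JoinIdx G x n} {t : JoinIdx G y m}
    (h : joinIdxMap θ ζ s = t)

theorem joinHom_r : joinHom θ ζ h ≫ joinR t = joinR s ≫ ζ :=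
  Subtype.ext (congrArg Quiver.Hom.op (jr_map θ.unop ζ.1.unop))

/-- The morphism between the strings of `D` of elements of `JoinIdx`. -/
def joinHomL : elt (nerve D) n s.1.1 ⟶ elt (nerve D) m t.1.1 :=
  CategoryOfElements.homMk (elt (nerve D) n s.1.1) (elt (nerve D) m t.1.1) θ
    (congrArg (fun r => r.1.1) h)

theorem joinHom_l : joinHom θ ζ h ≫ joinL t = joinL s ≫ (simpMap G).map (joinHomL h) :=
  Subtype.ext (congrArg Quiver.Hom.op (jl_map θ.unop ζ.1.unop))

end

theorem joinHom_id {s : JoinIdx G x n} (h : joinIdxMap (𝟙 n) (𝟙 x) s = s) :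
    joinHom (𝟙 n) (𝟙 x) h = 𝟙 _ :=
  Subtype.ext (congrArg Quiver.Hom.op (jmap_id _ _))

theorem joinHom_comp {θ : n ⟶ m} {θ' : m ⟶ k} {ζ : x ⟶ y} {ζ' : y ⟶ z} {s : JoinIdx G x n}
    {t : JoinIdx G y m} {r : JoinIdx G z k} (h : joinIdxMap θ ζ s = t)
    (h' : joinIdxMap θ' ζ' t = r) (h'' : joinIdxMap (θ ≫ θ') (ζ ≫ ζ') s = r) :
    joinHom (θ ≫ θ') (ζ ≫ ζ') h'' = joinHom θ ζ h ≫ joinHom θ' ζ' h' :=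
  Subtype.ext (congrArg Quiver.Hom.op (jmap_comp θ'.unop ζ'.1.unop θ.unop ζ.1.unop))

end JoinIdx

section JoinSect

variable {B C D : Type w} [Category.{w} B] [Category.{w} C] [Category.{w} D] {G : D ⥤ C}
  {E : C ⥤ B} {𝓕 : Type u₁} [Category.{v₁} 𝓕] {q : 𝓕 ⥤ Bᵒᵖ}

theorem tailOver_map_of_last {x y : Simp C} (f : x ⟶ y) (h : ordMap f (Fin.last _) = Fin.last _)
    (e : (tailOver E).obj x = (tailOver E).obj y) : (tailOver E).map f = eqToHom e := by
  have h1 := lastMap_of_last ((simpMap E).map f) h (congrArg unop e.symm)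
  refine (congrArg Quiver.Hom.op h1).trans ?_
  exact eqToHom_op _

/-- Passing to the ends of strings does not change the image in the base. -/
theorem isHomLift_of_last {s s' x x' : Simp C} {r : s ⟶ x} {r' : s' ⟶ x'}
    (hr : ordMap r (Fin.last _) = Fin.last _) (hr' : ordMap r' (Fin.last _) = Fin.last _)
    {f : s ⟶ s'} {ζ : x ⟶ x'} (e : f ≫ r' = r ≫ ζ) {a b : 𝓕} {φ : a ⟶ b}
    (hφ : q.IsHomLift ((tailOver E).map f) φ) : q.IsHomLift ((tailOver E).map ζ) φ := by
  have h : (tailOver E).obj s = (tailOver E).obj x :=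
    congrArg op (lastObj_of_last ((simpMap E).map r) hr).symm
  have h' : (tailOver E).obj s' = (tailOver E).obj x' :=
    congrArg op (lastObj_of_last ((simpMap E).map r') hr').symm
  have e' := congrArg (tailOver E).map e
  rw [(tailOver E).map_comp, (tailOver E).map_comp, tailOver_map_of_last r hr h,
    tailOver_map_of_last r' hr' h'] at e'
  have e'' : (tailOver E).map ζ = eqToHom h.symm ≫ (tailOver E).map f ≫ eqToHom h' := by
    rw [e', eqToHom_trans_assoc, eqToHom_refl, Category.id_comp]
  rw [e'']
  infer_instance

variable (A A' : Sect (tailOver E) q) {x y z : Simp C} {n m k : SimplexCategoryᵒᵖ}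

/-- The value of a section at a string with end `x`, as an object of the fibre over the last object
of `x`. -/
def joinVal (s : JoinIdx G x n) : q.Fiber ((tailOver E).obj x) :=
  ⟨A.toFunctor.obj (joinStr s), (A.proj_obj _).trans
    (congrArg op (lastObj_of_last ((simpMap E).map (joinR s)) (joinR_last s)).symm)⟩

/-- The morphisms between the values of a section given by the functoriality of `JoinIdx`. -/
def joinMor (θ : n ⟶ m) (ζ : x ⟶ y) {s : JoinIdx G x n} {t : JoinIdx G y m}
    (h : joinIdxMap θ ζ s = t) : fobj (joinVal A s) ⟶ fobj (joinVal A t) :=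
  A.mor (joinHom θ ζ h)

theorem joinMor_over (θ : n ⟶ m) (ζ : x ⟶ y) {s : JoinIdx G x n} {t : JoinIdx G y m}
    (h : joinIdxMap θ ζ s = t) : q.IsHomLift ((tailOver E).map ζ) (joinMor A θ ζ h) :=
  isHomLift_of_last (joinR_last s) (joinR_last t) (joinHom_r h) (A.mor_over _)

theorem joinMor_id_over (θ : n ⟶ m) {s : JoinIdx G x n} {t : JoinIdx G x m}
    (h : joinIdxMap θ (𝟙 x) s = t) : q.IsHomLift (𝟙 ((tailOver E).obj x)) (joinMor A θ (𝟙 x) h) :=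
  (tailOver E).map_id x ▸ joinMor_over A θ (𝟙 x) h

theorem joinMor_comp {θ : n ⟶ m} {θ' : m ⟶ k} {ζ : x ⟶ y} {ζ' : y ⟶ z} {s : JoinIdx G x n}
    {t : JoinIdx G y m} {r : JoinIdx G z k} (h : joinIdxMap θ ζ s = t)
    (h' : joinIdxMap θ' ζ' t = r) {θ'' : n ⟶ k} {ζ'' : x ⟶ z} (hθ : θ ≫ θ' = θ'')
    (hζ : ζ ≫ ζ' = ζ'') (h'' : joinIdxMap θ'' ζ'' s = r) :
    joinMor A θ ζ h ≫ joinMor A θ' ζ' h' = joinMor A θ'' ζ'' h'' := by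
  subst hθ hζ
  exact (A.mor_comp _ _).symm.trans (congrArg A.mor (joinHom_comp h h' h'').symm)

variable (G x) in
/-- The values of a section at the strings in `JoinIdx G x`, as a functor. -/
def joinDiagram : (joinIdx G x).Elements ⥤ q.Fiber ((tailOver E).obj x) where
  obj e := joinVal (G := G) A (n := e.1) e.2
  map f := fmk (joinMor A f.1 (𝟙 x) f.2) (joinMor_id_over A f.1 f.2)
  map_id e := fval_ext ((congrArg A.mor (joinHom_id _)).trans (A.mor_id _))
  map_comp f g := fval_ext (joinMor_comp A f.2 g.2 rfl (Category.comp_id _) (f ≫ g).2).symm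

variable [∀ b, HasCoproducts.{w} (q.Fiber b)]

variable (G x) in
/-- The simplicial object `n ↦ ∐ A(s)`, the coproduct being over the strings `s` in
`JoinIdx G x n`. -/
noncomputable def joinObj : SimplexCategoryᵒᵖ ⥤ q.Fiber ((tailOver E).obj x) :=
  elSum (joinDiagram G A x)

/-- The inclusions of the summands of `joinObj`. -/
noncomputable def joinι (s : JoinIdx G x n) :
    fobj (joinVal A s) ⟶ fobj ((joinObj G A x).obj n) :=
  fval (elι (joinDiagram G A x) n s)

theorem joinι_over (s : JoinIdx G x n) : q.IsHomLift (𝟙 ((tailOver E).obj x)) (joinι A s) :=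
  fval_over _

theorem joinMor_joinι {θ θ' : n ⟶ m} {ζ ζ' : x ⟶ y} {s : JoinIdx G x n} {t t' : JoinIdx G y m}
    (h : joinIdxMap θ ζ s = t) (h' : joinIdxMap θ' ζ' s = t') (hθ : θ = θ') (hζ : ζ = ζ') :
    joinMor A θ ζ h ≫ joinι A t = joinMor A θ' ζ' h' ≫ joinι A t' := by
  subst hθ hζ h h'
  rfl

theorem joinι_map (θ : n ⟶ m) (s : JoinIdx G x n) :
    joinι A s ≫ fval ((joinObj G A x).map θ) =
      joinMor A θ (𝟙 x) rfl ≫ joinι A (joinIdxMap θ (𝟙 x) s) :=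
  congrArg fval (elι_map (joinDiagram G A x) θ s)

variable [q.IsFibered]

theorem joinObj_hom_ext {b : Bᵒᵖ} {z : q.Fiber b} {g : (tailOver E).obj x ⟶ b}
    {f f' : fobj ((joinObj G A x).obj n) ⟶ fobj z} (hf : q.IsHomLift g f)
    (hf' : q.IsHomLift g f') (h : ∀ s : JoinIdx G x n, joinι A s ≫ f = joinι A s ≫ f') : f = f' :=
  sigma_hom_ext_over hf hf' h

variable {A A' A'' : Sect (tailOver E) q}

/-- A morphism of sections, on the values at a string in `JoinIdx G x n`. -/
def joinNatMor (η : A ⟶ A') (s : JoinIdx G x n) : fobj (joinVal A s) ⟶ fobj (joinVal A' s) :=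
  Sect.app η (joinStr s)

theorem joinNatMor_over (η : A ⟶ A') (s : JoinIdx G x n) :
    q.IsHomLift (𝟙 ((tailOver E).obj x)) (joinNatMor η s) := by
  have h : (tailOver E).obj (joinStr s) = (tailOver E).obj x :=
    congrArg op (lastObj_of_last ((simpMap E).map (joinR s)) (joinR_last s)).symm
  exact isHomLift_of_eq h (Sect.app_over η (joinStr s))

theorem joinMor_joinNatMor (η : A ⟶ A') (θ : n ⟶ m) (ζ : x ⟶ y) {s : JoinIdx G x n}
    {t : JoinIdx G y m} (h : joinIdxMap θ ζ s = t) :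
    joinMor A θ ζ h ≫ joinNatMor η t = joinNatMor η s ≫ joinMor A' θ ζ h :=
  Sect.app_naturality η _

theorem joinTerm_congr (η : A ⟶ A') {θ : n ⟶ m} {ζ : x ⟶ y} {s : JoinIdx G x n}
    {t t' : JoinIdx G y m} (h : joinIdxMap θ ζ s = t) (h' : joinIdxMap θ ζ s = t') :
    joinMor A θ ζ h ≫ joinNatMor η t ≫ joinι A' t =
      joinMor A θ ζ h' ≫ joinNatMor η t' ≫ joinι A' t' := by
  subst h h'
  rfl

/-- The functoriality of `joinObj G A x` in `A` and `x`, on a summand. -/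
noncomputable def joinTerm (ζ : x ⟶ y) (η : A ⟶ A') (s : JoinIdx G x n) :
    fobj (joinVal A s) ⟶ fobj ((joinObj G A' y).obj n) :=
  joinMor A (𝟙 n) ζ rfl ≫ joinNatMor η _ ≫ joinι A' (joinIdxMap (𝟙 n) ζ s)

theorem joinTerm_over (ζ : x ⟶ y) (η : A ⟶ A') (s : JoinIdx G x n) :
    q.IsHomLift ((tailOver E).map ζ) (joinTerm ζ η s) :=
  isHomLift_comp_id (joinMor_over A (𝟙 n) ζ rfl)
    (isHomLift_comp_id (joinNatMor_over η _) (joinι_over A' _))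

variable (G) in
/-- The functoriality of `joinObj G A x` in `A` and `x`, in one degree. -/
noncomputable def joinApp (ζ : x ⟶ y) (η : A ⟶ A') (n : SimplexCategoryᵒᵖ) :
    fobj ((joinObj G A x).obj n) ⟶ fobj ((joinObj G A' y).obj n) :=
  sigmaDescOver (fun s : JoinIdx G x n => joinVal A s) (z := (joinObj G A' y).obj n)
    ((tailOver E).map ζ) (f := joinTerm ζ η) (joinTerm_over ζ η)

theorem joinApp_over (ζ : x ⟶ y) (η : A ⟶ A') (n : SimplexCategoryᵒᵖ) :
    q.IsHomLift ((tailOver E).map ζ) (joinApp G ζ η n) :=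
  sigmaDescOver_over _ _ _

theorem joinι_joinApp (ζ : x ⟶ y) (η : A ⟶ A') (s : JoinIdx G x n) :
    joinι A s ≫ joinApp G ζ η n =
      joinMor A (𝟙 n) ζ rfl ≫ joinNatMor η _ ≫ joinι A' (joinIdxMap (𝟙 n) ζ s) :=
  ι_sigmaDescOver (fun s : JoinIdx G x n => joinVal A s) (z := (joinObj G A' y).obj n)
    ((tailOver E).map ζ) (f := joinTerm ζ η) (joinTerm_over ζ η) s

theorem joinApp_id (x : Simp C) (n : SimplexCategoryᵒᵖ) : joinApp G (𝟙 x) (𝟙 A) n = 𝟙 _ := by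
  refine joinObj_hom_ext A (joinApp_over (𝟙 x) (𝟙 A) n) ?_ fun s => ?_
  · rw [(tailOver E).map_id]
    exact IsHomLift.id (fobj_over _)
  · rw [joinι_joinApp, Category.comp_id]
    have h1 : joinNatMor (𝟙 A) (joinIdxMap (𝟙 n) (𝟙 x) s) = 𝟙 _ := rfl
    rw [h1, Category.id_comp]
    refine (joinMor_joinι A _ (joinIdxMap_id s) rfl rfl).trans ?_
    have h2 : joinMor A (𝟙 n) (𝟙 x) (joinIdxMap_id s) = 𝟙 _ :=
      (congrArg A.mor (joinHom_id _)).trans (A.mor_id _)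
    rw [h2, Category.id_comp]

theorem joinApp_comp (ζ : x ⟶ y) (ζ' : y ⟶ z) (η : A ⟶ A') (η' : A' ⟶ A'')
    (n : SimplexCategoryᵒᵖ) :
    joinApp G (ζ ≫ ζ') (η ≫ η') n = joinApp G ζ η n ≫ joinApp G ζ' η' n := by
  refine joinObj_hom_ext A (joinApp_over _ _ n) ?_ fun s => ?_
  · rw [(tailOver E).map_comp]
    exact isHomLift_comp (joinApp_over ζ η n) (joinApp_over ζ' η' n)
  · have hr : joinIdxMap (𝟙 n) (ζ ≫ ζ') s = joinIdxMap (𝟙 n) ζ' (joinIdxMap (𝟙 n) ζ s) := by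
      rw [← joinIdxMap_comp, Category.comp_id]
    rw [joinι_joinApp, ← Category.assoc (joinι A s), joinι_joinApp, Category.assoc, Category.assoc,
      joinι_joinApp]
    have h1 : joinNatMor η (joinIdxMap (𝟙 n) ζ s) ≫ joinMor A' (𝟙 n) ζ' rfl ≫
        joinNatMor η' _ ≫ joinι A'' (joinIdxMap (𝟙 n) ζ' (joinIdxMap (𝟙 n) ζ s)) =
        joinMor A (𝟙 n) ζ' rfl ≫ joinNatMor (η ≫ η') _ ≫ joinι A'' _ := by
      rw [← Category.assoc, ← joinMor_joinNatMor, Category.assoc, ← Category.assoc (joinNatMor η _)]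
      rfl
    rw [h1]
    refine (joinTerm_congr (η ≫ η') rfl hr).trans ?_
    rw [← Category.assoc (joinMor A (𝟙 n) ζ rfl),
      joinMor_comp A rfl rfl (Category.comp_id (𝟙 n)) rfl hr]

variable (G) in
/-- The functoriality of `joinObj G A x` in `A` and `x`. -/
noncomputable def joinOver (ζ : x ⟶ y) (η : A ⟶ A') :
    SimplicialOver ((tailOver E).map ζ) (joinObj G A x) (joinObj G A' y) where
  app n := joinApp G ζ η n
  isHomLift n := joinApp_over ζ η n
  naturality {n m} θ := by
    refine joinObj_hom_ext A (isHomLift_id_comp (fval_over _) (joinApp_over ζ η m))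
      (isHomLift_comp_id (joinApp_over ζ η n) (fval_over _)) fun s => ?_
    have h1 : joinι A s ≫ joinApp G ζ η n ≫ fval ((joinObj G A' y).map θ) =
        joinMor A θ ζ rfl ≫ joinNatMor η _ ≫ joinι A' (joinIdxMap θ ζ s) := by
      rw [← Category.assoc, joinι_joinApp, Category.assoc, Category.assoc, joinι_map,
        ← Category.assoc (joinNatMor η _), ← joinMor_joinNatMor, Category.assoc, ← Category.assoc,
        joinMor_comp A rfl rfl (Category.id_comp θ) (Category.comp_id ζ)
          (by rw [← joinIdxMap_comp, Category.comp_id, Category.id_comp])]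
      exact joinTerm_congr η _ _
    have h2 : joinι A s ≫ fval ((joinObj G A x).map θ) ≫ joinApp G ζ η m =
        joinMor A θ ζ rfl ≫ joinNatMor η _ ≫ joinι A' (joinIdxMap θ ζ s) := by
      rw [← Category.assoc, joinι_map, Category.assoc, joinι_joinApp, ← Category.assoc,
        joinMor_comp A rfl rfl (Category.comp_id θ) (Category.id_comp ζ)
          (by rw [← joinIdxMap_comp, Category.comp_id, Category.id_comp])]
      exact joinTerm_congr η _ _
    exact h2.trans h1.symm

end JoinSect

/-! ### Realizations over morphisms of the base -/

section RealOver

variable {𝓕 : Type u₁} [Category.{v₁} 𝓕] {B : Type u₂} [Category.{v₂} B] {q : 𝓕 ⥤ B}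
  [q.IsFibered] (S : DeltaFibStructure q) [∀ b : B, HasColimitsOfSize.{0, 0} (q.Fiber b)]
  {b b' : B} {g : b ⟶ b'} {Y Z : SimplexCategoryᵒᵖ ⥤ q.Fiber b}
  {Y' Z' : SimplexCategoryᵒᵖ ⥤ q.Fiber b'}

namespace DeltaFibStructure

theorem ιOver_real_map (f : Y ⟶ Z) (n : SimplexCategory) :
    S.ιOver Y n ≫ fval ((S.fiber b).real.map f) =
      (S.tensor.obj n).map (fval (f.app (op n))) ≫ S.ιOver Z n :=
  congrArg fval ((S.fiber b).realι_map f n)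

theorem realOver_natural (φ : SimplicialOver g Y Y') (ψ : SimplicialOver g Z Z') (f : Y ⟶ Z)
    (f' : Y' ⟶ Z') (h : ∀ n, φ.app n ≫ fval (f'.app n) = fval (f.app n) ≫ ψ.app n) :
    S.realOver φ ≫ fval ((S.fiber b').real.map f') =
      fval ((S.fiber b).real.map f) ≫ S.realOver ψ := by
  refine S.real_ext_over (isHomLift_comp_id (S.realOver_over φ) (fval_over _))
    (isHomLift_id_comp (fval_over _) (S.realOver_over ψ)) fun n => ?_
  refine (Category.assoc _ _ _).symm.trans ?_
  refine (congrArg (· ≫ _) (S.ι_realOver φ n)).trans ?_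
  refine (Category.assoc _ _ _).trans ?_
  refine (congrArg (_ ≫ ·) (S.ιOver_real_map f' n)).trans ?_
  symm
  refine (Category.assoc _ _ _).symm.trans ?_
  refine (congrArg (· ≫ _) (S.ιOver_real_map f n)).trans ?_
  refine (Category.assoc _ _ _).trans ?_
  refine (congrArg (_ ≫ ·) (S.ι_realOver ψ n)).trans ?_
  rw [← Functor.map_comp_assoc, ← Functor.map_comp_assoc, h]

theorem ιOver_realAug {z : q.Fiber b} (ε : Y ⟶ (Functor.const SimplexCategoryᵒᵖ).obj z)
    (n : SimplexCategory) : S.ιOver Y n ≫ fval ((S.fiber b).realAug ε) =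
      (S.tensor.obj n).map (fval (ε.app (op n))) ≫
        (S.tensor.map (SimplexCategory.const n ⦋0⦌ 0)).app (fobj z) ≫ S.unit.hom.app (fobj z) :=
  congrArg fval ((S.fiber b).ι_realAug ε n)

theorem realOver_realAug (φ : SimplicialOver g Y Y') {z : q.Fiber b} {z' : q.Fiber b'}
    (ε : Y ⟶ (Functor.const SimplexCategoryᵒᵖ).obj z)
    (ε' : Y' ⟶ (Functor.const SimplexCategoryᵒᵖ).obj z') {a : fobj z ⟶ fobj z'}
    (ha : q.IsHomLift g a) (h : ∀ n, φ.app n ≫ fval (ε'.app n) = fval (ε.app n) ≫ a) :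
    S.realOver φ ≫ fval ((S.fiber b').realAug ε') = fval ((S.fiber b).realAug ε) ≫ a := by
  refine S.real_ext_over (isHomLift_comp_id (S.realOver_over φ) (fval_over _))
    (isHomLift_id_comp (fval_over _) ha) fun n => ?_
  refine (Category.assoc _ _ _).symm.trans ?_
  refine (congrArg (· ≫ _) (S.ι_realOver φ n)).trans ?_
  refine (Category.assoc _ _ _).trans ?_
  refine (congrArg (_ ≫ ·) (S.ιOver_realAug ε' n)).trans ?_
  symm
  refine (Category.assoc _ _ _).symm.trans ?_
  refine (congrArg (· ≫ _) (S.ιOver_realAug ε n)).trans ?_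
  refine (Category.assoc _ _ _).trans ?_
  have key : ((S.tensor.map (SimplexCategory.const n ⦋0⦌ 0)).app (fobj z) ≫
      S.unit.hom.app (fobj z)) ≫ a = (S.tensor.obj n).map a ≫
        (S.tensor.map (SimplexCategory.const n ⦋0⦌ 0)).app (fobj z') ≫
          S.unit.hom.app (fobj z') := by
    refine (Category.assoc _ _ _).trans ?_
    refine (congrArg (_ ≫ ·) (S.unit.hom.naturality a).symm).trans ?_
    exact (NatTrans.naturality_assoc (S.tensor.map (SimplexCategory.const n ⦋0⦌ 0)) a _).symm
  refine (congrArg ((S.tensor.obj n).map (fval (ε.app (op n))) ≫ ·) key).trans ?_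
  refine ((S.tensor.obj n).map_comp_assoc _ _ _).symm.trans ?_
  refine Eq.trans ?_ ((S.tensor.obj n).map_comp_assoc _ _ _)
  exact congrArg (fun t => (S.tensor.obj n).map t ≫ _) (h (op n)).symm

end DeltaFibStructure

end RealOver

theorem isHomLift_of_eqToHom_comp {𝓕 : Type u₁} [Category.{v₁} 𝓕] {B : Type u₂} [Category.{v₂} B]
    {q : 𝓕 ⥤ B} {a b c : B} (h : a = b) {g : b ⟶ c} {x y : 𝓕} {f : x ⟶ y}
    (hf : q.IsHomLift (eqToHom h ≫ g) f) : q.IsHomLift g f := by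
  subst h
  rwa [eqToHom_refl, Category.id_comp] at hf

theorem isHomLift_congr {𝓕 : Type u₁} [Category.{v₁} 𝓕] {B : Type u₂} [Category.{v₂} B]
    {q : 𝓕 ⥤ B} {a b : B} {g g' : a ⟶ b} (h : g = g') {x y : 𝓕} {f : x ⟶ y}
    (hf : q.IsHomLift g f) : q.IsHomLift g' f :=
  h ▸ hf

/-! ### The section of joins and its comparison morphisms -/

section JoinSection

variable {B C D : Type w} [Category.{w} B] [Category.{w} C] [Category.{w} D] {G : D ⥤ C}
  {E : C ⥤ B} {𝓕 : Type u₁} [Category.{v₁} 𝓕] {q : 𝓕 ⥤ Bᵒᵖ}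
  {A A' : Sect (tailOver E) q} {x y : Simp C} {n m : SimplexCategoryᵒᵖ}

/-- The restriction of a section from a string in `JoinIdx G x n` to `x`. -/
def augTerm (A : Sect (tailOver E) q) (s : JoinIdx G x n) : fobj (joinVal A s) ⟶ fobj (A.val x) :=
  A.mor (joinR s)

theorem mor_over_of_last (A : Sect (tailOver E) q) {s : Simp C} {r : s ⟶ x}
    (hr : ordMap r (Fin.last _) = Fin.last _) :
    q.IsHomLift (𝟙 ((tailOver E).obj x)) (A.mor r) := by
  have h : (tailOver E).obj s = (tailOver E).obj x :=
    congrArg op (lastObj_of_last ((simpMap E).map r) hr).symm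
  have e := A.mor_over r
  rw [tailOver_map_of_last r hr h] at e
  exact isHomLift_of_eqToHom_comp h ((Category.comp_id (eqToHom h)).symm ▸ e)

theorem augTerm_over (A : Sect (tailOver E) q) (s : JoinIdx G x n) :
    q.IsHomLift (𝟙 ((tailOver E).obj x)) (augTerm A s) :=
  mor_over_of_last A (joinR_last s)

theorem joinMor_augTerm (η : A ⟶ A') (θ : n ⟶ m) (ζ : x ⟶ y) {s : JoinIdx G x n}
    {t : JoinIdx G y m} (h : joinIdxMap θ ζ s = t) :
    joinMor A θ ζ h ≫ joinNatMor η t ≫ augTerm A' t = augTerm A s ≫ A.mor ζ ≫ Sect.app η y := by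
  have h1 : joinNatMor η t ≫ augTerm A' t = augTerm A t ≫ Sect.app η y :=
    (Sect.app_naturality η (joinR t)).symm
  rw [h1]
  have h2 : joinMor A θ ζ h ≫ augTerm A t = augTerm A s ≫ A.mor ζ :=
    (A.mor_comp _ _).symm.trans ((congrArg A.mor (joinHom_r h)).trans (A.mor_comp _ _))
  rw [← Category.assoc, h2, Category.assoc]

theorem lastMap_op_eq (s : JoinIdx G x n) (h : (tailOver E).obj (joinStr s) = (tailOver E).obj x) :
    (tailOver E).map (joinL s) = eqToHom h ≫ totalOp ((simpMap E).obj x) ≫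
      Quiver.Hom.op (connMap ((simpMap E).map (joinL s)) ((simpMap E).map (joinR s))
        (joinL_le_joinR s)) := by
  have h1 := lastMap_eq_connMap ((simpMap E).map (joinL s)) ((simpMap E).map (joinR s))
    (joinL_le_joinR s)
  rw [lastMap_of_last ((simpMap E).map (joinR s)) (joinR_last s) (congrArg unop h.symm)] at h1
  refine (congrArg Quiver.Hom.op h1).trans ?_
  rw [op_comp, op_comp, Category.assoc]
  exact congrArg (· ≫ _) (eqToHom_op _)

/-- The morphism from the end of the first part of a string in `JoinIdx G x n` to the beginning of
`x`, as a simplex of the indexing simplicial set of the bar construction. -/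
def joinArr (E : C ⥤ B) (s : JoinIdx G x n) : op (headObj ((simpMap E).obj x)) ⟶
    (simpMap G ⋙ tailOver E).obj (elt (nerve D) n s.1.1) :=
  Quiver.Hom.op (connMap ((simpMap E).map (joinL s)) ((simpMap E).map (joinR s)) (joinL_le_joinR s))

theorem joinArr_map (E : C ⥤ B) (θ : n ⟶ m) (ζ : x ⟶ y) {s : JoinIdx G x n} {t : JoinIdx G y m}
    (h : joinIdxMap θ ζ s = t) :
    joinArr E t = headOp ((simpMap E).map ζ) ≫ joinArr E s ≫
      (simpMap G ⋙ tailOver E).map (joinHomL h) := by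
  have h1 := connMap_naturality (l := (simpMap E).map (joinL s)) (r := (simpMap E).map (joinR s))
    (l' := (simpMap E).map (joinL t)) (r' := (simpMap E).map (joinR t))
    ((simpMap E).map (joinHom θ ζ h)) (u := (simpMap E).map ((simpMap G).map (joinHomL h)))
    (ζ := (simpMap E).map ζ) (congrArg (simpMap E).map (joinHom_l h))
    (congrArg (simpMap E).map (joinHom_r h)) (joinL_le_joinR s) (joinL_le_joinR t)
  refine (congrArg Quiver.Hom.op h1).trans ?_
  rw [op_comp, op_comp, Category.assoc]
  rfl

variable (G) in
/-- The restriction of a section along `G`. -/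
abbrev resSect (A : Sect (tailOver E) q) : Sect (simpMap G ⋙ tailOver E) q :=
  (Sect.pullback (simpMap G)).obj A

variable (G) in
/-- The restriction of a morphism of sections along `G`. -/
abbrev resMap (η : A ⟶ A') : resSect G A ⟶ resSect G A' := (Sect.pullback (simpMap G)).map η

theorem mor_joinL_over (A : Sect (tailOver E) q) (s : JoinIdx G x n) :
    q.IsHomLift (totalOp ((simpMap E).obj x) ≫ joinArr E s) (A.mor (joinL s)) := by
  have h : (tailOver E).obj (joinStr s) = (tailOver E).obj x :=
    congrArg op (lastObj_of_last ((simpMap E).map (joinR s)) (joinR_last s)).symm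
  have e := A.mor_over (joinL s)
  rw [lastMap_op_eq s h] at e
  exact isHomLift_of_eqToHom_comp h e

variable [q.IsFibered]

/-- The restriction of a section from a string in `JoinIdx G x n` to its first part, as a morphism
to a summand of the bar construction. -/
noncomputable def barTermOf (A : Sect (tailOver E) q) (s : JoinIdx G x n) :
    fobj (joinVal A s) ⟶ fobj (barTerm (resSect G A) ((simpMap E).obj x) s.1.1 (joinArr E s)) :=
  toPull (𝟙 _) (totalOp ((simpMap E).obj x) ≫ joinArr E s) (Category.id_comp _).symm
    (y := (resSect G A).val (elt (nerve D) n s.1.1)) (mor_joinL_over A s)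

theorem barTermOf_over (A : Sect (tailOver E) q) (s : JoinIdx G x n) :
    q.IsHomLift (𝟙 ((tailOver E).obj x)) (barTermOf A s) :=
  toPull_over _ _

theorem barTermOf_fac (A : Sect (tailOver E) q) (s : JoinIdx G x n) :
    barTermOf A s ≫ pullπ (totalOp ((simpMap E).obj x) ≫ joinArr E s)
      ((resSect G A).val (elt (nerve D) n s.1.1)) = A.mor (joinL s) :=
  toPull_fac (Category.id_comp _).symm (mor_joinL_over A s)

variable [∀ b, HasCoproducts.{w} (q.Fiber b)]

/-- The naturality of `barTermOf`. -/
theorem comp_barTermOf {s : JoinIdx G x n} {t : JoinIdx G y m} {u : (tailOver E).obj x ⟶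
      (tailOver E).obj y} {κ : (simpMap G ⋙ tailOver E).obj (elt (nerve D) n s.1.1) ⟶
      (simpMap G ⋙ tailOver E).obj (elt (nerve D) m t.1.1)}
    {f : fobj (joinVal A s) ⟶ fobj (joinVal A' t)} (hf : q.IsHomLift u f)
    {g : fobj ((resSect G A).val (elt (nerve D) n s.1.1)) ⟶
      fobj ((resSect G A').val (elt (nerve D) m t.1.1))} (hg : q.IsHomLift κ g)
    (e : (totalOp ((simpMap E).obj x) ≫ joinArr E s) ≫ κ =
      u ≫ totalOp ((simpMap E).obj y) ≫ joinArr E t)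
    (h : f ≫ A'.mor (joinL t) = A.mor (joinL s) ≫ g) :
    f ≫ barTermOf A' t = barTermOf A s ≫ barTermMap e hg := by
  refine pull_hom_ext (isHomLift_comp_id hf (barTermOf_over A' t))
    (isHomLift_id_comp (barTermOf_over A s) (barTermMap_over e hg)) ?_
  refine (Category.assoc _ _ _).trans ((congrArg (f ≫ ·) (barTermOf_fac A' t)).trans ?_)
  refine h.trans (Eq.symm ?_)
  refine (Category.assoc _ _ _).trans ?_
  refine (congrArg (barTermOf A s ≫ ·) (pullMap_fac e hg)).trans ?_
  refine (Category.assoc _ _ _).symm.trans ?_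
  exact congrArg (· ≫ g) (barTermOf_fac A s)

theorem joinArr_aux (E : C ⥤ B) (θ : n ⟶ m) (ζ : x ⟶ y) {s : JoinIdx G x n} {t : JoinIdx G y m}
    (h : joinIdxMap θ ζ s = t) : (totalOp ((simpMap E).obj x) ≫ joinArr E s) ≫
      (simpMap G ⋙ tailOver E).map (joinHomL h) =
        (tailOver E).map ζ ≫ totalOp ((simpMap E).obj y) ≫ joinArr E t := by
  rw [joinArr_map E θ ζ h, totalOp_eq ((simpMap E).map ζ)]
  simp only [Category.assoc]
  rfl

theorem joinMor_mor_joinL (A : Sect (tailOver E) q) (θ : n ⟶ m) (ζ : x ⟶ y) {s : JoinIdx G x n}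
    {t : JoinIdx G y m} (h : joinIdxMap θ ζ s = t) :
    joinMor A θ ζ h ≫ A.mor (joinL t) = A.mor (joinL s) ≫ (resSect G A).mor (joinHomL h) :=
  (A.mor_comp _ _).symm.trans ((congrArg A.mor (joinHom_l h)).trans (A.mor_comp _ _))

theorem joinAug_aux (A : Sect (tailOver E) q) (x : Simp C) (θ : n ⟶ m) (s : JoinIdx G x n) :
    (joinDiagram G A x).map (eltMap (T := joinIdx G x) θ s) ≫
        fmk (augTerm A (joinIdxMap θ (𝟙 x) s)) (augTerm_over A _) =
      fmk (augTerm A s) (augTerm_over A s) ≫ 𝟙 (A.val x) := by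
  refine fval_ext ?_
  refine Eq.trans ?_ ((joinMor_augTerm (𝟙 A) θ (𝟙 x) (s := s) rfl).trans ?_)
  · exact congrArg (joinMor A θ (𝟙 x) rfl ≫ ·) (Category.id_comp _).symm
  · refine congrArg (augTerm A s ≫ ·) ?_
    exact (congrArg (· ≫ 𝟙 _) (A.mor_id x)).trans (Category.id_comp _)

/-- The augmentation of `joinObj G A x`. -/
noncomputable def joinAug (A : Sect (tailOver E) q) (x : Simp C) :
    joinObj G A x ⟶ (Functor.const SimplexCategoryᵒᵖ).obj (A.val x) :=
  elSumDesc (joinDiagram G A x) (fun n s => fmk (augTerm A (n := n) s) (augTerm_over A s))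
    (joinAug_aux A x)

theorem joinι_joinAug (A : Sect (tailOver E) q) (s : JoinIdx G x n) :
    joinι A s ≫ fval ((joinAug A x).app n) = augTerm A s :=
  congrArg fval (elι_elSumDesc (joinDiagram G A x) _ (joinAug_aux A x) n s)

theorem joinApp_joinAug (ζ : x ⟶ y) (η : A ⟶ A') (n : SimplexCategoryᵒᵖ) :
    joinApp G ζ η n ≫ fval ((joinAug A' y).app n) =
      fval ((joinAug A x).app n) ≫ A.mor ζ ≫ Sect.app η y := by
  refine joinObj_hom_ext A (z := A'.val y) (isHomLift_comp_id (joinApp_over ζ η n) (fval_over _))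
    (isHomLift_id_comp (fval_over _) (isHomLift_comp_id (A.mor_over ζ) (Sect.app_over η y)))
    fun s => ?_
  refine (Category.assoc _ _ _).symm.trans ?_
  refine (congrArg (· ≫ _) (joinι_joinApp ζ η s)).trans ?_
  rw [Category.assoc, Category.assoc, joinι_joinAug, joinMor_augTerm]
  refine Eq.trans ?_ (Category.assoc _ _ _)
  exact congrArg (· ≫ A.mor ζ ≫ Sect.app η y) (joinι_joinAug A s).symm

theorem joinBar_aux (A : Sect (tailOver E) q) (x : Simp C) (θ : n ⟶ m) (s : JoinIdx G x n) :
    (joinDiagram G A x).map (eltMap (T := joinIdx G x) θ s) ≫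
        fmk (barTermOf A (joinIdxMap θ (𝟙 x) s)) (barTermOf_over A _) ≫
          piι (barDiagram (resSect G A) ((simpMap E).obj x)) m ⟨_, joinArr E (joinIdxMap θ (𝟙 x) s)⟩ =
      (fmk (barTermOf A s) (barTermOf_over A s) ≫
        piι (barDiagram (resSect G A) ((simpMap E).obj x)) n ⟨s.1.1, joinArr E s⟩) ≫
          (bar (resSect G A) ((simpMap E).obj x)).map θ := by
  refine fval_ext ?_
  have h := comp_barTermOf (A := A) (A' := A) (joinMor_id_over A θ (s := s) rfl)
    ((resSect G A).mor_over (joinHomL rfl)) ((joinArr_aux E θ (𝟙 x) (s := s) rfl).trans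
      (congrArg (· ≫ _) ((tailOver E).map_id x))) (joinMor_mor_joinL A θ (𝟙 x) rfl)
  refine (Category.assoc _ _ _).symm.trans ((congrArg (· ≫ barι _ _ _ _) h).trans ?_)
  refine (Category.assoc _ _ _).trans (Eq.trans ?_ (Category.assoc _ _ _).symm)
  refine congrArg (barTermOf A s ≫ ·) (Eq.trans ?_ (barι_map (resSect G A) _ θ _ _).symm)
  refine barTermMap_barι_congr _ _ _ _ ?_ rfl rfl rfl
  refine (joinArr_map E θ (𝟙 x) (s := s) rfl).trans ?_
  rw [(simpMap E).map_id, headOp_id, Category.id_comp]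
  rfl

/-- The comparison morphism from `joinObj` to the bar construction. -/
noncomputable def joinBar (A : Sect (tailOver E) q) (x : Simp C) :
    joinObj G A x ⟶ bar (resSect G A) ((simpMap E).obj x) :=
  elSumDesc (joinDiagram G A x) (fun n s => fmk (barTermOf A (n := n) s) (barTermOf_over A s) ≫
      piι (barDiagram (resSect G A) ((simpMap E).obj x)) n ⟨s.1.1, joinArr E s⟩) (joinBar_aux A x)

theorem joinι_joinBar (A : Sect (tailOver E) q) (s : JoinIdx G x n) :
    joinι A s ≫ fval ((joinBar A x).app n) =
      barTermOf A s ≫ barι (resSect G A) ((simpMap E).obj x) s.1.1 (joinArr E s) :=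
  congrArg fval (elι_elSumDesc (joinDiagram G A x) _ (joinBar_aux A x) n s)

theorem barTermMap_barι_hcongr {k : Simp D ⥤ Bᵒᵖ} {S S' : Sect k q} {x y : Simp B}
    {d d' d'' : (nerve D).obj n} (hd : d'' = d') {α : op (headObj x) ⟶ k.obj (elt (nerve D) n d)}
    {β' : op (headObj y) ⟶ k.obj (elt (nerve D) n d')}
    {β'' : op (headObj y) ⟶ k.obj (elt (nerve D) n d'')} {u u₁ : (tail B).obj x ⟶ (tail B).obj y}
    {κ : k.obj (elt (nerve D) n d) ⟶ k.obj (elt (nerve D) n d')}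
    {κ₁ : k.obj (elt (nerve D) n d) ⟶ k.obj (elt (nerve D) n d'')}
    {s : fobj (S.val (elt (nerve D) n d)) ⟶ fobj (S'.val (elt (nerve D) n d'))}
    {s₁ : fobj (S.val (elt (nerve D) n d)) ⟶ fobj (S'.val (elt (nerve D) n d''))}
    (e : (totalOp x ≫ α) ≫ κ = u ≫ totalOp y ≫ β') (hs : q.IsHomLift κ s)
    (e' : (totalOp x ≫ α) ≫ κ₁ = u₁ ≫ totalOp y ≫ β'') (hs' : q.IsHomLift κ₁ s₁)
    (hu : u = u₁) {f : elt (nerve D) n d'' ⟶ elt (nerve D) n d'} (hf : f.1 = 𝟙 n)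
    (hβ : β' = β'' ≫ k.map f) (hκ : κ = κ₁ ≫ k.map f) (h : s = s₁ ≫ S'.mor f) :
    barTermMap e hs ≫ barι S' y d' β' = barTermMap e' hs' ≫ barι S' y d'' β'' := by
  subst hd
  obtain rfl : f = 𝟙 _ := Subtype.ext hf
  rw [k.map_id, Category.comp_id] at hβ hκ
  rw [S'.mor_id, Category.comp_id] at h
  exact barTermMap_barι_congr e hs e' hs' hβ hu hκ h

theorem joinApp_joinBar (ζ : x ⟶ y) (η : A ⟶ A') (n : SimplexCategoryᵒᵖ) :
    joinApp G ζ η n ≫ fval ((joinBar A' y).app n) =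
      fval ((joinBar A x).app n) ≫ barApp ((simpMap E).map ζ) (resMap G η) n := by
  refine joinObj_hom_ext A (isHomLift_comp_id (joinApp_over ζ η n) (fval_over _))
    (isHomLift_id_comp (fval_over _) (barApp_over _ _ n)) fun s => ?_
  refine (Category.assoc _ _ _).symm.trans ?_
  refine (congrArg (· ≫ _) (joinι_joinApp ζ η s)).trans ?_
  rw [Category.assoc, Category.assoc, joinι_joinBar]
  have hg : q.IsHomLift ((simpMap G ⋙ tailOver E).map (joinHomL rfl))
      ((resSect G A).mor (joinHomL rfl) ≫ Sect.app (resMap G η)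
        (elt (nerve D) n (joinIdxMap (𝟙 n) ζ s).1.1)) :=
    isHomLift_comp_id ((resSect G A).mor_over (joinHomL rfl)) (Sect.app_over _ _)
  have h := comp_barTermOf (A := A) (A' := A')
    (isHomLift_comp_id (joinMor_over A (𝟙 n) ζ (s := s) rfl) (joinNatMor_over η _))
    hg (joinArr_aux E (𝟙 n) ζ (s := s) rfl) (by
      have h1 : joinNatMor η (joinIdxMap (𝟙 n) ζ s) ≫ A'.mor (joinL (joinIdxMap (𝟙 n) ζ s)) =
        A.mor (joinL (joinIdxMap (𝟙 n) ζ s)) ≫ Sect.app (resMap G η) _ :=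
        (Sect.app_naturality η _).symm
      refine (Category.assoc _ _ _).trans ((congrArg (_ ≫ ·) h1).trans ?_)
      refine (Category.assoc _ _ _).symm.trans (Eq.trans ?_ (Category.assoc _ _ _))
      exact congrArg (· ≫ _) (joinMor_mor_joinL A (𝟙 n) ζ (s := s) rfl))
  refine (congrArg (joinMor A (𝟙 n) ζ rfl ≫ ·) (Category.assoc _ _ _).symm).trans ?_
  refine (Category.assoc _ _ _).symm.trans ?_
  refine (congrArg (· ≫ barι _ _ _ _) ((Category.assoc _ _ _).symm.trans h)).trans ?_
  refine (Category.assoc _ _ _).trans ?_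
  symm
  refine (Category.assoc _ _ _).symm.trans ?_
  refine (congrArg (· ≫ _) (joinι_joinBar A s)).trans ?_
  refine (Category.assoc _ _ _).trans ?_
  refine (congrArg (_ ≫ ·) (barι_barApp _ _ _ _)).trans ?_
  refine congrArg (barTermOf A s ≫ ·) (Eq.symm ?_)
  refine barTermMap_barι_hcongr ?_ _ _ _ _ rfl (f := joinHomL rfl) rfl ?_ ?_ ?_
  · exact (congrArg (fun t => t s.1.1) ((nerve D).map_id n)).symm
  · exact (joinArr_map E (𝟙 n) ζ (s := s) rfl).trans (Category.assoc _ _ _).symm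
  · exact (Category.id_comp _).symm
  · exact Sect.app_naturality (resMap G η) _

variable (Δ : DeltaFibStructure q) [∀ b, HasColimitsOfSize.{0, 0} (q.Fiber b)]

variable (G) in
/-- The section `x ↦ |∐ A(s)|`, the coproduct being over the strings `s` which consist of the image
of a string of `D` and of the string `x`. -/
noncomputable def joinSect (A : Sect (tailOver E) q) : Sect (tailOver E) q where
  toFunctor :=
    { obj := fun x => fobj ((Δ.fiber _).real.obj (joinObj G A x))
      map := fun ζ => Δ.realOver (joinOver G ζ (𝟙 A))
      map_id := fun x => Δ.realOver_id ((tailOver E).map_id x) _ _ fun n => joinApp_id x n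
      map_comp := fun ζ ζ' => Δ.realOver_comp ((tailOver E).map_comp ζ ζ').symm _ _ _ fun n =>
        (congrArg (fun t => joinApp G (ζ ≫ ζ') t n) (Category.comp_id (𝟙 A)).symm).trans
          (joinApp_comp ζ ζ' (𝟙 A) (𝟙 A) n) }
  isHomLift := fun _ => Δ.realOver_over _

variable (G) in
/-- The functoriality of `joinSect G Δ A` in `A`. -/
noncomputable def joinSectMap (η : A ⟶ A') : joinSect G Δ A ⟶ joinSect G Δ A' where
  toNatTrans :=
    { app := fun x => Δ.realOver (joinOver G (𝟙 x) η)
      naturality := fun x y ζ => by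
        have h1 := Δ.realOver_comp ((tailOver E).map_comp ζ (𝟙 y)).symm (joinOver G ζ (𝟙 A))
          (joinOver G (𝟙 y) η) (joinOver G (ζ ≫ 𝟙 y) (𝟙 A ≫ η)) fun n => joinApp_comp _ _ _ _ n
        have h2 := Δ.realOver_comp ((tailOver E).map_comp (𝟙 x) ζ).symm (joinOver G (𝟙 x) η)
          (joinOver G ζ (𝟙 A')) (joinOver G (𝟙 x ≫ ζ) (η ≫ 𝟙 A')) fun n => joinApp_comp _ _ _ _ n
        refine h1.symm.trans (Eq.trans ?_ h2)
        rw [Category.comp_id, Category.id_comp, Category.comp_id, Category.id_comp] }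
  isHomLift := fun x => isHomLift_congr ((tailOver E).map_id x)
    (Δ.realOver_over (joinOver G (𝟙 x) η))

variable (G) in
/-- The augmentation of `joinSect`. -/
noncomputable def joinSectAug (A : Sect (tailOver E) q) : joinSect G Δ A ⟶ A where
  toNatTrans :=
    { app := fun x => fval ((Δ.fiber _).realAug (joinAug A x))
      naturality := fun x y ζ => Δ.realOver_realAug (joinOver G ζ (𝟙 A)) (joinAug A x) (joinAug A y)
        (A.mor_over ζ) fun n => (joinApp_joinAug ζ (𝟙 A) n).trans
          (congrArg (_ ≫ ·) (Category.comp_id _)) }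
  isHomLift := fun x => fval_over _

theorem joinSectMap_aug (η : A ⟶ A') :
    joinSectMap G Δ η ≫ joinSectAug G Δ A' = joinSectAug G Δ A ≫ η :=
  SectHom.ext (NatTrans.ext (funext fun x => Δ.realOver_realAug (joinOver G (𝟙 x) η) (joinAug A x)
    (joinAug A' x) ((tailOver E).map_id x ▸ Sect.app_over η x) fun n =>
      (joinApp_joinAug (𝟙 x) η n).trans (congrArg (_ ≫ ·)
        ((congrArg (· ≫ _) (A.mor_id x)).trans (Category.id_comp _)))))

/-- The restriction along `E` of the derived pushforward of the restriction of a section. -/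
noncomputable abbrev pushRes (A : Sect (tailOver E) q) : Sect (tailOver E) q :=
  (Sect.pullback (simpMap E)).obj ((pushforward Δ).obj (resSect G A))

variable (G) in
/-- The comparison morphism from `joinSect` to the derived pushforward. -/
noncomputable def joinSectBar (A : Sect (tailOver E) q) :
    joinSect G Δ A ⟶ pushRes (G := G) Δ A where
  toNatTrans :=
    { app := fun x => fval ((Δ.fiber _).real.map (joinBar A x))
      naturality := fun x y ζ => Δ.realOver_natural (joinOver G ζ (𝟙 A))
        (barOver ((simpMap E).map ζ) (𝟙 (resSect G A))) (joinBar A x) (joinBar A y)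
          fun n => joinApp_joinBar ζ (𝟙 A) n }
  isHomLift := fun x => fval_over _

theorem joinSectMap_bar (η : A ⟶ A') :
    joinSectMap G Δ η ≫ joinSectBar G Δ A' = joinSectBar G Δ A ≫
      (Sect.pullback (simpMap E)).map ((pushforward Δ).map (resMap G η)) :=
  SectHom.ext (NatTrans.ext (funext fun x => by
    have h := Δ.realOver_natural (joinOver G (𝟙 x) η) (barOver ((simpMap E).map (𝟙 x)) (resMap G η))
      (joinBar A x) (joinBar A' x) fun n => joinApp_joinBar (𝟙 x) η n
    refine h.trans (congrArg (_ ≫ ·) ?_)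
    exact congrArg (fun t => pushMor Δ t (resMap G η)) ((simpMap E).map_id x)))

end JoinSection

/-! ### The augmentation of the section of joins -/

section UnderIdx

variable {B C : Type w} [Category.{w} B] [Category.{w} C] {E : C ⥤ B} {𝓕 : Type u₁}
  [Category.{v₁} 𝓕] {q : 𝓕 ⥤ Bᵒᵖ} {x : Simp C}

variable (x) in
/-- The presheaf of strings with end `x`, on the category of ordinals under the length of `x`. -/
def underIdx : (LastUnder x.1.unop)ᵒᵖ ⥤ Type w where
  obj a := { σ : (nerve C).obj (op a.unop.obj) // (nerve C).map a.unop.r.op σ = x.2 }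
  map {a b} f := ↾fun σ => ⟨(nerve C).map f.unop.1.op σ.1, by
    have h (g : x.1.unop ⟶ a.unop.obj) (hg : b.unop.r ≫ f.unop.1 = g) :
        (nerve C).map b.unop.r.op ((nerve C).map f.unop.1.op σ.1) = (nerve C).map g.op σ.1 := by
      rw [← hg, op_comp, Functor.map_comp]
      rfl
    exact (h _ f.unop.2).trans σ.2⟩
  map_id a := ConcreteCategory.hom_ext _ _ fun σ => Subtype.ext
    (congrArg (fun t => t σ.1) ((nerve C).map_id (op a.unop.obj)))
  map_comp f g := ConcreteCategory.hom_ext _ _ fun σ => Subtype.ext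
    (congrArg (fun t => t σ.1) ((nerve C).map_comp f.unop.1.op g.unop.1.op))

/-- The string of an element of `underIdx x`. -/
def underStr (e : (underIdx x).Elements) : Simp C := elt (nerve C) (op e.1.unop.obj) e.2.1

/-- The morphism of strings underlying a morphism of elements of `underIdx x`. -/
def underMap {e e' : (underIdx x).Elements} (f : e ⟶ e') : underStr e ⟶ underStr e' :=
  CategoryOfElements.homMk (underStr e) (underStr e') f.1.unop.1.op (congrArg Subtype.val f.2)

/-- The restriction of a string with end `x` to `x`. -/
def underR (e : (underIdx x).Elements) : underStr e ⟶ x :=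
  CategoryOfElements.homMk (underStr e) x e.1.unop.r.op e.2.2

theorem underMap_r {e e' : (underIdx x).Elements} (f : e ⟶ e') :
    underMap f ≫ underR e' = underR e :=
  Subtype.ext (congrArg Quiver.Hom.op f.1.unop.2)

theorem underR_last (e : (underIdx x).Elements) :
    ordMap (underR e) (Fin.last _) = Fin.last _ :=
  e.1.unop.last

variable (x) in
/-- The values of a section at the strings with end `x`. -/
def underDiagram (A : Sect (tailOver E) q) :
    (underIdx x).Elements ⥤ q.Fiber ((tailOver E).obj x) where
  obj e := ⟨A.toFunctor.obj (underStr e), (A.proj_obj _).trans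
    (congrArg op (lastObj_of_last ((simpMap E).map (underR e)) (underR_last e)).symm)⟩
  map {e e'} f := fmk (A.mor (underMap f)) (isHomLift_congr ((tailOver E).map_id x)
    (isHomLift_of_last (underR_last e) (underR_last e') ((underMap_r f).trans
      (Category.comp_id _).symm) (A.mor_over _)))
  map_id e := fval_ext (A.mor_id (underStr e))
  map_comp f g := fval_ext (A.mor_comp (underMap f) (underMap g))

/-- The restriction of a section from a string with end `x` to `x`. -/
def underAug (A : Sect (tailOver E) q) (e : (underIdx x).Elements) :
    (underDiagram x A).obj e ⟶ A.val x :=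
  fmk (A.mor (underR e)) (mor_over_of_last A (underR_last e))

theorem underDiagram_map_aug (A : Sect (tailOver E) q) {e e' : (underIdx x).Elements}
    (f : e ⟶ e') : (underDiagram x A).map f ≫ underAug A e' = underAug A e :=
  fval_ext ((A.mor_comp _ _).symm.trans (congrArg A.mor (underMap_r f)))

variable (x) in
/-- The string `x`, as an element of `underIdx x`. -/
def underId : (underIdx x).obj (op ⟨x.1.unop, 𝟙 _, rfl⟩) :=
  ⟨x.2, congrArg (fun t => t x.2) ((nerve C).map_id x.1)⟩

theorem eq_underId (σ : (underIdx x).obj (op ⟨x.1.unop, 𝟙 _, rfl⟩)) : σ = underId x :=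
  Subtype.ext ((congrArg (fun t => t σ.1) ((nerve C).map_id x.1)).symm.trans σ.2)

variable [∀ b, HasCoproducts.{w} (q.Fiber b)]

variable (x) in
/-- The augmentation of the coproduct of the values of a section at the strings with end `x`. -/
noncomputable def underπ (A : Sect (tailOver E) q) :
    (elSum (underDiagram x A)).obj (op ⟨x.1.unop, 𝟙 _, rfl⟩) ⟶ A.val x :=
  elDesc (underDiagram x A) fun s => underAug A (el _ _ s)

theorem isIso_underπ (A : Sect (tailOver E) q) : IsIso (underπ x A) := by
  have h : elι (underDiagram x A) _ (underId x) ≫ underπ x A = 𝟙 _ :=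
    (elι_desc _ _ _).trans (fval_ext ((congrArg A.mor (Subtype.ext rfl)).trans (A.mor_id x)))
  refine ⟨elι (underDiagram x A) _ (underId x), ?_, h⟩
  refine elSum_hom_ext fun s => ?_
  obtain rfl := eq_underId s
  refine (Category.assoc _ _ _).symm.trans ((congrArg (· ≫ _) h).trans ?_)
  exact (Category.id_comp _).trans (Category.comp_id _).symm

theorem joinToUnder_aux (A : Sect (tailOver E) q) {m n : SimplexCategoryᵒᵖ} (θ : m ⟶ n)
    (s : JoinIdx (𝟭 C) x m) :
    (joinDiagram (𝟭 C) A x).map (eltMap (T := joinIdx (𝟭 C) x) θ s) ≫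
        elι (underDiagram x A) (op ((joinUnder x.1.unop).obj n.unop))
          ⟨(joinIdxMap θ (𝟙 x) s).1.2, (joinIdxMap θ (𝟙 x) s).2.2⟩ =
      elι (underDiagram x A) (op ((joinUnder x.1.unop).obj m.unop)) ⟨s.1.2, s.2.2⟩ ≫
        (elSum (underDiagram x A)).map ((joinUnder x.1.unop).map θ.unop).op :=
  (elι_map (underDiagram x A) ((joinUnder x.1.unop).map θ.unop).op ⟨s.1.2, s.2.2⟩).symm

/-- The comparison between the two descriptions of the coproduct of the values of a section at the
strings of dimension `[n] ⋆ [m]` with end `x`. -/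
noncomputable def joinToUnder (A : Sect (tailOver E) q) :
    joinObj (𝟭 C) A x ⟶ (joinUnder x.1.unop).op ⋙ elSum (underDiagram x A) :=
  elSumDesc (joinDiagram (𝟭 C) A x)
    (fun n s => elι (underDiagram x A) (op ((joinUnder x.1.unop).obj n.unop)) ⟨s.1.2, s.2.2⟩)
    (joinToUnder_aux A)

theorem joinι_joinToUnder (A : Sect (tailOver E) q) {n : SimplexCategoryᵒᵖ}
    (s : JoinIdx (𝟭 C) x n) : elι (joinDiagram (𝟭 C) A x) n s ≫ (joinToUnder A).app n =
      elι (underDiagram x A) (op ((joinUnder x.1.unop).obj n.unop)) ⟨s.1.2, s.2.2⟩ :=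
  elι_elSumDesc (joinDiagram (𝟭 C) A x) _ (joinToUnder_aux A) n s

variable [q.IsFibered]

/-- For the identity functor, the augmentation of `joinObj` is given by a contraction of joins. -/
theorem joinAug_eq (A : Sect (tailOver E) q) (x : Simp C) :
    joinAug (G := 𝟭 C) A x = joinToUnder A ≫
      (joinUnderContraction x.1.unop).aug (elSum (underDiagram x A)) ≫
        (Functor.const SimplexCategoryᵒᵖ).map (underπ x A) := by
  refine NatTrans.ext (funext fun n => elSum_hom_ext fun s => ?_)
  refine (elι_elSumDesc (joinDiagram (𝟭 C) A x) _ (joinAug_aux A x) n s).trans ?_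
  symm
  refine (Category.assoc _ _ _).symm.trans ((congrArg (· ≫ _) (joinι_joinToUnder A s)).trans ?_)
  refine (Category.assoc _ _ _).symm.trans ((congrArg (· ≫ _) (elι_map _ _ _)).trans ?_)
  refine (Category.assoc _ _ _).trans ((congrArg (_ ≫ ·) (elι_desc _ _ _)).trans ?_)
  exact underDiagram_map_aug A _

end UnderIdx

section AugW

variable {B C D : Type w} [Category.{w} B] [Category.{w} C] [Category.{w} D] {𝓔 : Type u}
  [Category.{v} 𝓔] {p : 𝓔 ⥤ B} [IsOpfibration p] (H : HomotopicalDeltaOpfibration p) {E : C ⥤ B}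
  {G : D ⥤ C}
  [∀ b, HasCoproducts.{w} ((Transpose.proj p).Fiber b)]
  [∀ b, HasColimitsOfSize.{0, 0} ((Transpose.proj p).Fiber b)]

namespace HomotopicalDeltaOpfibration

/-- The simplicial object `n ↦ ∐ A(s)`, the coproduct being over all strings of dimension
`[n] ⋆ [m]` with end `x`, is a deformation retract of `A(x)`. -/
theorem joinAug_W (A : Sect (tailOver E) (Transpose.proj p)) (x : Simp C) :
    fiberW p H.W _ ((H.delta.fiber _).realAug (joinAug (G := 𝟭 C) A x)) := by
  have h := H.homotopical ((tailOver E).obj x)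
  have := isIso_underπ (x := x) A
  rw [DeltaStructure.realAug_eq]
  have := (H.delta.fiber ((tailOver E).obj x)).isIso_realAug_id (A.val x)
  refine h.comp ?_ (h.of_isIso _)
  rw [joinAug_eq, Functor.map_comp, Functor.map_comp]
  refine h.comp (h.realization _ fun n => ?_) (h.comp ?_ (h.of_isIso _))
  · refine h.elSum (fun s => ⟨s.1.2, s.2.2⟩) ⟨fun s t e => ?_, fun σ => ?_⟩ (fun s => 𝟙 _)
      (fun s => h.of_iso (Iso.refl ((joinDiagram (𝟭 C) A x).obj (el _ n s))))
      (fun s => (joinι_joinToUnder A s).trans (Category.id_comp _).symm)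
    · have e2 : s.1.2 = t.1.2 := congrArg Subtype.val e
      refine joinIdx_ext ?_ e2
      refine s.2.1.symm.trans ((congrArg _ e2).trans t.2.1)
    · exact ⟨⟨((nerve C).map (jl n.unop x.1.unop).op σ.1, σ.1), rfl, σ.2⟩, rfl⟩
  · exact (joinUnderContraction x.1.unop).real_aug h _

end HomotopicalDeltaOpfibration

end AugW

/-! ### The comparison with the bar construction -/

section BarW

variable {C D : Type w} [Category.{w} C] [Category.{w} D] {F : D ⥤ C} {x : Simp C}
  {n : SimplexCategoryᵒᵖ}

theorem eqToHom_comp_eqToHom_heq {a a' b b' : C} (h : a = a') (f : a' ⟶ b') (h' : b' = b) :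
    eqToHom h ≫ f ≫ eqToHom h' ≍ f := by
  subst h h'
  rw [eqToHom_refl, eqToHom_refl, Category.id_comp, Category.comp_id]

theorem joinArr_unop_heq (s : JoinIdx F x n) : (joinArr (𝟭 C) s).unop ≍ conn s.1.2 :=
  eqToHom_comp_eqToHom_heq _ _ _

/-- A string which consists of the image of `d₀ ⟶ ⋯ ⟶ dₙ` and of `x` is given by the former
and a morphism from the image of `dₙ` to the beginning of `x`. -/
theorem joinArr_bijective : Function.Bijective (fun s : JoinIdx F x n =>
    (⟨s.1.1, joinArr (𝟭 C) s⟩ : (idx (simpMap F ⋙ tailOver (𝟭 C)) (headObj x)).obj n)) := by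
  refine ⟨fun s t e => ?_, fun ⟨d, α⟩ => ?_⟩
  · have e1 : s.1.1 = t.1.1 := congrArg Sigma.fst e
    refine joinIdx_ext e1 (join_string_ext ?_ (s.2.2.trans t.2.2.symm) ?_)
    · exact s.2.1.trans ((congrArg _ e1).trans t.2.1.symm)
    · refine (joinArr_unop_heq s).symm.trans (HEq.trans ?_ (joinArr_unop_heq t))
      have key (a b : (idx (simpMap F ⋙ tailOver (𝟭 C)) (headObj x)).obj n) (h : a = b) :
          a.2.unop ≍ b.2.unop := by
        subst h
        rfl
      exact key _ _ e
  · let g : ((nerveMap F).app n d).obj (Fin.last _) ⟶ x.2.obj 0 := α.unop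
    let s : JoinIdx F x n := ⟨(d, glue (n := n.unop) (m := x.1.unop) ((nerveMap F).app n d) x.2 g),
      glue_l _ _ g, glue_r _ _ g⟩
    refine ⟨s, ?_⟩
    have h : joinArr (𝟭 C) s = α :=
      Quiver.Hom.unop_inj (eq_of_heq ((joinArr_unop_heq s).trans (conn_glue _ _ g)))
    exact congrArg (Sigma.mk d) h

variable {𝓔 : Type u} [Category.{v} 𝓔] {p : 𝓔 ⥤ C} [IsOpfibration p]
  (H : HomotopicalDeltaOpfibration p)
  [∀ b, HasCoproducts.{w} ((Transpose.proj p).Fiber b)]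
  [∀ b, HasColimitsOfSize.{0, 0} ((Transpose.proj p).Fiber b)]

namespace HomotopicalDeltaOpfibration

/-- For a derived section, the morphism `joinBar` is an objectwise weak equivalence: the summands
are related by the anchor maps which restrict strings to their first parts. -/
theorem joinBar_W {A : Sect (tailOver (𝟭 C)) (Transpose.proj p)} (hA : H.IsDerived _ A)
    (x : Simp C) :
    fiberW p H.W _ ((H.delta.fiber _).real.map (joinBar (G := F) A x)) := by
  have h := H.homotopical ((tailOver (𝟭 C)).obj x)
  refine h.realization _ fun n => ?_
  refine h.elSum (X := joinDiagram F A x)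
    (X' := barDiagram (resSect F A) ((simpMap (𝟭 C)).obj x)) _ joinArr_bijective
    (fun s => fmk (barTermOf A s) (barTermOf_over A s)) (fun s => ?_) fun s => ?_
  · exact (H.isWeaklyCartesian_iff_toPullFib (mor_joinL_over A s)).mp
      (hA _ fun i => rfl)
  · exact elι_elSumDesc (joinDiagram F A x) _ (joinBar_aux A x) n s

end HomotopicalDeltaOpfibration

end BarW

/-! ### Degenerate strings -/

section PointIdx

theorem DeltaStructure.to0_realAug {M : Type u} [Category.{v} M] (S : DeltaStructure M)
    [HasColimitsOfSize.{0, 0} M] {X : SimplexCategoryᵒᵖ ⥤ M} {x : M}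
    (ε : X ⟶ (Functor.const SimplexCategoryᵒᵖ).obj x) :
    S.to0 X ≫ S.realAug ε = ε.app (op ⦋0⦌) := by
  have h := S.toRealConst_realAug x
  rw [S.realAug_eq, ← Category.assoc, S.to0_map, Category.assoc]
  exact (congrArg (_ ≫ ·) h).trans (Category.comp_id _)

/-- If a string is degenerate between the end of `a` and the beginning of `x`, the morphism
`connMap` is an identity, up to the equality of its ends. -/
theorem connMap_eqToHom {C : Type w} [Category.{w} C] {s a x y : Simp C} (l : s ⟶ a) (r : s ⟶ x)
    (h : ordMap l (Fin.last _) ≤ ordMap r 0) (f : y ⟶ s)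
    (hf : ordMap f (ordMap l (Fin.last _)) = ordMap f (ordMap r 0)) (e : lastObj a = headObj x) :
    connMap l r h = eqToHom e := by
  have key {n : ℕ} (σ : ComposableArrows C n) {i j : Fin (n + 1)} (hij : i = j) (h : i ≤ j)
      {c d : C} (e : c = σ.obj i) (e' : σ.obj j = d) (e'' : c = d) :
      eqToHom e ≫ σ.map (homOfLE h) ≫ eqToHom e' = eqToHom e'' := by
    subst hij e e'
    refine (Category.id_comp _).trans ((Category.comp_id _).trans ?_)
    exact σ.map_id _
  unfold connMap
  rw [arrows_map f]
  simp only [Category.assoc, eqToHom_trans_assoc, eqToHom_trans]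
  exact key _ hf _ _ _ _

variable {C D : Type w} [Category.{w} C] [Category.{w} D] {G : D ⥤ C}

variable (x : Simp C) (d : (nerve D).obj (op ⦋0⦌))
  (hd : (nerveMap G).app (op ⦋0⦌) d = (nerve C).map (SimplexCategory.const ⦋0⦌ x.1.unop 0).op x.2)

/-- The string `x` with its first object repeated, as a string of dimension `[0] ⋆ [m]`. -/
def pointIdx : JoinIdx G x (op ⦋0⦌) :=
  ⟨(d, (nerve C).map (jp ⦋0⦌ x.1.unop).op x.2), by
    refine Eq.trans ?_ hd.symm
    refine (congrArg (fun t => t x.2) ((nerve C).map_comp (jp _ _).op (jl _ _).op)).symm.trans ?_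
    exact congrArg (fun t => (nerve C).map (Quiver.Hom.op t) x.2) (jl_jp ⦋0⦌ x.1.unop), by
    refine (congrArg (fun t => t x.2) ((nerve C).map_comp (jp _ _).op (jr _ _).op)).symm.trans ?_
    refine (congrArg (fun t => (nerve C).map (Quiver.Hom.op t) x.2) (jr_jp ⦋0⦌ x.1.unop)).trans ?_
    exact congrArg (fun t => t x.2) ((nerve C).map_id x.1)⟩

/-- The degeneracy which repeats the first object of a string. -/
def pointMap : x ⟶ joinStr (pointIdx x d hd) :=
  CategoryOfElements.homMk x (joinStr (pointIdx x d hd)) (jp ⦋0⦌ x.1.unop).op rfl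

theorem pointMap_joinR : pointMap x d hd ≫ joinR (pointIdx x d hd) = 𝟙 x :=
  Subtype.ext (congrArg Quiver.Hom.op (jr_jp ⦋0⦌ x.1.unop))

theorem ordMap_pointMap_joinL (i : Fin 1) :
    ordMap (pointMap x d hd) (ordMap (joinL (pointIdx x d hd)) i) = 0 :=
  congrArg (fun t => t.toOrderHom i) (jl_jp ⦋0⦌ x.1.unop)

theorem pointMap_joinL_anchor : IsAnchor (pointMap x d hd ≫ joinL (pointIdx x d hd)) := by
  intro i
  have h : (i : ℕ) = 0 := Nat.lt_one_iff.mp i.2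
  rw [h]
  exact congrArg Fin.val (ordMap_pointMap_joinL x d hd i)

theorem joinArr_pointIdx {B : Type w} [Category.{w} B] (E : C ⥤ B)
    (e : lastObj ((simpMap E).obj ((simpMap G).obj (elt (nerve D) (op ⦋0⦌) d))) =
      headObj ((simpMap E).obj x)) :
    joinArr E (pointIdx x d hd) = Quiver.Hom.op (eqToHom e) := by
  refine congrArg Quiver.Hom.op (connMap_eqToHom _ _ _ ((simpMap E).map (pointMap x d hd)) ?_ e)
  refine (ordMap_pointMap_joinL x d hd (Fin.last 0)).trans ?_
  exact (congrArg (fun t => t.toOrderHom 0) (jr_jp ⦋0⦌ x.1.unop)).symm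

end PointIdx

section PointW

variable {B C D : Type w} [Category.{w} B] [Category.{w} C] [Category.{w} D] {𝓔 : Type u}
  [Category.{v} 𝓔] {p : 𝓔 ⥤ B} [IsOpfibration p] (H : HomotopicalDeltaOpfibration p) {E : C ⥤ B}
  {G : D ⥤ C} {A : Sect (tailOver E) (Transpose.proj p)}

namespace HomotopicalDeltaOpfibration

/-- For a derived section, restriction from the string `x` with repeated first object to `x` is a
weak equivalence: it is a retraction of the value at a degeneracy, which is weakly Cartesian because
its composite with an anchor map is an anchor map. -/
theorem augTerm_W (hA : H.IsDerived _ A) (x : Simp C) (d : (nerve D).obj (op ⦋0⦌))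
    (hd : (nerveMap G).app (op ⦋0⦌) d =
      (nerve C).map (SimplexCategory.const ⦋0⦌ x.1.unop 0).op x.2) :
    fiberW p H.W _ (fmk (augTerm A (pointIdx x d hd)) (augTerm_over A _)) := by
  have hr : A.mor (pointMap x d hd) ≫ A.mor (joinR (pointIdx x d hd)) = 𝟙 _ :=
    (A.mor_comp _ _).symm.trans ((congrArg A.mor (pointMap_joinR x d hd)).trans (A.mor_id x))
  have hW : H.IsWeaklyCartesian (A.mor (pointMap x d hd)) := by
    have h1 := hA _ (pointMap_joinL_anchor x d hd)
    rw [A.mor_comp] at h1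
    exact (H.isWeaklyCartesian_comp_iff (A.mor_over _) (A.mor_over _)
      (hA (joinL (pointIdx x d hd)) fun i => rfl)).mp h1
  have hb : (tailOver E).obj (joinStr (pointIdx x d hd)) = (tailOver E).obj x :=
    congrArg op (lastObj_of_last ((simpMap E).map (joinR (pointIdx x d hd)))
      (joinR_last (pointIdx x d hd))).symm
  have ho : (Transpose.proj p).IsHomLift (𝟙 ((tailOver E).obj x)) (A.mor (pointMap x d hd)) := by
    have e := (congrArg (tailOver E).map (pointMap_joinR x d hd)).trans ((tailOver E).map_id x)
    rw [(tailOver E).map_comp, tailOver_map_of_last _ (joinR_last _) hb] at e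
    have e' : (tailOver E).map (pointMap x d hd) = eqToHom hb.symm := by
      refine Eq.trans ?_ ((congrArg (· ≫ eqToHom hb.symm) e).trans (Category.id_comp _))
      rw [Category.assoc, eqToHom_trans, eqToHom_refl, Category.comp_id]
    refine isHomLift_of_eq hb (isHomLift_of_eqToHom_comp hb.symm (isHomLift_congr ?_ (A.mor_over _)))
    rw [Category.comp_id]
    exact e'
  have h := H.homotopical ((tailOver E).obj x)
  let f : A.val x ⟶ joinVal A (pointIdx x d hd) := fmk (A.mor (pointMap x d hd)) ho
  refine h.of_comp_left (f := f) ((H.isWeaklyCartesian_fval_iff f).mp hW) ?_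
  have e : f ≫ fmk (augTerm A (pointIdx x d hd)) (augTerm_over A _) = 𝟙 _ := fval_ext hr
  rw [e]
  exact h.of_iso (Iso.refl _)

variable [∀ b, HasCoproducts.{w} ((Transpose.proj p).Fiber b)]
  [∀ b, HasColimitsOfSize.{0, 0} ((Transpose.proj p).Fiber b)]

/-- If the summand of the bar construction given by an object over the beginning of `x` is weakly
equivalent to the realization, then the two comparison morphisms of `joinObj` are weak equivalences
or not at the same time. -/
theorem joinAug_W_iff (hA : H.IsDerived _ A) (x : Simp C) (d : (nerve D).obj (op ⦋0⦌))
    (hd : (nerveMap G).app (op ⦋0⦌) d =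
      (nerve C).map (SimplexCategory.const ⦋0⦌ x.1.unop 0).op x.2)
    (hW : fiberW p H.W _ (elι (barDiagram (resSect G A) ((simpMap E).obj x)) (op ⦋0⦌)
      ⟨d, joinArr E (pointIdx x d hd)⟩ ≫
        (H.delta.fiber _).to0 (bar (resSect G A) ((simpMap E).obj x)))) :
    fiberW p H.W _ ((H.delta.fiber _).realAug (joinAug (G := G) A x)) ↔
      fiberW p H.W _ ((H.delta.fiber _).real.map (joinBar (G := G) A x)) := by
  have h := H.homotopical ((tailOver E).obj x)
  let e := elι (joinDiagram G A x) (op ⦋0⦌) (pointIdx x d hd) ≫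
    (H.delta.fiber _).to0 (joinObj G A x)
  have h1 : fiberW p H.W _ (e ≫ (H.delta.fiber _).realAug (joinAug (G := G) A x)) := by
    have h2 : e ≫ (H.delta.fiber _).realAug (joinAug (G := G) A x) =
        fmk (augTerm A (pointIdx x d hd)) (augTerm_over A _) := by
      refine (Category.assoc _ _ _).trans ((congrArg (_ ≫ ·) (DeltaStructure.to0_realAug _ _)).trans ?_)
      exact elι_elSumDesc (joinDiagram G A x) _ (joinAug_aux A x) (op ⦋0⦌) (pointIdx x d hd)
    rw [h2]
    exact H.augTerm_W hA x d hd
  have h3 : fiberW p H.W _ (e ≫ (H.delta.fiber _).real.map (joinBar (G := G) A x)) := by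
    have h4 : e ≫ (H.delta.fiber _).real.map (joinBar (G := G) A x) =
        fmk (barTermOf A (pointIdx x d hd)) (barTermOf_over A _) ≫
          elι (barDiagram (resSect G A) ((simpMap E).obj x)) (op ⦋0⦌)
            ⟨d, joinArr E (pointIdx x d hd)⟩ ≫
              (H.delta.fiber _).to0 (bar (resSect G A) ((simpMap E).obj x)) := by
      refine (Category.assoc _ _ _).trans ((congrArg (_ ≫ ·) (DeltaStructure.to0_map _ _)).trans ?_)
      refine (Category.assoc _ _ _).symm.trans (Eq.trans ?_ (Category.assoc _ _ _))
      exact congrArg (· ≫ _) (elι_elSumDesc (joinDiagram G A x) _ (joinBar_aux A x) (op ⦋0⦌)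
        (pointIdx x d hd))
    rw [h4]
    refine h.comp ?_ hW
    exact (H.isWeaklyCartesian_iff_toPullFib (mor_joinL_over A _)).mp (hA _ fun i => rfl)
  exact ⟨fun ha => h.of_comp_left (h.of_comp_right ha h1) h3,
    fun hb => h.of_comp_left (h.of_comp_right hb h3) h1⟩

end HomotopicalDeltaOpfibration

end PointW

section Zigzag

variable {C D : Type w} [Category.{w} C] [Category.{w} D] {𝓔 : Type u} [Category.{v} 𝓔]
  {p : 𝓔 ⥤ C} [IsOpfibration p] (H : HomotopicalDeltaOpfibration p) {F : D ⥤ C} [IsOpfibration F]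
  [∀ b, HasCoproducts.{w} ((Transpose.proj p).Fiber b)]
  [∀ b, HasColimitsOfSize.{0, 0} ((Transpose.proj p).Fiber b)]

namespace HomotopicalDeltaOpfibration

/-- The statement of `bar_point_W` for a given form of the index of the summand. -/
theorem pushforward_point_W (hs : H.IsSpecial F) {S : PSectOver F p}
    (hS : H.IsDerivedLocallyConstant F S) (x : Simp C) (d : F.Fiber (headObj x))
    (t : (idx (tailOver F) (headObj x)).obj (op ⦋0⦌))
    (ht : t = (fibreIncl F (headObj x)).app (op ⦋0⦌) (ComposableArrows.mk₀ d)) :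
    fiberW p H.W _ (elι (barDiagram S x) (op ⦋0⦌) t ≫ (H.delta.fiber _).to0 (bar S x)) := by
  subst ht
  exact H.bar_point_W hs hS x d

theorem head_eq (x : Simp C) (d : F.Fiber (headObj x)) :
    (nerveMap F).app (op ⦋0⦌) ((nerveMap Functor.Fiber.fiberInclusion).app (op ⦋0⦌)
      (ComposableArrows.mk₀ d)) = (nerve C).map (SimplexCategory.const ⦋0⦌ x.1.unop 0).op x.2 := by
  refine ComposableArrows.ext₀ ?_
  exact d.2

/-- The augmentation of `joinSect` is a weak equivalence for derived sections over the base. -/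
theorem joinSectAug_W_base (hs : H.IsSpecial F) {A : Sect (tailOver (𝟭 C)) (Transpose.proj p)}
    (hA : H.IsDerived _ A) (hS : H.IsDerivedLocallyConstant F (resSect F A)) (x : Simp C)
    (d : F.Fiber (headObj x)) :
    fiberW p H.W _ ((H.delta.fiber _).realAug (joinAug (G := F) A x)) := by
  refine (H.joinAug_W_iff hA x _ (head_eq x d) ?_).mpr (H.joinBar_W hA x)
  refine H.pushforward_point_W hs hS x d _ ?_
  exact congrArg (Sigma.mk _) (joinArr_pointIdx (G := F) x ((nerveMap Functor.Fiber.fiberInclusion).app (op ⦋0⦌)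
    (ComposableArrows.mk₀ d)) (head_eq x d) (𝟭 C) d.2)

/-- The comparison of `joinSect` with the derived pushforward is a weak equivalence for locally
constant derived sections over the resolution. -/
theorem joinSectBar_W_resolution (hs : H.IsSpecial F) {A : PSectOver F p}
    (hA : H.IsDerivedLocallyConstant F A) (x : Simp D) :
    fiberW p H.W _ ((H.delta.fiber _).real.map (joinBar (G := 𝟭 D) (E := F) A x)) := by
  have hd : (nerveMap (𝟭 D)).app (op ⦋0⦌) ((nerveMap Functor.Fiber.fiberInclusion).app (op ⦋0⦌)
      (ComposableArrows.mk₀ (Functor.Fiber.mk (p := F) (a := headObj x) rfl))) =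
        (nerve D).map (SimplexCategory.const ⦋0⦌ x.1.unop 0).op x.2 :=
    ComposableArrows.ext₀ rfl
  refine (H.joinAug_W_iff hA.1 x _ hd ?_).mp (H.joinAug_W A x)
  refine H.pushforward_point_W hs hA ((simpMap F).obj x)
    (Functor.Fiber.mk (p := F) (a := headObj x) rfl) _ ?_
  exact congrArg (Sigma.mk _) (joinArr_pointIdx x _ hd F rfl)

end HomotopicalDeltaOpfibration

end Zigzag

/-! ### Weak equivalences, derived sections and locally constant sections -/

section RealOver

variable {𝓕 : Type u₁} [Category.{v₁} 𝓕] {B : Type u₂} [Category.{v₂} B] {q : 𝓕 ⥤ B}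
  [q.IsFibered] (S : DeltaFibStructure q) [∀ b : B, HasColimitsOfSize.{0, 0} (q.Fiber b)]
  {b b' : B}

namespace DeltaFibStructure

theorem realOver_eq {g : b ⟶ b} (hg : g = 𝟙 b) {Y Y' : SimplexCategoryᵒᵖ ⥤ q.Fiber b}
    (φ : SimplicialOver g Y Y') (f : Y ⟶ Y') (h : ∀ n, φ.app n = fval (f.app n)) :
    S.realOver φ = fval ((S.fiber b).real.map f) := by
  subst hg
  refine S.real_ext_over (S.realOver_over φ) (fval_over _) fun n => ?_
  refine (S.ι_realOver φ n).trans ?_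
  rw [h]
  exact (S.ιOver_real_map f n).symm

theorem to0_realOver {g : b ⟶ b'} {Y : SimplexCategoryᵒᵖ ⥤ q.Fiber b}
    {Y' : SimplexCategoryᵒᵖ ⥤ q.Fiber b'} (φ : SimplicialOver g Y Y') :
    fval ((S.fiber b).to0 Y) ≫ S.realOver φ =
      φ.app (op ⦋0⦌) ≫ fval ((S.fiber b').to0 Y') := by
  have h1 : fval ((S.fiber b).to0 Y) = S.unit.inv.app (fobj (Y.obj (op ⦋0⦌))) ≫ S.ιOver Y ⦋0⦌ := rfl
  have h2 : fval ((S.fiber b').to0 Y') =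
    S.unit.inv.app (fobj (Y'.obj (op ⦋0⦌))) ≫ S.ιOver Y' ⦋0⦌ := rfl
  rw [h1, h2]
  refine (Category.assoc _ _ _).trans ((congrArg (_ ≫ ·) (S.ι_realOver φ ⦋0⦌)).trans ?_)
  refine (Category.assoc _ _ _).symm.trans (Eq.trans ?_ (Category.assoc _ _ _))
  exact congrArg (· ≫ _) (S.unit.inv.naturality (φ.app (op ⦋0⦌))).symm

end DeltaFibStructure

end RealOver

section Properties

variable {C D : Type w} [Category.{w} C] [Category.{w} D] {𝓔 : Type u} [Category.{v} 𝓔]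
  {p : 𝓔 ⥤ C} [IsOpfibration p] (H : HomotopicalDeltaOpfibration p) {F : D ⥤ C}

namespace HomotopicalDeltaOpfibration

theorem isWeaklyCartesian_iff_transposeW {c : Cᵒᵖ} {x z : Transpose p} {φ : x ⟶ z}
    (h : (Transpose.proj p).IsHomLift (𝟙 c) φ) : H.IsWeaklyCartesian φ ↔ transposeW p H.W φ := by
  let x' : (Transpose.proj p).Fiber c := ⟨x, IsHomLift.domain_eq (Transpose.proj p) (𝟙 c) φ⟩
  let z' : (Transpose.proj p).Fiber c := ⟨z, IsHomLift.codomain_eq (Transpose.proj p) (𝟙 c) φ⟩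
  exact H.isWeaklyCartesian_fval_iff (fmk (x := x') (y := z') φ h)

/-- Weakly equivalent sections send the same morphisms to weakly Cartesian morphisms. -/
theorem isDerived_iff_of_weakEquivalence {k : Simp D ⥤ Cᵒᵖ} {A A' : Sect k (Transpose.proj p)}
    (η : A ⟶ A') (hη : H.weakEquivalences k η) {x y : Simp D} (f : x ⟶ y) :
    H.IsWeaklyCartesian (A.mor f) ↔ H.IsWeaklyCartesian (A'.mor f) := by
  rw [← H.isWeaklyCartesian_comp_iff (A.mor_over f) (Sect.app_over η y)
    (H.isWeaklyCartesian_of_transposeW (hη y)), Sect.app_naturality]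
  exact H.isWeaklyCartesian_fval_comp_iff (f := fmk (Sect.app η x) (Sect.app_over η x))
    (A'.mor_over f) (hη x)

theorem mor_fiber_over (A : PSectOver F p) {c : C} {x y : Simp (F.Fiber c)} (f : x ⟶ y) :
    (Transpose.proj p).IsHomLift (𝟙 (op c))
      (A.mor ((simpMap (Functor.Fiber.fiberInclusion (p := F) (S := c))).map f)) := by
  have key {k k' : Cᵒᵖ} {g : k ⟶ k'} (h : k = op c) (h' : op c = k') (e : g = eqToHom (h.trans h'))
      {a b : Transpose p} {φ : a ⟶ b} (hφ : (Transpose.proj p).IsHomLift g φ) :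
      (Transpose.proj p).IsHomLift (𝟙 (op c)) φ := by
    subst h h' e
    exact hφ
  have h := Functor.Fiber.fiberInclusion_comp_eq_const (p := F) (S := c)
  have e := congrArg (fun K => (tail C).obj ((simpMap K).obj x)) h
  have e' := congrArg (fun K => (tail C).obj ((simpMap K).obj y)) h
  refine key (g := (tail C).map ((simpMap (Functor.Fiber.fiberInclusion ⋙ F)).map f)) e e'.symm ?_
    (A.mor_over ((simpMap Functor.Fiber.fiberInclusion).map f))
  have key2 (K : F.Fiber c ⥤ C) (hK : K = (Functor.const _).obj c)
      (h : (tail C).obj ((simpMap K).obj x) = (tail C).obj ((simpMap K).obj y)) :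
      (tail C).map ((simpMap K).map f) = eqToHom h := by
    subst hK
    exact congrArg Quiver.Hom.op (Category.id_comp (𝟙 c))
  exact key2 _ h _

theorem isLocallyConstant_iff (A : PSectOver F p) : H.IsLocallyConstant F A ↔
    ∀ (c : C) ⦃x y : Simp (F.Fiber c)⦄ (f : x ⟶ y), H.IsWeaklyCartesian
      (A.mor ((simpMap (Functor.Fiber.fiberInclusion (p := F) (S := c))).map f)) :=
  forall_congr' fun _ => forall_congr' fun _ => forall_congr' fun _ => forall_congr' fun f =>
    (H.isWeaklyCartesian_iff_transposeW (mor_fiber_over A f)).symm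

theorem isDerivedLocallyConstant_iff_of_weakEquivalence {A A' : PSectOver F p} (η : A ⟶ A')
    (hη : H.weakEquivalences _ η) :
    H.IsDerivedLocallyConstant F A ↔ H.IsDerivedLocallyConstant F A' := by
  have h {x y : Simp D} (f : x ⟶ y) := H.isDerived_iff_of_weakEquivalence η hη f
  refine and_congr ?_ ?_
  · exact forall_congr' fun _ => forall_congr' fun _ => forall_congr' fun f =>
      imp_congr_right fun _ => h f
  · rw [isLocallyConstant_iff, isLocallyConstant_iff]
    exact forall_congr' fun _ => forall_congr' fun _ => forall_congr' fun _ =>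
      forall_congr' fun f => h _

/-- A constant string. -/
def constStr (c : C) (n : SimplexCategoryᵒᵖ) : Simp C :=
  elt (nerve C) n ((Functor.const (Fin (n.unop.len + 1))).obj c)

/-- The morphisms between constant strings. -/
def constMap (c : C) {n m : SimplexCategoryᵒᵖ} (θ : n ⟶ m) : constStr c n ⟶ constStr c m :=
  CategoryOfElements.homMk (constStr c n) (constStr c m) θ rfl

theorem tail_constMap (c : C) {n m : SimplexCategoryᵒᵖ} (θ : n ⟶ m) :
    (tail C).map (constMap c θ) = 𝟙 (op c) :=
  congrArg Quiver.Hom.op (Category.id_comp (𝟙 c))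

/-- Derived sections send the morphisms between constant strings to weak equivalences, as these
strings are degenerations of a string of length `0`. -/
theorem constMap_W {A : PSect p} (hA : H.IsDerived (tail C) A) (c : C) {n m : SimplexCategoryᵒᵖ}
    (θ : n ⟶ m) : H.IsWeaklyCartesian (A.mor (constMap c θ)) := by
  have hs {k : SimplexCategory} (f g : k ⟶ ⦋0⦌) : f = g := Subsingleton.elim _ _
  let σ (n : SimplexCategoryᵒᵖ) : constStr c (op ⦋0⦌) ⟶ constStr c n :=
    constMap c (SimplexCategory.const n.unop ⦋0⦌ 0).op
  have hα (n : SimplexCategoryᵒᵖ) : H.IsWeaklyCartesian (A.mor (σ n)) := by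
    let α : constStr c n ⟶ constStr c (op ⦋0⦌) := constMap c (SimplexCategory.const ⦋0⦌ n.unop 0).op
    have h1 : IsAnchor α := fun i => (Nat.lt_one_iff.mp i.2).symm
    have h2 : σ n ≫ α = 𝟙 _ := Subtype.ext (congrArg Quiver.Hom.op (hs _ _))
    rw [← H.isWeaklyCartesian_comp_iff (A.mor_over _) (A.mor_over α) (hA α h1), ← A.mor_comp, h2]
    exact hA _ fun i => rfl
  have h1 : σ n ≫ constMap c θ = σ m :=
    Subtype.ext (congrArg Quiver.Hom.op (hs _ _))
  have h2 := hα m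
  rw [← h1, A.mor_comp] at h2
  have h3 : (Transpose.proj p).IsHomLift (𝟙 (op c)) (A.mor (σ n)) :=
    isHomLift_congr (tail_constMap c _) (A.mor_over _)
  exact (H.isWeaklyCartesian_fval_comp_iff
    (f := fmk (x := A.val (constStr c (op ⦋0⦌))) (y := A.val (constStr c n)) (A.mor (σ n)) h3)
    (A.mor_over (constMap c θ)) ((H.isWeaklyCartesian_fval_iff _).mp (hα n))).mp h2

/-- The pullback of a derived section is a locally constant derived section. -/
theorem isDerivedLocallyConstant_pullback {A : PSect p} (hA : H.IsDerived (tail C) A) :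
    H.IsDerivedLocallyConstant F ((pullbackFunctor F p).obj A) := by
  refine ⟨fun x y f hf => hA ((simpMap F).map f) hf, ?_⟩
  rw [isLocallyConstant_iff]
  intro c x y f
  have key (K : F.Fiber c ⥤ C) (hK : K = (Functor.const _).obj c) :
      H.IsWeaklyCartesian (A.mor ((simpMap K).map f)) := by
    subst hK
    exact H.constMap_W hA c f.1
  exact key _ Functor.Fiber.fiberInclusion_comp_eq_const

theorem weakEquivalences_pullback {A A' : PSect p} (η : A ⟶ A')
    (hη : H.weakEquivalences (tail C) η) :
    H.weakEquivalences (simpMap F ⋙ tail C) ((pullbackFunctor F p).map η) :=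
  fun x => hη ((simpMap F).obj x)

section

variable [∀ b, HasCoproducts.{w} ((Transpose.proj p).Fiber b)]
  [∀ b, HasColimitsOfSize.{0, 0} ((Transpose.proj p).Fiber b)]

/-- The derived pushforward preserves weak equivalences, as realizations, coproducts and pullbacks
do. -/
theorem weakEquivalences_pushforward {S S' : PSectOver F p} (η : S ⟶ S')
    (hη : H.weakEquivalences (simpMap F ⋙ tail C) η) :
    H.weakEquivalences (tail C) ((pushforward H.delta).map η) := by
  intro x
  have h := H.homotopical ((tail C).obj x)
  let f : bar S x ⟶ bar S' x :=
    { app := fun n => fmk (barApp (𝟙 x) η n)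
        (isHomLift_congr ((tail C).map_id x) (barApp_over (𝟙 x) η n))
      naturality := fun n m θ => fval_ext (barApp_naturality (𝟙 x) η θ) }
  have e : Sect.app ((pushforward H.delta).map η) x = fval ((H.delta.fiber _).real.map f) :=
    H.delta.realOver_eq ((tail C).map_id x) (barOver (𝟙 x) η) f fun n => rfl
  rw [e]
  refine h.realization f fun n => ?_
  let φ (s : (idx (tailOver F) (headObj x)).obj n) : (idx (tailOver F) (headObj x)).obj n :=
    ⟨s.1, headOp (𝟙 x) ≫ s.2⟩
  have hφ : φ = id := funext fun s =>
    congrArg (Sigma.mk s.1) ((congrArg (· ≫ s.2) (headOp_id x)).trans (Category.id_comp _))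
  refine h.elSum (X := barDiagram S x) (X' := barDiagram S' x) φ (hφ ▸ Function.bijective_id)
    (fun s => fmk (barTermMap (barApp_aux (𝟙 x) s.1 s.2) (Sect.app_over η _))
      (isHomLift_congr ((tail C).map_id x) (barTermMap_over _ _))) (fun s => ?_) fun s => ?_
  · exact (H.isWeaklyCartesian_fval_iff _).mp
      (H.isWeaklyCartesian_pullMap (barApp_aux (𝟙 x) s.1 s.2) (Sect.app_over η _)
        (H.isWeaklyCartesian_of_transposeW (hη _)))
  · exact fval_ext (barι_barApp (𝟙 x) η s.1 s.2)

theorem headMap_of_anchor {x y : Simp C} {f : x ⟶ y} (hf : IsAnchor f)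
    (e : headObj x = headObj y) : headMap f = eqToHom e := by
  have key {n : ℕ} (σ : ComposableArrows C n) {i : Fin (n + 1)} (hi : 0 = i) (h : 0 ≤ i) {c : C}
      (e : σ.obj i = c) (e' : σ.obj 0 = c) : σ.map (homOfLE h) ≫ eqToHom e = eqToHom e' := by
    subst hi
    exact (congrArg (· ≫ _) (σ.map_id _)).trans (Category.id_comp _)
  exact key _ (Fin.ext (hf 0).symm) _ _ _

variable [IsOpfibration F]

/-- The derived pushforward of a locally constant derived section is a derived section: its values
are those of the section at objects of the fibres over the beginnings of strings. -/
theorem isDerived_pushforward (hs : H.IsSpecial F) (hF : ∀ c, Nonempty (F.Fiber c))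
    {S : PSectOver F p} (hS : H.IsDerivedLocallyConstant F S) :
    H.IsDerived (tail C) ((pushforward H.delta).obj S) := by
  intro x y f hf
  obtain ⟨d⟩ := hF (headObj x)
  have hxy : headObj x = headObj y :=
    ((arrows_obj f 0).trans (congrArg (arrows x).obj (Fin.ext (hf 0)))).symm
  let d' : F.Fiber (headObj y) := ⟨d.1, d.2.trans hxy⟩
  let t : (idx (tailOver F) (headObj x)).obj (op ⦋0⦌) :=
    (fibreIncl F (headObj x)).app (op ⦋0⦌) (ComposableArrows.mk₀ d)
  let t' : (idx (tailOver F) (headObj y)).obj (op ⦋0⦌) := ⟨t.1, headOp f ≫ t.2⟩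
  have ht' : t' = (fibreIncl F (headObj y)).app (op ⦋0⦌) (ComposableArrows.mk₀ d') := by
    refine congrArg (Sigma.mk t.1) ?_
    refine (congrArg (fun s => Quiver.Hom.op s ≫ t.2) (headMap_of_anchor hf hxy)).trans ?_
    exact congrArg Quiver.Hom.op (eqToHom_trans d.2 hxy)
  have h1 := H.pushforward_point_W hs hS x d t rfl
  have h2 := H.pushforward_point_W hs hS y d' t' ht'
  have e : fval (elι (barDiagram S x) (op ⦋0⦌) t ≫ (H.delta.fiber _).to0 (bar S x)) ≫
      pushMor H.delta f (𝟙 S) = barTermMap (barApp_aux f t.1 t.2) (Sect.app_over (𝟙 S) _) ≫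
        fval (elι (barDiagram S y) (op ⦋0⦌) t' ≫ (H.delta.fiber _).to0 (bar S y)) := by
    refine (Category.assoc _ _ _).trans ((congrArg (_ ≫ ·)
      (H.delta.to0_realOver (barOver f (𝟙 S)))).trans ?_)
    refine (Category.assoc _ _ _).symm.trans (Eq.trans ?_ (Category.assoc _ _ _))
    exact congrArg (· ≫ _) (barι_barApp f (𝟙 S) t.1 t.2)
  refine (H.isWeaklyCartesian_fval_comp_iff (pushMor_over H.delta f (𝟙 S)) h1).mp ?_
  rw [e]
  refine (H.isWeaklyCartesian_comp_iff (barTermMap_over _ _) (fval_over _)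
    ((H.isWeaklyCartesian_fval_iff _).mpr h2)).mpr ?_
  refine H.isWeaklyCartesian_pullMap (barApp_aux f t.1 t.2) (Sect.app_over (𝟙 S) _) ?_
  exact (H.isWeaklyCartesian_fval_iff (𝟙 (S.val (elt (nerve D) (op ⦋0⦌) t.1)))).mpr
    ((H.homotopical _).of_iso (Iso.refl _))

end

end HomotopicalDeltaOpfibration

end Properties

/-! ### Zigzags of natural weak equivalences -/

section Zigzags

variable {𝓐 : Type u₁} [Category.{v₁} 𝓐] {𝓑 : Type u₂} [Category.{v₂} 𝓑]
  {W : MorphismProperty 𝓐} {P : ObjectProperty 𝓐} {W' : MorphismProperty 𝓑} {P' : ObjectProperty 𝓑}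

/-- A zigzag of natural weak equivalences between the identity and a functor, on the objects with a
given property. -/
structure Zigzag (W : MorphismProperty 𝓐) (P : ObjectProperty 𝓐) (Φ : 𝓐 ⥤ 𝓐) where
  T : 𝓐 → 𝓐
  map {A A' : 𝓐} (η : A ⟶ A') : T A ⟶ T A'
  a (A : 𝓐) : T A ⟶ A
  b (A : 𝓐) : T A ⟶ Φ.obj A
  a_naturality {A A' : 𝓐} (η : A ⟶ A') : map η ≫ a A' = a A ≫ η
  b_naturality {A A' : 𝓐} (η : A ⟶ A') : map η ≫ b A' = b A ≫ Φ.map η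
  prop (A : 𝓐) (hA : P A) : P (T A)
  a_W (A : 𝓐) (hA : P A) : W (a A)
  b_W (A : 𝓐) (hA : P A) : W (b A)

/-- A zigzag of natural weak equivalences gives an isomorphism of functors to the homotopy
category. -/
noncomputable def Zigzag.iso {Φ : 𝓐 ⥤ 𝓐} (z : Zigzag W P Φ) (hΦ : ∀ A, P A → P (Φ.obj A)) :
    P.lift (P.ι ⋙ Φ) (fun A => hΦ A.obj A.property) ⋙ (W.inverseImage P.ι).Q ≅
      (W.inverseImage P.ι).Q := by
  let T (A : P.FullSubcategory) : P.FullSubcategory := ⟨z.T A.obj, z.prop A.obj A.property⟩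
  let a (A : P.FullSubcategory) : T A ⟶ A := ObjectProperty.homMk (z.a A.obj)
  let b (A : P.FullSubcategory) :
      T A ⟶ (P.lift (P.ι ⋙ Φ) (fun A => hΦ A.obj A.property)).obj A :=
    ObjectProperty.homMk (z.b A.obj)
  have ha (A : P.FullSubcategory) : IsIso ((W.inverseImage P.ι).Q.map (a A)) :=
    (W.inverseImage P.ι).Q_inverts (a A) (z.a_W A.obj A.property)
  have hb (A : P.FullSubcategory) : IsIso ((W.inverseImage P.ι).Q.map (b A)) :=
    (W.inverseImage P.ι).Q_inverts (b A) (z.b_W A.obj A.property)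
  refine NatIso.ofComponents
    (fun A => (asIso ((W.inverseImage P.ι).Q.map (b A))).symm ≪≫
      asIso ((W.inverseImage P.ι).Q.map (a A))) fun {A A'} η => ?_
  let t : T A ⟶ T A' := ObjectProperty.homMk (z.map η.hom)
  have h1 : t ≫ a A' = a A ≫ η := ObjectProperty.hom_ext _ (z.a_naturality η.hom)
  have h2 : t ≫ b A' = b A ≫ (P.lift (P.ι ⋙ Φ) (fun A => hΦ A.obj A.property)).map η :=
    ObjectProperty.hom_ext _ (z.b_naturality η.hom)
  have h1' := congrArg (W.inverseImage P.ι).Q.map h1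
  have h2' := congrArg (W.inverseImage P.ι).Q.map h2
  rw [Functor.map_comp, Functor.map_comp] at h1' h2'
  have h3 : (W.inverseImage P.ι).Q.map
      ((P.lift (P.ι ⋙ Φ) (fun A => hΦ A.obj A.property)).map η) ≫
        inv ((W.inverseImage P.ι).Q.map (b A')) =
      inv ((W.inverseImage P.ι).Q.map (b A)) ≫ (W.inverseImage P.ι).Q.map t := by
    rw [IsIso.eq_inv_comp, ← Category.assoc, ← h2', Category.assoc, IsIso.hom_inv_id,
      Category.comp_id]
  dsimp only [Functor.comp_map, Iso.trans_hom, Iso.symm_hom, asIso_inv, asIso_hom]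
  refine (Category.assoc _ _ _).symm.trans ((congrArg (· ≫ _) h3).trans ?_)
  rw [Category.assoc, Category.assoc, h1']

/-- The transport of a zigzag along an equality of functors. -/
def Zigzag.ofEq {Φ Φ' : 𝓐 ⥤ 𝓐} (z : Zigzag W P Φ) (h : Φ = Φ') : Zigzag W P Φ' :=
  h ▸ z

theorem Q_hoMap (G : 𝓐 ⥤ 𝓑) (hP : ∀ A, P A → P' (G.obj A))
    (hW : ∀ ⦃A A' : 𝓐⦄ (f : A ⟶ A'), P A → P A' → W f → W' (G.map f)) :
    (W.inverseImage P.ι).Q ⋙ hoMap G hP hW =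
      P'.lift (P.ι ⋙ G) (fun A => hP A.obj A.property) ⋙ (W'.inverseImage P'.ι).Q :=
  Localization.Construction.fac _ _

/-- A zigzag of natural weak equivalences between the identity and a composite of functors gives an
isomorphism between the composite of the induced functors and the identity. -/
noncomputable def hoMapCompIso (G : 𝓐 ⥤ 𝓑) (G' : 𝓑 ⥤ 𝓐) (hP : ∀ A, P A → P' (G.obj A))
    (hW : ∀ ⦃A A' : 𝓐⦄ (f : A ⟶ A'), P A → P A' → W f → W' (G.map f))
    (hP' : ∀ A, P' A → P (G'.obj A))
    (hW' : ∀ ⦃A A' : 𝓑⦄ (f : A ⟶ A'), P' A → P' A' → W' f → W (G'.map f))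
    (z : Zigzag W P (G ⋙ G')) : hoMap G hP hW ⋙ hoMap G' hP' hW' ≅ 𝟭 (Ho W P) := by
  have e : (W.inverseImage P.ι).Q ⋙ hoMap G hP hW ⋙ hoMap G' hP' hW' =
      P.lift (P.ι ⋙ G ⋙ G') (fun A => hP' _ (hP A.obj A.property)) ⋙ (W.inverseImage P.ι).Q := by
    rw [← Functor.assoc, Q_hoMap, Functor.assoc, Q_hoMap]
    rfl
  have : Localization.Lifting (W.inverseImage P.ι).Q (W.inverseImage P.ι)
      (P.lift (P.ι ⋙ G ⋙ G') (fun A => hP' _ (hP A.obj A.property)) ⋙ (W.inverseImage P.ι).Q)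
      (hoMap G hP hW ⋙ hoMap G' hP' hW') := ⟨eqToIso e⟩
  have : Localization.Lifting (W.inverseImage P.ι).Q (W.inverseImage P.ι)
      (W.inverseImage P.ι).Q (𝟭 (Ho W P)) := ⟨Functor.rightUnitor _⟩
  exact Localization.liftNatIso (W.inverseImage P.ι).Q (W.inverseImage P.ι)
    (P.lift (P.ι ⋙ G ⋙ G') (fun A => hP' _ (hP A.obj A.property)) ⋙ (W.inverseImage P.ι).Q)
    (W.inverseImage P.ι).Q _ _ (z.iso fun A hA => hP' _ (hP A hA))

end Zigzags

/-! ### The derived pushforward and the pullback -/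

section Equivalence

variable {C D : Type w} [Category.{w} C] [Category.{w} D] {𝓔 : Type u} [Category.{v} 𝓔]
  {p : 𝓔 ⥤ C} [IsOpfibration p] (H : HomotopicalDeltaOpfibration p) {F : D ⥤ C}

theorem IsResolution.nonempty (hF : IsResolution F) (c : C) : Nonempty (F.Fiber c) := by
  have := hF.contractible c
  obtain ⟨b⟩ := nonempty_of_toTop (T := nerve (F.Fiber c)) inferInstance
  exact ⟨b.obj 0⟩

namespace HomotopicalDeltaOpfibration

/-- Contractible fibres are nonempty, which provides the object of `D(c₀)` that
`joinSectAug_W_base` requires. -/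
theorem joinSectAug_W (hF : IsResolution F) (hs : H.IsSpecial F) [IsOpfibration F]
    [∀ b, HasCoproducts.{w} ((Transpose.proj p).Fiber b)]
    [∀ b, HasColimitsOfSize.{0, 0} ((Transpose.proj p).Fiber b)]
    {A : Sect (tailOver (𝟭 C)) (Transpose.proj p)} (hA : H.IsDerived (tailOver (𝟭 C)) A) :
    H.weakEquivalences (tailOver (𝟭 C)) (joinSectAug F H.delta A) := fun x =>
  (hF.nonempty (headObj x)).elim fun d =>
    H.joinSectAug_W_base hs hA
      (H.isDerivedLocallyConstant_pullback (F := F) (p := p) (A := A) hA) x d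

/-- Pullback along the simplicial replacement of the identity functor does nothing. -/
theorem pushforwardFunctor_eq [∀ b, HasCoproducts.{w} ((Transpose.proj p).Fiber b)]
    [∀ b, HasColimitsOfSize.{0, 0} ((Transpose.proj p).Fiber b)] :
    pushforward (k := simpMap F ⋙ tail C) H.delta ⋙ Sect.pullback (simpMap (𝟭 C)) =
      H.pushforwardFunctor F :=
  rfl

/-- The zigzag of `zigzagBase`, with `C` regarded as lying over itself by the identity functor. -/
noncomputable def zigzagTailOver (hF : IsResolution F) (hs : H.IsSpecial F) [IsOpfibration F]
    [∀ b, HasCoproducts.{w} ((Transpose.proj p).Fiber b)]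
    [∀ b, HasColimitsOfSize.{0, 0} ((Transpose.proj p).Fiber b)] :
    Zigzag (H.weakEquivalences (tailOver (𝟭 C))) (H.IsDerived (tailOver (𝟭 C)))
      ((Sect.pullback (simpMap F) : Sect (tailOver (𝟭 C)) (Transpose.proj p) ⥤
          Sect (simpMap F ⋙ tailOver (𝟭 C)) (Transpose.proj p)) ⋙
        pushforward (k := simpMap F ⋙ tailOver (𝟭 C)) H.delta ⋙ Sect.pullback (simpMap (𝟭 C))) where
  T := joinSect F H.delta
  map := joinSectMap F H.delta
  a := joinSectAug F H.delta
  b := joinSectBar F H.delta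
  a_naturality := joinSectMap_aug H.delta
  b_naturality := joinSectMap_bar H.delta
  prop := fun A hA _ _ f hf =>
      (H.isDerived_iff_of_weakEquivalence _ (H.joinSectAug_W hF hs hA) f).mpr (hA f hf)
  a_W := fun _ => H.joinSectAug_W hF hs
  b_W := fun _ hA x => H.joinBar_W (F := F) hA x

/-- The zigzag between a derived section `A` and `𝔽_! 𝔽^* A`. -/
noncomputable def zigzagBase (hF : IsResolution F) (hs : H.IsSpecial F) :
    Zigzag (H.weakEquivalences (tail C)) (H.IsDerived (tail C))
      (pullbackFunctor F p ⋙ H.pushforwardFunctor F) :=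
  haveI := hF.isOpfibration
  haveI := H.hasCoproducts
  haveI := H.hasColimits
  (H.zigzagTailOver hF hs).ofEq (congrArg (Sect.pullback (simpMap F) ⋙ ·) H.pushforwardFunctor_eq)

/-- The zigzag between a locally constant derived section `S` and `𝔽^* 𝔽_! S`. -/
noncomputable def zigzagResolution (hF : IsResolution F) (hs : H.IsSpecial F) :
    Zigzag (H.weakEquivalences (simpMap F ⋙ tail C)) (H.IsDerivedLocallyConstant F)
      (H.pushforwardFunctor F ⋙ pullbackFunctor F p) :=
  haveI := hF.isOpfibration
  haveI := H.hasCoproducts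
  haveI := H.hasColimits
  have ha (S : PSectOver F p) : H.weakEquivalences (simpMap F ⋙ tail C)
      (joinSectAug (𝟭 D) H.delta (E := F) S) := fun x => H.joinAug_W (E := F) S x
  { T := fun S => joinSect (𝟭 D) H.delta (E := F) S
    map := fun η => joinSectMap (𝟭 D) H.delta (E := F) η
    a := fun S => joinSectAug (𝟭 D) H.delta (E := F) S
    b := fun S => joinSectBar (𝟭 D) H.delta (E := F) S
    a_naturality := fun η => joinSectMap_aug (E := F) H.delta η
    b_naturality := fun η => joinSectMap_bar (E := F) H.delta η
    prop := fun S hS => (H.isDerivedLocallyConstant_iff_of_weakEquivalence _ (ha S)).mpr hS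
    a_W := fun S _ => ha S
    b_W := fun _ hS x => H.joinSectBar_W_resolution hs hS x }

end HomotopicalDeltaOpfibration

end Equivalence

end DerSect

theorem mainTheorem2 {C D : Type w} [Category.{w} C] [Category.{w} D] {𝓔 : Type u}
    [Category.{v} 𝓔] (p : 𝓔 ⥤ C) [DerSect.IsOpfibration p] (H : DerSect.HomotopicalDeltaOpfibration p)
    (F : D ⥤ C) (hF : DerSect.IsResolution F) (hs : H.IsSpecial F) :
    ∃ (hpull : ∀ A : DerSect.PSect p, H.IsDerived (DerSect.tail C) A →
        H.IsDerivedLocallyConstant F ((DerSect.pullbackFunctor F p).obj A))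
      (hpullW : ∀ ⦃A A' : DerSect.PSect p⦄ (η : A ⟶ A'), H.weakEquivalences (DerSect.tail C) η →
        H.weakEquivalences (DerSect.simpMap F ⋙ DerSect.tail C) ((DerSect.pullbackFunctor F p).map η))
      (hpush : ∀ B : DerSect.PSectOver F p, H.IsDerivedLocallyConstant F B →
        H.IsDerived (DerSect.tail C) ((H.pushforwardFunctor F).obj B))
      (hpushW : ∀ ⦃B B' : DerSect.PSectOver F p⦄ (η : B ⟶ B'),
        H.weakEquivalences (DerSect.simpMap F ⋙ DerSect.tail C) η →
          H.weakEquivalences (DerSect.tail C) ((H.pushforwardFunctor F).map η))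
      (e : DerSect.Ho (H.weakEquivalences (DerSect.tail C)) (H.IsDerived (DerSect.tail C)) ≌
        DerSect.Ho (H.weakEquivalences (DerSect.simpMap F ⋙ DerSect.tail C)) (H.IsDerivedLocallyConstant F)),
      e.functor = DerSect.hoMap (DerSect.pullbackFunctor F p) hpull (fun _ _ η _ _ hη => hpullW η hη) ∧
        e.inverse = DerSect.hoMap (H.pushforwardFunctor F) hpush (fun _ _ η _ _ hη => hpushW η hη) := by
  have := hF.isOpfibration
  have := H.hasCoproducts
  have := H.hasColimits
  have hpull (A : DerSect.PSect p) (hA : H.IsDerived (DerSect.tail C) A) :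
      H.IsDerivedLocallyConstant F ((DerSect.pullbackFunctor F p).obj A) :=
    H.isDerivedLocallyConstant_pullback hA
  have hpush (B : DerSect.PSectOver F p) (hB : H.IsDerivedLocallyConstant F B) :
      H.IsDerived (DerSect.tail C) ((H.pushforwardFunctor F).obj B) :=
    H.isDerived_pushforward hs hF.nonempty hB
  refine ⟨hpull, fun _ _ η hη => H.weakEquivalences_pullback η hη, hpush,
    fun _ _ η hη => H.weakEquivalences_pushforward η hη, ?_⟩
  exact ⟨CategoryTheory.Equivalence.mk
    (DerSect.hoMap (DerSect.pullbackFunctor F p) hpull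
      fun _ _ η _ _ hη => H.weakEquivalences_pullback η hη)
    (DerSect.hoMap (H.pushforwardFunctor F) hpush
      fun _ _ η _ _ hη => H.weakEquivalences_pushforward η hη)
    (DerSect.hoMapCompIso _ _ _ _ _ _ (H.zigzagBase hF hs)).symm
    (DerSect.hoMapCompIso _ _ _ _ _ _ (H.zigzagResolution hF hs)), rfl, rfl⟩
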